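/- Let $\ell>0$ and let $U$ be a self-similar profile with support $[-\ell,\ell]$, i.e. $U\in C^1(\mathbb R)$ is nonnegative, $\{U>0\}=(-\ell,\ell)$ (so $U=U'=0$ at $\pm\ell$), $U\in C^3((-\ell,\ell))$, and $U'''-U^2U'-\tfrac x5=0$ in $(-\ell,\ell)$. Put $\Phi:=2(U')^2-4UU''+U^4$ and $$\mathcal L V:=U^{-1}\partial_x^2(U^2\partial_x^2V)-U^{-1}\partial_x(\Phi\,\partial_xV)+\tfrac15V\quad\text{in }(-\ell,\ell).$$ For $m\in\mathbb N_0$ let $\mathcal H^m$ be the closure of $C^m([-\ell,\ell])$ with respect to the norm $$|V|_m:=\Big(\sum_{j=0}^m\int_{-\ell}^{\ell}(\ell^2-x^2)^{j+2}(\partial_x^jV)^2\,dx\Big)^{1/2}.$$ Let $k\ge2$ be an integer, $V^{(0)}\in\mathcal H^6$, and $F\in L^2_{\mathrm{loc}}((0,\infty);\mathcal H^{2k})$ be such that $s\mapsto s^{\frac{k'-2}2}F(s)$ belongs to $L^2(0,\infty;\mathcal H^{2k'})$ for all $k'\in\{2,\dots,k\}$. Then there exists exactly one $$V\in H^1_{\mathrm{loc}}((0,\infty);\mathcal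 H^{2k})\cap L^2_{\mathrm{loc}}((0,\infty);\mathcal H^{2k+4})\cap C^0((0,\infty);\mathcal H^{2k+2})$$ such that, for all $k'\in\{2,\dots,k\}$, $$s^{\frac{k'-2}2}V\in L^2(0,\infty;\mathcal H^{2k'+4}),\qquad s^{\frac{k'-2}2}\partial_sV\in L^2(0,\infty;\mathcal H^{2k'}),\qquad s^{\frac{k'-2}2}V\in C^0([0,\infty);\mathcal H^{2k'+2})$$ (where for $k'>2$ the last function takes the value $0$ at $s=0$), and such that $$\partial_sV+\mathcal LV=F\ \text{ in }(0,\infty)\times(-\ell,\ell),\qquad V=V^{(0)}\ \text{ at }s=0.$$ Moreover, there is a constant $C<\infty$ depending only on $k$ and $\ell$ such that this solution satisfies, for all $s\ge0$ (where for $s=0$ the terms $s^{k'-2}|V(s)|_{2k'+2}^2$ with $k'>2$ are read as $0$), $$\sum_{k'=2}^k\Big(s^{k'-2}|V(s)|_{2k'+2}^2+\int_0^s(s')^{k'-2}\big(|\partial_sV(s')|_{2k'}^2+|V(s')|_{2k'+4}^2\big)\,ds'\Big)\le C\Big(|V^{(0)}|_6^2+\sum_{k'=2}^k\int_0^s(s')^{k'-2}|F(s')|_{2k'}^2\,ds'\Big).$$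 -/

import Mathlib

open MeasureTheory Set
open scoped ENNReal NNReal ContDiff

noncomputable section

namespace ThinFilm

/-! ### The self-similar profile -/

/-- `U` is a self-similar profile with support `[-ℓ, ℓ]`: a nonnegative function with
`{U > 0} = (-ℓ, ℓ)`, of class `C¹` on the line (so that `U = U' = 0` at the end points `±ℓ`, the
zero contact angle), of class `C³` in `(-ℓ, ℓ)`, and a classical solution there of
`U''' - U² U' - x / 5 = 0`. -/
structure IsProfile (ℓ : ℝ) (U : ℝ → ℝ) : Prop where
  pos : ∀ x ∈ Ioo (-ℓ) ℓ, 0 < U x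
  eq_zero : ∀ x ∉ Ioo (-ℓ) ℓ, U x = 0
  contDiff : ContDiff ℝ 1 U
  contDiffOn : ContDiffOn ℝ 3 U (Ioo (-ℓ) ℓ)
  ode : ∀ x ∈ Ioo (-ℓ) ℓ, iteratedDeriv 3 U x - U x ^ 2 * deriv U x - x / 5 = 0

/-- `Φ = 2 (U')² - 4 U U'' + U⁴`. -/
def Phi (U : ℝ → ℝ) (x : ℝ) : ℝ :=
  2 * deriv U x ^ 2 - 4 * U x * iteratedDeriv 2 U x + U x ^ 4

/-! ### The weighted Sobolev spaces -/

/-- The measure `(ℓ² - x²)^(j+2) dx` on `(-ℓ, ℓ)`. -/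
def wMeasure (ℓ : ℝ) (j : ℕ) : Measure ℝ :=
  (volume.restrict (Ioo (-ℓ) ℓ)).withDensity fun x => ENNReal.ofReal ((ℓ ^ 2 - x ^ 2) ^ (j + 2))

/-- The weighted space `L²((-ℓ, ℓ); (ℓ² - x²)² dx)`, in which all the functions of the space
variable live. -/
abbrev L2w (ℓ : ℝ) : Type := Lp ℝ 2 (wMeasure ℓ 0)

/-- The Hilbert space of tuples `(f₀, …, f_k)` with squared norm
`∑ j ≤ k, ∫ (ℓ² - x²)^(j+2) f_j² dx`. -/
abbrev Jets (ℓ : ℝ) (k : ℕ) : Type :=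
  PiLp 2 fun j : Fin (k + 1) => Lp ℝ 2 (wMeasure ℓ (j : ℕ))

/-- The image of `C^k([-ℓ, ℓ])` (restrictions of `C^k` functions on the line) under
`φ ↦ (φ, φ', …, φ^(k))`. The norm of `Jets ℓ k` restricts to `|φ|_k` on it. -/
def smoothJets (ℓ : ℝ) (k : ℕ) : Submodule ℝ (Jets ℓ k) where
  carrier := {f | ∃ φ : ℝ → ℝ, ContDiff ℝ k φ ∧
    ∀ j : Fin (k + 1), (f j : ℝ → ℝ) =ᵐ[wMeasure ℓ (j : ℕ)] iteratedDeriv (j : ℕ) φ}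
  zero_mem' := by
    refine ⟨fun _ => 0, contDiff_const, fun j => ?_⟩
    have h : iteratedDeriv (j : ℕ) (fun _ : ℝ => (0 : ℝ)) = 0 := by
      ext x
      simp
    rw [h]
    exact Lp.coeFn_zero ℝ 2 (wMeasure ℓ (j : ℕ))
  add_mem' := by
    rintro f g ⟨φ, hφ, hf⟩ ⟨ψ, hψ, hg⟩
    refine ⟨φ + ψ, hφ.add hψ, fun j => ?_⟩
    have hj : ((j : ℕ) : WithTop ℕ∞) ≤ (k : WithTop ℕ∞) := by
      exact_mod_cast Nat.lt_succ_iff.mp j.2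
    filter_upwards [hf j, hg j, Lp.coeFn_add (f j) (g j)] with x h1 h2 h3
    rw [PiLp.add_apply, h3, Pi.add_apply, h1, h2,
      iteratedDeriv_add ((hφ.of_le hj).contDiffAt) ((hψ.of_le hj).contDiffAt)]
  smul_mem' := by
    rintro c f ⟨φ, hφ, hf⟩
    refine ⟨c • φ, hφ.const_smul c, fun j => ?_⟩
    have hj : ((j : ℕ) : WithTop ℕ∞) ≤ (k : WithTop ℕ∞) := by
      exact_mod_cast Nat.lt_succ_iff.mp j.2
    filter_upwards [hf j, Lp.coeFn_smul c (f j)] with x h1 h3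
    rw [PiLp.smul_apply, h3, Pi.smul_apply, h1,
      iteratedDeriv_const_smul ((hφ.of_le hj).contDiffAt) c]

/-- The weighted Sobolev space `ℋ^k`: the closure of `C^k([-ℓ, ℓ])` with respect to
`|V|_k² = ∑ j ≤ k, ∫ (ℓ² - x²)^(j+2) (∂_x^j V)² dx`. An element is recorded as the tuple
`(V, ∂_x V, …, ∂_x^k V)`; its norm is `|V|_k`. -/
abbrev Hsp (ℓ : ℝ) (k : ℕ) : Type := (smoothJets ℓ k).topologicalClosure

/-- The embedding `ℋ^k ↪ L²((ℓ² - x²)² dx)`: the function underlying `(V, ∂_x V, …, ∂_x^k V)`. -/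
def toL2w {ℓ : ℝ} {k : ℕ} (v : Hsp ℓ k) : L2w ℓ :=
  (v : Jets ℓ k) (0 : Fin (k + 1))

/-- The norm `|v|_k` of a function `v`, with the value `∞` if `v` does not belong to `ℋ^k`. -/
def hnorm {ℓ : ℝ} (k : ℕ) (v : L2w ℓ) : ℝ≥0∞ :=
  ⨅ (w : Hsp ℓ k) (_ : toL2w w = v), ‖w‖ₑ

/-! ### The linear operator -/

/-- `g` is the `n`-th weak derivative of `f` in `(-ℓ, ℓ)`. -/
def HasWeakDeriv (ℓ : ℝ) (n : ℕ) (f g : ℝ → ℝ) : Prop :=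
  LocallyIntegrableOn f (Ioo (-ℓ) ℓ) ∧ LocallyIntegrableOn g (Ioo (-ℓ) ℓ) ∧
    ∀ φ : ℝ → ℝ, ContDiff ℝ ∞ φ → HasCompactSupport φ → tsupport φ ⊆ Ioo (-ℓ) ℓ →
      ∫ x in Ioo (-ℓ) ℓ, f x * iteratedDeriv n φ x = (-1) ^ n * ∫ x in Ioo (-ℓ) ℓ, g x * φ x

/-- `w = 𝓛 v`, where `𝓛 v = U⁻¹ ∂_x² (U² ∂_x² v) - U⁻¹ ∂_x (Φ ∂_x v) + v / 5` in `(-ℓ, ℓ)`; the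
four functions `v₁`, `v₂`, `g`, `h` are `∂_x v`, `∂_x² v`, `∂_x² (U² ∂_x² v)`, `∂_x (Φ ∂_x v)`. -/
def IsLinOp (ℓ : ℝ) (U : ℝ → ℝ) (v w : ℝ → ℝ) : Prop :=
  ∃ v₁ v₂ g h : ℝ → ℝ,
    HasWeakDeriv ℓ 1 v v₁ ∧ HasWeakDeriv ℓ 2 v v₂ ∧
    HasWeakDeriv ℓ 2 (fun x => U x ^ 2 * v₂ x) g ∧
    HasWeakDeriv ℓ 1 (fun x => Phi U x * v₁ x) h ∧
    ∀ᵐ x ∂(volume.restrict (Ioo (-ℓ) ℓ)), w x = (U x)⁻¹ * g x - (U x)⁻¹ * h x + v x / 5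

/-! ### Functions of time with values in `ℋ^m` -/

/-- `f ∈ L²(0, ∞; ℋ^m)`. -/
def MemL2 {ℓ : ℝ} (m : ℕ) (f : ℝ → L2w ℓ) : Prop :=
  ∃ g : ℝ → Hsp ℓ m, MemLp g 2 (volume.restrict (Ioi 0)) ∧
    ∀ᵐ s ∂(volume.restrict (Ioi (0 : ℝ))), toL2w (g s) = f s

/-- `f ∈ L²_loc((0, ∞); ℋ^m)`. -/
def MemL2loc {ℓ : ℝ} (m : ℕ) (f : ℝ → L2w ℓ) : Prop :=
  ∃ g : ℝ → Hsp ℓ m, (∀ a b : ℝ, 0 < a → MemLp g 2 (volume.restrict (Icc a b))) ∧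
    ∀ᵐ s ∂(volume.restrict (Ioi (0 : ℝ))), toL2w (g s) = f s

/-- `f ∈ C⁰(S; ℋ^m)`. -/
def MemC0 {ℓ : ℝ} (m : ℕ) (S : Set ℝ) (f : ℝ → L2w ℓ) : Prop :=
  ∃ g : ℝ → Hsp ℓ m, ContinuousOn g S ∧ ∀ s ∈ S, toL2w (g s) = f s

/-- `D` is the weak derivative in time of `V` on `(0, ∞)`, as functions with values in the weighted
`L²` space. -/
def IsTimeDeriv {ℓ : ℝ} (V D : ℝ → L2w ℓ) : Prop :=
  LocallyIntegrableOn V (Ioi 0) ∧ LocallyIntegrableOn D (Ioi 0) ∧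
    ∀ φ : ℝ → ℝ, ContDiff ℝ ∞ φ → HasCompactSupport φ → tsupport φ ⊆ Ioi 0 →
      ∫ s in Ioi (0 : ℝ), deriv φ s • V s = -∫ s in Ioi (0 : ℝ), φ s • D s

/-- The function `s ↦ s^((k'-2)/2) f(s)`. -/
def weighted {ℓ : ℝ} (k' : ℕ) (f : ℝ → L2w ℓ) : ℝ → L2w ℓ :=
  fun s => s ^ (((k' : ℝ) - 2) / 2) • f s

/-- `V`, with time derivative `D = ∂_s V`, is a solution of `∂_s V + 𝓛 V = F` in
`(0, ∞) × (-ℓ, ℓ)` with `V = V⁰` at `s = 0`, in the regularity class of the linear theory. -/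
structure IsSolution (ℓ : ℝ) (U : ℝ → ℝ) (k : ℕ) (V₀ : Hsp ℓ 6) (F V D : ℝ → L2w ℓ) :
    Prop where
  timeDeriv : IsTimeDeriv V D
  /-- `V ∈ H¹_loc((0, ∞); ℋ^(2k))`. -/
  memH1loc : MemL2loc (2 * k) V ∧ MemL2loc (2 * k) D
  /-- `V ∈ L²_loc((0, ∞); ℋ^(2k+4))`. -/
  memL2loc : MemL2loc (2 * k + 4) V
  /-- `V ∈ C⁰((0, ∞); ℋ^(2k+2))`. -/
  memC0 : MemC0 (2 * k + 2) (Ioi 0) V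
  weighted_L2 : ∀ k' : ℕ, 2 ≤ k' → k' ≤ k → MemL2 (2 * k' + 4) (weighted k' V)
  weighted_L2_timeDeriv : ∀ k' : ℕ, 2 ≤ k' → k' ≤ k → MemL2 (2 * k') (weighted k' D)
  weighted_C0 : ∀ k' : ℕ, 2 ≤ k' → k' ≤ k → MemC0 (2 * k' + 2) (Ici 0) (weighted k' V)
  initial : V 0 = toL2w V₀
  /-- `𝓛 V(s) = F(s) - ∂_s V(s)` for almost every `s > 0`. -/
  equation : ∀ᵐ s ∂(volume.restrict (Ioi (0 : ℝ))), IsLinOp ℓ U (V s) (F s - D s : L2w ℓ)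

end ThinFilm

end

noncomputable section

namespace ThinFilm

/-! ### Weighted Sobolev seminorms of classical functions -/

/-! Write `ρ = ℓ² - x²`. The proof diagonalises `𝓛` in a basis adapted to the spaces `ℋ^(2i)`, which
turns the equation into a family of scalar equations `a' = -ν² a + f`, solved by Duhamel's formula
and estimated uniformly in `ν`.

Structure of the operator. Integrating the profile equation once gives `U'' = U³/3 + x²/10 + c`, and
this makes `U` smooth up to `±ℓ`. Zero contact angle and `U''(±ℓ) > 0` yield `U = ρ² u` with `u`
smooth and positive on `[-ℓ, ℓ]` (`IsProfile.exists_factor`). Since `Φ' = -(4/5) x U`, also `Φ = ρ³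
β` with `β` smooth and positive (`IsProfile.exists_factor_Phi`). Hence `u 𝓛` is the operator `ellOp`
with coefficients `α = u²`, `β`, `γ = u/5`: it is symmetric for `ρ² dx`, with quadratic form `∫ ρ⁴ α
(p'')² + ρ³ β (p')² + ρ² γ p²`, comparable to the squared norm of `ℋ²`. So `𝓛` is symmetric and
coercive for `ρ² u dx = U dx`.

Elliptic theory. The operator is built from the weighted divergences `Dst`, which satisfy the
coercive identity `ip_Dst_self` and the commutator rule `deriv_Dst`. These give `|p|_(m+4) ≤ C
|ellOp p|_m` for every `m` (`sob_le_ellOp`). Surjectivity `ℋ^(m+4) → ℋ^m` follows by the method of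
continuity from constant coefficients, where the operator is triangular on polynomials with nonzero
diagonal (`surjective_ellP`), and polynomials are dense in every `ℋ^m`.

Spectral theory. The embedding of `ℋ^(m+1)` into the weighted `L²` is compact, because polynomials
of degree `< n` approximate with error `O(n^(-1/2))` (`poincare`, `approx_poly`). The compact
self-adjoint operator `√u A⁻¹ √u`, with `A = ellOp`, therefore has a countable eigenbasis. In the
resulting coordinates `𝓛` is multiplication by `ν²`, and `ℋ^(2i)` consists exactly of the functions
with `∑ (ν^i B)² < ∞`, with equivalent norms (`exists_diagonalization`): `i = 0` is `L²`, `i = 1` is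
the form domain, and `𝓛 : ℋ^(m+4) ≃ ℋ^m` raises `i` by two.

Evolution. For one mode with `μ = ν²`, testing with `s^i a` bounds the quantities of weight `s^i` by
those of weight `s^(i-1)` and the data; after multiplication by `μ^(i+3)` the bounds chain without
loss (`mode_energy`, `mode_bound`). Summing over the modes, with `i = k' - 2`, gives existence,
regularity and the estimate. Uniqueness holds mode by mode: the coordinates of any solution are
continuous on `[0, ∞)` and solve the scalar equation weakly (`mode_unique`).

Dependence of the constant. For given `ℓ` there is at most one profile (`IsProfile.unique`), so a
constant built from the profile depends only on `k` and `ℓ`. -/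

/-- The weighted pairing `∫ (ℓ² - x²)^a f g` on `(-ℓ, ℓ)`. -/
def ip (ℓ : ℝ) (a : ℕ) (f g : ℝ → ℝ) : ℝ :=
  ∫ x in (-ℓ)..ℓ, (ℓ ^ 2 - x ^ 2) ^ a * (f x * g x)

/-- The squared seminorm `∑ j ≤ m, ∫ (ℓ² - x²)^(a+j) (f^(j))²`. -/
def sob (ℓ : ℝ) : ℕ → ℕ → (ℝ → ℝ) → ℝ
  | a, 0, f => ip ℓ a f f
  | a, m + 1, f => ip ℓ a f f + sob ℓ (a + 1) m (deriv f)

/-- `(ℓ² - x²)^(-a) ∂_x ((ℓ² - x²)^(a+1) p)`. -/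
def Dst (ℓ : ℝ) (a : ℕ) (p : ℝ → ℝ) (x : ℝ) : ℝ :=
  (ℓ ^ 2 - x ^ 2) * deriv p x - 2 * (a + 1) * x * p x

/-- The derivatives of `α` of order at most `m` are bounded by `K` on `[-ℓ, ℓ]`. -/
def CBound (ℓ K : ℝ) : ℕ → (ℝ → ℝ) → Prop
  | 0, α => ∀ x ∈ Icc (-ℓ) ℓ, |α x| ≤ K
  | m + 1, α => (∀ x ∈ Icc (-ℓ) ℓ, |α x| ≤ K) ∧ CBound ℓ K m (deriv α)

lemma wt_nonneg {ℓ x : ℝ} (hx : x ∈ Icc (-ℓ) ℓ) : 0 ≤ ℓ ^ 2 - x ^ 2 := by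
  nlinarith [hx.1, hx.2]

lemma ip_nonneg {ℓ : ℝ} (hℓ : 0 < ℓ) (a : ℕ) (f : ℝ → ℝ) : 0 ≤ ip ℓ a f f := by
  refine intervalIntegral.integral_nonneg (by linarith) fun x hx => ?_
  exact mul_nonneg (pow_nonneg (wt_nonneg hx) _) (mul_self_nonneg _)

lemma ip_comm (ℓ : ℝ) (a : ℕ) (f g : ℝ → ℝ) : ip ℓ a f g = ip ℓ a g f := by
  simp only [ip, mul_comm (f _)]

lemma ip_integrable {ℓ : ℝ} {a : ℕ} {f g : ℝ → ℝ} (hf : Continuous f) (hg : Continuous g) :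
    IntervalIntegrable (fun x => (ℓ ^ 2 - x ^ 2) ^ a * (f x * g x)) volume (-ℓ) ℓ :=
  (by fun_prop : Continuous fun x => (ℓ ^ 2 - x ^ 2) ^ a * (f x * g x)).intervalIntegrable _ _

lemma ip_add_left {ℓ : ℝ} {a : ℕ} {f g h : ℝ → ℝ} (hf : Continuous f) (hg : Continuous g)
    (hh : Continuous h) : ip ℓ a (fun x => f x + g x) h = ip ℓ a f h + ip ℓ a g h := by
  rw [ip, ip, ip, ← intervalIntegral.integral_add (ip_integrable hf hh) (ip_integrable hg hh)]
  congr 1; ext x; ring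

lemma ip_smul_left {ℓ : ℝ} {a : ℕ} (c : ℝ) (f h : ℝ → ℝ) :
    ip ℓ a (fun x => c * f x) h = c * ip ℓ a f h := by
  rw [ip, ip, ← intervalIntegral.integral_const_mul]
  congr 1; ext x; ring

lemma ip_congr {ℓ : ℝ} (hℓ : 0 < ℓ) {a : ℕ} {f g f' g' : ℝ → ℝ}
    (hf : ∀ x ∈ Icc (-ℓ) ℓ, f x = f' x) (hg : ∀ x ∈ Icc (-ℓ) ℓ, g x = g' x) :
    ip ℓ a f g = ip ℓ a f' g' := by
  refine intervalIntegral.integral_congr fun x hx => ?_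
  rw [uIcc_of_le (by linarith)] at hx
  simp only [hf x hx, hg x hx]

lemma ip_mono {ℓ : ℝ} (hℓ : 0 < ℓ) {a : ℕ} {f g : ℝ → ℝ} (hf : Continuous f) (hg : Continuous g)
    {C : ℝ} (h : ∀ x ∈ Icc (-ℓ) ℓ, f x * f x ≤ C * (g x * g x)) :
    ip ℓ a f f ≤ C * ip ℓ a g g := by
  rw [ip, ip, ← intervalIntegral.integral_const_mul]
  refine intervalIntegral.integral_mono_on (by linarith) (ip_integrable hf hf)
    ((ip_integrable hg hg).const_mul _) fun x hx => ?_
  have := mul_le_mul_of_nonneg_left (h x hx) (pow_nonneg (wt_nonneg hx) a)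
  linarith

lemma ip_weight {ℓ : ℝ} (hℓ : 0 < ℓ) {a : ℕ} {f : ℝ → ℝ} (hf : Continuous f) :
    ip ℓ (a + 1) f f ≤ ℓ ^ 2 * ip ℓ a f f := by
  rw [ip, ip, ← intervalIntegral.integral_const_mul]
  refine intervalIntegral.integral_mono_on (by linarith) (ip_integrable hf hf)
    ((ip_integrable hf hf).const_mul _) fun x hx => ?_
  have h1 := mul_nonneg (pow_nonneg (wt_nonneg hx) a) (mul_self_nonneg (f x))
  rw [pow_succ]
  nlinarith [mul_nonneg h1 (sq_nonneg x)]

lemma ip_add_le {ℓ : ℝ} (hℓ : 0 < ℓ) {a : ℕ} {f g : ℝ → ℝ} (hf : Continuous f)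
    (hg : Continuous g) :
    ip ℓ a (fun x => f x + g x) (fun x => f x + g x) ≤ 2 * ip ℓ a f f + 2 * ip ℓ a g g := by
  rw [ip, ip, ip, ← intervalIntegral.integral_const_mul, ← intervalIntegral.integral_const_mul,
    ← intervalIntegral.integral_add ((ip_integrable hf hf).const_mul _)
      ((ip_integrable hg hg).const_mul _)]
  refine intervalIntegral.integral_mono_on (by linarith)
    (ip_integrable (hf.add hg) (hf.add hg))
    (((ip_integrable hf hf).const_mul _).add ((ip_integrable hg hg).const_mul _)) fun x hx => ?_
  nlinarith [mul_nonneg (pow_nonneg (wt_nonneg hx) a) (sq_nonneg (f x - g x))]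

lemma contDiff_deriv {m : ℕ} {f : ℝ → ℝ} (hf : ContDiff ℝ (m + 1 : ℕ) f) :
    ContDiff ℝ m (deriv f) := by
  have : ContDiff ℝ ((m : WithTop ℕ∞) + 1) f := by exact_mod_cast hf
  exact (contDiff_succ_iff_deriv.1 this).2.2

lemma contDiff_pred {m : ℕ} {f : ℝ → ℝ} (hf : ContDiff ℝ (m + 1 : ℕ) f) : ContDiff ℝ m f :=
  hf.of_le (by exact_mod_cast Nat.le_succ m)

lemma contDiff_natLE {m n : ℕ} {f : ℝ → ℝ} (hf : ContDiff ℝ n f) (h : m ≤ n) : ContDiff ℝ m f :=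
  hf.of_le (by exact_mod_cast h)

lemma contDiff_succ_differentiable {m : ℕ} {f : ℝ → ℝ} (hf : ContDiff ℝ (m + 1 : ℕ) f) :
    Differentiable ℝ f :=
  hf.differentiable (by exact_mod_cast Nat.succ_ne_zero m)

lemma sob_nonneg {ℓ : ℝ} (hℓ : 0 < ℓ) (a m : ℕ) (f : ℝ → ℝ) : 0 ≤ sob ℓ a m f := by
  induction m generalizing a f with
  | zero => exact ip_nonneg hℓ _ _
  | succ m ih => exact add_nonneg (ip_nonneg hℓ _ _) (ih _ _)

lemma ip_le_sob {ℓ : ℝ} (hℓ : 0 < ℓ) (a m : ℕ) (f : ℝ → ℝ) : ip ℓ a f f ≤ sob ℓ a m f := by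
  cases m with
  | zero => exact le_rfl
  | succ m => exact le_add_of_nonneg_right (sob_nonneg hℓ _ _ _)

lemma sob_succ_le {ℓ : ℝ} (hℓ : 0 < ℓ) (a m : ℕ) (f : ℝ → ℝ) :
    sob ℓ a m f ≤ sob ℓ a (m + 1) f := by
  induction m generalizing a f with
  | zero => exact ip_le_sob hℓ a 1 f
  | succ m ih =>
    rw [sob, sob]
    exact add_le_add_right (ih _ _) _

lemma sob_mono {ℓ : ℝ} (hℓ : 0 < ℓ) (a : ℕ) {m n : ℕ} (h : m ≤ n) (f : ℝ → ℝ) :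
    sob ℓ a m f ≤ sob ℓ a n f := by
  induction h with
  | refl => exact le_rfl
  | step _ ih => exact ih.trans (sob_succ_le hℓ _ _ _)

lemma sob_deriv_le {ℓ : ℝ} (hℓ : 0 < ℓ) (a m : ℕ) (f : ℝ → ℝ) :
    sob ℓ (a + 1) m (deriv f) ≤ sob ℓ a (m + 1) f :=
  le_add_of_nonneg_left (ip_nonneg hℓ _ _)

lemma sob_weight {ℓ : ℝ} (hℓ : 0 < ℓ) {a m : ℕ} {f : ℝ → ℝ} (hf : ContDiff ℝ m f) :
    sob ℓ (a + 1) m f ≤ ℓ ^ 2 * sob ℓ a m f := by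
  induction m generalizing a f with
  | zero => exact ip_weight hℓ hf.continuous
  | succ m ih =>
    rw [sob, sob, mul_add]
    exact add_le_add (ip_weight hℓ hf.continuous) (ih (contDiff_deriv hf))

lemma sob_add_le {ℓ : ℝ} (hℓ : 0 < ℓ) {a m : ℕ} {f g : ℝ → ℝ} (hf : ContDiff ℝ m f)
    (hg : ContDiff ℝ m g) :
    sob ℓ a m (fun x => f x + g x) ≤ 2 * sob ℓ a m f + 2 * sob ℓ a m g := by
  induction m generalizing a f g with
  | zero => exact ip_add_le hℓ hf.continuous hg.continuous
  | succ m ih =>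
    have hd : deriv (fun x => f x + g x) = fun x => deriv f x + deriv g x := by
      ext x
      exact deriv_fun_add (contDiff_succ_differentiable hf x) (contDiff_succ_differentiable hg x)
    rw [sob, sob, sob, hd]
    have h1 := ip_add_le hℓ (a := a) hf.continuous hg.continuous
    have h2 := ih (a := a + 1) (contDiff_deriv hf) (contDiff_deriv hg)
    linarith

lemma sob_smul {ℓ : ℝ} (a m : ℕ) (c : ℝ) (f : ℝ → ℝ) :
    sob ℓ a m (fun x => c * f x) = c ^ 2 * sob ℓ a m f := by
  have hip : ∀ (b : ℕ) (f : ℝ → ℝ),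
      ip ℓ b (fun x => c * f x) (fun x => c * f x) = c ^ 2 * ip ℓ b f f := fun b f => by
    rw [ip_smul_left, ip_comm, ip_smul_left]; ring
  induction m generalizing a f with
  | zero => exact hip _ _
  | succ m ih =>
    rw [sob, sob, hip, deriv_const_mul_field', ih]; ring

lemma CBound.pred {ℓ K : ℝ} {m : ℕ} {α : ℝ → ℝ} (h : CBound ℓ K (m + 1) α) : CBound ℓ K m α := by
  induction m generalizing α with
  | zero => exact h.1
  | succ m ih => exact ⟨h.1, ih h.2⟩

lemma CBound.natLE {ℓ K : ℝ} {m n : ℕ} (hmn : m ≤ n) {α : ℝ → ℝ} (h : CBound ℓ K n α) :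
    CBound ℓ K m α := by
  induction hmn with
  | refl => exact h
  | step _ ih => exact ih h.pred

lemma CBound.bound {ℓ K : ℝ} {m : ℕ} {α : ℝ → ℝ} (h : CBound ℓ K m α) :
    ∀ x ∈ Icc (-ℓ) ℓ, |α x| ≤ K := by
  cases m with
  | zero => exact h
  | succ m => exact h.1

lemma CBound.mono {ℓ K K' : ℝ} (hK : K ≤ K') {m : ℕ} {α : ℝ → ℝ} (h : CBound ℓ K m α) :
    CBound ℓ K' m α := by
  induction m generalizing α with
  | zero => exact fun x hx => (h x hx).trans hK
  | succ m ih => exact ⟨fun x hx => (h.1 x hx).trans hK, ih h.2⟩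

lemma CBound.add {ℓ K K' : ℝ} {m : ℕ} {α β : ℝ → ℝ} (h : CBound ℓ K m α) (h' : CBound ℓ K' m β)
    (hα : ContDiff ℝ m α) (hβ : ContDiff ℝ m β) : CBound ℓ (K + K') m (fun x => α x + β x) := by
  induction m generalizing α β with
  | zero => exact fun x hx => (abs_add_le _ _).trans (add_le_add (h x hx) (h' x hx))
  | succ m ih =>
    refine ⟨fun x hx => (abs_add_le _ _).trans (add_le_add (h.1 x hx) (h'.1 x hx)), ?_⟩
    have hd : deriv (fun x => α x + β x) = fun x => deriv α x + deriv β x := by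
      ext x
      exact deriv_fun_add (contDiff_succ_differentiable hα x) (contDiff_succ_differentiable hβ x)
    rw [hd]
    exact ih h.2 h'.2 (contDiff_deriv hα) (contDiff_deriv hβ)

lemma CBound.const_mul {ℓ K c : ℝ} {m : ℕ} {α : ℝ → ℝ} (h : CBound ℓ K m α) :
    CBound ℓ (|c| * K) m (fun x => c * α x) := by
  induction m generalizing α with
  | zero => exact fun x hx => by rw [abs_mul]; gcongr; exact h x hx
  | succ m ih =>
    refine ⟨fun x hx => by rw [abs_mul]; gcongr; exact h.1 x hx, ?_⟩
    rw [deriv_const_mul_field']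
    exact ih h.2

lemma exists_CBound (ℓ : ℝ) {m : ℕ} {α : ℝ → ℝ} (hα : ContDiff ℝ m α) :
    ∃ K, CBound ℓ K m α := by
  have hc : ∀ {f : ℝ → ℝ}, Continuous f → ∃ K, ∀ x ∈ Icc (-ℓ) ℓ, |f x| ≤ K := fun hf =>
    (isCompact_Icc.exists_bound_of_continuousOn hf.continuousOn)
  induction m generalizing α with
  | zero => exact hc hα.continuous
  | succ m ih =>
    obtain ⟨K, hK⟩ := hc hα.continuous
    obtain ⟨K', hK'⟩ := ih (contDiff_deriv hα)
    exact ⟨max K K', fun x hx => (hK x hx).trans (le_max_left _ _), hK'.mono (le_max_right _ _)⟩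

lemma deriv_mul_eq {m : ℕ} {f g : ℝ → ℝ} (hf : ContDiff ℝ (m + 1 : ℕ) f)
    (hg : ContDiff ℝ (m + 1 : ℕ) g) :
    deriv (fun x => f x * g x) = fun x => deriv f x * g x + f x * deriv g x := by
  ext x
  exact deriv_fun_mul (contDiff_succ_differentiable hf x) (contDiff_succ_differentiable hg x)

/-- Leibniz rule and induction on the order. The term `α' f` carries one more power of the weight
than needed, which costs only `ℓ²`. The constant does not depend on the weight exponent, since the
induction uses the estimate at `a + 1`. -/
lemma sob_mul {ℓ : ℝ} (hℓ : 0 < ℓ) (m : ℕ) (K : ℝ) : ∃ C, 0 ≤ C ∧ ∀ (a : ℕ) (α f : ℝ → ℝ),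
    ContDiff ℝ m α → CBound ℓ K m α → ContDiff ℝ m f →
      sob ℓ a m (fun x => α x * f x) ≤ C * sob ℓ a m f := by
  have hip : ∀ (a : ℕ) (α f : ℝ → ℝ), Continuous α → (∀ x ∈ Icc (-ℓ) ℓ, |α x| ≤ K) →
      Continuous f → ip ℓ a (fun x => α x * f x) (fun x => α x * f x) ≤ K ^ 2 * ip ℓ a f f := by
    intro a α f hα hK hf
    refine ip_mono hℓ (hα.mul hf) hf fun x hx => ?_
    have h1 : α x ^ 2 ≤ K ^ 2 := sq_le_sq' (abs_le.1 (hK x hx)).1 (abs_le.1 (hK x hx)).2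
    have := mul_le_mul_of_nonneg_right h1 (mul_self_nonneg (f x))
    simp only [Pi.mul_apply]
    linarith
  induction m with
  | zero => exact ⟨K ^ 2, sq_nonneg _, fun a α f hα hK hf => hip a α f hα.continuous hK hf.continuous⟩
  | succ m ih =>
    obtain ⟨C, hC, h⟩ := ih
    refine ⟨K ^ 2 + 2 * C * ℓ ^ 2 + 2 * C, by positivity, fun a α f hα hK hf => ?_⟩
    rw [sob, deriv_mul_eq hα hf]
    have hα' := contDiff_deriv hα
    have hf' := contDiff_deriv hf
    have h1 := hip a α f hα.continuous hK.1 hf.continuous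
    have h2 := sob_add_le hℓ (a := a + 1) (hα'.mul (contDiff_pred hf)) ((contDiff_pred hα).mul hf')
    have h3 := h (a + 1) _ _ hα' hK.2 (contDiff_pred hf)
    have h4 := h (a + 1) _ _ (contDiff_pred hα) hK.pred hf'
    have h5 := sob_weight hℓ (a := a) (contDiff_pred hf)
    have h6 := sob_succ_le hℓ a m f
    have h7 := sob_deriv_le hℓ a m f
    have h8 := ip_le_sob hℓ a (m + 1) f
    calc _ ≤ K ^ 2 * sob ℓ a (m + 1) f + (2 * (C * (ℓ ^ 2 * sob ℓ a (m + 1) f)) +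
          2 * (C * sob ℓ a (m + 1) f)) := by
          refine add_le_add (h1.trans (by gcongr)) (h2.trans (add_le_add ?_ ?_))
          · exact mul_le_mul_of_nonneg_left (h3.trans (by gcongr; exact h5.trans (by gcongr)))
              (by norm_num)
          · exact mul_le_mul_of_nonneg_left (h4.trans (by gcongr)) (by norm_num)
      _ = _ := by ring

/-- Division by `α` without forming `1/α`: `α f' = (α f)' - α' f`, where `α' f` is of lower order in
`f` and is controlled by the induction hypothesis at the same weight. -/
lemma sob_mul_lower {ℓ : ℝ} (hℓ : 0 < ℓ) (m : ℕ) (K c : ℝ) (hc : 0 < c) :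
    ∃ C, 0 ≤ C ∧ ∀ (a : ℕ) (α f : ℝ → ℝ),
    ContDiff ℝ m α → CBound ℓ K m α → (∀ x ∈ Icc (-ℓ) ℓ, c ≤ α x) → ContDiff ℝ m f →
      sob ℓ a m f ≤ C * sob ℓ a m (fun x => α x * f x) := by
  have hip : ∀ (a : ℕ) (α f : ℝ → ℝ), Continuous α → (∀ x ∈ Icc (-ℓ) ℓ, c ≤ α x) →
      Continuous f → ip ℓ a f f ≤ (c ^ 2)⁻¹ * ip ℓ a (fun x => α x * f x) (fun x => α x * f x) := by
    intro a α f hα hK hf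
    refine ip_mono hℓ hf (hα.mul hf) fun x hx => ?_
    have h1 : c ^ 2 ≤ α x ^ 2 := pow_le_pow_left₀ hc.le (hK x hx) 2
    rw [inv_mul_eq_div, le_div_iff₀ (by positivity)]
    have := mul_le_mul_of_nonneg_right h1 (mul_self_nonneg (f x))
    simp only [Pi.mul_apply]
    linarith
  induction m with
  | zero =>
    exact ⟨(c ^ 2)⁻¹, by positivity, fun a α f hα hK hc hf => hip a α f hα.continuous hc hf.continuous⟩
  | succ m ih =>
    obtain ⟨C, hC, h⟩ := ih
    obtain ⟨C', hC', h'⟩ := sob_mul hℓ m K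
    refine ⟨(c ^ 2)⁻¹ + C * (2 + 2 * (C' * (ℓ ^ 2 * C))), by positivity,
      fun a α f hα hK hl hf => ?_⟩
    have hα' := contDiff_deriv hα
    have hf' := contDiff_deriv hf
    set g := fun x => α x * f x with hg
    have hgm : ContDiff ℝ (m + 1 : ℕ) g := hα.mul hf
    have h1 := hip a α f hα.continuous hl hf.continuous
    have h2 := h (a + 1) α (deriv f) (contDiff_pred hα) hK.pred hl hf'
    have h3 : (fun x => α x * deriv f x) = fun x => deriv g x + (-1) * (deriv α x * f x) := by
      rw [hg, deriv_mul_eq hα hf]; ext x; ring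
    have h4 := sob_add_le hℓ (a := a + 1) (contDiff_deriv hgm)
      (contDiff_const.mul (hα'.mul (contDiff_pred hf)) : ContDiff ℝ m
        fun x => (-1 : ℝ) * (deriv α x * f x))
    rw [← h3, sob_smul] at h4
    have h5 := h' (a + 1) _ _ hα' hK.2 (contDiff_pred hf)
    have h6 := sob_weight hℓ (a := a) (contDiff_pred hf)
    have h7 := h a α f (contDiff_pred hα) hK.pred hl (contDiff_pred hf)
    have h8 := sob_succ_le hℓ a m g
    have h9 := sob_deriv_le hℓ a m g
    have h10 := ip_le_sob hℓ a (m + 1) g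
    have h11 : sob ℓ (a + 1) m (fun x => deriv α x * f x) ≤
        C' * (ℓ ^ 2 * (C * sob ℓ a (m + 1) g)) :=
      h5.trans (by gcongr; exact h6.trans (by gcongr; exact h7.trans (by gcongr)))
    have h12 : sob ℓ (a + 1) m (fun x => α x * deriv f x) ≤
        (2 + 2 * (C' * (ℓ ^ 2 * C))) * sob ℓ a (m + 1) g := by linarith
    rw [sob]
    calc _ ≤ (c ^ 2)⁻¹ * sob ℓ a (m + 1) g + C * ((2 + 2 * (C' * (ℓ ^ 2 * C))) *
          sob ℓ a (m + 1) g) :=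
          add_le_add (h1.trans (by gcongr)) (h2.trans (by gcongr))
      _ = _ := by ring

/-! ### The adjoint derivative -/

lemma hasDerivAt_wt (ℓ x : ℝ) : HasDerivAt (fun x : ℝ => ℓ ^ 2 - x ^ 2) (-(2 * x)) x := by
  simpa using (hasDerivAt_pow 2 x).const_sub (ℓ ^ 2)

lemma hasDerivAt_wt_pow (ℓ : ℝ) (a : ℕ) (x : ℝ) :
    HasDerivAt (fun x : ℝ => (ℓ ^ 2 - x ^ 2) ^ (a + 1))
      (-(2 * (a + 1) * x * (ℓ ^ 2 - x ^ 2) ^ a)) x := by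
  refine ((hasDerivAt_wt ℓ x).fun_pow (a + 1)).congr_deriv ?_
  push_cast
  ring

lemma contDiff_Dst {ℓ : ℝ} {a m : ℕ} {p : ℝ → ℝ} (hp : ContDiff ℝ (m + 1 : ℕ) p) :
    ContDiff ℝ m (Dst ℓ a p) := by
  have h1 := contDiff_deriv hp
  have h2 := contDiff_pred hp
  unfold Dst
  fun_prop

lemma hasDerivAt_wt_pow_mul {ℓ : ℝ} {a : ℕ} {p : ℝ → ℝ} (hp : Differentiable ℝ p) (x : ℝ) :
    HasDerivAt (fun x => (ℓ ^ 2 - x ^ 2) ^ (a + 1) * p x)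
      ((ℓ ^ 2 - x ^ 2) ^ a * Dst ℓ a p x) x := by
  refine ((hasDerivAt_wt_pow ℓ a x).fun_mul (hp x).hasDerivAt).congr_deriv ?_
  rw [Dst]; ring

/-- The commutator with `∂_x` is of order zero, and the weight exponent rises by one. This is why
the weight in `sob` grows with the order of the derivative. -/
lemma deriv_Dst {ℓ : ℝ} {a : ℕ} {p : ℝ → ℝ} (hp : ContDiff ℝ 2 p) :
    deriv (Dst ℓ a p) = fun x => Dst ℓ (a + 1) (deriv p) x + -(2 * (a + 1)) * p x := by
  have hp' : ContDiff ℝ 1 (deriv p) := contDiff_deriv (m := 1) (by exact_mod_cast hp)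
  ext x
  have h1 := ((hp'.differentiable (by norm_num)) x).hasDerivAt
  have h2 := ((hp.differentiable (by norm_num)) x).hasDerivAt
  have h := ((hasDerivAt_wt ℓ x).mul h1).sub
    ((((hasDerivAt_id x).const_mul (2 * ((a : ℝ) + 1)))).mul h2)
  refine (HasDerivAt.deriv (h.congr_of_eventuallyEq (.of_forall fun y => ?_))).trans ?_
  · simp [Dst]
  · simp [Dst]; ring

/-- `-Dst` is the adjoint of the derivative. -/
lemma ip_Dst {ℓ : ℝ} {a : ℕ} {p q : ℝ → ℝ} (hp : ContDiff ℝ 1 p) (hq : ContDiff ℝ 1 q) :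
    ip ℓ a (Dst ℓ a p) q = -ip ℓ (a + 1) p (deriv q) := by
  have hp1 := hp.differentiable (by norm_num)
  have hq1 := hq.differentiable (by norm_num)
  have hpc : Continuous (deriv p) := hp.continuous_deriv_one
  have hqc : Continuous (deriv q) := hq.continuous_deriv_one
  have hpc' := hp.continuous
  have hqc' := hq.continuous
  have h := intervalIntegral.integral_deriv_mul_eq_sub (a := -ℓ) (b := ℓ)
    (u := fun x => (ℓ ^ 2 - x ^ 2) ^ (a + 1) * p x) (v := q)
    (u' := fun x => (ℓ ^ 2 - x ^ 2) ^ a * Dst ℓ a p x) (v' := deriv q)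
    (fun x _ => hasDerivAt_wt_pow_mul hp1 x) (fun x _ => (hq1 x).hasDerivAt)
    (by unfold Dst; exact Continuous.intervalIntegrable (by fun_prop) _ _)
    (hqc.intervalIntegrable _ _)
  rw [show (ℓ ^ 2 - ℓ ^ 2 : ℝ) ^ (a + 1) * p ℓ * q ℓ -
    (ℓ ^ 2 - (-ℓ) ^ 2) ^ (a + 1) * p (-ℓ) * q (-ℓ) = 0 by simp,
    intervalIntegral.integral_add] at h
  · rw [ip, ip, eq_neg_iff_add_eq_zero, ← h]
    congr 1 <;> (congr 1; ext x; ring)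
  · unfold Dst; exact Continuous.intervalIntegrable (by fun_prop) _ _
  · exact Continuous.intervalIntegrable (by fun_prop) _ _

/-- The two integrands differ by the derivative of `-2(a+1) x ρ^(a+1) p²`, which vanishes at `±ℓ`.
Both terms on the right are nonnegative, so `Dst` controls `p` and `p'` with no boundary condition
on `p`. -/
lemma ip_Dst_self {ℓ : ℝ} {a : ℕ} {p : ℝ → ℝ} (hp : ContDiff ℝ 1 p) :
    ip ℓ a (Dst ℓ a p) (Dst ℓ a p) =
      ip ℓ (a + 2) (deriv p) (deriv p) + 2 * (a + 1) * ip ℓ (a + 1) p p := by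
  have hp1 := hp.differentiable (by norm_num)
  have hpc : Continuous (deriv p) := hp.continuous_deriv_one
  have hpc' := hp.continuous
  have h := intervalIntegral.integral_eq_sub_of_hasDerivAt (a := -ℓ) (b := ℓ)
    (f := fun x => (ℓ ^ 2 - x ^ 2) ^ (a + 1) * (-(2 * (a + 1)) * (x * (p x * p x))))
    (f' := fun x => (ℓ ^ 2 - x ^ 2) ^ a * (Dst ℓ a p x * Dst ℓ a p x) -
      ((ℓ ^ 2 - x ^ 2) ^ (a + 2) * (deriv p x * deriv p x) +
        2 * (a + 1) * ((ℓ ^ 2 - x ^ 2) ^ (a + 1) * (p x * p x))))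
    (fun x _ => by
      refine ((hasDerivAt_wt_pow ℓ a x).fun_mul (((hasDerivAt_id' x).fun_mul
        ((hp1 x).hasDerivAt.fun_mul (hp1 x).hasDerivAt)).const_mul
          (-(2 * ((a : ℝ) + 1))))).congr_deriv ?_
      simp only [Dst]; ring)
    (by unfold Dst; exact Continuous.intervalIntegrable (by fun_prop) _ _)
  simp only [neg_sq, sub_self, ne_eq, Nat.add_eq_zero_iff, one_ne_zero, and_false,
    not_false_eq_true, zero_pow, zero_mul] at h
  rw [intervalIntegral.integral_sub, intervalIntegral.integral_add,
    intervalIntegral.integral_const_mul, sub_eq_zero] at h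
  · exact h
  all_goals
    try unfold Dst
    exact Continuous.intervalIntegrable (by fun_prop) _ _

lemma sob_Dst_le {ℓ : ℝ} (hℓ : 0 < ℓ) (m a : ℕ) : ∃ C, 0 ≤ C ∧ ∀ p : ℝ → ℝ,
    ContDiff ℝ (m + 1 : ℕ) p → sob ℓ a m (Dst ℓ a p) ≤ C * sob ℓ (a + 1) (m + 1) p := by
  have h0 : ∀ (a : ℕ) (p : ℝ → ℝ), ContDiff ℝ 1 p →
      ip ℓ a (Dst ℓ a p) (Dst ℓ a p) ≤ (2 * (a + 1) + 1) * sob ℓ (a + 1) 1 p := by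
    intro a p hp
    rw [ip_Dst_self hp, sob, sob]
    have h1 := ip_nonneg hℓ (a + 1) p
    have h2 := ip_nonneg hℓ (a + 1 + 1) (deriv p)
    have h3 : (0 : ℝ) ≤ a := a.cast_nonneg
    nlinarith [mul_nonneg h3 h2]
  induction m generalizing a with
  | zero => exact ⟨2 * (a + 1) + 1, by positivity, fun p hp => h0 a p (by exact_mod_cast hp)⟩
  | succ m ih =>
    obtain ⟨C, hC, h⟩ := ih (a + 1)
    refine ⟨(2 * (a + 1) + 1) + (2 * C + 2 * (-(2 * ((a : ℝ) + 1))) ^ 2), by positivity,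
      fun p hp => ?_⟩
    have hp' := contDiff_deriv hp
    have h1 := h0 a p (contDiff_natLE (m := 1) hp (by lia))
    have h2 := sob_add_le hℓ (a := a + 1) (contDiff_Dst (ℓ := ℓ) (a := a + 1) hp')
      (contDiff_const.mul (contDiff_pred (contDiff_pred hp)) : ContDiff ℝ m
        fun x => (-(2 * ((a : ℝ) + 1))) * p x)
    rw [sob_smul] at h2
    have h3 := h _ hp'
    have h4 := sob_mono hℓ (a + 1) (show 1 ≤ m + 1 + 1 by lia) p
    have h5 := sob_mono hℓ (a + 1) (show m ≤ m + 1 + 1 by lia) p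
    have h6 := sob_deriv_le hℓ (a + 1) (m + 1) p
    rw [sob, deriv_Dst (contDiff_natLE (m := 2) hp (by lia))]
    calc _ ≤ (2 * (a + 1) + 1) * sob ℓ (a + 1) (m + 1 + 1) p +
        (2 * (C * sob ℓ (a + 1) (m + 1 + 1) p) +
          2 * ((-(2 * ((a : ℝ) + 1))) ^ 2 * sob ℓ (a + 1) (m + 1 + 1) p)) := by
          refine add_le_add (h1.trans (by gcongr)) (h2.trans (add_le_add ?_ ?_))
          · exact mul_le_mul_of_nonneg_left (h3.trans (by gcongr)) (by norm_num)
          · gcongr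
      _ = _ := by ring

/-- Inverting `Dst` gains one derivative. Order one is `ip_Dst_self`; for higher orders the rule
`deriv_Dst` rewrites `Dst` of `p'` as `(Dst p)'` plus a multiple of `p`, and the latter is already
controlled. -/
lemma le_sob_Dst {ℓ : ℝ} (hℓ : 0 < ℓ) (m a : ℕ) : ∃ C, 0 ≤ C ∧ ∀ p : ℝ → ℝ,
    ContDiff ℝ (m + 1 : ℕ) p → sob ℓ (a + 1) (m + 1) p ≤ C * sob ℓ a m (Dst ℓ a p) := by
  have h0 : ∀ (a : ℕ) (p : ℝ → ℝ), ContDiff ℝ 1 p →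
      sob ℓ (a + 1) 1 p ≤ 1 * ip ℓ a (Dst ℓ a p) (Dst ℓ a p) := by
    intro a p hp
    rw [ip_Dst_self hp, sob, sob]
    have h1 := ip_nonneg hℓ (a + 1) p
    have h2 := ip_nonneg hℓ (a + 1 + 1) (deriv p)
    have h3 : (0 : ℝ) ≤ a := a.cast_nonneg
    nlinarith [mul_nonneg h3 h1]
  induction m generalizing a with
  | zero => exact ⟨1, by positivity, fun p hp => h0 a p (by exact_mod_cast hp)⟩
  | succ m ih =>
    obtain ⟨C, hC, h⟩ := ih (a + 1)
    obtain ⟨C', hC', h'⟩ := ih a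
    refine ⟨1 + C * (2 + 2 * ((2 * ((a : ℝ) + 1)) ^ 2 * C')), by positivity,
      fun p hp => ?_⟩
    have hp' := contDiff_deriv hp
    have hp1 := contDiff_pred hp
    have hD : ContDiff ℝ (m + 1 : ℕ) (Dst ℓ a p) := contDiff_Dst hp
    have h1 := h0 a p (contDiff_natLE (m := 1) hp (by lia))
    have h2 := h _ hp'
    have h3 : Dst ℓ (a + 1) (deriv p) = fun x => deriv (Dst ℓ a p) x + (2 * (a + 1)) * p x := by
      rw [deriv_Dst (contDiff_natLE (m := 2) hp (by lia))]
      ext x; ring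
    have h4 := sob_add_le hℓ (a := a + 1) (contDiff_deriv hD)
      (contDiff_const.mul (contDiff_pred hp1) : ContDiff ℝ m
        fun x => (2 * ((a : ℝ) + 1)) * p x)
    rw [← h3, sob_smul] at h4
    have h5 := h' p hp1
    have h6 := sob_succ_le hℓ (a + 1) m p
    have h7 := sob_succ_le hℓ a m (Dst ℓ a p)
    have h8 := sob_deriv_le hℓ a m (Dst ℓ a p)
    have h9 := ip_le_sob hℓ a (m + 1) (Dst ℓ a p)
    have h10 : ip ℓ (a + 1) p p ≤ sob ℓ (a + 1) 1 p := ip_le_sob hℓ _ _ _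
    have h11 : sob ℓ (a + 1) m p ≤ C' * sob ℓ a (m + 1) (Dst ℓ a p) :=
      h6.trans (h5.trans (by gcongr))
    rw [sob]
    calc _ ≤ 1 * sob ℓ a (m + 1) (Dst ℓ a p) + C * (2 * sob ℓ a (m + 1) (Dst ℓ a p) +
          2 * ((2 * ((a : ℝ) + 1)) ^ 2 * (C' * sob ℓ a (m + 1) (Dst ℓ a p)))) := by
          refine add_le_add (h10.trans (h1.trans (by gcongr))) (h2.trans ?_)
          gcongr
          exact h4.trans (by gcongr)
      _ = _ := by ring

/-! ### The elliptic operator on classical functions -/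

/-- `(ℓ² - x²)⁻³ ∂_x ((ℓ² - x²)⁴ α ∂_x² p) - β ∂_x p`. -/
def flux (ℓ : ℝ) (α β p : ℝ → ℝ) (x : ℝ) : ℝ :=
  Dst ℓ 3 (fun y => α y * deriv (deriv p) y) x + -1 * (β x * deriv p x)

/-- `(ℓ² - x²)⁻² (∂_x² ((ℓ² - x²)⁴ α ∂_x² p) - ∂_x ((ℓ² - x²)³ β ∂_x p)) + γ p`. -/
def ellOp (ℓ : ℝ) (α β γ p : ℝ → ℝ) (x : ℝ) : ℝ :=
  Dst ℓ 2 (flux ℓ α β p) x + γ x * p x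

lemma contDiff_mul_deriv_deriv {m : ℕ} {α p : ℝ → ℝ} (hα : ContDiff ℝ m α)
    (hp : ContDiff ℝ (m + 2 : ℕ) p) : ContDiff ℝ m (fun x => α x * deriv (deriv p) x) :=
  hα.mul (contDiff_deriv (contDiff_deriv hp))

lemma contDiff_flux {ℓ : ℝ} {m : ℕ} {α β p : ℝ → ℝ} (hα : ContDiff ℝ (m + 1 : ℕ) α)
    (hβ : ContDiff ℝ m β) (hp : ContDiff ℝ (m + 3 : ℕ) p) : ContDiff ℝ m (flux ℓ α β p) :=
  (contDiff_Dst (contDiff_mul_deriv_deriv hα hp)).add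
    (contDiff_const.mul (hβ.mul (contDiff_natLE (contDiff_deriv hp) (by lia))))

lemma contDiff_ellOp {ℓ : ℝ} {m : ℕ} {α β γ p : ℝ → ℝ} (hα : ContDiff ℝ (m + 2 : ℕ) α)
    (hβ : ContDiff ℝ (m + 1 : ℕ) β) (hγ : ContDiff ℝ m γ) (hp : ContDiff ℝ (m + 4 : ℕ) p) :
    ContDiff ℝ m (ellOp ℓ α β γ p) :=
  (contDiff_Dst (contDiff_flux hα hβ hp)).add (hγ.mul (contDiff_natLE hp (by lia)))

/-- Integration by parts twice with `ip_Dst`. The boundary terms carry powers of `ρ`, so no boundary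
condition enters; the form obtained is symmetric in `p` and `q`. -/
lemma ip_ellOp {ℓ : ℝ} {α β γ p q : ℝ → ℝ} (hα : ContDiff ℝ 2 α) (hβ : ContDiff ℝ 1 β)
    (hγ : Continuous γ) (hp : ContDiff ℝ 4 p) (hq : ContDiff ℝ 2 q) :
    ip ℓ 2 (ellOp ℓ α β γ p) q = ip ℓ 4 (fun x => α x * deriv (deriv p) x) (deriv (deriv q)) +
      ip ℓ 3 (fun x => β x * deriv p x) (deriv q) + ip ℓ 2 (fun x => γ x * p x) q := by
  have hp4 : ContDiff ℝ (4 : ℕ) p := by exact_mod_cast hp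
  have hβ1 : ContDiff ℝ (1 : ℕ) β := by exact_mod_cast hβ
  have hα2 : ContDiff ℝ (1 + 1 : ℕ) α := by exact_mod_cast hα
  have hq2 : ContDiff ℝ (1 + 1 : ℕ) q := by exact_mod_cast hq
  have hF : ContDiff ℝ (1 : ℕ) (flux ℓ α β p) := contDiff_flux hα2 hβ1 hp4
  have hA : ContDiff ℝ (1 : ℕ) (fun y => α y * deriv (deriv p) y) :=
    contDiff_mul_deriv_deriv (contDiff_pred hα2) (contDiff_pred hp4)
  have hq' := contDiff_deriv hq2
  have hD : Continuous (Dst ℓ 3 (fun y => α y * deriv (deriv p) y)) :=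
    (contDiff_Dst (m := 0) hA).continuous
  have hp' : ContDiff ℝ (3 : ℕ) (deriv p) := contDiff_deriv hp4
  have e1 : ellOp ℓ α β γ p = fun x => Dst ℓ 2 (flux ℓ α β p) x + γ x * p x := rfl
  have e2 : flux ℓ α β p = fun x => Dst ℓ 3 (fun y => α y * deriv (deriv p) y) x +
    -1 * (β x * deriv p x) := rfl
  rw [e1, ip_add_left (contDiff_Dst (m := 0) hF).continuous
      (g := fun x => γ x * p x) (hγ.mul hp.continuous) hq.continuous,
    ip_Dst (by exact_mod_cast hF) (by exact_mod_cast (contDiff_pred hq2)), e2,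
    ip_add_left hD (g := fun x => -1 * (β x * deriv p x)) (continuous_const.mul (hβ.continuous.mul hp'.continuous)) hq'.continuous,
    ip_smul_left, ip_Dst (by exact_mod_cast hA) (by exact_mod_cast hq')]
  ring

lemma le_ip_mul {ℓ : ℝ} (hℓ : 0 < ℓ) {a : ℕ} {α f : ℝ → ℝ} (hα : Continuous α)
    (hf : Continuous f) {c : ℝ} (h : ∀ x ∈ Icc (-ℓ) ℓ, c ≤ α x) :
    c * ip ℓ a f f ≤ ip ℓ a (fun x => α x * f x) f := by
  rw [ip, ip, ← intervalIntegral.integral_const_mul]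
  refine intervalIntegral.integral_mono_on (by linarith)
    ((ip_integrable hf hf).const_mul _) (ip_integrable (hα.mul hf) hf) fun x hx => ?_
  have := mul_le_mul_of_nonneg_right (h x hx)
    (mul_nonneg (pow_nonneg (wt_nonneg hx) a) (mul_self_nonneg (f x)))
  linarith

lemma ip_mul_le {ℓ : ℝ} (hℓ : 0 < ℓ) {a : ℕ} {α f : ℝ → ℝ} (hα : Continuous α)
    (hf : Continuous f) {K : ℝ} (h : ∀ x ∈ Icc (-ℓ) ℓ, |α x| ≤ K) :
    ip ℓ a (fun x => α x * f x) f ≤ K * ip ℓ a f f := by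
  rw [ip, ip, ← intervalIntegral.integral_const_mul]
  refine intervalIntegral.integral_mono_on (by linarith) (ip_integrable (hα.mul hf) hf)
    ((ip_integrable hf hf).const_mul _) fun x hx => ?_
  have := mul_le_mul_of_nonneg_right ((le_abs_self _).trans (h x hx))
    (mul_nonneg (pow_nonneg (wt_nonneg hx) a) (mul_self_nonneg (f x)))
  linarith

lemma ip_young {ℓ : ℝ} (hℓ : 0 < ℓ) {a : ℕ} {f g : ℝ → ℝ} (hf : Continuous f)
    (hg : Continuous g) {c : ℝ} (hc : 0 < c) :
    ip ℓ a f g ≤ (2 * c)⁻¹ * ip ℓ a f f + c / 2 * ip ℓ a g g := by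
  rw [ip, ip, ip, ← intervalIntegral.integral_const_mul, ← intervalIntegral.integral_const_mul,
    ← intervalIntegral.integral_add ((ip_integrable hf hf).const_mul _)
      ((ip_integrable hg hg).const_mul _)]
  refine intervalIntegral.integral_mono_on (by linarith) (ip_integrable hf hg)
    (((ip_integrable hf hf).const_mul _).add ((ip_integrable hg hg).const_mul _)) fun x hx => ?_
  have h1 := mul_nonneg (pow_nonneg (wt_nonneg hx) a) (mul_nonneg (by positivity : 0 ≤ (2 * c)⁻¹)
    (sq_nonneg (f x - c * g x)))
  have h2 : (2 * c)⁻¹ * (f x - c * g x) ^ 2 =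
      (2 * c)⁻¹ * (f x * f x) + c / 2 * (g x * g x) - f x * g x := by
    field_simp; ring
  rw [h2] at h1
  linarith

lemma sob_two_eq (ℓ : ℝ) (a : ℕ) (p : ℝ → ℝ) : sob ℓ a 2 p =
    ip ℓ a p p + (ip ℓ (a + 1) (deriv p) (deriv p) +
      ip ℓ (a + 2) (deriv (deriv p)) (deriv (deriv p))) := rfl

lemma energy_lower {ℓ : ℝ} (hℓ : 0 < ℓ) {α β γ p : ℝ → ℝ} (hα : ContDiff ℝ 2 α)
    (hβ : ContDiff ℝ 1 β) (hγ : Continuous γ) {c : ℝ} (hαc : ∀ x ∈ Icc (-ℓ) ℓ, c ≤ α x)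
    (hβc : ∀ x ∈ Icc (-ℓ) ℓ, c ≤ β x) (hγc : ∀ x ∈ Icc (-ℓ) ℓ, c ≤ γ x)
    (hp : ContDiff ℝ 4 p) : c * sob ℓ 2 2 p ≤ ip ℓ 2 (ellOp ℓ α β γ p) p := by
  have hp4 : ContDiff ℝ (4 : ℕ) p := by exact_mod_cast hp
  rw [ip_ellOp hα hβ hγ hp (hp.of_le (by norm_num)), sob_two_eq]
  have h1 := le_ip_mul hℓ (a := 2) hγ hp.continuous hγc
  have h2 := le_ip_mul hℓ (a := 3) hβ.continuous (contDiff_deriv hp4).continuous hβc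
  have h3 := le_ip_mul hℓ (a := 4) hα.continuous
    (contDiff_deriv (contDiff_deriv hp4)).continuous hαc
  linarith

lemma energy_upper {ℓ : ℝ} (hℓ : 0 < ℓ) {α β γ p : ℝ → ℝ} (hα : ContDiff ℝ 2 α)
    (hβ : ContDiff ℝ 1 β) (hγ : Continuous γ) {K : ℝ} (hαc : ∀ x ∈ Icc (-ℓ) ℓ, |α x| ≤ K)
    (hβc : ∀ x ∈ Icc (-ℓ) ℓ, |β x| ≤ K) (hγc : ∀ x ∈ Icc (-ℓ) ℓ, |γ x| ≤ K)
    (hp : ContDiff ℝ 4 p) : ip ℓ 2 (ellOp ℓ α β γ p) p ≤ K * sob ℓ 2 2 p := by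
  have hp4 : ContDiff ℝ (4 : ℕ) p := by exact_mod_cast hp
  rw [ip_ellOp hα hβ hγ hp (hp.of_le (by norm_num)), sob_two_eq]
  have h1 := ip_mul_le hℓ (a := 2) hγ hp.continuous hγc
  have h2 := ip_mul_le hℓ (a := 3) hβ.continuous (contDiff_deriv hp4).continuous hβc
  have h3 := ip_mul_le hℓ (a := 4) hα.continuous
    (contDiff_deriv (contDiff_deriv hp4)).continuous hαc
  linarith

/-- Admissible coefficients: smooth of order `m`, with bounds `K` and positive lower bound `c`. -/
structure Coef (ℓ K c : ℝ) (m : ℕ) (α : ℝ → ℝ) : Prop where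
  smooth : ContDiff ℝ m α
  bound : CBound ℓ K m α
  lower : ∀ x ∈ Icc (-ℓ) ℓ, c ≤ α x

lemma Coef.natLE {ℓ K c : ℝ} {m n : ℕ} (h : m ≤ n) {α : ℝ → ℝ} (hα : Coef ℓ K c n α) :
    Coef ℓ K c m α :=
  ⟨contDiff_natLE hα.smooth h, hα.bound.natLE h, hα.lower⟩

lemma sob_ellOp_le {ℓ : ℝ} (hℓ : 0 < ℓ) (m : ℕ) (K c : ℝ) : ∃ C, 0 ≤ C ∧
    ∀ α β γ p : ℝ → ℝ, Coef ℓ K c (m + 4) α → Coef ℓ K c (m + 4) β → Coef ℓ K c (m + 4) γ →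
      ContDiff ℝ (m + 4 : ℕ) p → sob ℓ 2 m (ellOp ℓ α β γ p) ≤ C * sob ℓ 2 (m + 4) p := by
  obtain ⟨D2, hD2, h2⟩ := sob_Dst_le hℓ m 2
  obtain ⟨D3, hD3, h3⟩ := sob_Dst_le hℓ (m + 1) 3
  obtain ⟨M0, hM0, m0⟩ := sob_mul hℓ m K
  obtain ⟨M1, hM1, m1⟩ := sob_mul hℓ (m + 1) K
  obtain ⟨M2, hM2, m2⟩ := sob_mul hℓ (m + 2) K
  refine ⟨2 * (D2 * (2 * (D3 * M2) + 2 * M1)) + 2 * M0, by positivity,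
    fun α β γ p hα hβ hγ hp => ?_⟩
  have hp1 := contDiff_deriv hp
  have hp2 : ContDiff ℝ (m + 2 : ℕ) (deriv (deriv p)) := contDiff_deriv hp1
  have hA : ContDiff ℝ (m + 2 : ℕ) (fun x => α x * deriv (deriv p) x) :=
    (hα.natLE (by lia)).smooth.mul hp2
  have hB : ContDiff ℝ (m + 1 : ℕ) (fun x => β x * deriv p x) :=
    (hβ.natLE (by lia)).smooth.mul (contDiff_natLE hp1 (by lia))
  have hF : ContDiff ℝ (m + 1 : ℕ) (flux ℓ α β p) :=
    contDiff_flux (hα.natLE (by lia)).smooth (hβ.natLE (by lia)).smooth hp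
  have s1 : sob ℓ 4 (m + 2) (fun x => α x * deriv (deriv p) x) ≤ M2 * sob ℓ 2 (m + 4) p :=
    (m2 4 _ _ (hα.natLE (by lia)).smooth (hα.natLE (by lia)).bound hp2).trans
      (mul_le_mul_of_nonneg_left ((sob_deriv_le hℓ 3 (m + 2) (deriv p)).trans
        (sob_deriv_le hℓ 2 (m + 3) p)) hM2)
  have s2 : sob ℓ 3 (m + 1) (fun x => β x * deriv p x) ≤ M1 * sob ℓ 2 (m + 4) p :=
    (m1 3 _ _ (hβ.natLE (by lia)).smooth (hβ.natLE (by lia)).bound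
      (contDiff_natLE hp1 (by lia))).trans
      (mul_le_mul_of_nonneg_left ((sob_deriv_le hℓ 2 (m + 1) p).trans
        (sob_mono hℓ 2 (by lia) p)) hM1)
  have s3 : sob ℓ 2 m (fun x => γ x * p x) ≤ M0 * sob ℓ 2 (m + 4) p :=
    (m0 2 _ _ (hγ.natLE (by lia)).smooth (hγ.natLE (by lia)).bound
      (contDiff_natLE hp (by lia))).trans
      (mul_le_mul_of_nonneg_left (sob_mono hℓ 2 (by lia) p) hM0)
  have s4 := h3 _ hA
  have s5 := sob_add_le hℓ (a := 3) (contDiff_Dst (ℓ := ℓ) (a := 3) hA)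
    (contDiff_const.mul hB : ContDiff ℝ (m + 1 : ℕ) fun x => (-1 : ℝ) * (β x * deriv p x))
  rw [sob_smul] at s5
  have s6 : sob ℓ 3 (m + 1) (flux ℓ α β p) ≤
      (2 * (D3 * M2) + 2 * M1) * sob ℓ 2 (m + 4) p := by
    refine s5.trans ?_
    have := s4.trans (mul_le_mul_of_nonneg_left s1 hD3)
    linarith
  have s7 := h2 _ hF
  have s8 := sob_add_le hℓ (a := 2) (contDiff_Dst (ℓ := ℓ) (a := 2) hF)
    ((hγ.natLE (by lia : m ≤ m + 4)).smooth.mul (contDiff_natLE hp (by lia : m ≤ m + 4)))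
  refine s8.trans ?_
  have := s7.trans (mul_le_mul_of_nonneg_left s6 hD2)
  have s3' : sob ℓ 2 m (γ * p) ≤ M0 * sob ℓ 2 (m + 4) p := s3
  linarith

/-- Coercivity of the form, with half of it absorbing the factor `p` in the pairing of `ellOp p`
with `p`. -/
lemma energy_apriori {ℓ : ℝ} (hℓ : 0 < ℓ) {K c : ℝ} (hc : 0 < c) {α β γ p : ℝ → ℝ}
    (hα : Coef ℓ K c 4 α) (hβ : Coef ℓ K c 4 β) (hγ : Coef ℓ K c 4 γ)
    (hp : ContDiff ℝ (4 : ℕ) p) :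
    sob ℓ 2 2 p ≤ (c ^ 2)⁻¹ * ip ℓ 2 (ellOp ℓ α β γ p) (ellOp ℓ α β γ p) := by
  have hE : Continuous (ellOp ℓ α β γ p) := (contDiff_ellOp (m := 0) (hα.natLE (by lia)).smooth
    (hβ.natLE (by lia)).smooth (hγ.natLE (by lia)).smooth hp).continuous
  have h1 := energy_lower hℓ (p := p) (by exact_mod_cast (hα.natLE (m := 2) (by lia)).smooth)
    (by exact_mod_cast (hβ.natLE (m := 1) (by lia)).smooth) hγ.smooth.continuous
    hα.lower hβ.lower hγ.lower (by exact_mod_cast hp)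
  have h2 := ip_young hℓ (a := 2) hE hp.continuous hc
  have h3 := ip_le_sob hℓ 2 2 p
  have h4 : c / 2 * sob ℓ 2 2 p ≤ (2 * c)⁻¹ * ip ℓ 2 (ellOp ℓ α β γ p) (ellOp ℓ α β γ p) := by
    have := mul_le_mul_of_nonneg_left h3 (by positivity : 0 ≤ c / 2)
    linarith
  have h5 := mul_le_mul_of_nonneg_left h4 (by positivity : 0 ≤ 2 / c)
  calc sob ℓ 2 2 p = 2 / c * (c / 2 * sob ℓ 2 2 p) := by field_simp
    _ ≤ _ := h5
    _ = _ := by field_simp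

/-- Elliptic regularity up to the boundary. The energy estimate gives two derivatives; the remaining
ones are recovered by inverting the two outer operators `Dst`, of weights 2 and 3, and then dividing
by `α`. -/
lemma sob_le_ellOp {ℓ : ℝ} (hℓ : 0 < ℓ) (m : ℕ) (K c : ℝ) (hc : 0 < c) : ∃ C, 0 ≤ C ∧
    ∀ α β γ p : ℝ → ℝ, Coef ℓ K c (m + 4) α → Coef ℓ K c (m + 4) β → Coef ℓ K c (m + 4) γ →
      ContDiff ℝ (m + 4 : ℕ) p → sob ℓ 2 (m + 4) p ≤ C * sob ℓ 2 m (ellOp ℓ α β γ p) := by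
  -- A bound at order `m + 2` is enough to move `γ p` and `β p'` to the right-hand side; then `Dst`
  -- is inverted for the flux, again for `α p''`, and this yields order `m + 4`.
  have step : ∀ m : ℕ, ∀ C₀ : ℝ, 0 ≤ C₀ → ∃ C, 0 ≤ C ∧ ∀ α β γ p : ℝ → ℝ,
      Coef ℓ K c (m + 4) α → Coef ℓ K c (m + 4) β → Coef ℓ K c (m + 4) γ →
      ContDiff ℝ (m + 4 : ℕ) p → sob ℓ 2 (m + 2) p ≤ C₀ * sob ℓ 2 m (ellOp ℓ α β γ p) →
      sob ℓ 2 (m + 4) p ≤ C * sob ℓ 2 m (ellOp ℓ α β γ p) := by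
    intro m C₀ hC₀
    obtain ⟨D2, hD2, h2⟩ := le_sob_Dst hℓ m 2
    obtain ⟨D3, hD3, h3⟩ := le_sob_Dst hℓ (m + 1) 3
    obtain ⟨M0, hM0, m0⟩ := sob_mul hℓ m K
    obtain ⟨M1, hM1, m1⟩ := sob_mul hℓ (m + 1) K
    obtain ⟨M2, hM2, m2⟩ := sob_mul_lower hℓ (m + 2) K c hc
    refine ⟨2 * C₀ + M2 * (D3 * (2 * (D2 * (2 + 2 * (M0 * C₀))) + 2 * (M1 * C₀))), by positivity,
      fun α β γ p hα hβ hγ hp h0 => ?_⟩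
    set E := sob ℓ 2 m (ellOp ℓ α β γ p) with hE
    have hp1 := contDiff_deriv hp
    have hp2 : ContDiff ℝ (m + 2 : ℕ) (deriv (deriv p)) := contDiff_deriv hp1
    have hA : ContDiff ℝ (m + 2 : ℕ) (fun x => α x * deriv (deriv p) x) :=
      (hα.natLE (by lia)).smooth.mul hp2
    have hB : ContDiff ℝ (m + 1 : ℕ) (fun x => β x * deriv p x) :=
      (hβ.natLE (by lia)).smooth.mul (contDiff_natLE hp1 (by lia))
    have hF : ContDiff ℝ (m + 1 : ℕ) (flux ℓ α β p) :=
      contDiff_flux (hα.natLE (by lia)).smooth (hβ.natLE (by lia)).smooth hp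
    have hO : ContDiff ℝ m (ellOp ℓ α β γ p) := contDiff_ellOp (hα.natLE (by lia)).smooth
      (hβ.natLE (by lia)).smooth (hγ.natLE (by lia)).smooth hp
    have hG : ContDiff ℝ m (fun x => γ x * p x) :=
      (hγ.natLE (by lia)).smooth.mul (contDiff_natLE hp (by lia))
    have s3 : sob ℓ 2 m (fun x => γ x * p x) ≤ M0 * (C₀ * E) :=
      (m0 2 _ _ (hγ.natLE (by lia)).smooth (hγ.natLE (by lia)).bound
        (contDiff_natLE hp (by lia))).trans
        (mul_le_mul_of_nonneg_left ((sob_mono hℓ 2 (by lia) p).trans h0) hM0)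
    have e1 : Dst ℓ 2 (flux ℓ α β p) = fun x => ellOp ℓ α β γ p x + -1 * (γ x * p x) := by
      ext x; simp only [ellOp]; ring
    have s4 := sob_add_le hℓ (a := 2) hO (contDiff_const.mul hG :
      ContDiff ℝ m fun x => (-1 : ℝ) * (γ x * p x))
    rw [← e1, sob_smul] at s4
    have s5 : sob ℓ 3 (m + 1) (flux ℓ α β p) ≤ D2 * ((2 + 2 * (M0 * C₀)) * E) :=
      (h2 _ hF).trans (mul_le_mul_of_nonneg_left (by linarith) hD2)
    have s6 : sob ℓ 3 (m + 1) (fun x => β x * deriv p x) ≤ M1 * (C₀ * E) :=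
      (m1 3 _ _ (hβ.natLE (by lia)).smooth (hβ.natLE (by lia)).bound
        (contDiff_natLE hp1 (by lia))).trans
        (mul_le_mul_of_nonneg_left ((sob_deriv_le hℓ 2 (m + 1) p).trans h0) hM1)
    have e2 : Dst ℓ 3 (fun y => α y * deriv (deriv p) y) =
        fun x => flux ℓ α β p x + β x * deriv p x := by
      ext x; simp only [flux]; ring
    have s7 := sob_add_le hℓ (a := 3) hF hB
    rw [← e2] at s7
    have s8 : sob ℓ 4 (m + 2) (fun y => α y * deriv (deriv p) y) ≤
        D3 * ((2 * (D2 * (2 + 2 * (M0 * C₀))) + 2 * (M1 * C₀)) * E) :=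
      (h3 _ hA).trans (mul_le_mul_of_nonneg_left (by linarith) hD3)
    have s9 := (m2 4 _ _ (hα.natLE (by lia)).smooth (hα.natLE (by lia)).bound hα.lower hp2).trans
      (mul_le_mul_of_nonneg_left s8 hM2)
    have s10 : ip ℓ 2 p p ≤ C₀ * E := (ip_le_sob hℓ 2 (m + 2) p).trans h0
    have s11 : ip ℓ 3 (deriv p) (deriv p) ≤ C₀ * E :=
      (ip_le_sob hℓ 3 (m + 1) _).trans ((sob_deriv_le hℓ 2 (m + 1) p).trans h0)
    have e3 : sob ℓ 2 (m + 4) p = ip ℓ 2 p p + (ip ℓ 3 (deriv p) (deriv p) +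
      sob ℓ 4 (m + 2) (deriv (deriv p))) := rfl
    rw [e3]
    linarith
  induction m with
  | zero =>
    obtain ⟨C, hC, h⟩ := step 0 (c ^ 2)⁻¹ (by positivity)
    exact ⟨C, hC, fun α β γ p hα hβ hγ hp => h α β γ p hα hβ hγ hp
      (energy_apriori hℓ hc hα hβ hγ hp)⟩
  | succ m ih =>
    obtain ⟨C, hC, h⟩ := ih
    obtain ⟨C', hC', h'⟩ := step (m + 1) C hC
    refine ⟨C', hC', fun α β γ p hα hβ hγ hp => h' α β γ p hα hβ hγ hp ?_⟩
    have h1 := h α β γ p (hα.natLE (by lia)) (hβ.natLE (by lia)) (hγ.natLE (by lia))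
      (contDiff_natLE hp (by lia))
    -- The next step needs order `m + 3` only, and the induction hypothesis supplies order `m + 4`.
    refine (sob_mono hℓ 2 (by lia : m + 1 + 2 ≤ m + 4) p).trans (h1.trans ?_)
    exact mul_le_mul_of_nonneg_left (sob_succ_le hℓ _ _ _) hC

/-! ### Approximation by polynomials -/

lemma exists_polynomial_derivative (q : Polynomial ℝ) : ∃ P : Polynomial ℝ, P.derivative = q := by
  induction q using Polynomial.induction_on' with
  | add p q hp hq =>
    obtain ⟨P, rfl⟩ := hp
    obtain ⟨Q, rfl⟩ := hq
    exact ⟨P + Q, Polynomial.derivative_add⟩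
  | monomial n a =>
    refine ⟨Polynomial.monomial (n + 1) (a / (n + 1)), ?_⟩
    rw [Polynomial.derivative_monomial]
    congr 1
    have : (n : ℝ) + 1 ≠ 0 := by positivity
    push_cast
    field_simp

lemma polynomial_deriv_eq (P : Polynomial ℝ) :
    deriv (fun x => P.eval x) = fun x => P.derivative.eval x := by
  ext x; exact P.deriv

/-- Weierstrass approximation of the highest derivative, integrated repeatedly. -/
lemma exists_polynomial_CBound {ℓ : ℝ} (hℓ : 0 < ℓ) {m : ℕ} {f : ℝ → ℝ} (hf : ContDiff ℝ m f)
    {ε : ℝ} (hε : 0 < ε) : ∃ p : Polynomial ℝ, CBound ℓ ε m (fun x => f x + -1 * p.eval x) := by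
  induction m generalizing f ε with
  | zero =>
    obtain ⟨p, hp⟩ := exists_polynomial_near_of_continuousOn (-ℓ) ℓ f hf.continuous.continuousOn ε hε
    refine ⟨p, fun x hx => ?_⟩
    have := (hp x hx).le
    rw [abs_sub_comm] at this
    change |f x + -1 * p.eval x| ≤ ε
    rwa [neg_one_mul, ← sub_eq_add_neg]
  | succ m ih =>
    -- Integrating from `0` multiplies the error by at most `ℓ`; the divisor `1 + ℓ` also keeps the
    -- error of the derivative below `ε`.
    have hε' : 0 < ε / (1 + ℓ) := by positivity
    obtain ⟨q, hq⟩ := ih (contDiff_deriv hf) hε'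
    obtain ⟨P₀, hP₀⟩ := exists_polynomial_derivative q
    -- The primitive of `q` that agrees with `f` at `0`.
    set P := P₀ + Polynomial.C (f 0 - P₀.eval 0) with hP
    have hPd : P.derivative = q := by simp [hP, hP₀]
    have hd : deriv (fun x => f x + -1 * P.eval x) = fun x => deriv f x + -1 * q.eval x := by
      ext x
      rw [deriv_fun_add (contDiff_succ_differentiable hf x)
        (P.differentiable.const_mul (-1 : ℝ) x), deriv_const_mul_field, P.deriv, hPd]
    have hle : ε / (1 + ℓ) ≤ ε := div_le_self hε.le (by linarith)
    refine ⟨P, fun x hx => ?_, ?_⟩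
    · have h0 : (0 : ℝ) ∈ Icc (-ℓ) ℓ := ⟨by linarith, hℓ.le⟩
      have h := (convex_Icc (-ℓ) ℓ).norm_image_sub_le_of_norm_deriv_le
        (f := fun x => f x + -1 * P.eval x) (C := ε / (1 + ℓ))
        (fun x _ => (contDiff_succ_differentiable hf x).add (P.differentiable.const_mul (-1 : ℝ) x))
        (fun x hx => by rw [hd, Real.norm_eq_abs]; exact hq.bound x hx) h0 hx
      have h1 : f 0 + -1 * P.eval 0 = 0 := by simp [hP]
      rw [h1, sub_zero, sub_zero, Real.norm_eq_abs, Real.norm_eq_abs] at h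
      refine h.trans ?_
      have h2 : |x| ≤ 1 + ℓ := (abs_le.2 hx).trans (by linarith)
      calc ε / (1 + ℓ) * |x| ≤ ε / (1 + ℓ) * (1 + ℓ) := by gcongr
        _ = ε := by field_simp
    · rw [hd]; exact hq.mono hle

lemma sob_le_of_CBound {ℓ : ℝ} (hℓ : 0 < ℓ) (a m : ℕ) : ∃ C, 0 ≤ C ∧ ∀ (ε : ℝ) (g : ℝ → ℝ),
    ContDiff ℝ m g → CBound ℓ ε m g → sob ℓ a m g ≤ C * ε ^ 2 := by
  have hip : ∀ (a : ℕ) (ε : ℝ) (g : ℝ → ℝ), Continuous g → (∀ x ∈ Icc (-ℓ) ℓ, |g x| ≤ ε) →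
      ip ℓ a g g ≤ ip ℓ a (fun _ => 1) (fun _ => 1) * ε ^ 2 := by
    intro a ε g hg h
    rw [mul_comm]
    refine ip_mono hℓ hg continuous_const fun x hx => ?_
    have := sq_le_sq' (abs_le.1 (h x hx)).1 (abs_le.1 (h x hx)).2
    linarith
  induction m generalizing a with
  | zero => exact ⟨_, ip_nonneg hℓ a (fun _ => 1), fun ε g hg h => hip a ε g hg.continuous h⟩
  | succ m ih =>
    obtain ⟨C, hC, h⟩ := ih (a + 1)
    refine ⟨ip ℓ a (fun _ => 1) (fun _ => 1) + C, add_nonneg (ip_nonneg hℓ _ _) hC,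
      fun ε g hg hb => ?_⟩
    rw [sob, add_mul]
    exact add_le_add (hip a ε g hg.continuous hb.1) (h ε _ (contDiff_deriv hg) hb.2)

/-! ### Classes of smooth functions in the weighted spaces -/

lemma measurable_weight (ℓ : ℝ) (j : ℕ) :
    Measurable fun x : ℝ => ENNReal.ofReal ((ℓ ^ 2 - x ^ 2) ^ (j + 2)) := by fun_prop

instance isFiniteMeasure_wMeasure (ℓ : ℝ) (j : ℕ) : IsFiniteMeasure (wMeasure ℓ j) := by
  refine isFiniteMeasure_withDensity ?_
  have h : IntegrableOn (fun x : ℝ => (ℓ ^ 2 - x ^ 2) ^ (j + 2)) (Ioo (-ℓ) ℓ) :=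
    ((by fun_prop : Continuous fun x : ℝ => (ℓ ^ 2 - x ^ 2) ^ (j + 2)).integrableOn_Icc).mono_set
      Ioo_subset_Icc_self
  exact (lintegral_ofReal_le_lintegral_enorm _).trans_lt h.2 |>.ne

lemma ae_wMeasure_iff {ℓ : ℝ} {j : ℕ} {p : ℝ → Prop} :
    (∀ᵐ x ∂(wMeasure ℓ j), p x) ↔ ∀ᵐ x ∂(volume.restrict (Ioo (-ℓ) ℓ)), p x := by
  constructor
  · intro h
    refine (withDensity_absolutelyContinuous' (measurable_weight ℓ j).aemeasurable ?_).ae_le h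
    filter_upwards [ae_restrict_mem measurableSet_Ioo] with x hx
    have : 0 < (ℓ ^ 2 - x ^ 2) ^ (j + 2) := pow_pos (by nlinarith [hx.1, hx.2]) _
    simpa using this
  · exact fun h => (withDensity_absolutelyContinuous _ _).ae_le h

lemma ae_wMeasure_mem (ℓ : ℝ) (j : ℕ) : ∀ᵐ x ∂(wMeasure ℓ j), x ∈ Ioo (-ℓ) ℓ :=
  ae_wMeasure_iff.2 (ae_restrict_mem measurableSet_Ioo)

lemma integral_wMeasure {ℓ : ℝ} (hℓ : 0 < ℓ) (j : ℕ) (f : ℝ → ℝ) :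
    ∫ x, f x ∂(wMeasure ℓ j) = ∫ x in (-ℓ)..ℓ, (ℓ ^ 2 - x ^ 2) ^ (j + 2) * f x := by
  rw [wMeasure, integral_withDensity_eq_integral_toReal_smul (measurable_weight ℓ j) (by simp),
    intervalIntegral.integral_of_le (by linarith), integral_Ioc_eq_integral_Ioo]
  refine setIntegral_congr_fun measurableSet_Ioo fun x hx => ?_
  simp only [smul_eq_mul]
  rw [ENNReal.toReal_ofReal (pow_nonneg (wt_nonneg (Ioo_subset_Icc_self hx)) _)]

lemma memLp_of_continuous {ℓ : ℝ} {j : ℕ} {f : ℝ → ℝ} (hf : Continuous f) :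
    MemLp f 2 (wMeasure ℓ j) := by
  obtain ⟨K, hK⟩ := isCompact_Icc.exists_bound_of_continuousOn (s := Icc (-ℓ) ℓ) hf.continuousOn
  refine MemLp.of_bound hf.aestronglyMeasurable K ?_
  filter_upwards [ae_wMeasure_mem ℓ j] with x hx
  exact hK x (Ioo_subset_Icc_self hx)

/-- The class of a continuous function. -/
def cls (ℓ : ℝ) (j : ℕ) (f : ℝ → ℝ) (hf : Continuous f) : Lp ℝ 2 (wMeasure ℓ j) :=
  (memLp_of_continuous hf).toLp f

lemma coeFn_cls {ℓ : ℝ} {j : ℕ} {f : ℝ → ℝ} (hf : Continuous f) :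
    (cls ℓ j f hf : ℝ → ℝ) =ᵐ[wMeasure ℓ j] f := MemLp.coeFn_toLp _

lemma inner_cls {ℓ : ℝ} (hℓ : 0 < ℓ) {j : ℕ} {f g : ℝ → ℝ} (hf : Continuous f)
    (hg : Continuous g) : inner ℝ (cls ℓ j f hf) (cls ℓ j g hg) = ip ℓ (j + 2) f g := by
  rw [L2.inner_def, ip, ← integral_wMeasure hℓ]
  refine integral_congr_ae ?_
  filter_upwards [coeFn_cls (ℓ := ℓ) (j := j) hf, coeFn_cls (ℓ := ℓ) (j := j) hg] with x h1 h2
  rw [h1, h2]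
  simp [mul_comm]

lemma norm_sq_cls {ℓ : ℝ} (hℓ : 0 < ℓ) {j : ℕ} {f : ℝ → ℝ} (hf : Continuous f) :
    ‖cls ℓ j f hf‖ ^ 2 = ip ℓ (j + 2) f f := by
  rw [← inner_cls hℓ hf hf, real_inner_self_eq_norm_sq]

/-- Functions of class `C^m` on the line. -/
def Cm (m : ℕ) : Submodule ℝ (ℝ → ℝ) where
  carrier := {f | ContDiff ℝ m f}
  zero_mem' := by
    change ContDiff ℝ m fun _ => (0 : ℝ)
    exact contDiff_const
  add_mem' := by
    intro f g (hf : ContDiff ℝ m f) (hg : ContDiff ℝ m g)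
    exact hf.add hg
  smul_mem' := by
    intro c f (hf : ContDiff ℝ m f)
    exact hf.const_smul c

lemma contDiff_Cm {m : ℕ} (f : Cm m) : ContDiff ℝ m (f : ℝ → ℝ) := f.2

lemma continuous_iteratedDeriv_Cm {m : ℕ} (f : Cm m) (j : Fin (m + 1)) :
    Continuous (iteratedDeriv (j : ℕ) (f : ℝ → ℝ)) :=
  (contDiff_Cm f).continuous_iteratedDeriv j (by exact_mod_cast Nat.lt_succ_iff.1 j.2)

/-- The jet of a function of class `C^m` as an element of `ℋ^m`. -/
def jet (ℓ : ℝ) (m : ℕ) : Cm m →ₗ[ℝ] Hsp ℓ m where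
  toFun f := ⟨WithLp.toLp 2 fun j => cls ℓ j _ (continuous_iteratedDeriv_Cm f j),
    subset_closure ⟨f, f.2, fun j => coeFn_cls (continuous_iteratedDeriv_Cm f j)⟩⟩
  map_add' f g := by
    apply Subtype.ext
    ext j : 1
    change cls ℓ j _ (continuous_iteratedDeriv_Cm (f + g) j) =
      cls ℓ j _ (continuous_iteratedDeriv_Cm f j) + cls ℓ j _ (continuous_iteratedDeriv_Cm g j)
    refine Lp.ext ?_
    filter_upwards [coeFn_cls (ℓ := ℓ) (j := j) (continuous_iteratedDeriv_Cm (f + g) j),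
      coeFn_cls (ℓ := ℓ) (j := j) (continuous_iteratedDeriv_Cm f j),
      coeFn_cls (ℓ := ℓ) (j := j) (continuous_iteratedDeriv_Cm g j),
      Lp.coeFn_add (cls ℓ j _ (continuous_iteratedDeriv_Cm f j))
        (cls ℓ j _ (continuous_iteratedDeriv_Cm g j))] with x h1 h2 h3 h4
    have hj : ((j : ℕ) : WithTop ℕ∞) ≤ (m : WithTop ℕ∞) := by
      exact_mod_cast Nat.lt_succ_iff.1 j.2
    rw [h1, h4, Pi.add_apply, h2, h3]
    exact iteratedDeriv_add (((contDiff_Cm f).of_le hj).contDiffAt)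
      (((contDiff_Cm g).of_le hj).contDiffAt)
  map_smul' c f := by
    apply Subtype.ext
    ext j : 1
    change cls ℓ j _ (continuous_iteratedDeriv_Cm (c • f) j) =
      c • cls ℓ j _ (continuous_iteratedDeriv_Cm f j)
    refine Lp.ext ?_
    filter_upwards [coeFn_cls (ℓ := ℓ) (j := j) (continuous_iteratedDeriv_Cm (c • f) j),
      coeFn_cls (ℓ := ℓ) (j := j) (continuous_iteratedDeriv_Cm f j),
      Lp.coeFn_smul c (cls ℓ j _ (continuous_iteratedDeriv_Cm f j))] with x h1 h2 h4
    have hj : ((j : ℕ) : WithTop ℕ∞) ≤ (m : WithTop ℕ∞) := by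
      exact_mod_cast Nat.lt_succ_iff.1 j.2
    rw [h1, h4, Pi.smul_apply, h2]
    exact iteratedDeriv_const_smul (((contDiff_Cm f).of_le hj).contDiffAt) c

lemma jet_apply {ℓ : ℝ} {m : ℕ} (f : Cm m) (j : Fin (m + 1)) :
    (jet ℓ m f : Jets ℓ m) j = cls ℓ j _ (continuous_iteratedDeriv_Cm f j) := rfl

lemma sob_eq_sum (ℓ : ℝ) (a m : ℕ) (f : ℝ → ℝ) : sob ℓ a m f =
    ∑ j ∈ Finset.range (m + 1), ip ℓ (a + j) (iteratedDeriv j f) (iteratedDeriv j f) := by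
  induction m generalizing a f with
  | zero => simp [sob]
  | succ m ih =>
    rw [sob, ih, Finset.sum_range_succ' _ (m + 1), add_comm]
    congr 1
    · refine Finset.sum_congr rfl fun j _ => ?_
      rw [iteratedDeriv_succ', show a + 1 + j = a + (j + 1) by ring]

lemma norm_sq_jet {ℓ : ℝ} (hℓ : 0 < ℓ) {m : ℕ} (f : Cm m) :
    ‖jet ℓ m f‖ ^ 2 = sob ℓ 2 m f := by
  rw [Submodule.coe_norm, PiLp.norm_sq_eq_of_L2, sob_eq_sum, ← Fin.sum_univ_eq_sum_range
    (fun j => ip ℓ (2 + j) (iteratedDeriv j f) (iteratedDeriv j f))]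
  refine Finset.sum_congr rfl fun j _ => ?_
  rw [jet_apply, norm_sq_cls hℓ, add_comm]

/-- The function of a polynomial. -/
def polyFun (m : ℕ) : Polynomial ℝ →ₗ[ℝ] Cm m where
  toFun p := ⟨fun x => p.eval x, (by simpa using p.contDiff_aeval (𝕜 := ℝ) m : ContDiff ℝ m fun x => p.eval x)⟩
  map_add' p q := by ext x; simp
  map_smul' c p := by ext x; simp

/-- The jet of a polynomial. -/
def polyJet (ℓ : ℝ) (m : ℕ) : Polynomial ℝ →ₗ[ℝ] Hsp ℓ m := jet ℓ m ∘ₗ polyFun m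

lemma jet_mem_closure_polyJet {ℓ : ℝ} (hℓ : 0 < ℓ) {m : ℕ} (f : Cm m) :
    jet ℓ m f ∈ closure (range (polyJet ℓ m)) := by
  obtain ⟨C, hC, h⟩ := sob_le_of_CBound hℓ 2 m
  rw [Metric.mem_closure_iff]
  intro ε hε
  set δ := ε / (C + 1) with hδ
  have hδ' : 0 < δ := by positivity
  obtain ⟨p, hp⟩ := exists_polynomial_CBound hℓ f.2
    (show 0 < ε / (C + 1) by positivity)
  refine ⟨_, ⟨p, rfl⟩, ?_⟩
  rw [dist_eq_norm, polyJet, LinearMap.comp_apply, ← map_sub]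
  refine abs_lt_of_sq_lt_sq' ?_ hε.le |>.2
  rw [norm_sq_jet hℓ]
  have e : ((f - polyFun m p : Cm m) : ℝ → ℝ) = fun x => (f : ℝ → ℝ) x + -1 * p.eval x := by
    ext x
    simp [polyFun, sub_eq_add_neg]
  have hcd := (f - polyFun m p : Cm m).2
  rw [e] at hcd ⊢
  refine (h _ _ hcd hp).trans_lt ?_
  rw [div_pow, ← mul_div_assoc, div_lt_iff₀ (by positivity)]
  have : 0 < ε ^ 2 := by positivity
  nlinarith [mul_nonneg hC hC, mul_nonneg (mul_nonneg hC hC) this.le, mul_nonneg hC this.le]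

lemma denseRange_polyJet {ℓ : ℝ} (hℓ : 0 < ℓ) (m : ℕ) : DenseRange (polyJet ℓ m) := by
  intro w
  have h1 : Dense (range (jet ℓ m)) := by
    intro w
    rw [closure_subtype]
    refine closure_mono (s := (smoothJets ℓ m : Set (Jets ℓ m))) ?_ w.2
    rintro f ⟨φ, hφ, hf⟩
    refine ⟨jet ℓ m ⟨φ, hφ⟩, ⟨_, rfl⟩, ?_⟩
    ext j : 1
    rw [jet_apply]
    refine Lp.ext ?_
    filter_upwards [hf j, coeFn_cls (ℓ := ℓ) (j := j)
      (continuous_iteratedDeriv_Cm (⟨φ, hφ⟩ : Cm m) j)] with x h1 h2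
    rw [h1, h2]
  have h2 : closure (range (jet ℓ m)) ⊆ closure (range (polyJet ℓ m)) :=
    closure_minimal (by rintro _ ⟨f, rfl⟩; exact jet_mem_closure_polyJet hℓ f) isClosed_closure
  exact h2 (h1 w)

/-- The embedding `ℋ^m ↪ L²((ℓ² - x²)² dx)` as a continuous linear map. -/
def toL2wL (ℓ : ℝ) (m : ℕ) : Hsp ℓ m →L[ℝ] L2w ℓ :=
  (PiLp.proj 2 (fun j : Fin (m + 1) => Lp ℝ 2 (wMeasure ℓ (j : ℕ))) (0 : Fin (m + 1))).comp
    (smoothJets ℓ m).topologicalClosure.subtypeL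

lemma toL2wL_apply {ℓ : ℝ} {m : ℕ} (w : Hsp ℓ m) : toL2wL ℓ m w = toL2w w := rfl

/-- The class of a polynomial. -/
def polyCls (ℓ : ℝ) : Polynomial ℝ →ₗ[ℝ] L2w ℓ := (toL2wL ℓ 0).toLinearMap ∘ₗ polyJet ℓ 0

lemma toL2wL_jet {ℓ : ℝ} {m : ℕ} (f : Cm m) :
    toL2wL ℓ m (jet ℓ m f) = cls ℓ 0 f (contDiff_Cm f).continuous := by
  rw [toL2wL_apply, toL2w, jet_apply]
  simp [iteratedDeriv_zero]

lemma polyCls_apply {ℓ : ℝ} (p : Polynomial ℝ) :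
    polyCls ℓ p = cls ℓ 0 (fun x => p.eval x) p.continuous := toL2wL_jet _

lemma toL2wL_polyJet {ℓ : ℝ} {m : ℕ} (p : Polynomial ℝ) :
    toL2wL ℓ m (polyJet ℓ m p) = polyCls ℓ p := by
  rw [polyCls_apply]; exact toL2wL_jet _

lemma norm_toL2wL_zero {ℓ : ℝ} (w : Hsp ℓ 0) : ‖toL2wL ℓ 0 w‖ = ‖w‖ := by
  rw [← sq_eq_sq₀ (norm_nonneg _) (norm_nonneg _), Submodule.coe_norm w,
    PiLp.norm_sq_eq_of_L2]
  simp [toL2wL_apply, toL2w]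

/-- Bounded continuous functions are dense in `L²` of a finite measure, and continuous functions are
uniform limits of polynomials on `[-ℓ, ℓ]`. -/
lemma denseRange_polyCls {ℓ : ℝ} (hℓ : 0 < ℓ) : DenseRange (polyCls ℓ) := by
  have h1 : ∀ f : ℝ → ℝ, ∀ hf : Continuous f, cls ℓ 0 f hf ∈ closure (range (polyCls ℓ)) := by
    intro f hf
    have h := jet_mem_closure_polyJet hℓ (m := 0) ⟨f, contDiff_zero.2 hf⟩
    have h3 := image_closure_subset_closure_image (toL2wL ℓ 0).continuous
      (mem_image_of_mem (toL2wL ℓ 0) h)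
    rw [toL2wL_jet, ← range_comp] at h3
    exact h3
  have h2 : ∀ v : L2w ℓ, v ∈ closure (range (polyCls ℓ)) := by
    intro v
    have hd := Lp.boundedContinuousFunction_dense ℝ (wMeasure ℓ 0) (p := 2) (by simp)
    refine closure_minimal ?_ isClosed_closure (hd v)
    intro g hg
    obtain ⟨f, hf⟩ := (Lp.mem_boundedContinuousFunction_iff).1 hg
    have : g = cls ℓ 0 f f.continuous := by
      refine Lp.ext ?_
      have h3 := ContinuousMap.coeFn_toAEEqFun (wMeasure ℓ 0) (f : C(ℝ, ℝ))
      rw [show ContinuousMap.toAEEqFun (wMeasure ℓ 0) (f : C(ℝ, ℝ)) = (g : ℝ →ₘ[wMeasure ℓ 0] ℝ) from hf] at h3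
      filter_upwards [h3, coeFn_cls (ℓ := ℓ) (j := 0) f.continuous] with x h4 h5
      rw [h5, h4]; rfl
    rw [this]
    exact h1 _ _
  exact h2

/-! ### Method of continuity -/

/-- If `T θ` is invertible, then `T θ' = T θ (1 - (θ - θ') (T θ)⁻¹ S)` is surjective by a Neumann
series once `|θ - θ'| C ‖S‖ < 1`. As `C` does not depend on `θ`, the admissible step length is
uniform and finitely many steps lead from `0` to `1`. -/
lemma surjective_of_continuity {X Y : Type*} [NormedAddCommGroup X] [NormedSpace ℝ X]
    [CompleteSpace X] [NormedAddCommGroup Y] [NormedSpace ℝ Y] [CompleteSpace Y]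
    (T₀ T₁ : X →L[ℝ] Y) (C : ℝ) (hC : 0 ≤ C)
    (h : ∀ θ ∈ Icc (0 : ℝ) 1, ∀ x, ‖x‖ ≤ C * ‖T₀ x + θ • (T₁ x - T₀ x)‖)
    (h₀ : Function.Surjective T₀) : Function.Surjective T₁ := by
  set S := T₁ - T₀ with hS
  set T : ℝ → X →L[ℝ] Y := fun θ => T₀ + θ • S with hT
  have hb : ∀ θ ∈ Icc (0 : ℝ) 1, ∀ x, ‖x‖ ≤ C * ‖T θ x‖ := h
  have step : ∀ θ ∈ Icc (0 : ℝ) 1, ∀ θ' ∈ Icc (0 : ℝ) 1, |θ - θ'| * (C * ‖S‖) < 1 →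
      Function.Surjective (T θ) → Function.Surjective (T θ') := by
    intro θ hθ θ' hθ' hlt hs
    have hi : Function.Injective (T θ) := by
      rw [injective_iff_map_eq_zero]
      intro x hx
      have := hb θ hθ x
      rw [hx, norm_zero, mul_zero] at this
      exact norm_le_zero_iff.1 this
    let e := ContinuousLinearEquiv.ofBijective (T θ) (LinearMap.ker_eq_bot.2 hi)
      (LinearMap.range_eq_top.2 hs)
    have he : ∀ x, e x = T θ x := fun x => rfl
    let E : X →L[ℝ] X := (θ - θ') • (e.symm : Y →L[ℝ] X).comp S
    have hE : ‖E‖ < 1 := by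
      refine lt_of_le_of_lt (ContinuousLinearMap.opNorm_le_bound _ (by positivity) fun x => ?_) hlt
      have h1 := hb θ hθ (e.symm (S x))
      rw [← he, e.apply_symm_apply] at h1
      calc ‖E x‖ = |θ - θ'| * ‖e.symm (S x)‖ := by
            simp [E, norm_smul]
        _ ≤ |θ - θ'| * (C * (‖S‖ * ‖x‖)) := by
            gcongr
            exact h1.trans (by gcongr; exact S.le_opNorm x)
        _ = _ := by ring
    obtain ⟨u, hu⟩ := isUnit_one_sub_of_norm_lt_one hE
    intro y
    refine ⟨(↑u⁻¹ : X →L[ℝ] X) (e.symm y), ?_⟩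
    set z := (↑u⁻¹ : X →L[ℝ] X) (e.symm y) with hz
    have h1 : z - E z = e.symm y := by
      have : (u : X →L[ℝ] X) z = e.symm y :=
        congrArg (fun T : X →L[ℝ] X => T (e.symm y)) u.mul_inv
      rw [hu] at this
      simpa using this
    have h2 : e z - e (E z) = y := by rw [← map_sub, h1, e.apply_symm_apply]
    have h3 : e (E z) = (θ - θ') • S z := by
      simp [E]
    rw [h3, he] at h2
    rw [← h2]
    simp only [hT, add_apply, smul_apply, sub_smul]
    abel
  -- Steps of length `1/N` satisfy the smallness condition of the Neumann series.
  obtain ⟨N, hN⟩ := exists_nat_gt (C * ‖S‖)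
  have hN0 : (0 : ℝ) < N := lt_of_le_of_lt (by positivity) hN
  have hmem : ∀ i : ℕ, i ≤ N → (i : ℝ) / N ∈ Icc (0 : ℝ) 1 := fun i hi =>
    ⟨by positivity, div_le_one_of_le₀ (by exact_mod_cast hi) hN0.le⟩
  have key : ∀ i : ℕ, i ≤ N → Function.Surjective (T (i / N)) := by
    intro i
    induction i with
    | zero => intro _; simpa [hT] using h₀
    | succ i ih =>
      intro hi
      refine step _ (hmem i (by lia)) _ (hmem _ hi) ?_ (ih (by lia))
      have : (i : ℝ) / N - ((i + 1 : ℕ) : ℝ) / N = -(1 / N) := by push_cast; ring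
      rw [this, abs_neg, abs_of_pos (by positivity), one_div_mul_eq_div, div_lt_one hN0]
      exact hN
  have := key N le_rfl
  rw [div_self hN0.ne'] at this
  simpa [hT, hS] using this

/-! ### Operators on the weighted spaces -/

lemma denseRange_jet {ℓ : ℝ} (hℓ : 0 < ℓ) (m : ℕ) : DenseRange (jet ℓ m) :=
  (denseRange_polyJet hℓ m).mono (range_comp_subset_range (polyFun m) (jet ℓ m))

lemma clm_ext_jet {ℓ : ℝ} (hℓ : 0 < ℓ) {m : ℕ} {Y : Type*} [NormedAddCommGroup Y]
    [NormedSpace ℝ Y] {T S : Hsp ℓ m →L[ℝ] Y} (h : ∀ f, T (jet ℓ m f) = S (jet ℓ m f)) : T = S :=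
  DFunLike.coe_injective
    ((denseRange_jet hℓ m).equalizer T.continuous S.continuous (funext h))

lemma norm_jet_le {ℓ : ℝ} (hℓ : 0 < ℓ) {m n : ℕ} {C : ℝ} (hC : 0 ≤ C) {f : Cm m} {g : Cm n}
    (h : sob ℓ 2 m f ≤ C * sob ℓ 2 n g) : ‖jet ℓ m f‖ ≤ √C * ‖jet ℓ n g‖ := by
  refine abs_le_of_sq_le_sq' ?_ (by positivity) |>.2
  rw [mul_pow, Real.sq_sqrt hC, norm_sq_jet hℓ, norm_sq_jet hℓ]
  exact h

lemma Dst_add {ℓ : ℝ} {a : ℕ} {f g : ℝ → ℝ} (hf : Differentiable ℝ f) (hg : Differentiable ℝ g) :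
    Dst ℓ a (fun x => f x + g x) = fun x => Dst ℓ a f x + Dst ℓ a g x := by
  ext x
  simp only [Dst]
  rw [deriv_fun_add (hf x) (hg x)]
  ring

lemma Dst_smul {ℓ : ℝ} {a : ℕ} (c : ℝ) (f : ℝ → ℝ) :
    Dst ℓ a (fun x => c * f x) = fun x => c * Dst ℓ a f x := by
  ext x
  simp only [Dst]
  rw [deriv_const_mul_field]
  ring

lemma ellOp_add {ℓ : ℝ} {α β γ f g : ℝ → ℝ} (hα : ContDiff ℝ (2 : ℕ) α)
    (hβ : ContDiff ℝ (1 : ℕ) β) (hf : ContDiff ℝ (4 : ℕ) f) (hg : ContDiff ℝ (4 : ℕ) g) :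
    ellOp ℓ α β γ (fun x => f x + g x) = fun x => ellOp ℓ α β γ f x + ellOp ℓ α β γ g x := by
  have hd : deriv (fun x => f x + g x) = fun x => deriv f x + deriv g x := by
    ext x
    exact deriv_fun_add (contDiff_succ_differentiable hf x) (contDiff_succ_differentiable hg x)
  have hdd : deriv (fun x => deriv f x + deriv g x) =
      fun x => deriv (deriv f) x + deriv (deriv g) x := by
    ext x
    exact deriv_fun_add (contDiff_succ_differentiable (contDiff_deriv hf) x)
      (contDiff_succ_differentiable (contDiff_deriv hg) x)
  have hA : ∀ {f : ℝ → ℝ}, ContDiff ℝ (4 : ℕ) f →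
      Differentiable ℝ (fun x => α x * deriv (deriv f) x) := fun hf =>
    contDiff_succ_differentiable (m := 0)
      (contDiff_mul_deriv_deriv (contDiff_pred hα) (contDiff_natLE hf (by lia)))
  have hF : flux ℓ α β (fun x => f x + g x) = fun x => flux ℓ α β f x + flux ℓ α β g x := by
    ext x
    simp only [flux]
    rw [hd, hdd, show (fun y => α y * (deriv (deriv f) y + deriv (deriv g) y)) =
      fun y => α y * deriv (deriv f) y + α y * deriv (deriv g) y by ext; ring,
      Dst_add (hA hf) (hA hg)]
    ring
  ext x
  simp only [ellOp]
  rw [hF, Dst_add (contDiff_succ_differentiable (m := 0) (contDiff_flux hα hβ hf))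
    (contDiff_succ_differentiable (m := 0) (contDiff_flux hα hβ hg))]
  ring

lemma ellOp_smul {ℓ : ℝ} {α β γ : ℝ → ℝ} (c : ℝ) (f : ℝ → ℝ) :
    ellOp ℓ α β γ (fun x => c * f x) = fun x => c * ellOp ℓ α β γ f x := by
  have hF : flux ℓ α β (fun x => c * f x) = fun x => c * flux ℓ α β f x := by
    ext x
    simp only [flux]
    rw [deriv_const_mul_field', deriv_const_mul_field',
      show (fun y => α y * (c * deriv (deriv f) y)) = fun y => c * (α y * deriv (deriv f) y) by
        ext; ring, Dst_smul]
    ring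
  ext x
  simp only [ellOp]
  rw [hF, Dst_smul]
  ring

/-- Coefficients of an elliptic operator, of class `C^M`, positive on `[-ℓ, ℓ]`. -/
structure Coefs (ℓ : ℝ) (M : ℕ) where
  α : ℝ → ℝ
  β : ℝ → ℝ
  γ : ℝ → ℝ
  K : ℝ
  c : ℝ
  c_pos : 0 < c
  hα : Coef ℓ K c M α
  hβ : Coef ℓ K c M β
  hγ : Coef ℓ K c M γ

/-- The operator on smooth functions. -/
def ellC {ℓ : ℝ} {M : ℕ} (q : Coefs ℓ M) {m : ℕ} (hm : m + 4 ≤ M) : Cm (m + 4) →ₗ[ℝ] Cm m where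
  toFun f := ⟨ellOp ℓ q.α q.β q.γ f, contDiff_ellOp (q.hα.natLE (by lia)).smooth
    (q.hβ.natLE (by lia)).smooth (q.hγ.natLE (by lia)).smooth (contDiff_Cm f)⟩
  map_add' f g := by
    apply Subtype.ext
    exact ellOp_add (q.hα.natLE (by lia)).smooth (q.hβ.natLE (by lia)).smooth
      (contDiff_natLE (contDiff_Cm f) (by lia)) (contDiff_natLE (contDiff_Cm g) (by lia))
  map_smul' c f := by
    apply Subtype.ext
    exact ellOp_smul c _

/-- Multiplication by a smooth function. -/
def mulC {m : ℕ} (u : Cm m) : Cm m →ₗ[ℝ] Cm m where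
  toFun f := ⟨fun x => (u : ℝ → ℝ) x * (f : ℝ → ℝ) x, (contDiff_Cm u).mul (contDiff_Cm f)⟩
  map_add' f g := by
    apply Subtype.ext; ext x; simp [mul_add]
  map_smul' c f := by
    apply Subtype.ext; ext x; simp [mul_left_comm]

/-- Inclusion of classes of smooth functions. -/
def inclC {m n : ℕ} (h : n ≤ m) : Cm m →ₗ[ℝ] Cm n where
  toFun f := ⟨f, contDiff_natLE (contDiff_Cm f) h⟩
  map_add' _ _ := rfl
  map_smul' _ _ := rfl

/-- The elliptic operator `ℋ^(m+4) → ℋ^m`. -/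
def ellH {ℓ : ℝ} {M : ℕ} (q : Coefs ℓ M) {m : ℕ} (hm : m + 4 ≤ M) : Hsp ℓ (m + 4) →L[ℝ] Hsp ℓ m :=
  (jet ℓ m ∘ₗ ellC q hm).extendOfNorm (jet ℓ (m + 4))

/-- Multiplication by a smooth function on `ℋ^m`. -/
def mulH (ℓ : ℝ) {m : ℕ} (u : Cm m) : Hsp ℓ m →L[ℝ] Hsp ℓ m :=
  (jet ℓ m ∘ₗ mulC u).extendOfNorm (jet ℓ m)

/-- The inclusion `ℋ^m → ℋ^n`. -/
def resH (ℓ : ℝ) {m n : ℕ} (h : n ≤ m) : Hsp ℓ m →L[ℝ] Hsp ℓ n :=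
  (jet ℓ n ∘ₗ inclC h).extendOfNorm (jet ℓ m)

lemma ellH_jet {ℓ : ℝ} (hℓ : 0 < ℓ) {M : ℕ} (q : Coefs ℓ M) {m : ℕ} (hm : m + 4 ≤ M)
    (f : Cm (m + 4)) : ellH q hm (jet ℓ (m + 4) f) = jet ℓ m (ellC q hm f) := by
  obtain ⟨C, hC, h⟩ := sob_ellOp_le hℓ m q.K q.c
  exact LinearMap.extendOfNorm_eq (denseRange_jet hℓ _) ⟨√C, fun f => norm_jet_le hℓ hC
    (f := ellC q hm f) (h _ _ _ _ (q.hα.natLE hm) (q.hβ.natLE hm) (q.hγ.natLE hm) (contDiff_Cm f))⟩ f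

lemma mulH_jet {ℓ : ℝ} (hℓ : 0 < ℓ) {m : ℕ} (u f : Cm m) :
    mulH ℓ u (jet ℓ m f) = jet ℓ m (mulC u f) := by
  obtain ⟨K, hK⟩ := exists_CBound ℓ (contDiff_Cm u)
  obtain ⟨C, hC, h⟩ := sob_mul hℓ m K
  exact LinearMap.extendOfNorm_eq (denseRange_jet hℓ _) ⟨√C, fun f => norm_jet_le hℓ hC
    (f := mulC u f) (h _ _ _ (contDiff_Cm u) hK (contDiff_Cm f))⟩ f

lemma norm_resH_jet {ℓ : ℝ} (hℓ : 0 < ℓ) {m n : ℕ} (h : n ≤ m) (f : Cm m) :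
    ‖(jet ℓ n ∘ₗ inclC h) f‖ ≤ 1 * ‖jet ℓ m f‖ := by
  have := norm_jet_le hℓ (C := 1) (f := inclC h f) (g := f) zero_le_one
    (by rw [one_mul]; exact sob_mono hℓ 2 h f)
  simpa using this

lemma resH_jet {ℓ : ℝ} (hℓ : 0 < ℓ) {m n : ℕ} (h : n ≤ m) (f : Cm m) :
    resH ℓ h (jet ℓ m f) = jet ℓ n (inclC h f) :=
  LinearMap.extendOfNorm_eq (denseRange_jet hℓ _) ⟨1, norm_resH_jet hℓ h⟩ f

lemma toL2wL_resH {ℓ : ℝ} (hℓ : 0 < ℓ) {m n : ℕ} (h : n ≤ m) (w : Hsp ℓ m) :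
    toL2wL ℓ n (resH ℓ h w) = toL2wL ℓ m w := by
  refine congrFun ((denseRange_jet hℓ m).equalizer ((toL2wL ℓ n).continuous.comp
    (resH ℓ h).continuous) (toL2wL ℓ m).continuous (funext fun f => ?_)) w
  simp only [Function.comp_apply]
  rw [resH_jet hℓ, toL2wL_jet, toL2wL_jet]
  rfl

lemma resH_ellH {ℓ : ℝ} (hℓ : 0 < ℓ) {M : ℕ} (q : Coefs ℓ M) {m n : ℕ} (hm : m + 4 ≤ M)
    (h : n ≤ m) (w : Hsp ℓ (m + 4)) :
    resH ℓ h (ellH q hm w) =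
      ellH q (show n + 4 ≤ M by lia) (resH ℓ (show n + 4 ≤ m + 4 by lia) w) := by
  refine congrFun ((denseRange_jet hℓ (m + 4)).equalizer ((resH ℓ h).continuous.comp
    (ellH q hm).continuous) ((ellH q _).continuous.comp (resH ℓ _).continuous)
    (funext fun f => ?_)) w
  simp only [Function.comp_apply]
  rw [ellH_jet hℓ, resH_jet hℓ, resH_jet hℓ, ellH_jet hℓ]
  rfl

lemma resH_mulH {ℓ : ℝ} (hℓ : 0 < ℓ) {m n : ℕ} (h : n ≤ m) (u : Cm m) (w : Hsp ℓ m) :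
    resH ℓ h (mulH ℓ u w) = mulH ℓ (inclC h u) (resH ℓ h w) := by
  refine congrFun ((denseRange_jet hℓ m).equalizer ((resH ℓ h).continuous.comp
    (mulH ℓ u).continuous) ((mulH ℓ _).continuous.comp (resH ℓ _).continuous)
    (funext fun f => ?_)) w
  simp only [Function.comp_apply]
  rw [mulH_jet hℓ, resH_jet hℓ, resH_jet hℓ, mulH_jet hℓ]
  rfl

lemma CBound_zero_fun (ℓ : ℝ) (m : ℕ) {K : ℝ} (hK : 0 ≤ K) : CBound ℓ K m (fun _ => 0) := by
  induction m with
  | zero => intro x _; simpa using hK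
  | succ m ih => exact ⟨fun x _ => by simpa using hK, by simpa using ih⟩

lemma CBound_const (ℓ : ℝ) (m : ℕ) (c : ℝ) : CBound ℓ |c| m (fun _ => c) := by
  cases m with
  | zero => intro x _; exact le_rfl
  | succ m => exact ⟨fun x _ => le_rfl, by simpa using CBound_zero_fun ℓ m (abs_nonneg c)⟩

/-- The bounds along the homotopy do not depend on `θ`, so the a priori estimate is uniform, as the
method of continuity requires. -/
lemma Coef.interp {ℓ K c : ℝ} (hℓ : 0 < ℓ) {m : ℕ} {α : ℝ → ℝ} (h : Coef ℓ K c m α) {θ : ℝ}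
    (hθ : θ ∈ Icc (0 : ℝ) 1) : Coef ℓ (1 + K) (min 1 c) m (fun x => (1 - θ) + θ * α x) := by
  have hK : 0 ≤ K := (abs_nonneg _).trans (h.bound.bound 0 ⟨by linarith, hℓ.le⟩)
  refine ⟨contDiff_const.add (contDiff_const.mul h.smooth), ?_, fun x hx => ?_⟩
  · have h1 := (CBound_const ℓ m (1 - θ)).mono (K' := 1) (by
      rw [abs_of_nonneg (by linarith [hθ.2])]; linarith [hθ.1])
    have h2 := (h.bound.const_mul (c := θ)).mono (K' := K) (by
      rw [abs_of_nonneg hθ.1]; nlinarith [hθ.2])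
    exact h1.add h2 contDiff_const (contDiff_const.mul h.smooth)
  · have h1 := mul_le_mul_of_nonneg_left ((min_le_right 1 c).trans (h.lower x hx)) hθ.1
    have h2 := mul_le_mul_of_nonneg_left (min_le_left 1 c) (sub_nonneg.2 hθ.2)
    linarith

lemma Coef.one (ℓ : ℝ) (m : ℕ) : Coef ℓ 1 1 m (fun _ => 1) :=
  ⟨contDiff_const, by simpa using CBound_const ℓ m 1, fun _ _ => le_rfl⟩

lemma exists_norm_le_of_jet {ℓ : ℝ} (hℓ : 0 < ℓ) {m n : ℕ} {C : ℝ} {T : Hsp ℓ m →L[ℝ] Hsp ℓ n}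
    (h : ∀ f : Cm m, ‖jet ℓ m f‖ ≤ C * ‖T (jet ℓ m f)‖) (w : Hsp ℓ m) : ‖w‖ ≤ C * ‖T w‖ :=
  (denseRange_jet hℓ m).induction_on (p := fun w => ‖w‖ ≤ C * ‖T w‖) w
    (isClosed_le (by fun_prop) (by fun_prop)) h

lemma norm_le_mulH {ℓ : ℝ} (hℓ : 0 < ℓ) {m : ℕ} {K c : ℝ} (hc : 0 < c) : ∃ C, 0 ≤ C ∧
    ∀ u : Cm m, Coef ℓ K c m u → ∀ w, ‖w‖ ≤ C * ‖mulH ℓ u w‖ := by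
  obtain ⟨C, hC, h⟩ := sob_mul_lower hℓ m K c hc
  refine ⟨√C, by positivity, fun u hu w => exists_norm_le_of_jet hℓ (fun f => ?_) w⟩
  rw [mulH_jet hℓ]
  exact norm_jet_le hℓ hC (h 2 u f hu.smooth hu.bound hu.lower (contDiff_Cm f))

lemma norm_le_ellH {ℓ : ℝ} (hℓ : 0 < ℓ) {M m : ℕ} (hm : m + 4 ≤ M) {K c : ℝ} (hc : 0 < c) :
    ∃ C, 0 ≤ C ∧ ∀ q : Coefs ℓ M, q.K = K → q.c = c → ∀ w, ‖w‖ ≤ C * ‖ellH q hm w‖ := by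
  obtain ⟨C, hC, h⟩ := sob_le_ellOp hℓ m K c hc
  refine ⟨√C, by positivity, fun q hK hc w => exists_norm_le_of_jet hℓ (fun f => ?_) w⟩
  rw [ellH_jet hℓ]
  subst hK hc
  exact norm_jet_le hℓ hC (h _ _ _ f (q.hα.natLE hm) (q.hβ.natLE hm) (q.hγ.natLE hm)
    (contDiff_Cm f))

/-- The homotopy of `q` to constant coefficients. -/
def Coefs.interp {ℓ : ℝ} (hℓ : 0 < ℓ) {M : ℕ} (q : Coefs ℓ M) {θ : ℝ} (hθ : θ ∈ Icc (0 : ℝ) 1) :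
    Coefs ℓ M where
  α x := (1 - θ) + θ * q.α x
  β x := (1 - θ) + θ * q.β x
  γ x := (1 - θ) + θ * q.γ x
  K := 1 + q.K
  c := min 1 q.c
  c_pos := lt_min one_pos q.c_pos
  hα := q.hα.interp hℓ hθ
  hβ := q.hβ.interp hℓ hθ
  hγ := q.hγ.interp hℓ hθ

/-- The coefficients of the model operator. -/
def Coefs.one (ℓ : ℝ) (M : ℕ) : Coefs ℓ M :=
  ⟨_, _, _, 1, 1, one_pos, .one ℓ M, .one ℓ M, .one ℓ M⟩

lemma ellOp_interp {ℓ : ℝ} {α β γ p : ℝ → ℝ} (θ : ℝ) (hα : ContDiff ℝ (2 : ℕ) α)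
    (hβ : ContDiff ℝ (1 : ℕ) β) (hp : ContDiff ℝ (4 : ℕ) p) :
    ellOp ℓ (fun x => (1 - θ) + θ * α x) (fun x => (1 - θ) + θ * β x)
      (fun x => (1 - θ) + θ * γ x) p =
    fun x => (1 - θ) * ellOp ℓ (fun _ => 1) (fun _ => 1) (fun _ => 1) p x +
      θ * ellOp ℓ α β γ p x := by
  have hA : ∀ {α : ℝ → ℝ}, ContDiff ℝ (2 : ℕ) α →
      Differentiable ℝ (fun x => α x * deriv (deriv p) x) := fun hα =>
    contDiff_succ_differentiable (m := 0)
      (contDiff_mul_deriv_deriv (contDiff_pred hα) (contDiff_natLE hp (by lia)))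
  have h1 : ContDiff ℝ (2 : ℕ) (fun _ : ℝ => (1 : ℝ)) := contDiff_const
  have h1' : ContDiff ℝ (1 : ℕ) (fun _ : ℝ => (1 : ℝ)) := contDiff_const
  have hF : flux ℓ (fun x => (1 - θ) + θ * α x) (fun x => (1 - θ) + θ * β x) p =
      fun x => (1 - θ) * flux ℓ (fun _ => 1) (fun _ => 1) p x + θ * flux ℓ α β p x := by
    ext x
    simp only [flux]
    rw [show (fun y => (1 - θ + θ * α y) * deriv (deriv p) y) = fun y =>
      (1 - θ) * ((1 : ℝ) * deriv (deriv p) y) + θ * (α y * deriv (deriv p) y) by ext; ring,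
      Dst_add ((hA h1).const_mul _) ((hA hα).const_mul _), Dst_smul (1 - θ), Dst_smul θ]
    ring
  ext x
  simp only [ellOp]
  rw [hF, Dst_add ((contDiff_succ_differentiable (m := 0)
    (contDiff_flux h1 h1' hp)).const_mul _)
    ((contDiff_succ_differentiable (m := 0) (contDiff_flux hα hβ hp)).const_mul _),
    Dst_smul, Dst_smul]
  ring

/-! ### Surjectivity for the model operator -/

open Polynomial in
/-- `Dst` on polynomials. -/
def dstP (ℓ : ℝ) (a : ℕ) : ℝ[X] →ₗ[ℝ] ℝ[X] where
  toFun p := (C (ℓ ^ 2) - X ^ 2) * derivative p - C (2 * (a + 1) : ℝ) * X * p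
  map_add' p q := by simp only [map_add]; ring
  map_smul' c p := by simp only [smul_eq_C_mul, derivative_C_mul, RingHom.id_apply]; ring

open Polynomial in
lemma dstP_apply (ℓ : ℝ) (a : ℕ) (p : ℝ[X]) : dstP ℓ a p =
    (C (ℓ ^ 2) - X ^ 2) * derivative p - C (2 * (a + 1) : ℝ) * X * p := rfl

lemma Dst_polynomial (ℓ : ℝ) (a : ℕ) (p : Polynomial ℝ) :
    Dst ℓ a (fun x => p.eval x) = fun x => (dstP ℓ a p).eval x := by
  ext x
  simp [Dst, dstP_apply, Polynomial.deriv]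

open Polynomial in
lemma dstP_X_pow (ℓ : ℝ) (a n : ℕ) : dstP ℓ a (X ^ (n + 1) : ℝ[X]) =
    C (-(n + 2 * a + 3) : ℝ) * X ^ (n + 2) + C ((n + 1) * ℓ ^ 2 : ℝ) * X ^ n := by
  rw [dstP_apply, derivative_X_pow]
  simp only [Nat.add_sub_cancel, map_add, map_mul, map_neg, map_one, map_ofNat, Nat.cast_add,
    Nat.cast_one]
  ring

open Polynomial in
lemma dstP_one (ℓ : ℝ) (a : ℕ) : dstP ℓ a (1 : ℝ[X]) = C (-(2 * a + 2) : ℝ) * X := by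
  rw [dstP_apply, derivative_one]
  simp only [map_add, map_mul, map_neg, map_one, map_ofNat]
  ring

open Polynomial in
/-- The model operator on polynomials. -/
def ellP (ℓ : ℝ) : ℝ[X] →ₗ[ℝ] ℝ[X] :=
  dstP ℓ 2 ∘ₗ (dstP ℓ 3 ∘ₗ derivative ∘ₗ derivative - derivative) + LinearMap.id

open Polynomial in
lemma ellP_apply (ℓ : ℝ) (p : ℝ[X]) : ellP ℓ p =
    dstP ℓ 2 (dstP ℓ 3 (derivative (derivative p)) - derivative p) + p := rfl

lemma ellOp_polynomial (ℓ : ℝ) (p : Polynomial ℝ) :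
    ellOp ℓ (fun _ => 1) (fun _ => 1) (fun _ => 1) (fun x => p.eval x) =
      fun x => (ellP ℓ p).eval x := by
  have h : flux ℓ (fun _ => 1) (fun _ => 1) (fun x => p.eval x) =
      fun x => (dstP ℓ 3 (p.derivative.derivative) - p.derivative).eval x := by
    ext x
    simp only [flux, polynomial_deriv_eq, one_mul]
    rw [Dst_polynomial]
    simp [sub_eq_add_neg]
  ext x
  simp only [ellOp]
  rw [h, Dst_polynomial, ellP_apply]
  simp

open Polynomial in
lemma span_X_pow_eq_top {P : Submodule ℝ ℝ[X]} (h : ∀ n : ℕ, (X ^ n : ℝ[X]) ∈ P) (p : ℝ[X]) :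
    p ∈ P := by
  induction p using Polynomial.induction_on' with
  | add p q hp hq => exact P.add_mem hp hq
  | monomial n a =>
    rw [← C_mul_X_pow_eq_monomial, ← smul_eq_C_mul]
    exact P.smul_mem _ (h n)

open Polynomial in
lemma mem_of_leading {P : Submodule ℝ ℝ[X]} {c : ℝ} (hc : c ≠ 0) {p r s : ℝ[X]}
    (hp : p ∈ P) (hr : r ∈ P) (h : p = C c * s + r) : s ∈ P := by
  have : s = c⁻¹ • (p - r) := by
    rw [h, add_sub_cancel_right, ← smul_eq_C_mul, smul_smul, inv_mul_cancel₀ hc, one_smul]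
  rw [this]
  exact P.smul_mem _ (P.sub_mem hp hr)

-- `dstP` raises the degree by exactly one, with nonzero leading coefficient, so modulo its range
-- every polynomial reduces to a constant.
open Polynomial in
lemma exists_dstP_add_C (ℓ : ℝ) (a : ℕ) (p : ℝ[X]) : ∃ (r : ℝ[X]) (c : ℝ), p = dstP ℓ a r + C c := by
  set P : Submodule ℝ ℝ[X] := LinearMap.range (dstP ℓ a) ⊔ LinearMap.range (CAlgHom (R := ℝ)
    (A := ℝ)).toLinearMap with hP
  have hC : ∀ c : ℝ, (C c : ℝ[X]) ∈ P := fun c =>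
    (le_sup_right : _ ≤ P) ⟨c, rfl⟩
  have hD : ∀ r : ℝ[X], dstP ℓ a r ∈ P := fun r =>
    (le_sup_left : LinearMap.range (dstP ℓ a) ≤ P) ⟨r, rfl⟩
  have key : ∀ n : ℕ, (X ^ n : ℝ[X]) ∈ P := by
    intro n
    induction n using Nat.strong_induction_on with
    | _ n ih =>
      match n, ih with
      | 0, _ => simpa using hC 1
      | 1, _ =>
        refine mem_of_leading (c := -(2 * a + 2)) ?_ (hD 1) P.zero_mem (by rw [dstP_one]; ring)
        have : (0 : ℝ) < 2 * a + 2 := by positivity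
        linarith
      | n + 2, ih =>
        refine mem_of_leading (c := -(n + 2 * a + 3)) ?_ (hD (X ^ (n + 1)))
          (P.smul_mem ((n + 1) * ℓ ^ 2) (ih n (by lia))) (by rw [dstP_X_pow, smul_eq_C_mul])
        have : (0 : ℝ) < n + 2 * a + 3 := by positivity
        linarith
  obtain ⟨y, ⟨r, rfl⟩, z, ⟨c, rfl⟩, h⟩ := Submodule.mem_sup.1 (span_X_pow_eq_top key p)
  exact ⟨r, c, h.symm⟩

/-- The commutator rule `deriv_Dst` with `a = 2`, where `2(a+1) = 6`. It turns the fourth order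
model operator into a polynomial in the second order operator `jacP`. -/
lemma dstP_derivative_comm (ℓ : ℝ) (p : Polynomial ℝ) :
    dstP ℓ 3 p.derivative = (dstP ℓ 2 p).derivative + 6 * p := by
  simp only [dstP_apply, Polynomial.derivative_sub, Polynomial.derivative_mul,
    Polynomial.derivative_C, Polynomial.derivative_X_pow, Polynomial.derivative_X, map_mul,
    map_add, map_ofNat, map_natCast, map_one]
  push_cast
  simp only [Polynomial.derivative_ofNat, Polynomial.derivative_one]
  ring

/-- The second order model operator on polynomials. -/
def jacP (ℓ : ℝ) : Polynomial ℝ →ₗ[ℝ] Polynomial ℝ := dstP ℓ 2 ∘ₗ Polynomial.derivative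

-- `jacP` is a Gegenbauer operator, triangular on monomials with diagonal entries `-n(n+5)`. In
-- particular it preserves the degree filtration.
open Polynomial in
lemma jacP_X_pow (ℓ : ℝ) (n : ℕ) : ∃ r ∈ degreeLT ℝ n,
    jacP ℓ (X ^ n) = C (-(n * (n + 5)) : ℝ) * X ^ n + r := by
  match n with
  | 0 => exact ⟨0, Submodule.zero_mem _, by simp [jacP]⟩
  | 1 =>
    refine ⟨0, Submodule.zero_mem _, ?_⟩
    simp only [jacP, LinearMap.comp_apply, pow_one, derivative_X, dstP_one]
    norm_num
  | n + 2 =>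
    refine ⟨C ((n + 2) * ((n + 1) * ℓ ^ 2)) * X ^ n, ?_, ?_⟩
    · rw [mem_degreeLT]
      exact (degree_C_mul_X_pow_le n _).trans_lt (by exact_mod_cast (by lia : n < n + 2))
    · simp only [jacP, LinearMap.comp_apply, derivative_X_pow]
      rw [show n + 2 - 1 = n + 1 by lia, ← smul_eq_C_mul, map_smul, dstP_X_pow, smul_eq_C_mul]
      rw [mul_add, ← mul_assoc, ← mul_assoc, ← C_mul, ← C_mul]
      congr 3 <;> (congr 1; push_cast; ring)

open Polynomial in
lemma jacP_mem_degreeLT (ℓ : ℝ) {n : ℕ} {p : ℝ[X]} (hp : p ∈ degreeLT ℝ n) :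
    jacP ℓ p ∈ degreeLT ℝ n := by
  have h : degreeLT ℝ n ≤ (degreeLT ℝ n).comap (jacP ℓ) := by
    conv_lhs => rw [degreeLT_eq_span_X_pow]
    rw [Submodule.span_le]
    intro q hq
    simp only [Finset.coe_image, Finset.coe_range, mem_image, mem_Iio] at hq
    obtain ⟨k, hk, rfl⟩ := hq
    obtain ⟨r, hr, h⟩ := jacP_X_pow ℓ k
    change jacP ℓ (X ^ k) ∈ degreeLT ℝ n
    rw [h]
    refine Submodule.add_mem _ ?_ (degreeLT_mono hk.le hr)
    rw [mem_degreeLT]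
    exact (degree_C_mul_X_pow_le k _).trans_lt (by exact_mod_cast hk)
  exact h hp

-- With `J = jacP`, the model operator is `J² + 5 J + 1`, the `5` being the commutator constant `6`
-- minus the coefficient `1` of the second order term. It is triangular on monomials, with diagonal
-- entries `c² + 5c + 1` at `c = -n(n+5)`.
open Polynomial in
lemma surjective_ellP (ℓ : ℝ) : Function.Surjective (ellP ℓ) := by
  have e : ∀ p, ellP ℓ p = jacP ℓ (jacP ℓ p) + C 5 * jacP ℓ p + p := by
    intro p
    rw [ellP_apply, dstP_derivative_comm]
    have : derivative (dstP ℓ 2 (derivative p)) + 6 * derivative p - derivative p =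
      derivative (dstP ℓ 2 (derivative p)) + (5 : ℝ) • derivative p := by
      rw [smul_eq_C_mul, map_ofNat]; ring
    rw [this, map_add, map_smul, smul_eq_C_mul]
    rfl
  have key : ∀ n : ℕ, (X ^ n : ℝ[X]) ∈ LinearMap.range (ellP ℓ) := by
    intro n
    induction n using Nat.strong_induction_on with
    | _ n ih =>
      have hle : degreeLT ℝ n ≤ LinearMap.range (ellP ℓ) := by
        rw [degreeLT_eq_span_X_pow, Submodule.span_le]
        intro q hq
        simp only [Finset.coe_image, Finset.coe_range, mem_image, mem_Iio] at hq
        obtain ⟨k, hk, rfl⟩ := hq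
        exact ih k hk
      obtain ⟨r, hr, h⟩ := jacP_X_pow ℓ n
      set c : ℝ := -(n * (n + 5)) with hc
      -- For `n = 0` the value is `1`; for `n ≥ 1` one has `c ≤ -6`, hence `c (c + 5) > 0`.
      have hc' : c * c + 5 * c + 1 ≠ 0 := by
        rw [hc]
        rcases Nat.eq_zero_or_pos n with rfl | hn
        · norm_num
        · have : (1 : ℝ) ≤ n := by exact_mod_cast hn
          have : 0 < (n * ((n : ℝ) + 5)) * (n * (n + 5) - 5) := by
            apply mul_pos <;> nlinarith
          linarith
      refine mem_of_leading hc' (p := ellP ℓ (X ^ n)) ⟨_, rfl⟩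
        (hle (Submodule.add_mem _ (Submodule.add_mem _ (Submodule.smul_mem _ c hr)
          (jacP_mem_degreeLT ℓ hr)) (Submodule.smul_mem _ (5 : ℝ) hr))) ?_
      rw [e, h, map_add, ← smul_eq_C_mul, map_smul, h]
      simp only [smul_eq_C_mul, map_add, map_mul, map_one, mul_add]
      ring
  intro p
  exact span_X_pow_eq_top key p

lemma surjective_of_bound {X Y : Type*} [NormedAddCommGroup X] [NormedSpace ℝ X]
    [CompleteSpace X] [NormedAddCommGroup Y] [NormedSpace ℝ Y] (T : X →L[ℝ] Y) {C : ℝ}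
    (hC : 0 ≤ C) (h : ∀ x, ‖x‖ ≤ C * ‖T x‖) (hd : DenseRange T) : Function.Surjective T := by
  have ha : AntilipschitzWith ⟨C, hC⟩ T := AddMonoidHomClass.antilipschitz_of_bound T h
  have hc := ha.isClosed_range T.uniformContinuous
  intro y
  have := hd y
  rwa [hc.closure_eq] at this

/-- The range is closed by the a priori estimate and contains all polynomials. -/
lemma surjective_ellH_one {ℓ : ℝ} (hℓ : 0 < ℓ) {M m : ℕ} (hm : m + 4 ≤ M) :
    Function.Surjective (ellH (Coefs.one ℓ M) hm) := by
  obtain ⟨C, hC, h⟩ := norm_le_ellH hℓ hm one_pos (K := 1)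
  refine surjective_of_bound _ hC (h _ rfl rfl) ((denseRange_polyJet hℓ m).mono ?_)
  rintro _ ⟨p, rfl⟩
  obtain ⟨r, rfl⟩ := surjective_ellP ℓ p
  refine ⟨polyJet ℓ (m + 4) r, ?_⟩
  rw [polyJet, LinearMap.comp_apply, ellH_jet hℓ, polyJet, LinearMap.comp_apply]
  congr 1
  apply Subtype.ext
  exact ellOp_polynomial ℓ r

lemma surjective_ellH {ℓ : ℝ} (hℓ : 0 < ℓ) {M m : ℕ} (q : Coefs ℓ M) (hm : m + 4 ≤ M) :
    Function.Surjective (ellH q hm) := by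
  obtain ⟨C, hC, h⟩ := norm_le_ellH hℓ hm (lt_min one_pos q.c_pos) (K := 1 + q.K)
  refine surjective_of_continuity (ellH (Coefs.one ℓ M) hm) _ C hC (fun θ hθ w => ?_)
    (surjective_ellH_one hℓ hm)
  convert h (q.interp hℓ hθ) rfl rfl w using 3
  refine congrFun ((denseRange_jet hℓ (m + 4)).equalizer (g := fun w =>
    ellH (Coefs.one ℓ M) hm w + θ • (ellH q hm w - ellH (Coefs.one ℓ M) hm w))
    (by fun_prop) (ellH (q.interp hℓ hθ) hm).continuous (funext fun f => ?_)) w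
  simp only [Function.comp_apply]
  rw [ellH_jet hℓ, ellH_jet hℓ, ellH_jet hℓ, ← map_sub, ← map_smul, ← map_add]
  congr 1
  apply Subtype.ext
  have := ellOp_interp (ℓ := ℓ) (γ := q.γ) θ (q.hα.natLE (by lia)).smooth
    (q.hβ.natLE (by lia)).smooth (contDiff_natLE (contDiff_Cm f) (by lia : 4 ≤ m + 4))
  refine Eq.trans ?_ this.symm
  ext x
  simp only [ellC, Coefs.one, LinearMap.coe_mk, AddHom.coe_mk, Submodule.coe_add,
    Submodule.coe_smul, Submodule.coe_sub, Pi.add_apply, Pi.smul_apply, Pi.sub_apply, smul_eq_mul]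
  ring

/-- The lower bound on `u` holds on `[-ℓ, ℓ]` only, so `1/u` need not be of class `C^m` on the line.
The homotopy `1 - θ + θ u` to the identity is used instead. -/
lemma surjective_mulH {ℓ : ℝ} (hℓ : 0 < ℓ) {m : ℕ} {K c : ℝ} (hc : 0 < c) (u : Cm m)
    (hu : Coef ℓ K c m u) : Function.Surjective (mulH ℓ u) := by
  obtain ⟨C, hC, h⟩ := norm_le_mulH hℓ (m := m) (lt_min one_pos hc) (K := 1 + K)
  refine surjective_of_continuity (ContinuousLinearMap.id ℝ _) _ C hC (fun θ hθ w => ?_)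
    Function.surjective_id
  have hu' := hu.interp hℓ hθ
  set u' : Cm m := ⟨_, hu'.smooth⟩ with hu'_def
  suffices e : w + θ • (mulH ℓ u w - w) = mulH ℓ u' w by
    change ‖w‖ ≤ C * ‖w + θ • (mulH ℓ u w - w)‖
    rw [e]
    exact h u' hu' w
  have E : ContinuousLinearMap.id ℝ (Hsp ℓ m) + θ • (mulH ℓ u - ContinuousLinearMap.id ℝ _) =
      mulH ℓ u' := by
    refine clm_ext_jet hℓ fun f => ?_
    change jet ℓ m f + θ • (mulH ℓ u (jet ℓ m f) - jet ℓ m f) = mulH ℓ u' (jet ℓ m f)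
    rw [mulH_jet hℓ, mulH_jet hℓ, ← map_sub, ← map_smul, ← map_add]
    congr 1
    apply Subtype.ext
    ext x
    simp only [hu'_def, mulC, LinearMap.coe_mk, AddHom.coe_mk, Submodule.coe_add,
      Submodule.coe_smul, Submodule.coe_sub, Pi.add_apply, Pi.smul_apply, Pi.sub_apply, smul_eq_mul]
    ring
  exact congrArg (fun T : Hsp ℓ m →L[ℝ] Hsp ℓ m => T w) E

/-! ### Spectral theorem for a compact self-adjoint operator. -/

open Module.End in
/-- A countable orthonormal eigenbasis for a compact self-adjoint operator. -/
lemma exists_eigenbasis {X : Type} [NormedAddCommGroup X] [InnerProductSpace ℝ X]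
    [CompleteSpace X] (T : X →L[ℝ] X) (hc : IsCompactOperator T) (hs : T.IsSymmetric)
    (D : ℕ → X) (hD : ∀ x : X, (∀ n, inner ℝ x (D n) = 0) → x = 0) :
    ∃ (ι : Type) (_ : Countable ι) (b : HilbertBasis ι ℝ X) (τ : ι → ℝ),
      ∀ i, T (b i) = τ i • b i := by
  have hcl : ∀ μ : ℝ, IsClosed ((eigenspace (T : X →ₗ[ℝ] X) μ : Submodule ℝ X) : Set X) := by
    intro μ
    have : ((eigenspace (T : X →ₗ[ℝ] X) μ : Submodule ℝ X) : Set X) = {x | T x = μ • x} := by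
      ext x; simp
    rw [this]
    exact isClosed_eq (by fun_prop) (by fun_prop)
  have hcs : ∀ μ : ℝ, CompleteSpace (eigenspace (T : X →ₗ[ℝ] X) μ) := fun μ =>
    (hcl μ).completeSpace_coe
  have hex := fun μ : ℝ => exists_hilbertBasis ℝ (eigenspace (T : X →ₗ[ℝ] X) μ)
  choose w b hb using hex
  -- Hilbert bases of the eigenspaces, for all real `μ` including `0`, taken together: distinct
  -- eigenspaces are orthogonal.
  have ho : Orthonormal ℝ fun a : Σ μ : ℝ, w μ =>
      (((a.2 : eigenspace (T : X →ₗ[ℝ] X) a.1)) : X) := by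
    have := (LinearMap.IsSymmetric.orthogonalFamily_eigenspaces hs).orthonormal_sigma_orthonormal
      (v_family := fun μ (i : w μ) => (i : eigenspace (T : X →ₗ[ℝ] X) μ))
      (fun μ => by rw [← hb μ]; exact (b μ).orthonormal)
    exact this
  have hbot : (Submodule.span ℝ (range fun a : Σ μ : ℝ, w μ =>
      (((a.2 : eigenspace (T : X →ₗ[ℝ] X) a.1)) : X)))ᗮ = ⊥ := by
    rw [eq_bot_iff, ← ContinuousLinearMap.orthogonalComplement_iSup_eigenspaces_eq_bot hc hs]
    intro x hx
    rw [Submodule.mem_orthogonal'] at hx ⊢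
    have h1 : ∀ μ : ℝ, ∀ y ∈ eigenspace (T : X →ₗ[ℝ] X) μ, inner ℝ x y = 0 := by
      intro μ y hy
      have h2 := (b μ).hasSum_repr ⟨y, hy⟩
      have h3 := (h2.mapL ((innerSL ℝ x).comp (eigenspace (T : X →ₗ[ℝ] X) μ).subtypeL))
      have h4 : ∀ i, ((innerSL ℝ x).comp (eigenspace (T : X →ₗ[ℝ] X) μ).subtypeL)
          ((b μ).repr ⟨y, hy⟩ i • b μ i) = 0 := by
        intro i
        rw [map_smul, hb μ]
        have : inner ℝ x ((i : eigenspace (T : X →ₗ[ℝ] X) μ) : X) = 0 :=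
          hx _ (Submodule.subset_span ⟨⟨μ, i⟩, rfl⟩)
        simp [this]
      simp only [h4] at h3
      exact (hasSum_zero.unique h3).symm
    intro y hy
    have h2 : (⨆ μ, eigenspace (T : X →ₗ[ℝ] X) μ) ≤ LinearMap.ker (innerSL ℝ x).toLinearMap :=
      iSup_le fun μ y hy => h1 μ y hy
    exact h2 hy
  refine ⟨Σ μ : ℝ, w μ, ?_, HilbertBasis.mkOfOrthogonalEqBot ho hbot, fun a => a.1, fun a => ?_⟩
  -- Countability of the basis: each `D n` has countably many nonzero coordinates, and a basis
  -- vector outside all these supports would be orthogonal to every `D n`, hence zero.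
  · set B := HilbertBasis.mkOfOrthogonalEqBot ho hbot
    have h1 : ∀ n, (Function.support fun i => B.repr (D n) i).Countable := by
      intro n
      have h := (B.summable_inner_mul_inner (D n) (D n)).countable_support
      refine h.mono fun i hi => ?_
      rw [Function.mem_support, B.repr_apply_apply] at hi
      rw [Function.mem_support]
      exact mul_ne_zero (by rwa [real_inner_comm]) hi
    have h2 : (univ : Set (Σ μ : ℝ, w μ)) ⊆ ⋃ n, Function.support fun i => B.repr (D n) i := by
      intro i _
      by_contra hcon
      simp only [mem_iUnion, Function.mem_support, not_exists, not_not] at hcon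
      have : B i = 0 := hD _ fun n => by
        rw [← B.repr_apply_apply]; exact hcon n
      have h3 := B.orthonormal.norm_eq_one i
      rw [this, norm_zero] at h3
      exact zero_ne_one h3
    exact countable_univ_iff.1 ((countable_iUnion h1).mono h2)
  · rw [HilbertBasis.coe_mkOfOrthogonalEqBot]
    exact mem_eigenspace_iff.1 (a.2 : eigenspace (T : X →ₗ[ℝ] X) a.1).2

/-! ### Compactness -/

/-- A Poincaré inequality whose constant improves with the number of vanishing moments. By duality
`W = Dst r`, where `r` has one vanishing moment less in the weight `ρ^(b+1)`; this drives the
induction. Linear growth in `n` suffices for compactness. -/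
lemma poincare {ℓ : ℝ} (hℓ : 0 < ℓ) (n b : ℕ) (W : Polynomial ℝ)
    (h : ∀ k < n, ip ℓ b (fun x => W.eval x) (fun x => x ^ k) = 0) :
    2 * n * ip ℓ b (fun x => W.eval x) (fun x => W.eval x) ≤
      ip ℓ (b + 1) (fun x => W.derivative.eval x) (fun x => W.derivative.eval x) := by
  induction n generalizing b W with
  | zero => simpa using ip_nonneg hℓ _ _
  | succ n ih =>
    obtain ⟨r, c, hr⟩ := exists_dstP_add_C ℓ b W
    have hcd : ∀ (p : Polynomial ℝ) (m : WithTop ℕ∞), ContDiff ℝ m fun x => p.eval x := fun p m => by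
      simpa using p.contDiff_aeval (𝕜 := ℝ) m
    have hD := Dst_polynomial ℓ b r
    -- The range of `Dst` is orthogonal to constants, and so is `W`; the constant `1` has positive
    -- norm.
    have hc : c = 0 := by
      have h0 := h 0 (by lia)
      have h1 : (fun x => W.eval x) = fun x => Dst ℓ b (fun x => r.eval x) x + c * 1 := by
        rw [hD, hr]; ext x; simp
      have h2 : ip ℓ b (fun _ => 1) (fun _ => 1) = ip ℓ b (fun _ => (1 : ℝ)) (fun x => x ^ 0) := by
        simp
      have h3 : 0 < ip ℓ b (fun _ => 1) (fun _ => 1) := by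
        refine intervalIntegral.intervalIntegral_pos_of_pos_on
          (ip_integrable continuous_const continuous_const) (fun x hx => ?_) (by linarith)
        have : 0 < (ℓ ^ 2 - x ^ 2) ^ b := pow_pos (by nlinarith [hx.1, hx.2]) _
        simpa using this
      rw [h1, ip_add_left (by rw [hD]; exact Polynomial.continuous _) (by fun_prop) (by fun_prop),
        ip_smul_left, ip_Dst (hcd r 1) (by fun_prop), ← h2] at h0
      simp only [pow_zero, deriv_const'] at h0
      have h4 : ip ℓ (b + 1) (fun x => r.eval x) (fun _ => 0) = 0 := by simp [ip]
      rw [h4, neg_zero, zero_add] at h0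
      exact (mul_eq_zero.1 h0).resolve_right h3.ne'
    have hW : (fun x => W.eval x) = Dst ℓ b (fun x => r.eval x) := by
      rw [hD, hr, hc]; simp
    -- The moment of `W` of order `k + 1` is `-(k + 1)` times the moment of `r` of order `k` in the
    -- next weight.
    have hrk : ∀ k < n, ip ℓ (b + 1) (fun x => r.eval x) (fun x => x ^ k) = 0 := by
      intro k hk
      have h1 := h (k + 1) (by lia)
      rw [hW, ip_Dst (hcd r 1) (by fun_prop), neg_eq_zero] at h1
      have h2 : deriv (fun x : ℝ => x ^ (k + 1)) = fun x => ((k : ℝ) + 1) * x ^ k := by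
        ext x; simp
      rw [h2, ip_comm, ip_smul_left] at h1
      rw [ip_comm]
      exact (mul_eq_zero.1 h1).resolve_left (by positivity)
    have h1 := ih (b + 1) r hrk
    have h2 := ip_Dst_self (ℓ := ℓ) (a := b) (hcd r 1)
    rw [← hW, polynomial_deriv_eq] at h2
    set A := ip ℓ b (fun x => W.eval x) (fun x => W.eval x)
    set R := ip ℓ (b + 1) (fun x => r.eval x) (fun x => r.eval x)
    set D := ip ℓ (b + 1) (fun x => W.derivative.eval x) (fun x => W.derivative.eval x)
    have hR : 0 ≤ R := ip_nonneg hℓ _ _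
    -- By `ip_Dst_self`, `A` is the weighted norm of `r'` plus `2(b+1) R`; the induction hypothesis
    -- bounds the former below by `2n R`.
    have h3 : (2 * (n + 1 : ℕ)) * R ≤ A := by
      push_cast
      have : 0 ≤ (b : ℝ) * R := by positivity
      linarith
    -- `A = -⟨r, W'⟩` in the weight `ρ^(b+1)`. The Young parameter `2(n+1)` is chosen so that the
    -- term with `R` is at most `A/2` by the preceding bound.
    have h4 : A ≤ (2 * (2 * ((n + 1 : ℕ) : ℝ)))⁻¹ * D + (2 * ((n + 1 : ℕ) : ℝ)) / 2 * R := by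
      have h5 : A = ip ℓ (b + 1) (fun x => W.derivative.eval x) (fun x => -1 * r.eval x) := by
        rw [ip_comm, ip_smul_left, ← polynomial_deriv_eq, neg_one_mul, ← ip_Dst (hcd r 1) (hcd W 1),
          ← hW]
      have h6 : R = ip ℓ (b + 1) (fun x => -1 * r.eval x) (fun x => -1 * r.eval x) := by
        rw [ip_smul_left, ip_comm, ip_smul_left]; ring
      rw [h5, h6]
      exact ip_young hℓ (by fun_prop) (by fun_prop) (by positivity)
    have h5 : 0 < 2 * ((n + 1 : ℕ) : ℝ) := by positivity
    have h7 : A / 2 ≤ (2 * (2 * ((n + 1 : ℕ) : ℝ)))⁻¹ * D := by linarith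
    have h8 := mul_le_mul_of_nonneg_left h7 (by positivity : 0 ≤ 2 * (2 * ((n + 1 : ℕ) : ℝ)))
    rw [← mul_assoc (2 * (2 * ((n + 1 : ℕ) : ℝ))), mul_inv_cancel₀ (by positivity), one_mul] at h8
    linarith

lemma inner_polyCls {ℓ : ℝ} (hℓ : 0 < ℓ) (p q : Polynomial ℝ) :
    inner ℝ (polyCls ℓ p) (polyCls ℓ q) = ip ℓ 2 (fun x => p.eval x) (fun x => q.eval x) := by
  rw [polyCls_apply, polyCls_apply, inner_cls hℓ]

/-- Classes of polynomials of degree less than `n`. -/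
def polySpace (ℓ : ℝ) (n : ℕ) : Submodule ℝ (L2w ℓ) :=
  (Polynomial.degreeLT ℝ n).map (polyCls ℓ)

instance (ℓ : ℝ) (n : ℕ) : FiniteDimensional ℝ (polySpace ℓ n) := by
  have : FiniteDimensional ℝ (Polynomial.degreeLT ℝ n) :=
    Module.Finite.equiv (Polynomial.degreeLTEquiv ℝ n).symm
  unfold polySpace
  infer_instance

/-- The `L²` projection `r` onto polynomials of degree `< n` leaves a remainder to which `poincare`
applies. It remains to see that `|(p - r)'| ≤ |p'|`, which holds because the projection is
orthogonal for the Dirichlet form as well. -/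
lemma approx_poly {ℓ : ℝ} (hℓ : 0 < ℓ) (n : ℕ) (p : Polynomial ℝ) :
    2 * n * ‖polyCls ℓ p - (polySpace ℓ n).starProjection (polyCls ℓ p)‖ ^ 2 ≤
      ip ℓ 3 (fun x => p.derivative.eval x) (fun x => p.derivative.eval x) := by
  obtain ⟨r, hr, hpr⟩ := (polySpace ℓ n).starProjection_apply_mem (polyCls ℓ p)
  have horth : ∀ s ∈ Polynomial.degreeLT ℝ n,
      ip ℓ 2 (fun x => (p - r).eval x) (fun x => s.eval x) = 0 := by
    intro s hs
    rw [← inner_polyCls hℓ, map_sub, hpr]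
    exact Submodule.starProjection_inner_eq_zero _ _ ⟨s, hs, rfl⟩
  have h1 : ‖polyCls ℓ p - (polySpace ℓ n).starProjection (polyCls ℓ p)‖ ^ 2 =
      ip ℓ 2 (fun x => (p - r).eval x) (fun x => (p - r).eval x) := by
    rw [← hpr, ← map_sub, ← real_inner_self_eq_norm_sq, inner_polyCls hℓ]
  have h2 := poincare hℓ n 2 (p - r) fun k hk => by
    have := horth (Polynomial.X ^ k) (by
      rw [Polynomial.mem_degreeLT]
      exact (Polynomial.degree_X_pow_le k).trans_lt (by exact_mod_cast hk))
    simpa using this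
  rw [h1]
  refine h2.trans ?_
  have hcd : ∀ (p : Polynomial ℝ) (m : WithTop ℕ∞), ContDiff ℝ m fun x => p.eval x := fun p m => by
    simpa using p.contDiff_aeval (𝕜 := ℝ) m
  -- The pairing of `r'` with `(p - r)'` equals minus that of `jacP r` with `p - r`, and `jacP r`
  -- still has degree `< n`.
  have h3 : ip ℓ 3 (fun x => r.derivative.eval x) (fun x => (p - r).derivative.eval x) = 0 := by
    have h4 := ip_Dst (ℓ := ℓ) (a := 2) (hcd r.derivative 1) (hcd (p - r) 1)
    rw [Dst_polynomial, polynomial_deriv_eq, ip_comm] at h4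
    have h5 := horth (jacP ℓ r) (jacP_mem_degreeLT ℓ hr)
    rw [jacP, LinearMap.comp_apply, h4, neg_eq_zero] at h5
    exact h5
  have h6 : (fun x => p.derivative.eval x) = fun x => (p - r).derivative.eval x +
      r.derivative.eval x := by ext x; simp
  have h7 := ip_nonneg hℓ 3 (fun x => r.derivative.eval x)
  rw [h6, ip_add_left (by fun_prop) (by fun_prop) (by fun_prop), ip_comm ℓ 3 _ (fun x => _ + _),
    ip_add_left (by fun_prop) (by fun_prop) (by fun_prop), ip_comm ℓ 3 (fun x => r.derivative.eval x)
      (fun x => _ + _), ip_add_left (by fun_prop) (by fun_prop) (by fun_prop), h3,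
    ip_comm ℓ 3 (fun x => (p - r).derivative.eval x) (fun x => r.derivative.eval x), h3]
  linarith

lemma isCompactOperator_of_approx {X Y : Type*} [NormedAddCommGroup X] [NormedSpace ℝ X]
    [NormedAddCommGroup Y] [NormedSpace ℝ Y] [CompleteSpace Y] (T : X →L[ℝ] Y)
    (F : ℕ → X →L[ℝ] Y) (hF : ∀ n, IsCompactOperator (F n))
    (hb : ∀ n : ℕ, ‖F n - T‖ ≤ √(1 / (n + 1))) : IsCompactOperator T := by
  refine isCompactOperator_of_tendsto (l := Filter.atTop) (F := F) ?_ (.of_forall hF)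
  have hlim : Filter.Tendsto (fun n : ℕ => √(1 / ((n : ℝ) + 1))) Filter.atTop (nhds 0) := by
    have := (Real.continuous_sqrt.tendsto 0).comp tendsto_one_div_add_atTop_nhds_zero_nat
    rwa [Real.sqrt_zero] at this
  exact tendsto_iff_norm_sub_tendsto_zero.2 (squeeze_zero (fun _ => norm_nonneg _) hb hlim)

/-- The embedding is a limit in operator norm of the finite rank operators given by projection onto
polynomials; the rate comes from `approx_poly`. -/
lemma isCompactOperator_toL2wL {ℓ : ℝ} (hℓ : 0 < ℓ) (m : ℕ) :
    IsCompactOperator (toL2wL ℓ (m + 1)) := by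
  have hb : ∀ n : ℕ, ‖((polySpace ℓ (n + 1)).starProjection).comp (toL2wL ℓ (m + 1)) -
      toL2wL ℓ (m + 1)‖ ≤ √(1 / (n + 1)) := by
    intro n
    refine ContinuousLinearMap.opNorm_le_bound _ (by positivity) fun w => ?_
    refine (denseRange_polyJet hℓ (m + 1)).induction_on (p := fun w =>
      ‖(((polySpace ℓ (n + 1)).starProjection).comp (toL2wL ℓ (m + 1)) -
        toL2wL ℓ (m + 1)) w‖ ≤ √(1 / (n + 1)) * ‖w‖) w
      (isClosed_le (ContinuousLinearMap.continuous _).norm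
        (continuous_const.mul continuous_norm)) fun p => ?_
    refine abs_le_of_sq_le_sq' ?_ (by positivity) |>.2
    rw [mul_pow, Real.sq_sqrt (by positivity), sub_apply,
      ContinuousLinearMap.comp_apply, toL2wL_polyJet, norm_sub_rev]
    have h1 := approx_poly hℓ (n + 1) p
    have h2 : ip ℓ 3 (fun x => p.derivative.eval x) (fun x => p.derivative.eval x) ≤
        ‖polyJet ℓ (m + 1) p‖ ^ 2 := by
      rw [polyJet, LinearMap.comp_apply, norm_sq_jet hℓ, ← polynomial_deriv_eq]
      exact (ip_le_sob hℓ 3 m _).trans (sob_deriv_le hℓ 2 m _)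
    have h3 : 0 ≤ ‖polyCls ℓ p - (polySpace ℓ (n + 1)).starProjection (polyCls ℓ p)‖ ^ 2 := by
      positivity
    rw [one_div, inv_mul_eq_div, le_div_iff₀ (by positivity)]
    push_cast at h1
    have : (0 : ℝ) ≤ n := n.cast_nonneg
    nlinarith [mul_nonneg this h3]
  refine isCompactOperator_of_approx _
    (fun n : ℕ => ((polySpace ℓ (n + 1)).starProjection).comp (toL2wL ℓ (m + 1)))
    (fun n => ?_) hb
  have h1 : IsCompactOperator (id : polySpace ℓ (n + 1) → polySpace ℓ (n + 1)) :=
      (isCompactOperator_id_iff_finiteDimensional (𝕜 := ℝ)).2 inferInstance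
  have h2 := (h1.comp_clm ((polySpace ℓ (n + 1)).orthogonalProjectionOnto.comp
      (toL2wL ℓ (m + 1)))).clm_comp (polySpace ℓ (n + 1)).subtypeL
  exact h2

/-! ### Square summable sequences -/

/-- Square summable real sequences. -/
abbrev Seq2 (ι : Type) : Type := lp (fun _ : ι => ℝ) 2

lemma hasSum_sq {ι : Type} (x : Seq2 ι) : HasSum (fun n => x n ^ 2) (‖x‖ ^ 2) := by
  rw [← real_inner_self_eq_norm_sq]
  have := lp.hasSum_inner (𝕜 := ℝ) x x
  simpa [sq] using this

lemma memℓp_of_summable_sq {ι : Type} {x : ι → ℝ} (h : Summable fun n => x n ^ 2) :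
    Memℓp x 2 := by
  refine memℓp_gen ?_
  simpa using h

/-- The element of `ℓ²` with given square summable coordinates. -/
def seqMk {ι : Type} (x : ι → ℝ) (h : Summable fun n => x n ^ 2) : Seq2 ι :=
  ⟨x, memℓp_of_summable_sq h⟩

lemma seqMk_apply {ι : Type} (x : ι → ℝ) (h : Summable fun n => x n ^ 2) (n : ι) :
    seqMk x h n = x n := rfl

lemma summable_diag {ι : Type} {d : ι → ℝ} {K : ℝ} (hd : ∀ n, |d n| ≤ K) (x : Seq2 ι) :
    Summable fun n => (d n * x n) ^ 2 := by
  refine Summable.of_nonneg_of_le (fun _ => sq_nonneg _) (fun n => ?_)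
    ((hasSum_sq x).summable.mul_left (K ^ 2))
  rw [mul_pow]
  exact mul_le_mul_of_nonneg_right (sq_le_sq' (abs_le.1 (hd n)).1 (abs_le.1 (hd n)).2)
    (sq_nonneg _)

/-- The diagonal operator on `ℓ²`. -/
def diagL {ι : Type} (d : ι → ℝ) (K : ℝ) (hd : ∀ n, |d n| ≤ K) : Seq2 ι →L[ℝ] Seq2 ι :=
  LinearMap.mkContinuous
    { toFun := fun x => seqMk (fun n => d n * x n) (summable_diag hd x)
      map_add' := fun x y => by
        apply lp.ext; ext n
        simp [seqMk_apply, mul_add]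
      map_smul' := fun c x => by
        apply lp.ext; ext n
        simp [seqMk_apply, mul_left_comm] } |K| (fun x => by
      refine abs_le_of_sq_le_sq' ?_ (by positivity) |>.2
      rw [mul_pow, sq_abs]
      refine hasSum_le (fun n => ?_) (hasSum_sq (seqMk (fun n => d n * x n) (summable_diag hd x)))
        ((hasSum_sq x).mul_left (K ^ 2))
      rw [seqMk_apply, mul_pow]
      exact mul_le_mul_of_nonneg_right (sq_le_sq' (abs_le.1 (hd n)).1 (abs_le.1 (hd n)).2)
        (sq_nonneg _))

lemma diagL_apply {ι : Type} (d : ι → ℝ) (K : ℝ) (hd : ∀ n, |d n| ≤ K) (x : Seq2 ι) (n : ι) :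
    diagL d K hd x n = d n * x n := rfl

/-- The range contains all finitely supported sequences. -/
lemma denseRange_diagL {ι : Type} (d : ι → ℝ) (K : ℝ) (hd : ∀ n, |d n| ≤ K) (h0 : ∀ n, d n ≠ 0) :
    DenseRange (diagL d K hd) := by
  classical
  intro x
  have h := lp.hasSum_single (E := fun _ : ι => ℝ) (p := 2) (by simp) x
  refine mem_closure_of_tendsto h (Filter.Eventually.of_forall fun s => ?_)
  change _ ∈ LinearMap.range (diagL d K hd).toLinearMap
  refine Submodule.sum_mem _ fun n _ => ⟨lp.single 2 n ((d n)⁻¹ * x n), ?_⟩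
  apply lp.ext
  ext i
  rw [ContinuousLinearMap.coe_coe, diagL_apply]
  by_cases hi : i = n
  · subst hi
    simp [h0 i]
  · simp [hi]

/-! ### Isomorphisms -/

/-- A bijective operator with a lower bound as an equivalence. -/
def equivOfBound {X Y : Type} [NormedAddCommGroup X] [NormedSpace ℝ X]
    [CompleteSpace X] [NormedAddCommGroup Y] [NormedSpace ℝ Y] [CompleteSpace Y] (T : X →L[ℝ] Y)
    (h : ∃ C : ℝ, ∀ x, ‖x‖ ≤ C * ‖T x‖) (hs : Function.Surjective T) : X ≃L[ℝ] Y :=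
  ContinuousLinearEquiv.ofBijective T (by
    obtain ⟨C, h⟩ := h
    refine LinearMap.ker_eq_bot'.2 fun x hx => ?_
    have h1 := h x
    rw [show T x = 0 from hx, norm_zero, mul_zero] at h1
    exact norm_le_zero_iff.1 h1) (LinearMap.range_eq_top.2 hs)

/-- The elliptic operator as an isomorphism. -/
def ellE {ℓ : ℝ} (hℓ : 0 < ℓ) {M : ℕ} (q : Coefs ℓ M) {m : ℕ} (hm : m + 4 ≤ M) :
    Hsp ℓ (m + 4) ≃L[ℝ] Hsp ℓ m :=
  equivOfBound (ellH q hm) (by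
    obtain ⟨C, -, h⟩ := norm_le_ellH hℓ hm q.c_pos (K := q.K)
    exact ⟨C, h q rfl rfl⟩) (surjective_ellH hℓ q hm)

/-- Multiplication by a positive function as an isomorphism. -/
def mulE {ℓ : ℝ} (hℓ : 0 < ℓ) {m : ℕ} (u : Cm m) (hu : ∃ K c, 0 < c ∧ Coef ℓ K c m u) :
    Hsp ℓ m ≃L[ℝ] Hsp ℓ m :=
  equivOfBound (mulH ℓ u) (by
    obtain ⟨K, c, hc, hu⟩ := hu
    obtain ⟨C, -, h⟩ := norm_le_mulH hℓ (m := m) (K := K) hc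
    exact ⟨C, h u hu⟩) (by
    obtain ⟨K, c, hc, hu⟩ := hu
    exact surjective_mulH hℓ hc u hu)

/-- `ℋ⁰` is the weighted `L²` space. -/
def baseE {ℓ : ℝ} (hℓ : 0 < ℓ) : Hsp ℓ 0 ≃L[ℝ] L2w ℓ :=
  equivOfBound (toL2wL ℓ 0) ⟨1, fun w => by rw [norm_toL2wL_zero, one_mul]⟩
    (surjective_of_bound _ zero_le_one (fun w => by rw [norm_toL2wL_zero, one_mul])
      ((denseRange_polyCls hℓ).mono (by
        rintro _ ⟨p, rfl⟩
        exact ⟨polyJet ℓ 0 p, toL2wL_polyJet p⟩)))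

lemma baseE_apply {ℓ : ℝ} (hℓ : 0 < ℓ) (w : Hsp ℓ 0) : baseE hℓ w = toL2w w := rfl

/-! ### Symmetry and coercivity of the operators on the weighted spaces. -/

lemma inner_jet_zero {ℓ : ℝ} (hℓ : 0 < ℓ) (f g : Cm 0) :
    inner ℝ (jet ℓ 0 f) (jet ℓ 0 g) = ip ℓ 2 f g := by
  have h1 : ∀ x y : Hsp ℓ 0, inner ℝ x y = inner ℝ (toL2wL ℓ 0 x) (toL2wL ℓ 0 y) := by
    intro x y
    rw [Submodule.coe_inner, PiLp.inner_apply]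
    simp [toL2wL_apply, toL2w]
  rw [h1, toL2wL_jet, toL2wL_jet, inner_cls hℓ]

lemma mulH_symm {ℓ : ℝ} (hℓ : 0 < ℓ) (u : Cm 0) (x y : Hsp ℓ 0) :
    inner ℝ (mulH ℓ u x) y = inner ℝ x (mulH ℓ u y) := by
  refine (denseRange_jet hℓ 0).induction_on₂ (p := fun x y =>
    inner ℝ (mulH ℓ u x) y = inner ℝ x (mulH ℓ u y)) (isClosed_eq ?_ ?_) (fun f g => ?_) x y
  · exact ((mulH ℓ u).continuous.comp continuous_fst).inner continuous_snd
  · exact continuous_fst.inner ((mulH ℓ u).continuous.comp continuous_snd)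
  · rw [mulH_jet hℓ, mulH_jet hℓ, inner_jet_zero hℓ, inner_jet_zero hℓ, ip, ip]
    congr 1
    ext x
    simp only [mulC, LinearMap.coe_mk, AddHom.coe_mk]
    ring

lemma ellH_symm {ℓ : ℝ} (hℓ : 0 < ℓ) {M : ℕ} (q : Coefs ℓ M) (hm : 0 + 4 ≤ M)
    (x y : Hsp ℓ (0 + 4)) :
    inner ℝ (ellH q hm x) (resH ℓ (Nat.zero_le _) y) =
      inner ℝ (resH ℓ (Nat.zero_le _) x) (ellH q hm y) := by
  refine (denseRange_jet hℓ (0 + 4)).induction_on₂ (p := fun x y =>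
    inner ℝ (ellH q hm x) (resH ℓ (Nat.zero_le _) y) =
      inner ℝ (resH ℓ (Nat.zero_le _) x) (ellH q hm y)) (isClosed_eq ?_ ?_) (fun f g => ?_) x y
  · exact ((ellH q hm).continuous.comp continuous_fst).inner
      ((resH ℓ _).continuous.comp continuous_snd)
  · exact ((resH ℓ _).continuous.comp continuous_fst).inner
      ((ellH q hm).continuous.comp continuous_snd)
  · rw [ellH_jet hℓ, ellH_jet hℓ, resH_jet hℓ, resH_jet hℓ, inner_jet_zero hℓ, inner_jet_zero hℓ,
      ip_comm ℓ 2 (inclC (Nat.zero_le (0 + 4)) f : Cm 0)]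
    have hα : ContDiff ℝ 2 q.α := by exact_mod_cast (q.hα.natLE (m := 2) (by lia)).smooth
    have hβ : ContDiff ℝ 1 q.β := by exact_mod_cast (q.hβ.natLE (m := 1) (by lia)).smooth
    have hcd : ∀ f : Cm (0 + 4), ContDiff ℝ 4 (f : ℝ → ℝ) := fun f => by
      exact_mod_cast contDiff_Cm f
    have h1 := ip_ellOp (ℓ := ℓ) hα hβ q.hγ.smooth.continuous (hcd f) ((hcd g).of_le (by norm_num))
    have h2 := ip_ellOp (ℓ := ℓ) hα hβ q.hγ.smooth.continuous (hcd g) ((hcd f).of_le (by norm_num))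
    refine h1.trans (Eq.trans ?_ h2.symm)
    simp only [ip]
    congr 1
    · congr 1 <;> (congr 1; ext x; ring)
    · congr 1; ext x; ring

/-- The quadratic form is comparable to the squared norm of `ℋ²`; this later identifies `ℋ²` as the
form domain. -/
lemma energy_ellH {ℓ : ℝ} (hℓ : 0 < ℓ) {M : ℕ} (q : Coefs ℓ M) (hm : 0 + 4 ≤ M)
    (x : Hsp ℓ (0 + 4)) :
    q.c * ‖resH ℓ (show 2 ≤ 0 + 4 by lia) x‖ ^ 2 ≤
        inner ℝ (ellH q hm x) (resH ℓ (Nat.zero_le _) x) ∧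
      inner ℝ (ellH q hm x) (resH ℓ (Nat.zero_le _) x) ≤
        q.K * ‖resH ℓ (show 2 ≤ 0 + 4 by lia) x‖ ^ 2 := by
  have hc1 : Continuous fun x : Hsp ℓ (0 + 4) =>
      inner ℝ (ellH q hm x) (resH ℓ (Nat.zero_le (0 + 4)) x) :=
    (ellH q hm).continuous.inner (resH ℓ _).continuous
  have hc2 : ∀ K : ℝ, Continuous fun x : Hsp ℓ (0 + 4) =>
      K * ‖resH ℓ (show 2 ≤ 0 + 4 by lia) x‖ ^ 2 := fun K =>
    continuous_const.mul ((resH ℓ _).continuous.norm.pow 2)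
  refine (denseRange_jet hℓ (0 + 4)).induction_on (p := fun x =>
    q.c * ‖resH ℓ (show 2 ≤ 0 + 4 by lia) x‖ ^ 2 ≤
        inner ℝ (ellH q hm x) (resH ℓ (Nat.zero_le _) x) ∧
      inner ℝ (ellH q hm x) (resH ℓ (Nat.zero_le _) x) ≤
        q.K * ‖resH ℓ (show 2 ≤ 0 + 4 by lia) x‖ ^ 2) x
    ((isClosed_le (hc2 _) hc1).inter (isClosed_le hc1 (hc2 _))) fun f => ?_
  rw [ellH_jet hℓ, resH_jet hℓ, resH_jet hℓ, inner_jet_zero hℓ, norm_sq_jet hℓ]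
  have hα : ContDiff ℝ 2 q.α := by exact_mod_cast (q.hα.natLE (m := 2) (by lia)).smooth
  have hβ : ContDiff ℝ 1 q.β := by exact_mod_cast (q.hβ.natLE (m := 1) (by lia)).smooth
  have hcd : ContDiff ℝ 4 (f : ℝ → ℝ) := by exact_mod_cast contDiff_Cm f
  exact ⟨energy_lower hℓ hα hβ q.hγ.smooth.continuous q.hα.lower q.hβ.lower q.hγ.lower hcd,
    energy_upper hℓ hα hβ q.hγ.smooth.continuous q.hα.bound.bound q.hβ.bound.bound
      q.hγ.bound.bound hcd⟩

/-- An element of the closure is a tuple, so it must be shown that its zeroth component determines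
the others. If that component vanishes, symmetry gives `⟨A x, p⟩ = ⟨x, A p⟩ = 0` for all polynomials
`p`, so `A x = 0` and hence `x = 0`. -/
lemma toL2wL_injective {ℓ : ℝ} (hℓ : 0 < ℓ) {M : ℕ} (q : Coefs ℓ M) (hm : 0 + 4 ≤ M)
    (x : Hsp ℓ (0 + 4)) (hx : resH ℓ (Nat.zero_le _) x = 0) : x = 0 := by
  have h1 : ellH q hm x = 0 := by
    refine (denseRange_polyJet hℓ 0).eq_zero_of_inner_left ℝ fun p => ?_
    have h2 := ellH_symm hℓ q hm x (polyJet ℓ (0 + 4) p)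
    rw [hx, inner_zero_left] at h2
    rw [← h2]
    congr 1
    rw [polyJet, polyJet, LinearMap.comp_apply, LinearMap.comp_apply, resH_jet hℓ]
    rfl
  exact (ellE hℓ q hm).injective (by rw [map_zero]; exact h1)

/-! ### Spectral coordinates for the scale of weighted spaces. -/

/-- Diagonalisation of the elliptic operator: `ν n ^ 2` are the eigenvalues, `B` are the
coordinates, and `ℋ^(2i)` is described by the weights `ν n ^ i`. -/
structure Diagonalization (ℓ : ℝ) (N : ℕ) (P : Hsp ℓ 4 → L2w ℓ → Prop) where
  ι : Type
  countable : Countable ι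
  ν : ι → ℝ
  ν₀ : ℝ
  ν₀_pos : 0 < ν₀
  le_ν : ∀ n, ν₀ ≤ ν n
  B : L2w ℓ ≃L[ℝ] Seq2 ι
  -- The order `m` is a separate variable tied to `2 * i` by an equation, so that orders such as `2
  -- * k' + 2` can be used without casts.
  E : ∀ i m : ℕ, m = 2 * i → m ≤ N → (Hsp ℓ m ≃L[ℝ] Seq2 ι)
  E_apply : ∀ i m hi hm w n, E i m hi hm w n = ν n ^ i * B (toL2w w) n
  eq_iff : ∀ w f, P w f ↔ ∀ n, B f n = ν n ^ 2 * B (toL2w w) n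

lemma mulC_sqrt {ℓ : ℝ} (hℓ : 0 < ℓ) {u r : Cm 0} (h : ∀ x ∈ Icc (-ℓ) ℓ,
    (r : ℝ → ℝ) x * (r : ℝ → ℝ) x = (u : ℝ → ℝ) x) (x : Hsp ℓ 0) :
    mulH ℓ r (mulH ℓ r x) = mulH ℓ u x := by
  have : (mulH ℓ r).comp (mulH ℓ r) = mulH ℓ u := by
    refine clm_ext_jet hℓ fun f => ?_
    rw [ContinuousLinearMap.comp_apply, mulH_jet hℓ, mulH_jet hℓ, mulH_jet hℓ, ← sub_eq_zero,
      ← map_sub, ← norm_eq_zero, ← sq_eq_zero_iff, norm_sq_jet hℓ, sob]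
    refine (ip_congr hℓ (f' := fun _ => 0) (g' := fun _ => 0) ?_ ?_).trans (by simp [ip])
    all_goals
      intro x hx
      simp only [mulC, LinearMap.coe_mk, AddHom.coe_mk, Submodule.coe_sub, Pi.sub_apply, ← h x hx]
      ring
  exact congrArg (fun T : Hsp ℓ 0 →L[ℝ] Hsp ℓ 0 => T x) this

/-- Continuity of the root suffices: it serves only as a symmetric operator on `ℋ⁰` that moves the
weight `u` into the scalar product. -/
lemma exists_sqrt {ℓ K c : ℝ} (hc : 0 < c) (u : Cm 0) (hu : Coef ℓ K c 0 u) :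
    ∃ r : Cm 0, (∃ K c, 0 < c ∧ Coef ℓ K c 0 (r : ℝ → ℝ)) ∧ ∀ x ∈ Icc (-ℓ) ℓ,
      (r : ℝ → ℝ) x * (r : ℝ → ℝ) x = (u : ℝ → ℝ) x := by
  have hr : ContDiff ℝ (0 : ℕ) fun x => √((u : ℝ → ℝ) x) :=
    contDiff_zero.2 (Real.continuous_sqrt.comp hu.smooth.continuous)
  obtain ⟨K', hK'⟩ := exists_CBound ℓ hr
  refine ⟨⟨_, hr⟩, ⟨K', √c, Real.sqrt_pos.2 hc, hr, hK', fun x hx =>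
    Real.sqrt_le_sqrt (hu.lower x hx)⟩, fun x hx =>
    Real.mul_self_sqrt (hc.le.trans (hu.lower x hx))⟩

/-- The operator `u⁻¹ ellH` as an isomorphism. -/
def linE {ℓ : ℝ} (hℓ : 0 < ℓ) {M : ℕ} (q : Coefs ℓ M) (u : Cm M)
    (hu : ∃ K c, 0 < c ∧ Coef ℓ K c M u) {m : ℕ} (hm : m + 4 ≤ M) :
    Hsp ℓ (m + 4) ≃L[ℝ] Hsp ℓ m :=
  (ellE hℓ q hm).trans (mulE hℓ (inclC (show m ≤ M by lia) u) (by
    obtain ⟨K, c, hc, hu⟩ := hu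
    exact ⟨K, c, hc, hu.natLE (by lia)⟩)).symm

lemma mulH_linE {ℓ : ℝ} (hℓ : 0 < ℓ) {M : ℕ} (q : Coefs ℓ M) (u : Cm M)
    (hu : ∃ K c, 0 < c ∧ Coef ℓ K c M u) {m : ℕ} (hm : m + 4 ≤ M) (w : Hsp ℓ (m + 4)) :
    mulH ℓ (inclC (show m ≤ M by lia) u) (linE hℓ q u hu hm w) = ellH q hm w :=
  ContinuousLinearEquiv.apply_symm_apply (mulE hℓ (inclC (show m ≤ M by lia) u) (by
    obtain ⟨K, c, hc, hu⟩ := hu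
    exact ⟨K, c, hc, hu.natLE (by lia)⟩)) _

lemma mulH_injective {ℓ : ℝ} (hℓ : 0 < ℓ) {m : ℕ} (u : Cm m)
    (hu : ∃ K c, 0 < c ∧ Coef ℓ K c m u) : Function.Injective (mulH ℓ u) :=
  (mulE hℓ u hu).injective

lemma resH_linE {ℓ : ℝ} (hℓ : 0 < ℓ) {M : ℕ} (q : Coefs ℓ M) (u : Cm M)
    (hu : ∃ K c, 0 < c ∧ Coef ℓ K c M u) {m : ℕ} (hm : m + 4 ≤ M) (w : Hsp ℓ (m + 4)) :
    resH ℓ (Nat.zero_le m) (linE hℓ q u hu hm w) =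
      linE hℓ q u hu (show 0 + 4 ≤ M by lia) (resH ℓ (show 0 + 4 ≤ m + 4 by lia) w) := by
  refine mulH_injective hℓ (inclC (Nat.zero_le M) u) (by
    obtain ⟨K, c, hc, hu⟩ := hu
    exact ⟨K, c, hc, hu.natLE (by lia)⟩) ?_
  rw [mulH_linE, ← resH_ellH hℓ q hm (Nat.zero_le m) w, ← mulH_linE hℓ q u hu hm,
    resH_mulH hℓ]
  rfl

/-- Simultaneous diagonalisation of the scalar product and of a symmetric positive operator with
compact inverse. -/
lemma exists_diagonal_coordinates {H W : Type} [NormedAddCommGroup H] [InnerProductSpace ℝ H]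
    [CompleteSpace H] [NormedAddCommGroup W] [NormedSpace ℝ W] (R : H ≃L[ℝ] H) (A : W ≃L[ℝ] H)
    (J : W →L[ℝ] H) (hR : ∀ x y, inner ℝ (R x) y = inner ℝ x (R y))
    (hA : ∀ x y, inner ℝ (A x) (J y) = inner ℝ (J x) (A y)) (hpos : ∀ x, 0 ≤ inner ℝ (A x) (J x))
    (hJ : IsCompactOperator J) (hJi : ∀ x, J x = 0 → x = 0) (D : ℕ → H)
    (hD : ∀ x, (∀ n, inner ℝ x (D n) = 0) → x = 0) :
    ∃ (ι : Type) (_ : Countable ι) (ν : ι → ℝ) (ν₀ : ℝ) (_ : 0 < ν₀) (_ : ∀ n, ν₀ ≤ ν n)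
      (B₀ : H ≃L[ℝ] Seq2 ι),
      (∀ x w n, R (R x) = A w → B₀ x n = ν n ^ 2 * B₀ (J w) n) ∧
      ∀ x w, R (R x) = A w → HasSum (fun n => (ν n * B₀ (J w) n) ^ 2) (inner ℝ (A w) (J w)) := by
  -- Conjugation of the inverse: `T = R J A⁻¹ R` is symmetric, unlike `J A⁻¹ R²`, which is the
  -- inverse of the operator `R⁻² A` to be diagonalised.
  set T : H →L[ℝ] H := (R : H →L[ℝ] H).comp (J.comp ((A.symm : H →L[ℝ] W).comp (R : H →L[ℝ] H)))
    with hT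
  have hTa : ∀ x, T x = R (J (A.symm (R x))) := fun x => rfl
  have hTi : ∀ x y, inner ℝ (T x) y = inner ℝ (J (A.symm (R x))) (A (A.symm (R y))) := by
    intro x y
    rw [A.apply_symm_apply, hTa, hR]
  have hsym : T.IsSymmetric := by
    intro x y
    change inner ℝ (T x) y = inner ℝ x (T y)
    rw [hTi, real_inner_comm (T y), hTi, ← hA, real_inner_comm]
  have hcomp : IsCompactOperator T :=
    (hJ.comp_clm ((A.symm : H →L[ℝ] W).comp (R : H →L[ℝ] H))).clm_comp (R : H →L[ℝ] H)
  have hinj : ∀ x, T x = 0 → x = 0 := by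
    intro x hx
    rw [hTa] at hx
    exact R.map_eq_zero_iff.1 (A.symm.map_eq_zero_iff.1 (hJi _ (R.map_eq_zero_iff.1 hx)))
  obtain ⟨ι, hι, b, τ, hb⟩ := exists_eigenbasis T hcomp hsym D hD
  have hbn : ∀ n, ‖b n‖ = 1 := b.orthonormal.norm_eq_one
  have hτ : ∀ n, 0 < τ n := by
    intro n
    have h1 : 0 ≤ inner ℝ (T (b n)) (b n) := by
      rw [hTi, ← hA]
      exact hpos _
    rw [hb, real_inner_smul_left, real_inner_self_eq_norm_sq, hbn, one_pow, mul_one] at h1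
    refine lt_of_le_of_ne h1 fun h2 => ?_
    have h3 : b n = 0 := hinj _ (by rw [hb, ← h2, zero_smul])
    have h4 := hbn n
    rw [h3, norm_zero] at h4
    exact zero_ne_one h4
  have hτb : ∀ n, τ n ≤ ‖T‖ := by
    intro n
    have h1 := T.le_opNorm (b n)
    rwa [hb, norm_smul, hbn, mul_one, mul_one, Real.norm_eq_abs, abs_of_pos (hτ n)] at h1
  have hsq : ∀ n, ((√(τ n))⁻¹) ^ 2 = (τ n)⁻¹ := fun n => by
    rw [inv_pow, Real.sq_sqrt (hτ n).le]
  -- The coordinates of `R x` in the eigenbasis, that is, those of `x` for the scalar product `⟨R x,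
  -- R y⟩`. With `R` the multiplication by `√u`, this is the scalar product with weight `U`.
  set B₀ : H ≃L[ℝ] Seq2 ι := R.trans b.repr.toContinuousLinearEquiv with hB₀
  have hB : ∀ x n, B₀ x n = inner ℝ (b n) (R x) := fun x n => b.repr_apply_apply _ _
  -- If `R² x = A w`, then `T (R x) = R J w`. Comparing coordinates, `τ` times that of `x` is that
  -- of `J w`, so `ν = τ^(-1/2)`.
  have key : ∀ x w n, R (R x) = A w → B₀ x n = ((√(τ n))⁻¹) ^ 2 * B₀ (J w) n := by
    intro x w n hxw
    have h1 : T (R x) = R (J w) := by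
      rw [hTa, hxw, A.symm_apply_apply]
    have h2 : inner ℝ (b n) (T (R x)) = inner ℝ (T (b n)) (R x) := (hsym _ _).symm
    rw [hsq, hB, hB, ← h1, h2, hb, real_inner_smul_left, inv_mul_cancel_left₀ (hτ n).ne']
  -- Eigenvalues of `T` are at most `‖T‖`, which bounds `ν` from below; adding `1` keeps the bound
  -- positive even if `T = 0`.
  refine ⟨ι, hι, fun n => (√(τ n))⁻¹, (√(‖T‖ + 1))⁻¹, by positivity, fun n => ?_, B₀, key,
    fun x w hxw => ?_⟩
  · refine inv_anti₀ (Real.sqrt_pos.2 (hτ n)) (Real.sqrt_le_sqrt ?_)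
    linarith [hτb n]
  -- Parseval for `⟨A w, J w⟩ = ⟨R x, R J w⟩`, whose factors have coordinates `ν² B₀ (J w)` and `B₀
  -- (J w)`.
  · have h1 := b.hasSum_inner_mul_inner (R x) (R (J w))
    rw [← hR, hxw] at h1
    have h2 : (fun n => inner ℝ (R x) (b n) * inner ℝ (b n) (R (J w))) =
        fun n => ((√(τ n))⁻¹ * B₀ (J w) n) ^ 2 := by
      ext n
      rw [real_inner_comm, ← hB, ← hB, key x w n hxw]
      ring
    rwa [h2] at h1

/-- The eigenbasis of the elliptic operator and its basic properties. -/
lemma exists_coordinates {ℓ : ℝ} (hℓ : 0 < ℓ) {M : ℕ} (q : Coefs ℓ M) (u : Cm M)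
    (hu : ∃ K c, 0 < c ∧ Coef ℓ K c M u) (hM : 0 + 4 ≤ M) :
    ∃ (ι : Type) (_ : Countable ι) (ν : ι → ℝ) (ν₀ : ℝ) (_ : 0 < ν₀) (_ : ∀ n, ν₀ ≤ ν n)
      (B₀ : Hsp ℓ 0 ≃L[ℝ] Seq2 ι),
      (∀ w n, B₀ (linE hℓ q u hu hM w) n = ν n ^ 2 * B₀ (resH ℓ (Nat.zero_le _) w) n) ∧
      ∀ w, HasSum (fun n => (ν n * B₀ (resH ℓ (Nat.zero_le _) w) n) ^ 2)
        (inner ℝ (ellH q hM w) (resH ℓ (Nat.zero_le _) w)) := by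
  obtain ⟨K, c, hc, hu'⟩ := id hu
  obtain ⟨r, hr, hru⟩ := exists_sqrt (ℓ := ℓ) hc (inclC (Nat.zero_le M) u) (hu'.natLE (Nat.zero_le _))
  have hcomp : IsCompactOperator (resH ℓ (Nat.zero_le (0 + 4)) : Hsp ℓ (0 + 4) →L[ℝ] Hsp ℓ 0) := by
    have h2 : (resH ℓ (Nat.zero_le (0 + 4)) : Hsp ℓ (0 + 4) →L[ℝ] Hsp ℓ 0) =
        ((baseE hℓ).symm : L2w ℓ →L[ℝ] Hsp ℓ 0).comp (toL2wL ℓ (0 + 4)) := by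
      ext w : 1
      rw [ContinuousLinearMap.comp_apply, ← toL2wL_resH hℓ (Nat.zero_le (0 + 4)) w]
      exact ((baseE hℓ).symm_apply_apply _).symm
    rw [h2]
    exact (isCompactOperator_toL2wL hℓ 3).clm_comp ((baseE hℓ).symm : L2w ℓ →L[ℝ] Hsp ℓ 0)
  obtain ⟨ι, hι, ν, ν₀, h0, h1, B₀, h2, h3⟩ := exists_diagonal_coordinates (mulE hℓ r hr)
    (ellE hℓ q hM) (resH ℓ (Nat.zero_le (0 + 4))) (mulH_symm hℓ r) (ellH_symm hℓ q hM)
    (fun x => (mul_nonneg q.c_pos.le (sq_nonneg _)).trans (energy_ellH hℓ q hM x).1)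
    hcomp (toL2wL_injective hℓ q hM) (fun n => polyJet ℓ 0 (Polynomial.X ^ n)) (fun x hx => by
      refine (denseRange_polyJet hℓ 0).eq_zero_of_inner_left ℝ fun p => ?_
      have h4 := span_X_pow_eq_top
        (P := LinearMap.ker (((innerSL ℝ x : Hsp ℓ 0 →L[ℝ] ℝ) : Hsp ℓ 0 →ₗ[ℝ] ℝ) ∘ₗ polyJet ℓ 0))
        (fun n => hx n) p
      exact h4)
  have hRR : ∀ w, mulE hℓ r hr (mulE hℓ r hr (linE hℓ q u hu hM w)) = ellE hℓ q hM w := fun w =>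
    (mulC_sqrt hℓ hru _).trans (mulH_linE hℓ q u hu hM w)
  exact ⟨ι, hι, ν, ν₀, h0, h1, B₀, fun w n => h2 _ _ n (hRR w), fun w => h3 _ _ (hRR w)⟩

/-- Identification of the form domain. On the dense image of `W` the form is both the `ℓ²` norm of
`ν B₀` and comparable to the norm of `X`, so `ν B₀` extends to an isomorphism from `X` onto `ℓ²`. -/
lemma exists_energy_equiv {H W X : Type} [NormedAddCommGroup H] [InnerProductSpace ℝ H]
    [CompleteSpace H] [NormedAddCommGroup W] [NormedSpace ℝ W]
    [NormedAddCommGroup X] [NormedSpace ℝ X] [CompleteSpace X] {ι : Type} (ν : ι → ℝ) {ν₀ : ℝ}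
    (h0 : 0 < ν₀) (hν : ∀ n, ν₀ ≤ ν n) (B₀ : H ≃L[ℝ] Seq2 ι) (A : W ≃L[ℝ] H) (J : W →L[ℝ] X)
    (J₀ : X →L[ℝ] H) (hJ : DenseRange J) (Q : W → ℝ) {c K : ℝ} (hc : 0 < c)
    (h1 : ∀ w n, B₀ (A w) n = ν n ^ 2 * B₀ (J₀ (J w)) n)
    (h2 : ∀ w, HasSum (fun n => (ν n * B₀ (J₀ (J w)) n) ^ 2) (Q w))
    (h3 : ∀ w, c * ‖J w‖ ^ 2 ≤ Q w ∧ Q w ≤ K * ‖J w‖ ^ 2) :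
    ∃ E : X ≃L[ℝ] Seq2 ι, ∀ x n, E x n = ν n * B₀ (J₀ x) n := by
  have hpos : ∀ n, 0 < ν n := fun n => h0.trans_le (hν n)
  have hd : ∀ n, |(ν n)⁻¹| ≤ ν₀⁻¹ := fun n => by
    rw [abs_of_pos (inv_pos.2 (hpos n))]
    exact inv_anti₀ h0 (hν n)
  -- The sequence `ν B₀ (J₀ (J w))` written as `ν⁻¹ B₀ (A w)`: a bounded diagonal operator, so
  -- square summability is automatic.
  set T : W →L[ℝ] Seq2 ι := (diagL (fun n => (ν n)⁻¹) _ hd).comp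
    ((B₀ : H →L[ℝ] Seq2 ι).comp (A : W →L[ℝ] H)) with hT
  have hTn : ∀ w n, T w n = ν n * B₀ (J₀ (J w)) n := by
    intro w n
    change diagL (fun n => (ν n)⁻¹) _ hd (B₀ (A w)) n = _
    rw [diagL_apply, h1]
    have := (hpos n).ne'
    field_simp
  have hTQ : ∀ w, ‖T w‖ ^ 2 = Q w := by
    intro w
    refine (hasSum_sq (T w)).unique ?_
    simp only [hTn]
    exact h2 w
  have hTb : ∀ w, ‖T w‖ ≤ √K * ‖J w‖ := by
    intro w
    have h4 := Real.sqrt_le_sqrt ((hTQ w).le.trans (h3 w).2)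
    rwa [Real.sqrt_sq (norm_nonneg _), Real.sqrt_mul' _ (sq_nonneg _),
      Real.sqrt_sq (norm_nonneg _)] at h4
  set S : X →L[ℝ] Seq2 ι := T.toLinearMap.extendOfNorm J.toLinearMap with hS
  have hSJ : ∀ w, S (J w) = T w := fun w =>
    LinearMap.extendOfNorm_eq hJ ⟨√K, hTb⟩ w
  have hSn : ∀ x n, S x n = ν n * B₀ (J₀ x) n := by
    intro x n
    have hcn : Continuous fun y : Seq2 ι => y n :=
      (lp.lipschitzWith_one_eval (E := fun _ : ι => ℝ) 2 n).continuous
    refine hJ.induction_on (p := fun x => S x n = ν n * B₀ (J₀ x) n) x (isClosed_eq ?_ ?_)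
      fun w => ?_
    · exact hcn.comp S.continuous
    · exact continuous_const.mul (hcn.comp (B₀.continuous.comp J₀.continuous))
    · rw [hSJ, hTn]
  have hSb : ∀ x, ‖x‖ ≤ (√c)⁻¹ * ‖S x‖ := by
    intro x
    refine hJ.induction_on (p := fun x => ‖x‖ ≤ (√c)⁻¹ * ‖S x‖) x (isClosed_le ?_ ?_) fun w => ?_
    · exact continuous_norm
    · exact continuous_const.mul S.continuous.norm
    · have h4 := Real.sqrt_le_sqrt ((h3 w).1.trans (hTQ w).ge)
      rw [Real.sqrt_sq (norm_nonneg _), Real.sqrt_mul' _ (sq_nonneg _),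
        Real.sqrt_sq (norm_nonneg _)] at h4
      rw [hSJ, inv_mul_eq_div, le_div_iff₀ (Real.sqrt_pos.2 hc), mul_comm]
      exact h4
  -- Since `B₀` and `A` are onto, the range contains that of the diagonal operator `ν⁻¹`.
  have hdense : DenseRange S := by
    refine (denseRange_diagL (fun n => (ν n)⁻¹) _ hd fun n => (inv_pos.2 (hpos n)).ne').mono ?_
    rintro _ ⟨y, rfl⟩
    refine ⟨J (A.symm (B₀.symm y)), ?_⟩
    rw [hSJ]
    change diagL (fun n => (ν n)⁻¹) _ hd (B₀ (A (A.symm (B₀.symm y)))) = _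
    rw [A.apply_symm_apply, B₀.apply_symm_apply]
  exact ⟨equivOfBound S ⟨_, hSb⟩ (surjective_of_bound S (by positivity) hSb hdense), hSn⟩

lemma toL2w_resH {ℓ : ℝ} (hℓ : 0 < ℓ) {m n : ℕ} (h : n ≤ m) (w : Hsp ℓ m) :
    toL2w (resH ℓ h w) = toL2w w :=
  toL2wL_resH hℓ h w

lemma baseE_resH {ℓ : ℝ} (hℓ : 0 < ℓ) {m : ℕ} (w : Hsp ℓ m) :
    (baseE hℓ).symm (toL2w w) = resH ℓ (Nat.zero_le m) w := by
  rw [← toL2w_resH hℓ (Nat.zero_le m) w, ← baseE_apply hℓ, ContinuousLinearEquiv.symm_apply_apply]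

lemma denseRange_resH {ℓ : ℝ} (hℓ : 0 < ℓ) {m n : ℕ} (h : n ≤ m) : DenseRange (resH ℓ h) :=
  (denseRange_polyJet hℓ n).mono (by
    rintro _ ⟨p, rfl⟩
    refine ⟨polyJet ℓ m p, ?_⟩
    rw [polyJet, polyJet, LinearMap.comp_apply, LinearMap.comp_apply, resH_jet hℓ]
    rfl)

lemma exists_base_coordinates {ℓ : ℝ} (hℓ : 0 < ℓ) {M : ℕ} (q : Coefs ℓ M) (u : Cm M)
    (hu : ∃ K c, 0 < c ∧ Coef ℓ K c M u) (hM : 0 + 4 ≤ M) :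
    ∃ (ι : Type) (_ : Countable ι) (ν : ι → ℝ) (ν₀ : ℝ) (_ : 0 < ν₀) (_ : ∀ n, ν₀ ≤ ν n)
      (B : L2w ℓ ≃L[ℝ] Seq2 ι),
      (∀ (w : Hsp ℓ (0 + 4)) f,
        mulH ℓ (inclC (Nat.zero_le M) u) ((baseE hℓ).symm f) = ellH q hM w ↔
          ∀ n, B f n = ν n ^ 2 * B (toL2w w) n) ∧
      (∀ (m : ℕ) (hm : m + 4 ≤ M) (w : Hsp ℓ (m + 4)) n,
        B (toL2w (linE hℓ q u hu hm w)) n = ν n ^ 2 * B (toL2w w) n) ∧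
      ∀ w : Hsp ℓ (0 + 4), HasSum (fun n => (ν n * B (toL2w w) n) ^ 2)
        (inner ℝ (ellH q hM w) (resH ℓ (Nat.zero_le _) w)) := by
  obtain ⟨ι, hι, ν, ν₀, h0, hν, B₀, h1, h2⟩ := exists_coordinates hℓ q u hu hM
  have hB : ∀ {m : ℕ} (w : Hsp ℓ m), ((baseE hℓ).symm.trans B₀) (toL2w w) =
      B₀ (resH ℓ (Nat.zero_le m) w) := by
    intro m w
    rw [ContinuousLinearEquiv.trans_apply, baseE_resH hℓ]
  refine ⟨ι, hι, ν, ν₀, h0, hν, (baseE hℓ).symm.trans B₀, fun w f => ?_, fun m hm w n => ?_,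
    fun w => ?_⟩
  · rw [← mulH_linE hℓ q u hu hM, (mulH_injective hℓ _ (by
      obtain ⟨K, c, hc, hu⟩ := hu
      exact ⟨K, c, hc, hu.natLE (by lia)⟩)).eq_iff, ← B₀.injective.eq_iff]
    constructor
    · intro h n
      rw [ContinuousLinearEquiv.trans_apply, h, h1, ← hB]
    · intro h
      apply lp.ext
      ext n
      rw [h1, ← hB]
      exact h n
  · rw [hB, resH_linE hℓ, h1, ← hB, toL2w_resH hℓ]
  · have h3 := h2 w
    rwa [← hB] at h3

lemma exists_trans_apply {W X : Type} [NormedAddCommGroup W] [NormedSpace ℝ W]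
    [NormedAddCommGroup X] [NormedSpace ℝ X] {ι : Type} (A : W ≃L[ℝ] X) (E : X ≃L[ℝ] Seq2 ι)
    {a : W → ι → ℝ} (h : ∀ w n, E (A w) n = a w n) :
    ∃ E' : W ≃L[ℝ] Seq2 ι, ∀ w n, E' w n = a w n :=
  ⟨A.trans E, h⟩

/-- Induction in steps of two, because `linE : ℋ^(m+4) ≃ ℋ^m` multiplies coordinates by `ν²`. The
two starting cases are `L²` for `i = 0` and the form domain for `i = 1`. -/
lemma exists_diagonalization {ℓ : ℝ} (hℓ : 0 < ℓ) {M : ℕ} (q : Coefs ℓ M) (u : Cm M)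
    (hu : ∃ K c, 0 < c ∧ Coef ℓ K c M u) (hM : 0 + 4 ≤ M) :
    Nonempty (Diagonalization ℓ M fun w f =>
      mulH ℓ (inclC (Nat.zero_le M) u) ((baseE hℓ).symm f) = ellH q hM w) := by
  obtain ⟨ι, hι, ν, ν₀, h0, hν, B, h1, h1', h2⟩ := exists_base_coordinates hℓ q u hu hM
  have hE : ∀ i m, m = 2 * i → m ≤ M → ∃ E : Hsp ℓ m ≃L[ℝ] Seq2 ι, ∀ w n,
      E w n = ν n ^ i * B (toL2w w) n := by
    intro i
    induction i using Nat.twoStepInduction with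
    | zero =>
      intro m hm _
      subst hm
      refine ⟨(baseE hℓ).trans B, fun w n => ?_⟩
      rw [pow_zero, one_mul]
      rfl
    | one =>
      intro m hm _
      have hm : m = 2 := hm
      subst hm
      obtain ⟨E, hE⟩ := exists_energy_equiv ν h0 hν ((baseE hℓ).trans B) (linE hℓ q u hu hM)
        (resH ℓ (show 2 ≤ 0 + 4 by lia)) (resH ℓ (Nat.zero_le 2)) (denseRange_resH hℓ _)
        (fun w => inner ℝ (ellH q hM w) (resH ℓ (Nat.zero_le _) w)) (K := q.K) q.c_pos
        (fun w n => by
          have h3 := h1' 0 hM w n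
          rw [ContinuousLinearEquiv.trans_apply, ContinuousLinearEquiv.trans_apply, baseE_apply,
            baseE_apply, toL2w_resH hℓ, toL2w_resH hℓ]
          exact h3) (fun w => by
          simp only [ContinuousLinearEquiv.trans_apply, baseE_apply, toL2w_resH hℓ]
          exact h2 w)
        (energy_ellH hℓ q hM)
      refine ⟨E, fun w n => ?_⟩
      have h3 := hE w n
      rw [ContinuousLinearEquiv.trans_apply, baseE_apply, toL2w_resH hℓ] at h3
      rw [pow_one, h3]
    | more i ih _ =>
      intro m hm hmM
      obtain ⟨m, rfl⟩ := Nat.exists_eq_add_of_le' (show 4 ≤ m by omega)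
      obtain ⟨E, hE⟩ := ih m (by omega) (by omega)
      refine exists_trans_apply (linE hℓ q u hu (show m + 4 ≤ M from hmM)) E fun w n => ?_
      have h3 := h1' m hmM w n
      have h4 := hE (linE hℓ q u hu hmM w) n
      rw [h3] at h4
      rw [h4]
      ring
  choose E hE using hE
  exact ⟨⟨ι, hι, ν, ν₀, h0, hν, B, E, hE, h1⟩⟩

/-! ### Division of smooth functions by the weight -/

/-- Differentiation under the integral. The factor `t^j` is present because every derivative in `x`
produces one more power of `t`. -/
lemma contDiff_average {m : ℕ} {h : ℝ → ℝ} (hh : ContDiff ℝ m h) (a : ℝ) (j : ℕ) :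
    ContDiff ℝ m fun x => ∫ t in (0 : ℝ)..1, t ^ j * h (a + t * (x - a)) := by
  induction m generalizing h j with
  | zero =>
    have hc := hh.continuous
    refine contDiff_zero.2 ?_
    apply intervalIntegral.continuous_parametric_intervalIntegral_of_continuous'
    fun_prop
  | succ m ih =>
    have h1 := contDiff_deriv hh
    have hd := contDiff_succ_differentiable hh
    have hc := hh.continuous
    have hc1 := h1.continuous
    have key : ∀ x, HasDerivAt (fun x => ∫ t in (0 : ℝ)..1, t ^ j * h (a + t * (x - a)))
        (∫ t in (0 : ℝ)..1, t ^ (j + 1) * deriv h (a + t * (x - a))) x := by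
      intro x
      obtain ⟨B, hB⟩ := (isCompact_Icc (a := a - (|x - a| + 1)) (b := a + (|x - a| + 1))).exists_bound_of_continuousOn
        (f := deriv h) hc1.continuousOn
      refine (intervalIntegral.hasDerivAt_integral_of_dominated_loc_of_deriv_le
        (F := fun x t => t ^ j * h (a + t * (x - a)))
        (F' := fun x t => t ^ (j + 1) * deriv h (a + t * (x - a))) (bound := fun _ => B)
        (Metric.ball_mem_nhds x one_pos) ?_ ?_ ?_ ?_ ?_ ?_).2
      · exact Filter.Eventually.of_forall fun y => by
          apply Continuous.aestronglyMeasurable; fun_prop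
      · apply Continuous.intervalIntegrable; fun_prop
      · apply Continuous.aestronglyMeasurable; fun_prop
      · refine Filter.Eventually.of_forall fun t ht y hy => ?_
        rw [uIoc_of_le zero_le_one] at ht
        rw [norm_mul, norm_pow, Real.norm_eq_abs, abs_of_pos ht.1]
        have hy' : |t * (y - a)| ≤ |x - a| + 1 := by
          rw [abs_mul, abs_of_pos ht.1]
          have h2 : |y - a| ≤ |x - a| + 1 := by
            have h3 := abs_sub_le y x a
            rw [Metric.mem_ball, Real.dist_eq] at hy
            linarith
          nlinarith [abs_nonneg (y - a), ht.1, ht.2]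
        have h4 := hB (a + t * (y - a)) ⟨by linarith [(abs_le.1 hy').1], by
          linarith [(abs_le.1 hy').2]⟩
        calc _ ≤ 1 * ‖deriv h (a + t * (y - a))‖ :=
              mul_le_mul_of_nonneg_right (pow_le_one₀ ht.1.le ht.2) (norm_nonneg _)
          _ ≤ B := by rwa [one_mul]
      · exact intervalIntegrable_const
      · refine Filter.Eventually.of_forall fun t ht y hy => ?_
        have h2 : HasDerivAt (fun y => a + t * (y - a)) t y := by
          simpa using (((hasDerivAt_id y).sub_const a).const_mul t).const_add a
        refine (((hd _).hasDerivAt.comp y h2).const_mul (t ^ j)).congr_deriv ?_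
        ring
    have h2 : ContDiff ℝ ((m : WithTop ℕ∞) + 1)
        fun x => ∫ t in (0 : ℝ)..1, t ^ j * h (a + t * (x - a)) := by
      refine contDiff_succ_iff_deriv.2 ⟨fun x => (key x).differentiableAt, by simp, ?_⟩
      rw [show deriv (fun x => ∫ t in (0 : ℝ)..1, t ^ j * h (a + t * (x - a))) =
        fun x => ∫ t in (0 : ℝ)..1, t ^ (j + 1) * deriv h (a + t * (x - a)) from
        funext fun x => (key x).deriv]
      exact ih h1 (j + 1)
    exact_mod_cast h2

/-- Hadamard's lemma: the quotient is the average of `f'` over the segment from `a` to `x`, which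
costs one derivative. -/
lemma exists_div_sub {m : ℕ} {f : ℝ → ℝ} (hf : ContDiff ℝ (m + 1 : ℕ) f) {a : ℝ} (ha : f a = 0) :
    ∃ g : ℝ → ℝ, ContDiff ℝ m g ∧ ∀ x, f x = (x - a) * g x := by
  refine ⟨_, contDiff_average (contDiff_deriv hf) a 0, fun x => ?_⟩
  have hd := contDiff_succ_differentiable hf
  have h1 : ∫ t in (0 : ℝ)..1, (x - a) * deriv f (a + t * (x - a)) =
      f (a + 1 * (x - a)) - f (a + 0 * (x - a)) := by
    refine intervalIntegral.integral_eq_sub_of_hasDerivAt (f := fun t => f (a + t * (x - a)))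
      (fun t _ => ?_) ?_
    · have h2 : HasDerivAt (fun t => a + t * (x - a)) (x - a) t := by
        simpa using ((hasDerivAt_id t).mul_const (x - a)).const_add a
      refine ((hd _).hasDerivAt.comp t h2).congr_deriv ?_
      ring
    · have hc1 := (contDiff_deriv hf).continuous
      apply Continuous.intervalIntegrable; fun_prop
  rw [intervalIntegral.integral_const_mul] at h1
  simp only [pow_zero, one_mul]
  rw [h1]
  simp [ha]

lemma exists_div_wt {ℓ : ℝ} (hℓ : 0 < ℓ) {m : ℕ} {f : ℝ → ℝ} (hf : ContDiff ℝ (m + 2 : ℕ) f)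
    (h1 : f (-ℓ) = 0) (h2 : f ℓ = 0) :
    ∃ g : ℝ → ℝ, ContDiff ℝ m g ∧ ∀ x, f x = (ℓ ^ 2 - x ^ 2) * g x := by
  obtain ⟨g, hg, hfg⟩ := exists_div_sub (m := m + 1) hf h1
  have h3 : g ℓ = 0 := by
    have h4 := hfg ℓ
    rw [h2] at h4
    rcases mul_eq_zero.1 h4.symm with h5 | h5
    · linarith
    · exact h5
  obtain ⟨k, hk, hgk⟩ := exists_div_sub (m := m) hg h3
  refine ⟨fun x => -k x, hk.neg, fun x => ?_⟩
  rw [hfg, hgk]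
  ring

lemma contDiff_primitive {m : ℕ} {g : ℝ → ℝ} (hg : ContDiff ℝ m g) (a : ℝ) :
    ContDiff ℝ (m + 1 : ℕ) fun x => ∫ y in a..x, g y := by
  have h : ContDiff ℝ ((m : WithTop ℕ∞) + 1) fun x => ∫ y in a..x, g y := by
    refine contDiff_succ_iff_deriv.2 ⟨fun x => ?_, by simp, ?_⟩
    · exact (hg.continuous.integral_hasStrictDerivAt a x).hasDerivAt.differentiableAt
    · rwa [show deriv (fun x => ∫ y in a..x, g y) = g from
        funext fun x => (hg.continuous.integral_hasStrictDerivAt a x).hasDerivAt.deriv]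
  exact_mod_cast h

lemma hasDerivAt_primitive {g : ℝ → ℝ} (hg : Continuous g) (a x : ℝ) :
    HasDerivAt (fun x => ∫ y in a..x, g y) (g x) x :=
  (hg.integral_hasStrictDerivAt a x).hasDerivAt

lemma eqOn_Icc_of_eqOn_Ioo {ℓ : ℝ} (hℓ : 0 < ℓ) {f g : ℝ → ℝ} (hf : Continuous f)
    (hg : Continuous g) (h : EqOn f g (Ioo (-ℓ) ℓ)) : EqOn f g (Icc (-ℓ) ℓ) := by
  rw [← closure_Ioo (by linarith : (-ℓ) ≠ ℓ)]
  exact h.closure hf hg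

/-- If `(ρ^(k+1) h)' = ρ^(k+1) w` then `h` vanishes at the end points. -/
lemma boundary_eq_zero {ℓ : ℝ} (hℓ : 0 < ℓ) {k : ℕ} {h w : ℝ → ℝ} (hh : ContDiff ℝ 1 h)
    (hw : Continuous w) (hd : ∀ x ∈ Ioo (-ℓ) ℓ,
      HasDerivAt (fun x => (ℓ ^ 2 - x ^ 2) ^ (k + 1) * h x) ((ℓ ^ 2 - x ^ 2) ^ (k + 1) * w x) x) :
    h (-ℓ) = 0 ∧ h ℓ = 0 := by
  have hc : Continuous (Dst ℓ k h) :=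
    (contDiff_Dst (m := 0) (by exact_mod_cast hh)).continuous
  -- Cancel `ρ^k` inside and pass to the end points by continuity. There the right-hand side
  -- vanishes, while `Dst` reduces to `-2(k+1) x h`.
  have h1 : EqOn (Dst ℓ k h) (fun x => (ℓ ^ 2 - x ^ 2) * w x) (Icc (-ℓ) ℓ) := by
    refine eqOn_Icc_of_eqOn_Ioo hℓ hc (by fun_prop) fun x hx => ?_
    have h2 := (hd x hx).unique (hasDerivAt_wt_pow_mul (hh.differentiable one_ne_zero) x)
    have h3 : 0 < ℓ ^ 2 - x ^ 2 := by nlinarith [hx.1, hx.2]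
    have h4 := pow_pos h3 k
    rw [pow_succ, mul_assoc] at h2
    exact (mul_left_cancel₀ h4.ne' h2).symm
  have h2 := h1 (left_mem_Icc.2 (by linarith))
  have h3 := h1 (right_mem_Icc.2 (by linarith))
  simp only [Dst, neg_sq, sub_self, zero_mul, zero_sub, neg_eq_zero, mul_eq_zero] at h2 h3
  constructor
  · rcases h2 with ((h | h) | h) | h <;> first | exact h | (exfalso; linarith)
  · rcases h3 with ((h | h) | h) | h <;> first | exact h | (exfalso; linarith)

/-! ### The profile -/

section Profile

variable {ℓ : ℝ} {U : ℝ → ℝ}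

lemma IsProfile.differentiable (h : IsProfile ℓ U) : Differentiable ℝ U :=
  h.contDiff.differentiable one_ne_zero

lemma IsProfile.continuous_deriv (h : IsProfile ℓ U) : Continuous (deriv U) :=
  h.contDiff.continuous_deriv le_rfl

lemma IsProfile.nonneg (h : IsProfile ℓ U) (x : ℝ) : 0 ≤ U x := by
  by_cases hx : x ∈ Ioo (-ℓ) ℓ
  · exact (h.pos x hx).le
  · exact (h.eq_zero x hx).ge

lemma IsProfile.deriv_eq_zero (h : IsProfile ℓ U) {x : ℝ} (hx : x ∉ Ioo (-ℓ) ℓ) :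
    deriv U x = 0 := by
  have : IsLocalMin U x := Filter.Eventually.of_forall fun y => by
    rw [h.eq_zero x hx]; exact h.nonneg y
  exact this.deriv_eq_zero

/-- The third order equation is the exact derivative of `U'' - U³/3 - x²/10`. -/
lemma IsProfile.exists_ode (h : IsProfile ℓ U) : ∃ c : ℝ, ∀ x ∈ Ioo (-ℓ) ℓ,
    HasDerivAt (deriv U) (U x ^ 3 / 3 + x ^ 2 / 10 + c) x := by
  have h1 : ContDiffOn ℝ 2 (deriv U) (Ioo (-ℓ) ℓ) :=
    h.contDiffOn.deriv_of_isOpen isOpen_Ioo (by norm_num)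
  have h2 : ContDiffOn ℝ 1 (deriv (deriv U)) (Ioo (-ℓ) ℓ) :=
    h1.deriv_of_isOpen isOpen_Ioo (by norm_num)
  have hd2 : ∀ x ∈ Ioo (-ℓ) ℓ, HasDerivAt (deriv U) (deriv (deriv U) x) x := fun x hx =>
    ((h1.differentiableOn (by norm_num)).differentiableAt (isOpen_Ioo.mem_nhds hx)).hasDerivAt
  have hd3 : ∀ x ∈ Ioo (-ℓ) ℓ,
      HasDerivAt (deriv (deriv U)) (U x ^ 2 * deriv U x + x / 5) x := fun x hx => by
    have h3 := h.ode x hx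
    rw [iteratedDeriv_succ, iteratedDeriv_succ, iteratedDeriv_one] at h3
    refine ((h2.differentiableOn one_ne_zero).differentiableAt
      (isOpen_Ioo.mem_nhds hx)).hasDerivAt.congr_deriv ?_
    linarith
  set f : ℝ → ℝ := fun x => deriv (deriv U) x - (U x ^ 3 / 3 + x ^ 2 / 10) with hf
  have hf' : ∀ x ∈ Ioo (-ℓ) ℓ, HasDerivAt f 0 x := fun x hx => by
    refine ((hd3 x hx).fun_sub ((((h.differentiable x).hasDerivAt.fun_pow 3).div_const 3).fun_add
      ((hasDerivAt_pow 2 x).div_const 10))).congr_deriv ?_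
    push_cast
    ring
  refine ⟨f 0, fun x hx => (hd2 x hx).congr_deriv ?_⟩
  have h0 : (0 : ℝ) ∈ Ioo (-ℓ) ℓ := by
    constructor <;> linarith [hx.1, hx.2]
  have h4 : f x = f 0 := isOpen_Ioo.is_const_of_deriv_eq_zero isPreconnected_Ioo
    (fun y hy => (hf' y hy).differentiableAt.differentiableWithinAt)
    (fun y hy => (hf' y hy).deriv) hx h0
  simp only [hf] at h4 ⊢
  linarith

/-- Bootstrap up to the boundary. `U` is the double primitive, from `-ℓ`, of `U³/3 + x²/10 + c`;
replacing `U` there by a smoother extension `Q` gives an extension one order smoother, defined on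
the whole line. -/
lemma IsProfile.exists_extension (h : IsProfile ℓ U) (m : ℕ) :
    ∃ Q : ℝ → ℝ, ContDiff ℝ (m + 1 : ℕ) Q ∧ EqOn Q U (Icc (-ℓ) ℓ) ∧
      EqOn (deriv Q) (deriv U) (Icc (-ℓ) ℓ) := by
  obtain ⟨c, hc⟩ := h.exists_ode
  induction m with
  | zero => exact ⟨U, by exact_mod_cast h.contDiff, fun _ _ => rfl, fun _ _ => rfl⟩
  | succ m ih =>
    obtain ⟨Q, hQ, hQU, -⟩ := ih
    have hQ := contDiff_pred hQ
    have hg : ContDiff ℝ m fun x => Q x ^ 3 / 3 + x ^ 2 / 10 + c := by fun_prop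
    have hgc := hg.continuous
    have hP := contDiff_primitive hg (-ℓ)
    have hR := contDiff_primitive hP (-ℓ)
    have hdR := hasDerivAt_primitive hP.continuous (-ℓ)
    set P : ℝ → ℝ := fun x => ∫ y in (-ℓ)..x, Q y ^ 3 / 3 + y ^ 2 / 10 + c with hPdef
    have hl : -ℓ ∉ Ioo (-ℓ) ℓ := fun hx => lt_irrefl _ hx.1
    have hPU : EqOn P (deriv U) (Icc (-ℓ) ℓ) := by
      intro x hx
      have h1 := intervalIntegral.integral_eq_sub_of_hasDerivAt_of_le (f := deriv U)
        (f' := fun x => Q x ^ 3 / 3 + x ^ 2 / 10 + c) hx.1 h.continuous_deriv.continuousOn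
        (fun y hy => by
          have hy' : y ∈ Ioo (-ℓ) ℓ := ⟨hy.1, hy.2.trans_le hx.2⟩
          simp only [hQU (Ioo_subset_Icc_self hy')]
          exact hc y hy') (hgc.intervalIntegrable _ _)
      rw [h.deriv_eq_zero hl, sub_zero] at h1
      exact h1
    refine ⟨fun x => ∫ y in (-ℓ)..x, P y, hR, fun x hx => ?_, fun x hx => ?_⟩
    · have h1 := intervalIntegral.integral_eq_sub_of_hasDerivAt_of_le (f := U)
        (f' := P) hx.1 h.contDiff.continuous.continuousOn
        (fun y hy => by
          have hy' : y ∈ Ioo (-ℓ) ℓ := ⟨hy.1, hy.2.trans_le hx.2⟩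
          rw [hPU (Ioo_subset_Icc_self hy')]
          exact (h.differentiable y).hasDerivAt) (hP.continuous.intervalIntegrable _ _)
      rw [h.eq_zero _ hl, sub_zero] at h1
      exact h1
    · rw [(hdR x).deriv]
      exact hPU hx

lemma deriv_eqOn_Ioo {f g : ℝ → ℝ} {a b : ℝ} (h : EqOn f g (Ioo a b)) :
    EqOn (deriv f) (deriv g) (Ioo a b) := fun _ hx =>
  (Filter.eventuallyEq_of_mem (isOpen_Ioo.mem_nhds hx) h).deriv_eq

/-- The second derivative of the profile is positive at the end points. -/
lemma IsProfile.boundary_pos (hℓ : 0 < ℓ) (h : IsProfile ℓ U) {c : ℝ}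
    (hc : ∀ x ∈ Ioo (-ℓ) ℓ, HasDerivAt (deriv U) (U x ^ 3 / 3 + x ^ 2 / 10 + c) x) :
    0 < ℓ ^ 2 / 10 + c := by
  by_contra! hcon
  obtain ⟨Q, hQ, hQU, hQ'⟩ := h.exists_extension 1
  have hl : -ℓ ∉ Ioo (-ℓ) ℓ := fun hx => lt_irrefl _ hx.1
  have hQl : Q (-ℓ) = 0 := by
    rw [hQU (left_mem_Icc.2 (by linarith)), h.eq_zero _ hl]
  obtain ⟨g, hg, hQg⟩ := exists_div_sub hQ hQl
  -- With `U = (x + ℓ) g`, the difference between `U''` and `ℓ²/10 + c` is `(x + ℓ)` times this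
  -- function, which is negative near `-ℓ`. So if `ℓ²/10 + c ≤ 0`, then `U''`, `U'` and `U` are
  -- successively negative there, contradicting `U ≥ 0`.
  have hk : Continuous fun x => (x + ℓ) ^ 2 * g x ^ 3 / 3 - (ℓ - x) / 10 := by
    have := hg.continuous
    fun_prop
  have hk0 : (-ℓ + ℓ) ^ 2 * g (-ℓ) ^ 3 / 3 - (ℓ - -ℓ) / 10 < 0 := by
    ring_nf
    linarith
  obtain ⟨δ, hδ, hball⟩ := Metric.eventually_nhds_iff.1 (hk.continuousAt.eventually_lt_const hk0)
  set b := min ℓ (-ℓ + δ) with hb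
  have hlb : -ℓ < b := lt_min (by linarith) (by linarith)
  have hIoo : ∀ x ∈ Ioo (-ℓ) b, x ∈ Ioo (-ℓ) ℓ := fun x hx =>
    ⟨hx.1, hx.2.trans_le (min_le_left _ _)⟩
  have hneg : ∀ x ∈ Ioo (-ℓ) b, U x ^ 3 / 3 + x ^ 2 / 10 + c < 0 := by
    intro x hx
    have h1 := hball (y := x) (by
      rw [Real.dist_eq, sub_neg_eq_add, abs_of_pos (by linarith [hx.1])]
      linarith [hx.2.trans_le (min_le_right ℓ (-ℓ + δ))])
    rw [← hQU (Ioo_subset_Icc_self (hIoo x hx)), hQg]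
    have h2 : 0 < x + ℓ := by linarith [hx.1]
    have h3 := mul_neg_of_pos_of_neg h2 h1
    nlinarith
  have hanti : ∀ f : ℝ → ℝ, Continuous f → f (-ℓ) = 0 → (∀ x ∈ Ioo (-ℓ) b, deriv f x < 0) →
      ∀ x ∈ Ioo (-ℓ) b, f x < 0 := by
    intro f hf hf0 hd x hx
    rw [← hf0]
    refine strictAntiOn_of_deriv_neg (convex_Icc (-ℓ) b) hf.continuousOn ?_
      (left_mem_Icc.2 hlb.le) (Ioo_subset_Icc_self hx) hx.1
    rwa [interior_Icc]
  have h1 := hanti (deriv U) h.continuous_deriv (h.deriv_eq_zero hl) fun x hx => by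
    rw [(hc x (hIoo x hx)).deriv]
    exact hneg x hx
  have h2 := hanti U h.contDiff.continuous (h.eq_zero _ hl) h1
  have hmid : (-ℓ + b) / 2 ∈ Ioo (-ℓ) b := ⟨by linarith, by linarith⟩
  exact (h2 _ hmid).not_ge (h.nonneg _)

lemma exists_pos_lower_bound (hℓ : 0 < ℓ) {f : ℝ → ℝ} (hf : Continuous f)
    (h : ∀ x ∈ Icc (-ℓ) ℓ, 0 < f x) : ∃ c, 0 < c ∧ ∀ x ∈ Icc (-ℓ) ℓ, c ≤ f x := by
  obtain ⟨x, hx, hmin⟩ := isCompact_Icc.exists_isMinOn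
    (nonempty_Icc.2 (by linarith : -ℓ ≤ ℓ)) hf.continuousOn
  exact ⟨f x, h x hx, fun y hy => hmin hy⟩

lemma mem_Icc_cases {x : ℝ} (hx : x ∈ Icc (-ℓ) ℓ) : x ∈ Ioo (-ℓ) ℓ ∨ x = -ℓ ∨ x = ℓ := by
  rcases hx.1.eq_or_lt with h | h
  · exact Or.inr (Or.inl h.symm)
  rcases hx.2.eq_or_lt with h' | h'
  · exact Or.inr (Or.inr h')
  · exact Or.inl ⟨h, h'⟩

/-- `U = (ℓ² - x²)² u` with a smooth positive function `u`. -/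
lemma IsProfile.exists_factor (hℓ : 0 < ℓ) (h : IsProfile ℓ U) (m : ℕ) :
    ∃ u : ℝ → ℝ, ContDiff ℝ m u ∧ (∀ x ∈ Icc (-ℓ) ℓ, U x = (ℓ ^ 2 - x ^ 2) ^ 2 * u x) ∧
      ∀ x ∈ Icc (-ℓ) ℓ, 0 < u x := by
  obtain ⟨c, hc⟩ := h.exists_ode
  obtain ⟨Q, hQ, hQU, hQ'⟩ := h.exists_extension (m + 5)
  have hl : -ℓ ∉ Ioo (-ℓ) ℓ := fun hx => lt_irrefl _ hx.1
  have hr : ℓ ∉ Ioo (-ℓ) ℓ := fun hx => lt_irrefl _ hx.2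
  have hlm : -ℓ ∈ Icc (-ℓ) ℓ := left_mem_Icc.2 (by linarith)
  have hrm : ℓ ∈ Icc (-ℓ) ℓ := right_mem_Icc.2 (by linarith)
  obtain ⟨g, hg, hQg⟩ := exists_div_wt hℓ (m := m + 4) hQ
    (by rw [hQU hlm, h.eq_zero _ hl]) (by rw [hQU hrm, h.eq_zero _ hr])
  have hdg : ∀ x, deriv Q x = Dst ℓ 0 g x := fun x => by
    have h1 := hasDerivAt_wt_pow_mul (ℓ := ℓ) (a := 0)
      (contDiff_succ_differentiable (m := m + 3) hg) x
    rw [pow_zero, one_mul] at h1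
    rw [← h1.deriv]
    congr 1
    ext y
    rw [hQg]
    ring
  -- `Q' = ρ g' - 2 x g` vanishes at the end points because of the zero contact angle; this allows a
  -- second division by `ρ`.
  have hgl : g (-ℓ) = 0 := by
    have h1 := hdg (-ℓ)
    rw [hQ' hlm, h.deriv_eq_zero hl, Dst] at h1
    push_cast at h1
    have h2 : ℓ * g (-ℓ) = 0 := by linear_combination -h1 / 2
    exact (mul_eq_zero.1 h2).resolve_left hℓ.ne'
  have hgr : g ℓ = 0 := by
    have h1 := hdg ℓ
    rw [hQ' hrm, h.deriv_eq_zero hr, Dst] at h1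
    push_cast at h1
    have h2 : ℓ * g ℓ = 0 := by linear_combination h1 / 2
    exact (mul_eq_zero.1 h2).resolve_left hℓ.ne'
  obtain ⟨u, hu, hgu⟩ := exists_div_wt hℓ (m := m + 2) hg hgl hgr
  have hUu : ∀ x ∈ Icc (-ℓ) ℓ, U x = (ℓ ^ 2 - x ^ 2) ^ 2 * u x := fun x hx => by
    rw [← hQU hx, hQg, hgu]
    ring
  have hud := contDiff_succ_differentiable (m := m + 1) hu
  have hp : ContDiff ℝ (m + 1 : ℕ) (Dst ℓ 1 u) := contDiff_Dst hu
  have hpd := contDiff_succ_differentiable hp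
  have hpc : Continuous (Dst ℓ 0 (Dst ℓ 1 u)) := (contDiff_Dst (m := m) hp).continuous
  have h1 : EqOn (deriv U) (fun x => (ℓ ^ 2 - x ^ 2) ^ (0 + 1) * Dst ℓ 1 u x) (Ioo (-ℓ) ℓ) := by
    intro x hx
    have h2 : EqOn U (fun x => (ℓ ^ 2 - x ^ 2) ^ (1 + 1) * u x) (Ioo (-ℓ) ℓ) := fun y hy =>
      hUu y (Ioo_subset_Icc_self hy)
    rw [deriv_eqOn_Ioo h2 hx, (hasDerivAt_wt_pow_mul hud x).deriv]
  have h2 : EqOn (fun x => Q x ^ 3 / 3 + x ^ 2 / 10 + c) (Dst ℓ 0 (Dst ℓ 1 u))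
      (Icc (-ℓ) ℓ) := by
    refine eqOn_Icc_of_eqOn_Ioo hℓ ?_ hpc fun x hx => ?_
    · have := hQ.continuous
      fun_prop
    · simp only [hQU (Ioo_subset_Icc_self hx)]
      rw [← (hc x hx).deriv, deriv_eqOn_Ioo h1 hx, (hasDerivAt_wt_pow_mul hpd x).deriv, pow_zero,
        one_mul]
  have hpos := h.boundary_pos hℓ hc
  refine ⟨u, contDiff_natLE hu (by lia), hUu, fun x hx => ?_⟩
  rcases mem_Icc_cases hx with hx | rfl | rfl
  · have h3 := h.pos x hx
    rw [hUu x (Ioo_subset_Icc_self hx)] at h3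
    exact pos_of_mul_pos_right h3 (sq_nonneg _)
  · have h3 := h2 hlm
    simp only [hQU hlm, h.eq_zero _ hl, Dst] at h3
    push_cast at h3
    -- `U'' = Dst 0 (Dst 1 u)`; where `ρ` vanishes this is `(-2x)(-4x) u = 8 x² u`, so positivity of
    -- `U''` gives positivity of `u`.
    have h4 : ℓ ^ 2 / 10 + c = 8 * ℓ ^ 2 * u (-ℓ) := by linear_combination h3
    rw [h4] at hpos
    exact pos_of_mul_pos_right hpos (by positivity)
  · have h3 := h2 hrm
    simp only [hQU hrm, h.eq_zero _ hr, Dst] at h3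
    push_cast at h3
    have h4 : x ^ 2 / 10 + c = 8 * x ^ 2 * u x := by linear_combination h3
    rw [h4] at hpos
    exact pos_of_mul_pos_right hpos (by positivity)

/-- `Φ' = -(4/5) x U`. -/
lemma IsProfile.Phi_eq (h : IsProfile ℓ U) (hℓ : 0 < ℓ) {Q : ℝ → ℝ} (hQ : Continuous Q)
    (hQU : EqOn Q U (Icc (-ℓ) ℓ)) :
    (∀ x ∈ Ioo (-ℓ) ℓ, Phi U x = ∫ y in (-ℓ)..x, -(4 / 5) * y * Q y) ∧
      ∫ y in (-ℓ)..ℓ, -(4 / 5) * y * Q y = 0 := by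
  obtain ⟨c, hc⟩ := h.exists_ode
  have hl : -ℓ ∉ Ioo (-ℓ) ℓ := fun hx => lt_irrefl _ hx.1
  have hr : ℓ ∉ Ioo (-ℓ) ℓ := fun hx => lt_irrefl _ hx.2
  -- `Φ` with `U''` replaced by the integrated equation. This version is continuous on the line and
  -- vanishes at `±ℓ`, so it can be integrated up to the end points.
  set f : ℝ → ℝ := fun x =>
    2 * deriv U x ^ 2 - 4 * U x * (U x ^ 3 / 3 + x ^ 2 / 10 + c) + U x ^ 4 with hf
  have hfc : Continuous f := by
    have h1 := h.contDiff.continuous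
    have h2 := h.continuous_deriv
    fun_prop
  have h0 : f (-ℓ) = 0 := by simp [hf, h.eq_zero _ hl, h.deriv_eq_zero hl]
  have hfi : ∀ x ∈ Icc (-ℓ) ℓ, ∫ y in (-ℓ)..x, -(4 / 5) * y * Q y = f x := by
    intro x hx
    rw [← sub_zero (f x), ← h0]
    refine intervalIntegral.integral_eq_sub_of_hasDerivAt_of_le hx.1 hfc.continuousOn
      (fun y hy => ?_) (Continuous.intervalIntegrable (by fun_prop) _ _)
    have hy : y ∈ Ioo (-ℓ) ℓ := ⟨hy.1, hy.2.trans_le hx.2⟩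
    have hU := (h.differentiable y).hasDerivAt
    rw [hQU (Ioo_subset_Icc_self hy)]
    refine (((((hc y hy).fun_pow 2).const_mul 2).fun_sub ((hU.const_mul 4).fun_mul
      ((((hU.fun_pow 3).div_const 3).fun_add ((hasDerivAt_pow 2 y).div_const 10)).add_const
        c))).fun_add (hU.fun_pow 4)).congr_deriv ?_
    push_cast
    ring
  refine ⟨fun x hx => ?_, ?_⟩
  · rw [hfi x (Ioo_subset_Icc_self hx), Phi, iteratedDeriv_succ, iteratedDeriv_one,
      (hc x hx).deriv]
  · rw [hfi ℓ (right_mem_Icc.2 (by linarith))]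
    simp [hf, h.eq_zero _ hr, h.deriv_eq_zero hr]

/-- `Φ = (ℓ² - x²)³ β` with a smooth positive function `β`. -/
lemma IsProfile.exists_factor_Phi (hℓ : 0 < ℓ) (h : IsProfile ℓ U) (m : ℕ) :
    ∃ β : ℝ → ℝ, ContDiff ℝ m β ∧ (∀ x ∈ Ioo (-ℓ) ℓ, Phi U x = (ℓ ^ 2 - x ^ 2) ^ 3 * β x) ∧
      ∀ x ∈ Icc (-ℓ) ℓ, 0 < β x := by
  obtain ⟨u, hu, hUu, hupos⟩ := h.exists_factor hℓ (m + 7)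
  set Q : ℝ → ℝ := fun x => (ℓ ^ 2 - x ^ 2) ^ 2 * u x with hQdef
  have hQ : ContDiff ℝ (m + 7 : ℕ) Q := by fun_prop
  have hQU : EqOn Q U (Icc (-ℓ) ℓ) := fun x hx => (hUu x hx).symm
  obtain ⟨hPhi, hPr⟩ := h.Phi_eq hℓ hQ.continuous hQU
  have hw : ContDiff ℝ (m + 7 : ℕ) fun x => -(4 / 5) * x * Q x := by fun_prop
  have hP := contDiff_natLE (contDiff_primitive hw (-ℓ)) (Nat.le_succ (m + 7))
  have hPd := hasDerivAt_primitive hw.continuous (-ℓ)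
  have hPl : ∫ y in (-ℓ)..(-ℓ), -(4 / 5) * y * Q y = 0 := intervalIntegral.integral_same
  set P : ℝ → ℝ := fun x => ∫ y in (-ℓ)..x, -(4 / 5) * y * Q y with hPdef
  have huc := hu.continuous
  obtain ⟨h₁, hh₁, hPh₁⟩ := exists_div_wt hℓ (m := m + 5) hP hPl hPr
  -- `P' = -(4/5) x ρ² u` contains two factors `ρ`, so the quotients `P/ρ` and `P/ρ²` vanish at the
  -- end points too, and `P` is divisible by `ρ³`.
  obtain ⟨h1l, h1r⟩ := boundary_eq_zero hℓ (k := 0) (h := h₁)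
    (w := fun x => (ℓ ^ 2 - x ^ 2) * (-(4 / 5) * x * u x))
    (hh₁.of_le (by exact_mod_cast (by lia : 1 ≤ m + 5))) (by fun_prop) (fun x _ => by
      have h1 : (fun x => (ℓ ^ 2 - x ^ 2) ^ (0 + 1) * h₁ x) = P := funext fun y => by
        rw [hPh₁]; ring
      rw [h1]
      refine (hPd x).congr_deriv ?_
      rw [hQdef]
      ring)
  obtain ⟨h₂, hh₂, hh₁₂⟩ := exists_div_wt hℓ (m := m + 3) hh₁ h1l h1r
  obtain ⟨h2l, h2r⟩ := boundary_eq_zero hℓ (k := 1) (h := h₂)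
    (w := fun x => -(4 / 5) * x * u x)
    (hh₂.of_le (by exact_mod_cast (by lia : 1 ≤ m + 3))) (by fun_prop) (fun x _ => by
      have h1 : (fun x => (ℓ ^ 2 - x ^ 2) ^ (1 + 1) * h₂ x) = P := funext fun y => by
        rw [hPh₁, hh₁₂]; ring
      rw [h1]
      refine (hPd x).congr_deriv ?_
      rw [hQdef]
      ring)
  obtain ⟨β, hβ, hh₂β⟩ := exists_div_wt hℓ (m := m + 1) hh₂ h2l h2r
  have hPβ : ∀ x, P x = (ℓ ^ 2 - x ^ 2) ^ (2 + 1) * β x := fun x => by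
    rw [hPh₁, hh₁₂, hh₂β]; ring
  have hβd := contDiff_succ_differentiable hβ
  have hβ2 : EqOn (Dst ℓ 2 β) (fun x => -(4 / 5) * x * u x) (Icc (-ℓ) ℓ) := by
    refine eqOn_Icc_of_eqOn_Ioo hℓ (contDiff_Dst hβ).continuous (by fun_prop) fun x hx => ?_
    have h1 := hasDerivAt_wt_pow_mul (ℓ := ℓ) (a := 2) hβd x
    rw [← funext hPβ] at h1
    have h2 := h1.unique (hPd x)
    have h3 : 0 < ℓ ^ 2 - x ^ 2 := by nlinarith [hx.1, hx.2]
    refine mul_left_cancel₀ (pow_pos h3 2).ne' (h2.trans ?_)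
    rw [hQdef]
    ring
  have hlm : -ℓ ∈ Icc (-ℓ) ℓ := left_mem_Icc.2 (by linarith)
  have hrm : ℓ ∈ Icc (-ℓ) ℓ := right_mem_Icc.2 (by linarith)
  have hPc : Continuous P := hP.continuous
  refine ⟨β, contDiff_pred hβ, fun x hx => (hPhi x hx).trans (hPβ x), fun x hx => ?_⟩
  rcases mem_Icc_cases hx with hx | rfl | rfl
  · have h3 : 0 < (ℓ ^ 2 - x ^ 2) ^ (2 + 1) := pow_pos (by nlinarith [hx.1, hx.2]) _
    refine pos_of_mul_pos_right ((hPβ x) ▸ ?_) h3.le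
    have hQpos : ∀ y ∈ Ioo (-ℓ) ℓ, 0 < Q y := fun y hy => by
      rw [hQU (Ioo_subset_Icc_self hy)]
      exact h.pos y hy
    -- `P` vanishes at both ends, increases for `x < 0` and decreases for `x > 0`, hence is positive
    -- inside.
    rcases le_total x 0 with h0 | h0
    · rw [← hPl]
      refine strictMonoOn_of_deriv_pos (convex_Icc (-ℓ) 0) hPc.continuousOn (fun y hy => ?_)
        (left_mem_Icc.2 (by linarith)) ⟨hx.1.le, h0⟩ hx.1
      rw [interior_Icc] at hy
      rw [(hPd y).deriv]
      nlinarith [hQpos y ⟨hy.1, hy.2.trans hℓ⟩, hy.2]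
    · rw [← hPr]
      refine strictAntiOn_of_deriv_neg (convex_Icc 0 ℓ) hPc.continuousOn (fun y hy => ?_)
        ⟨h0, hx.2.le⟩ (right_mem_Icc.2 hℓ.le) hx.2
      rw [interior_Icc] at hy
      rw [(hPd y).deriv]
      nlinarith [hQpos y ⟨by linarith [hy.1], hy.2⟩, hy.1]
  · have h3 := hβ2 hlm
    simp only [Dst] at h3
    push_cast at h3
    -- At the end points `Dst 2 β = -6 x β`, so `-6 x β = -(4/5) x u` and `β = (2/15) u`.
    have h4 : ℓ * (2 / 15 * u (-ℓ)) = ℓ * β (-ℓ) := by linear_combination -h3 / 6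
    rw [← mul_left_cancel₀ hℓ.ne' h4]
    have := hupos _ hlm
    positivity
  · have h3 := hβ2 hrm
    simp only [Dst] at h3
    push_cast at h3
    have h4 : x * (2 / 15 * u x) = x * β x := by linear_combination h3 / 6
    rw [← mul_left_cancel₀ hℓ.ne' h4]
    have := hupos _ hrm
    positivity

/-- Multiplying `𝓛` by `U = ρ² u` gives `ρ²` times the operator `ellOp` with `α = u²` from `U² = ρ⁴
u²`, `β` from `Φ = ρ³ β`, and `γ = u/5`. -/
lemma IsProfile.exists_coefs (hℓ : 0 < ℓ) (h : IsProfile ℓ U) (M : ℕ) :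
    ∃ (q : Coefs ℓ M) (u : Cm M), (∃ K c, 0 < c ∧ Coef ℓ K c M u) ∧
      (∀ x ∈ Ioo (-ℓ) ℓ, U x = (ℓ ^ 2 - x ^ 2) ^ 2 * (u : ℝ → ℝ) x) ∧
      (∀ x ∈ Ioo (-ℓ) ℓ, Phi U x = (ℓ ^ 2 - x ^ 2) ^ 3 * q.β x) ∧
      (∀ x, q.α x = (u : ℝ → ℝ) x ^ 2) ∧ ∀ x, q.γ x = (u : ℝ → ℝ) x / 5 := by
  obtain ⟨u, hu, hUu, hupos⟩ := h.exists_factor hℓ M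
  obtain ⟨β, hβ, hPβ, hβpos⟩ := h.exists_factor_Phi hℓ M
  have hα : ContDiff ℝ M fun x => u x ^ 2 := by fun_prop
  have hγ : ContDiff ℝ M fun x => u x / 5 := by fun_prop
  obtain ⟨K₀, hK₀⟩ := exists_CBound ℓ hu
  obtain ⟨K₁, hK₁⟩ := exists_CBound ℓ hα
  obtain ⟨K₂, hK₂⟩ := exists_CBound ℓ hβ
  obtain ⟨K₃, hK₃⟩ := exists_CBound ℓ hγ
  obtain ⟨c₀, hc₀, h0⟩ := exists_pos_lower_bound hℓ hu.continuous hupos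
  obtain ⟨c₁, hc₁, h1⟩ := exists_pos_lower_bound hℓ hα.continuous fun x hx => pow_pos (hupos x hx) 2
  obtain ⟨c₂, hc₂, h2⟩ := exists_pos_lower_bound hℓ hβ.continuous hβpos
  obtain ⟨c₃, hc₃, h3⟩ := exists_pos_lower_bound hℓ hγ.continuous
    fun x hx => div_pos (hupos x hx) (by norm_num)
  refine ⟨⟨_, β, _, max K₁ (max K₂ K₃), min c₁ (min c₂ c₃), lt_min hc₁ (lt_min hc₂ hc₃),
    ⟨hα, hK₁.mono (le_max_left _ _), fun x hx => (min_le_left _ _).trans (h1 x hx)⟩,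
    ⟨hβ, hK₂.mono ((le_max_left _ _).trans (le_max_right _ _)), fun x hx =>
      ((min_le_right _ _).trans (min_le_left _ _)).trans (h2 x hx)⟩,
    ⟨hγ, hK₃.mono ((le_max_right _ _).trans (le_max_right _ _)), fun x hx =>
      ((min_le_right _ _).trans (min_le_right _ _)).trans (h3 x hx)⟩⟩, ⟨u, hu⟩,
    ⟨K₀, c₀, hc₀, hu, hK₀, h0⟩, fun x hx => hUu x (Ioo_subset_Icc_self hx), hPβ,
    fun x => rfl, fun x => rfl⟩

/-! ### Uniqueness of the profile -/

/-- Comparison principle for `U'' = U³/3 + x²/10 + c`, whose right-hand side increases in `U`: the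
profile with the larger constant lies below, and then the double zero at `-ℓ` forces the constants
to agree. -/
lemma IsProfile.le_of_le (hℓ : 0 < ℓ) {U₁ U₂ : ℝ → ℝ} (h₁ : IsProfile ℓ U₁) (h₂ : IsProfile ℓ U₂)
    {c₁ c₂ : ℝ} (hc : c₂ ≤ c₁)
    (hc₁ : ∀ x ∈ Ioo (-ℓ) ℓ, HasDerivAt (deriv U₁) (U₁ x ^ 3 / 3 + x ^ 2 / 10 + c₁) x)
    (hc₂ : ∀ x ∈ Ioo (-ℓ) ℓ, HasDerivAt (deriv U₂) (U₂ x ^ 3 / 3 + x ^ 2 / 10 + c₂) x) :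
    c₁ = c₂ ∧ ∀ x, U₁ x ≤ U₂ x := by
  have hd : deriv (fun x => U₁ x - U₂ x) = fun x => deriv U₁ x - deriv U₂ x := funext fun x =>
    ((h₁.differentiable x).hasDerivAt.fun_sub (h₂.differentiable x).hasDerivAt).deriv
  have hdd : ∀ x ∈ Ioo (-ℓ) ℓ, deriv (deriv fun x => U₁ x - U₂ x) x =
      (U₁ x ^ 3 - U₂ x ^ 3) / 3 + (c₁ - c₂) := fun x hx => by
    rw [hd, ((hc₁ x hx).fun_sub (hc₂ x hx)).deriv]
    ring
  have hWc : Continuous fun x => U₁ x - U₂ x := h₁.contDiff.continuous.sub h₂.contDiff.continuous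
  have hle : ∀ x, U₁ x ≤ U₂ x := by
    by_contra! hcon
    obtain ⟨y, hy⟩ := hcon
    have hyI : y ∈ Icc (-ℓ) ℓ := by
      by_contra hy'
      have := fun h => hy' (Ioo_subset_Icc_self h)
      rw [h₁.eq_zero y this, h₂.eq_zero y this] at hy
      exact lt_irrefl _ hy
    obtain ⟨x, hx, hmax⟩ := isCompact_Icc.exists_isMaxOn ⟨y, hyI⟩ hWc.continuousOn
    have hxpos : 0 < U₁ x - U₂ x := (sub_pos.2 hy).trans_le (hmax hyI)
    have hxI : x ∈ Ioo (-ℓ) ℓ := by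
      by_contra hx'
      rw [h₁.eq_zero x hx', h₂.eq_zero x hx', sub_zero] at hxpos
      exact lt_irrefl _ hxpos
    have hlmax : IsLocalMax (fun x => U₁ x - U₂ x) x := hmax.isLocalMax (Icc_mem_nhds hxI.1 hxI.2)
    have hpos : 0 < deriv (deriv fun x => U₁ x - U₂ x) x := by
      rw [hdd x hxI]
      have h3 := pow_lt_pow_left₀ (sub_pos.1 hxpos) (h₂.nonneg x) (n := 3) (by norm_num)
      linarith
    -- At a positive maximum the second derivative of the difference is positive, so the point is
    -- also a local minimum. The difference is then locally constant and its second derivative zero,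
    -- a contradiction.
    have hlmin := isLocalMin_of_deriv_deriv_pos hpos hlmax.deriv_eq_zero hWc.continuousAt
    have heq : (fun x => U₁ x - U₂ x) =ᶠ[nhds x] fun _ => U₁ x - U₂ x := by
      filter_upwards [hlmax, hlmin] with z hz1 hz2 using le_antisymm hz1 hz2
    have h0 : deriv (deriv fun x => U₁ x - U₂ x) x = 0 := by
      rw [heq.deriv.deriv_eq]
      simp
    exact hpos.ne' h0
  refine ⟨le_antisymm ?_ hc, hle⟩
  -- If `c₁ > c₂`, the difference has vanishing value and slope at `-ℓ` and positive second
  -- derivative near it, so it becomes positive, against `U₁ ≤ U₂`.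
  by_contra! hlt
  have hl : -ℓ ∉ Ioo (-ℓ) ℓ := fun hx => lt_irrefl _ hx.1
  have hgc : Continuous fun x => (U₁ x ^ 3 - U₂ x ^ 3) / 3 + (c₁ - c₂) := by
    have h3 := h₁.contDiff.continuous
    have h4 := h₂.contDiff.continuous
    fun_prop
  have h0 : 0 < (U₁ (-ℓ) ^ 3 - U₂ (-ℓ) ^ 3) / 3 + (c₁ - c₂) := by
    rw [h₁.eq_zero _ hl, h₂.eq_zero _ hl]
    linarith
  obtain ⟨δ, hδ, hball⟩ := Metric.eventually_nhds_iff.1 (hgc.continuousAt.eventually_const_lt h0)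
  set b := min ℓ (-ℓ + δ) with hb
  have hlb : -ℓ < b := lt_min (by linarith) (by linarith)
  have hmono : ∀ f : ℝ → ℝ, Continuous f → f (-ℓ) = 0 → (∀ x ∈ Ioo (-ℓ) b, 0 < deriv f x) →
      ∀ x ∈ Ioo (-ℓ) b, 0 < f x := by
    intro f hf hf0 hd x hx
    rw [← hf0]
    refine strictMonoOn_of_deriv_pos (convex_Icc (-ℓ) b) hf.continuousOn ?_
      (left_mem_Icc.2 hlb.le) (Ioo_subset_Icc_self hx) hx.1
    rwa [interior_Icc]
  have h1 := hmono (deriv fun x => U₁ x - U₂ x)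
    (hd ▸ h₁.continuous_deriv.sub h₂.continuous_deriv)
    (by simp only [hd, h₁.deriv_eq_zero hl, h₂.deriv_eq_zero hl, sub_zero]) fun x hx => by
      rw [hdd x ⟨hx.1, hx.2.trans_le (min_le_left _ _)⟩]
      refine hball (y := x) ?_
      rw [Real.dist_eq, sub_neg_eq_add, abs_of_pos (by linarith [hx.1])]
      linarith [hx.2.trans_le (min_le_right ℓ (-ℓ + δ))]
  have h2 := hmono _ hWc (by rw [h₁.eq_zero _ hl, h₂.eq_zero _ hl, sub_zero]) h1
  have hmid : (-ℓ + b) / 2 ∈ Ioo (-ℓ) b := ⟨by linarith, by linarith⟩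
  linarith [h2 _ hmid, hle ((-ℓ + b) / 2)]

/-- Needed so that the constant of the estimate depends on `ℓ` but not on the profile. -/
lemma IsProfile.unique (hℓ : 0 < ℓ) {U₁ U₂ : ℝ → ℝ} (h₁ : IsProfile ℓ U₁) (h₂ : IsProfile ℓ U₂) :
    U₁ = U₂ := by
  obtain ⟨c₁, hc₁⟩ := h₁.exists_ode
  obtain ⟨c₂, hc₂⟩ := h₂.exists_ode
  rcases le_total c₂ c₁ with hc | hc
  · obtain ⟨he, hle⟩ := h₁.le_of_le hℓ h₂ hc hc₁ hc₂
    exact funext fun x => le_antisymm (hle x) ((h₂.le_of_le hℓ h₁ he.le hc₂ hc₁).2 x)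
  · obtain ⟨he, hle⟩ := h₂.le_of_le hℓ h₁ hc hc₂ hc₁
    exact funext fun x => le_antisymm ((h₁.le_of_le hℓ h₂ he.le hc₁ hc₂).2 x) (hle x)

end Profile

/-! ### Weak derivatives -/

lemma integrable_wMeasure_iff (ℓ : ℝ) (j : ℕ) (F : ℝ → ℝ) : Integrable F (wMeasure ℓ j) ↔
    Integrable (fun x => (ENNReal.ofReal ((ℓ ^ 2 - x ^ 2) ^ (j + 2))).toReal • F x)
      (volume.restrict (Ioo (-ℓ) ℓ)) := by
  rw [wMeasure, integrable_withDensity_iff_integrable_smul' (measurable_weight ℓ j) (by simp)]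

lemma integral_wMeasure_eq_setIntegral (ℓ : ℝ) (j : ℕ) (F : ℝ → ℝ) : ∫ x, F x ∂(wMeasure ℓ j) =
    ∫ x in Ioo (-ℓ) ℓ, (ENNReal.ofReal ((ℓ ^ 2 - x ^ 2) ^ (j + 2))).toReal • F x := by
  rw [wMeasure, integral_withDensity_eq_integral_toReal_smul (measurable_weight ℓ j) (by simp)]

/-- Since `ψ` is supported away from `±ℓ`, `ψ / ρ^(j+2)` is continuous, and pairing with `ψ` is a
scalar product in the weighted space. -/
lemma exists_pairing {ℓ : ℝ} (j : ℕ) {ψ : ℝ → ℝ} (hc : Continuous ψ)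
    (hs : tsupport ψ ⊆ Ioo (-ℓ) ℓ) : ∃ L : Lp ℝ 2 (wMeasure ℓ j) →L[ℝ] ℝ, ∀ f,
      Integrable (fun x => f x * ψ x) (volume.restrict (Ioo (-ℓ) ℓ)) ∧
        L f = ∫ x in Ioo (-ℓ) ℓ, f x * ψ x := by
  have hpos : ∀ x ∈ Ioo (-ℓ) ℓ, 0 < (ℓ ^ 2 - x ^ 2) ^ (j + 2) := fun x hx =>
    pow_pos (by nlinarith [hx.1, hx.2]) _
  have hχ : Continuous fun x => ψ x * ((ℓ ^ 2 - x ^ 2) ^ (j + 2))⁻¹ := by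
    refine continuous_of_tsupport fun x hx => ?_
    have hx' := hs (tsupport_mul_subset_left hx)
    exact hc.continuousAt.mul (ContinuousAt.inv₀ (by fun_prop) (hpos x hx').ne')
  refine ⟨innerSL ℝ (cls ℓ j _ hχ), fun f => ?_⟩
  have h1 : ∀ᵐ x ∂(volume.restrict (Ioo (-ℓ) ℓ)),
      (ENNReal.ofReal ((ℓ ^ 2 - x ^ 2) ^ (j + 2))).toReal • inner ℝ (cls ℓ j _ hχ x) (f x) =
        f x * ψ x := by
    filter_upwards [ae_wMeasure_iff.1 (coeFn_cls (ℓ := ℓ) (j := j) hχ),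
      ae_restrict_mem measurableSet_Ioo] with x h1 hx
    have h3 := hpos x hx
    rw [h1, ENNReal.toReal_ofReal h3.le, smul_eq_mul]
    simp only [RCLike.inner_apply, conj_trivial]
    field_simp
  have h2 := L2.integrable_inner (𝕜 := ℝ) (cls ℓ j _ hχ) f
  rw [integrable_wMeasure_iff] at h2
  refine ⟨h2.congr h1, ?_⟩
  rw [innerSL_apply_apply, L2.inner_def, integral_wMeasure_eq_setIntegral]
  exact integral_congr_ae h1

lemma locallyIntegrableOn_congr {ℓ : ℝ} {f g : ℝ → ℝ} (hf : LocallyIntegrableOn f (Ioo (-ℓ) ℓ))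
    (h : f =ᵐ[volume.restrict (Ioo (-ℓ) ℓ)] g) : LocallyIntegrableOn g (Ioo (-ℓ) ℓ) := by
  rw [locallyIntegrableOn_iff isOpen_Ioo.isLocallyClosed] at hf ⊢
  exact fun k hk hkc => (hf k hk hkc).congr (ae_restrict_of_ae_restrict_of_subset hk h)

lemma locallyIntegrableOn_coeFn {ℓ : ℝ} (j : ℕ) (f : Lp ℝ 2 (wMeasure ℓ j)) :
    LocallyIntegrableOn f (Ioo (-ℓ) ℓ) := by
  have h1 : Integrable f (wMeasure ℓ j) := (Lp.memLp f).integrable one_le_two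
  rw [integrable_wMeasure_iff] at h1
  have hpos : ∀ x ∈ Ioo (-ℓ) ℓ, 0 < (ℓ ^ 2 - x ^ 2) ^ (j + 2) := fun x hx =>
    pow_pos (by nlinarith [hx.1, hx.2]) _
  have h2 : LocallyIntegrableOn (fun x => ((ℓ ^ 2 - x ^ 2) ^ (j + 2))⁻¹ *
      ((ENNReal.ofReal ((ℓ ^ 2 - x ^ 2) ^ (j + 2))).toReal • f x)) (Ioo (-ℓ) ℓ) :=
    LocallyIntegrableOn.continuousOn_mul (IntegrableOn.locallyIntegrableOn h1)
      (ContinuousOn.inv₀ (by fun_prop) fun x hx => (hpos x hx).ne') isOpen_Ioo.isLocallyClosed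
  refine locallyIntegrableOn_congr h2 ?_
  filter_upwards [ae_restrict_mem measurableSet_Ioo] with x hx
  rw [ENNReal.toReal_ofReal (hpos x hx).le, smul_eq_mul, inv_mul_cancel_left₀ (hpos x hx).ne']

lemma HasWeakDeriv.unique {ℓ : ℝ} {n : ℕ} {f f' g g' : ℝ → ℝ} (h : HasWeakDeriv ℓ n f g)
    (h' : HasWeakDeriv ℓ n f' g') (hf : f =ᵐ[volume.restrict (Ioo (-ℓ) ℓ)] f') :
    g =ᵐ[volume.restrict (Ioo (-ℓ) ℓ)] g' := by
  have hloc := h.2.1.sub h'.2.1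
  have hint : ∀ {g : ℝ → ℝ}, LocallyIntegrableOn g (Ioo (-ℓ) ℓ) → ∀ φ : ℝ → ℝ, ContDiff ℝ ∞ φ →
      HasCompactSupport φ → tsupport φ ⊆ Ioo (-ℓ) ℓ →
      Integrable (fun x => g x * φ x) (volume.restrict (Ioo (-ℓ) ℓ)) := by
    intro g hg φ hφ hc hs
    have h1 : IntegrableOn (fun x => g x * φ x) (tsupport φ) :=
      (hg.integrableOn_compact_subset hs hc).mul_continuousOn hφ.continuous.continuousOn hc
    have h2 : Integrable (fun x => g x * φ x) := by
      rwa [integrableOn_iff_integrable_of_support_subset] at h1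
      exact fun x hx => subset_tsupport φ (fun h0 => hx (by simp [h0]))
    exact h2.restrict
  have h1 := isOpen_Ioo.ae_eq_zero_of_integral_contDiff_smul_eq_zero hloc fun φ hφ hc hs => ?_
  · refine (ae_restrict_iff' measurableSet_Ioo).2 ?_
    filter_upwards [h1] with x hx hxI
    exact sub_eq_zero.1 (hx hxI)
  · have h3 : ∫ x in Ioo (-ℓ) ℓ, f x * iteratedDeriv n φ x =
        ∫ x in Ioo (-ℓ) ℓ, f' x * iteratedDeriv n φ x := by
      refine integral_congr_ae ?_
      filter_upwards [hf] with x hx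
      rw [hx]
    rw [h.2.2 φ hφ hc hs, h'.2.2 φ hφ hc hs] at h3
    have h4 := mul_left_cancel₀ (pow_ne_zero n (by norm_num : (-1 : ℝ) ≠ 0)) h3
    have h5 : ∫ x in Ioo (-ℓ) ℓ, φ x • (g - g') x = 0 := by
      rw [← sub_eq_zero] at h4
      rw [← integral_sub (hint h.2.1 φ hφ hc hs) (hint h'.2.1 φ hφ hc hs)] at h4
      rw [← h4]
      refine integral_congr_ae (Filter.Eventually.of_forall fun x => ?_)
      simp only [Pi.sub_apply, smul_eq_mul]
      ring
    rw [← h5]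
    refine (setIntegral_eq_integral_of_forall_compl_eq_zero fun x hx => ?_).symm
    rw [image_eq_zero_of_notMem_tsupport fun h => hx (hs h), zero_smul]

lemma IsLinOp.unique {ℓ : ℝ} {U v w w' : ℝ → ℝ} (h : IsLinOp ℓ U v w) (h' : IsLinOp ℓ U v w') :
    w =ᵐ[volume.restrict (Ioo (-ℓ) ℓ)] w' := by
  obtain ⟨v₁, v₂, g, k, h1, h2, h3, h4, h5⟩ := h
  obtain ⟨v₁', v₂', g', k', h1', h2', h3', h4', h5'⟩ := h'
  have e1 := h1.unique h1' (Filter.EventuallyEq.refl _ _)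
  have e2 := h2.unique h2' (Filter.EventuallyEq.refl _ _)
  have e3 := h3.unique h3' (by filter_upwards [e2] with x hx; rw [hx])
  have e4 := h4.unique h4' (by filter_upwards [e1] with x hx; rw [hx])
  filter_upwards [h5, h5', e3, e4] with x a b c d
  rw [a, b, c, d]

lemma integral_mul_deriv_of_tsupport {ℓ : ℝ} (hℓ : 0 < ℓ) {F F' φ : ℝ → ℝ}
    (hF : ∀ x, HasDerivAt F (F' x) x) (hF' : Continuous F') (hφ : ContDiff ℝ 1 φ)
    (hs : tsupport φ ⊆ Ioo (-ℓ) ℓ) :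
    ∫ x in Ioo (-ℓ) ℓ, F x * deriv φ x = -∫ x in Ioo (-ℓ) ℓ, F' x * φ x := by
  have h0 : ∀ x, x ∉ Ioo (-ℓ) ℓ → φ x = 0 := fun x hx =>
    image_eq_zero_of_notMem_tsupport fun h => hx (hs h)
  have h1 := intervalIntegral.integral_mul_deriv_eq_deriv_mul (a := -ℓ) (b := ℓ)
    (u := F) (v := φ) (u' := F') (v' := deriv φ) (fun x _ => hF x)
    (fun x _ => (hφ.differentiable one_ne_zero x).hasDerivAt) (hF'.intervalIntegrable _ _)
    ((hφ.continuous_deriv le_rfl).intervalIntegrable _ _)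
  rw [h0 ℓ (fun h => lt_irrefl _ h.2), h0 (-ℓ) (fun h => lt_irrefl _ h.1), mul_zero, mul_zero,
    sub_zero, zero_sub, intervalIntegral.integral_of_le (by linarith),
    intervalIntegral.integral_of_le (by linarith), integral_Ioc_eq_integral_Ioo,
    integral_Ioc_eq_integral_Ioo] at h1
  exact h1

/-- The component `∂_x^j w` of an element of `ℋ^m`. -/
def compL (ℓ : ℝ) (m : ℕ) (j : Fin (m + 1)) : Hsp ℓ m →L[ℝ] Lp ℝ 2 (wMeasure ℓ (j : ℕ)) :=
  (PiLp.proj 2 (fun j : Fin (m + 1) => Lp ℝ 2 (wMeasure ℓ (j : ℕ))) j).comp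
    (smoothJets ℓ m).topologicalClosure.subtypeL

/-- Weak identities on `ℋ^m` become equalities of continuous functionals and need only be checked on
smooth functions, where they are classical integrations by parts. -/
lemma exists_jet_pairing {ℓ : ℝ} {m : ℕ} (j : Fin (m + 1)) {ψ : ℝ → ℝ} (hc : Continuous ψ)
    (hs : tsupport ψ ⊆ Ioo (-ℓ) ℓ) : ∃ P : Hsp ℓ m →L[ℝ] ℝ,
      (∀ w, Integrable (fun x => compL ℓ m j w x * ψ x) (volume.restrict (Ioo (-ℓ) ℓ))) ∧
      (∀ w, P w = ∫ x in Ioo (-ℓ) ℓ, compL ℓ m j w x * ψ x) ∧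
      ∀ f : Cm m, P (jet ℓ m f) = ∫ x in Ioo (-ℓ) ℓ, iteratedDeriv j (f : ℝ → ℝ) x * ψ x := by
  obtain ⟨L, hL⟩ := exists_pairing (ℓ := ℓ) j hc hs
  refine ⟨L.comp (compL ℓ m j), fun w => (hL _).1, fun w => (hL _).2, fun f => ?_⟩
  refine (hL _).2.trans (integral_congr_ae ?_)
  filter_upwards [ae_wMeasure_iff.1 (coeFn_cls (ℓ := ℓ) (j := j)
    (continuous_iteratedDeriv_Cm f j))] with x hx
  rw [← hx]
  rfl

lemma hasWeakDeriv_comp_one {ℓ : ℝ} (hℓ : 0 < ℓ) (w : Hsp ℓ (0 + 4)) :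
    HasWeakDeriv ℓ 1 (compL ℓ (0 + 4) 0 w) (compL ℓ (0 + 4) 1 w) := by
  refine ⟨locallyIntegrableOn_coeFn _ _, locallyIntegrableOn_coeFn _ _, fun φ hφ hc hs => ?_⟩
  have hφ1 : ContDiff ℝ 1 φ := hφ.of_le (by exact_mod_cast le_top)
  rw [iteratedDeriv_one, pow_one, neg_one_mul]
  obtain ⟨P, -, hP, hPj⟩ := exists_jet_pairing (ℓ := ℓ) (m := 0 + 4) 0
    (hφ1.continuous_deriv le_rfl) ((tsupport_deriv_subset).trans hs)
  obtain ⟨P', -, hP', hPj'⟩ := exists_jet_pairing (ℓ := ℓ) (m := 0 + 4) 1 hφ1.continuous hs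
  have h1 : P = -P' := by
    refine clm_ext_jet hℓ fun f => ?_
    rw [neg_apply, hPj, hPj']
    have hf : ContDiff ℝ 4 (f : ℝ → ℝ) := by exact_mod_cast contDiff_Cm f
    have h2 := integral_mul_deriv_of_tsupport hℓ
      (fun x => (hf.differentiable (by norm_num) x).hasDerivAt)
      (hf.continuous_deriv (by norm_num)) hφ1 hs
    simpa [iteratedDeriv_one] using h2
  rw [← hP, ← hP', h1]
  rfl

lemma iteratedDeriv_two' (f : ℝ → ℝ) : iteratedDeriv 2 f = deriv (deriv f) := by
  rw [iteratedDeriv_succ, iteratedDeriv_one]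

lemma hasWeakDeriv_comp_two {ℓ : ℝ} (hℓ : 0 < ℓ) (w : Hsp ℓ (0 + 4)) :
    HasWeakDeriv ℓ 2 (compL ℓ (0 + 4) 0 w) (compL ℓ (0 + 4) 2 w) := by
  refine ⟨locallyIntegrableOn_coeFn _ _, locallyIntegrableOn_coeFn _ _, fun φ hφ hc hs => ?_⟩
  have hφ1 : ContDiff ℝ 1 φ := hφ.of_le (by exact_mod_cast le_top)
  have hφ2 : ContDiff ℝ 2 φ := by exact_mod_cast contDiff_infty.1 hφ 2
  have hφ' : ContDiff ℝ 1 (deriv φ) := contDiff_deriv (m := 1) (by exact_mod_cast hφ2)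
  have hs' : tsupport (deriv φ) ⊆ Ioo (-ℓ) ℓ := tsupport_deriv_subset.trans hs
  rw [iteratedDeriv_succ, iteratedDeriv_one, neg_one_sq, one_mul]
  obtain ⟨P, -, hP, hPj⟩ := exists_jet_pairing (ℓ := ℓ) (m := 0 + 4) 0
    (hφ'.continuous_deriv le_rfl) ((tsupport_deriv_subset).trans hs')
  obtain ⟨P', -, hP', hPj'⟩ := exists_jet_pairing (ℓ := ℓ) (m := 0 + 4) 2 hφ1.continuous hs
  have h1 : P = P' := by
    refine clm_ext_jet hℓ fun f => ?_
    rw [hPj, hPj']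
    have hf : ContDiff ℝ 4 (f : ℝ → ℝ) := by exact_mod_cast contDiff_Cm f
    have hf' : ContDiff ℝ 3 (deriv (f : ℝ → ℝ)) :=
      contDiff_deriv (m := 3) (by exact_mod_cast hf)
    have h2 := integral_mul_deriv_of_tsupport hℓ
      (fun x => (hf.differentiable (by norm_num) x).hasDerivAt)
      (hf.continuous_deriv (by norm_num)) hφ' hs'
    have h3 := integral_mul_deriv_of_tsupport hℓ
      (fun x => (hf'.differentiable (by norm_num) x).hasDerivAt)
      (hf'.continuous_deriv (by norm_num)) hφ1 hs
    rw [h3, neg_neg] at h2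
    have h5 : (((2 : Fin (0 + 4 + 1)) : ℕ)) = 2 := rfl
    rw [h5, iteratedDeriv_two']
    simpa using h2
  rw [← hP, ← hP', h1]

lemma integrableOn_Ioo_of_continuous {ℓ : ℝ} {G : ℝ → ℝ} (h : Continuous G) :
    IntegrableOn G (Ioo (-ℓ) ℓ) :=
  h.integrableOn_Icc.mono_set Ioo_subset_Icc_self

lemma tsupport_mul_subset_of_subset {ℓ : ℝ} {φ : ℝ → ℝ} (hs : tsupport φ ⊆ Ioo (-ℓ) ℓ)
    (a : ℝ → ℝ) : tsupport (fun x => a x * φ x) ⊆ Ioo (-ℓ) ℓ :=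
  (tsupport_mul_subset_right).trans hs

/-- The weak derivative of `(ℓ² - x²)³ β ∂_x w`. -/
lemma hasWeakDeriv_second_order {ℓ : ℝ} (hℓ : 0 < ℓ) {β : ℝ → ℝ} (hβ : ContDiff ℝ 1 β)
    (w : Hsp ℓ (0 + 4)) :
    HasWeakDeriv ℓ 1 (fun x => (ℓ ^ 2 - x ^ 2) ^ 3 * β x * compL ℓ (0 + 4) 1 w x)
      (fun x => (ℓ ^ 2 - x ^ 2) ^ 2 * Dst ℓ 2 β x * compL ℓ (0 + 4) 1 w x +
        (ℓ ^ 2 - x ^ 2) ^ 3 * β x * compL ℓ (0 + 4) 2 w x) := by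
  have hβc := hβ.continuous
  have hDc : Continuous (Dst ℓ 2 β) := (contDiff_Dst (m := 0) (by exact_mod_cast hβ)).continuous
  refine ⟨(locallyIntegrableOn_coeFn _ _).continuousOn_mul (by fun_prop)
    isOpen_Ioo.isLocallyClosed, ((locallyIntegrableOn_coeFn _ _).continuousOn_mul (by fun_prop)
    isOpen_Ioo.isLocallyClosed).add ((locallyIntegrableOn_coeFn _ _).continuousOn_mul
      (by fun_prop) isOpen_Ioo.isLocallyClosed), fun φ hφ hc hs => ?_⟩
  have hφ1 : ContDiff ℝ 1 φ := hφ.of_le (by exact_mod_cast le_top)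
  have hφc := hφ1.continuous
  have hφ'c := hφ1.continuous_deriv le_rfl
  rw [iteratedDeriv_one, pow_one, neg_one_mul]
  obtain ⟨P, -, hP, hPj⟩ := exists_jet_pairing (ℓ := ℓ) (m := 0 + 4) 1
    (ψ := fun x => ((ℓ ^ 2 - x ^ 2) ^ 3 * β x) * deriv φ x) (by fun_prop)
    (tsupport_mul_subset_of_subset (tsupport_deriv_subset.trans hs) _)
  obtain ⟨P₁, hi₁, hP₁, hPj₁⟩ := exists_jet_pairing (ℓ := ℓ) (m := 0 + 4) 1
    (ψ := fun x => ((ℓ ^ 2 - x ^ 2) ^ 2 * Dst ℓ 2 β x) * φ x) (by fun_prop)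
    (tsupport_mul_subset_of_subset hs _)
  obtain ⟨P₂, hi₂, hP₂, hPj₂⟩ := exists_jet_pairing (ℓ := ℓ) (m := 0 + 4) 2
    (ψ := fun x => ((ℓ ^ 2 - x ^ 2) ^ 3 * β x) * φ x) (by fun_prop)
    (tsupport_mul_subset_of_subset hs _)
  have h1 : P = -(P₁ + P₂) := by
    refine clm_ext_jet hℓ fun f => ?_
    have hf : ContDiff ℝ 4 (f : ℝ → ℝ) := by exact_mod_cast contDiff_Cm f
    have hf' : ContDiff ℝ 3 (deriv (f : ℝ → ℝ)) :=
      contDiff_deriv (m := 3) (by exact_mod_cast hf)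
    have hf1 := hf'.continuous
    have hf2 := hf'.continuous_deriv (by norm_num)
    have e1 : (((1 : Fin (0 + 4 + 1)) : ℕ)) = 1 := rfl
    have e2 : (((2 : Fin (0 + 4 + 1)) : ℕ)) = 2 := rfl
    rw [neg_apply, add_apply, hPj, hPj₁, hPj₂, e1, e2, iteratedDeriv_two', iteratedDeriv_one,
      ← integral_add (integrableOn_Ioo_of_continuous (by fun_prop))
        (integrableOn_Ioo_of_continuous (by fun_prop))]
    have hd : ∀ x, HasDerivAt (fun x => (ℓ ^ 2 - x ^ 2) ^ (2 + 1) * (β x * deriv (f : ℝ → ℝ) x))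
        ((ℓ ^ 2 - x ^ 2) ^ 2 * Dst ℓ 2 β x * deriv (f : ℝ → ℝ) x +
          (ℓ ^ 2 - x ^ 2) ^ 3 * β x * deriv (deriv (f : ℝ → ℝ)) x) x := fun x => by
      refine (((hasDerivAt_wt_pow_mul (ℓ := ℓ) (a := 2) (hβ.differentiable one_ne_zero) x).fun_mul
        (hf'.differentiable (by norm_num) x).hasDerivAt).congr_of_eventuallyEq
          (Filter.Eventually.of_forall fun y => ?_)).congr_deriv ?_ <;> ring
    have h2 := integral_mul_deriv_of_tsupport hℓ hd (by fun_prop) hφ1 hs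
    refine Eq.trans ?_ (h2.trans ?_)
    · congr 1
      ext x
      ring
    · congr 2
      ext x
      ring
  have h2 := hP w
  rw [h1, neg_apply, add_apply, hP₁, hP₂, ← integral_add (hi₁ w) (hi₂ w)] at h2
  refine Eq.trans ?_ (h2.symm.trans ?_)
  · congr 1
    ext x
    ring
  · congr 2
    ext x
    ring

/-- The weak second derivative of `(ℓ² - x²)⁴ α ∂_x² w`. -/
lemma hasWeakDeriv_fourth_order {ℓ : ℝ} (hℓ : 0 < ℓ) {M : ℕ} (q : Coefs ℓ M) (hm : 0 + 4 ≤ M)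
    (w : Hsp ℓ (0 + 4)) :
    HasWeakDeriv ℓ 2 (fun x => (ℓ ^ 2 - x ^ 2) ^ 4 * q.α x * compL ℓ (0 + 4) 2 w x)
      (fun x => (ℓ ^ 2 - x ^ 2) ^ 2 * compL ℓ 0 0 (ellH q hm w) x +
        ((ℓ ^ 2 - x ^ 2) ^ 2 * Dst ℓ 2 q.β x * compL ℓ (0 + 4) 1 w x +
        (ℓ ^ 2 - x ^ 2) ^ 3 * q.β x * compL ℓ (0 + 4) 2 w x) -
        (ℓ ^ 2 - x ^ 2) ^ 2 * q.γ x * compL ℓ (0 + 4) 0 w x) := by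
  have hα : ContDiff ℝ 2 q.α := by exact_mod_cast (q.hα.natLE (m := 2) (by lia)).smooth
  have hβ : ContDiff ℝ 1 q.β := by exact_mod_cast (q.hβ.natLE (m := 1) (by lia)).smooth
  have hαc := hα.continuous
  have hβc := hβ.continuous
  have hγc := q.hγ.smooth.continuous
  have hDc : Continuous (Dst ℓ 2 q.β) := (contDiff_Dst (m := 0) (by exact_mod_cast hβ)).continuous
  have hloc : ∀ {m : ℕ} (j : Fin (m + 1)) (w : Hsp ℓ m) {a : ℝ → ℝ}, Continuous a →
      LocallyIntegrableOn (fun x => a x * compL ℓ m j w x) (Ioo (-ℓ) ℓ) := fun j w a ha =>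
    (locallyIntegrableOn_coeFn _ _).continuousOn_mul ha.continuousOn isOpen_Ioo.isLocallyClosed
  refine ⟨hloc 2 w (by fun_prop), ((hloc 0 (ellH q hm w) (by fun_prop)).add
    ((hloc 1 w (by fun_prop)).add (hloc 2 w (by fun_prop)))).sub (hloc 0 w (by fun_prop)),
    fun φ hφ hc hs => ?_⟩
  have hφ1 : ContDiff ℝ 1 φ := hφ.of_le (by exact_mod_cast le_top)
  have hφ2 : ContDiff ℝ 2 φ := by exact_mod_cast contDiff_infty.1 hφ 2
  have hφ' : ContDiff ℝ 1 (deriv φ) := contDiff_deriv (m := 1) (by exact_mod_cast hφ2)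
  have hφc := hφ1.continuous
  have hφ''c := hφ'.continuous_deriv le_rfl
  have hs' : tsupport (deriv φ) ⊆ Ioo (-ℓ) ℓ := tsupport_deriv_subset.trans hs
  rw [iteratedDeriv_succ, iteratedDeriv_one, neg_one_sq, one_mul]
  obtain ⟨P, -, hP, hPj⟩ := exists_jet_pairing (ℓ := ℓ) (m := 0 + 4) 2
    (ψ := fun x => ((ℓ ^ 2 - x ^ 2) ^ 4 * q.α x) * deriv (deriv φ) x) (by fun_prop)
    (tsupport_mul_subset_of_subset (tsupport_deriv_subset.trans hs') _)
  obtain ⟨P₀, hi₀, hP₀, hPj₀⟩ := exists_jet_pairing (ℓ := ℓ) (m := 0) 0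
    (ψ := fun x => ((ℓ ^ 2 - x ^ 2) ^ 2) * φ x) (by fun_prop)
    (tsupport_mul_subset_of_subset hs _)
  obtain ⟨P₁, hi₁, hP₁, hPj₁⟩ := exists_jet_pairing (ℓ := ℓ) (m := 0 + 4) 1
    (ψ := fun x => ((ℓ ^ 2 - x ^ 2) ^ 2 * Dst ℓ 2 q.β x) * φ x) (by fun_prop)
    (tsupport_mul_subset_of_subset hs _)
  obtain ⟨P₂, hi₂, hP₂, hPj₂⟩ := exists_jet_pairing (ℓ := ℓ) (m := 0 + 4) 2
    (ψ := fun x => ((ℓ ^ 2 - x ^ 2) ^ 3 * q.β x) * φ x) (by fun_prop)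
    (tsupport_mul_subset_of_subset hs _)
  obtain ⟨P₃, hi₃, hP₃, hPj₃⟩ := exists_jet_pairing (ℓ := ℓ) (m := 0 + 4) 0
    (ψ := fun x => ((ℓ ^ 2 - x ^ 2) ^ 2 * q.γ x) * φ x) (by fun_prop)
    (tsupport_mul_subset_of_subset hs _)
  -- The definition of `ellOp` solved for its leading part. In this form the weak derivative
  -- involves only components of order at most two and the image `ellH w`.
  have h1 : P = P₀.comp (ellH q hm) + (P₁ + P₂) - P₃ := by
    refine clm_ext_jet hℓ fun f => ?_
    have hf : ContDiff ℝ 4 (f : ℝ → ℝ) := by exact_mod_cast contDiff_Cm f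
    have hf' : ContDiff ℝ 3 (deriv (f : ℝ → ℝ)) :=
      contDiff_deriv (m := 3) (by exact_mod_cast hf)
    have hf0 := hf.continuous
    have hf1 := hf'.continuous
    have hf2 := hf'.continuous_deriv (by norm_num)
    have hA : ContDiff ℝ 2 fun x => q.α x * deriv (deriv (f : ℝ → ℝ)) x := by
      exact_mod_cast contDiff_mul_deriv_deriv (m := 2) (by exact_mod_cast hα)
        (by exact_mod_cast hf)
    have hB : ContDiff ℝ 1 (Dst ℓ 3 fun x => q.α x * deriv (deriv (f : ℝ → ℝ)) x) := by
      exact_mod_cast contDiff_Dst (m := 1) (by exact_mod_cast hA)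
    have hBf : ContDiff ℝ 1 fun x => q.β x * deriv (f : ℝ → ℝ) x :=
      hβ.mul (hf'.of_le (by norm_num))
    have hB' : Continuous (Dst ℓ 2 (Dst ℓ 3 fun x => q.α x * deriv (deriv (f : ℝ → ℝ)) x)) :=
      (contDiff_Dst (m := 0) (by exact_mod_cast hB)).continuous
    have hE : ∀ x, ellOp ℓ q.α q.β q.γ f x =
        Dst ℓ 2 (Dst ℓ 3 fun x => q.α x * deriv (deriv (f : ℝ → ℝ)) x) x -
        (Dst ℓ 2 q.β x * deriv (f : ℝ → ℝ) x +
          (ℓ ^ 2 - x ^ 2) * q.β x * deriv (deriv (f : ℝ → ℝ)) x) + q.γ x * (f : ℝ → ℝ) x := by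
      intro x
      rw [ellOp, show flux ℓ q.α q.β f = fun x =>
        Dst ℓ 3 (fun x => q.α x * deriv (deriv (f : ℝ → ℝ)) x) x +
          -1 * (q.β x * deriv (f : ℝ → ℝ) x) from rfl,
        Dst_add (hB.differentiable one_ne_zero)
          ((hBf.differentiable one_ne_zero).const_mul (-1)), Dst_smul]
      simp only [Dst]
      rw [deriv_fun_mul (hβ.differentiable one_ne_zero x) (hf'.differentiable (by norm_num) x)]
      ring
    have hEc : Continuous (ellOp ℓ q.α q.β q.γ f) := by
      rw [funext hE]
      fun_prop
    have e1 : (((1 : Fin (0 + 4 + 1)) : ℕ)) = 1 := rfl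
    have e2 : (((2 : Fin (0 + 4 + 1)) : ℕ)) = 2 := rfl
    have e0 : (((0 : Fin (0 + 4 + 1)) : ℕ)) = 0 := rfl
    have e3 : (((0 : Fin (0 + 1)) : ℕ)) = 0 := rfl
    have e4 : ((ellC q hm f : Cm 0) : ℝ → ℝ) = ellOp ℓ q.α q.β q.γ f := rfl
    rw [sub_apply, add_apply, add_apply, ContinuousLinearMap.comp_apply, ellH_jet hℓ, hPj, hPj₀,
      hPj₁, hPj₂, hPj₃, e0, e1, e2, e3, iteratedDeriv_two', iteratedDeriv_one, iteratedDeriv_zero,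
      iteratedDeriv_zero, e4,
      ← integral_add (integrableOn_Ioo_of_continuous (by fun_prop))
        (integrableOn_Ioo_of_continuous (by fun_prop)),
      ← integral_add (integrableOn_Ioo_of_continuous (by fun_prop))
        (integrableOn_Ioo_of_continuous (by fun_prop)),
      ← integral_sub (integrableOn_Ioo_of_continuous (by fun_prop))
        (integrableOn_Ioo_of_continuous (by fun_prop))]
    have h2 := integral_mul_deriv_of_tsupport hℓ
      (fun x => hasDerivAt_wt_pow_mul (ℓ := ℓ) (a := 3) (hA.differentiable (by norm_num)) x)
      (by have := hB.continuous; fun_prop) hφ' hs'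
    have h3 := integral_mul_deriv_of_tsupport hℓ
      (fun x => hasDerivAt_wt_pow_mul (ℓ := ℓ) (a := 2) (hB.differentiable one_ne_zero) x)
      (by fun_prop) hφ1 hs
    rw [h3, neg_neg] at h2
    refine Eq.trans ?_ (h2.trans ?_)
    · congr 1
      ext x
      ring
    · congr 1
      ext x
      rw [hE]
      ring
  have h12 := (hi₁ w).add (hi₂ w)
  simp only [Pi.add_def] at h12
  have h012 := (hi₀ (ellH q hm w)).add h12
  simp only [Pi.add_def] at h012
  have h2 := hP w
  rw [h1, sub_apply, add_apply, add_apply, ContinuousLinearMap.comp_apply, hP₀, hP₁, hP₂, hP₃,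
    ← integral_add (hi₁ w) (hi₂ w), ← integral_add (hi₀ _) h12, ← integral_sub h012 (hi₃ w)] at h2
  refine Eq.trans ?_ (h2.symm.trans ?_)
  · congr 1
    ext x
    ring
  · congr 1
    ext x
    ring

lemma HasWeakDeriv.congr {ℓ : ℝ} {n : ℕ} {f f' g : ℝ → ℝ} (h : HasWeakDeriv ℓ n f g)
    (hf : f =ᵐ[volume.restrict (Ioo (-ℓ) ℓ)] f') : HasWeakDeriv ℓ n f' g := by
  refine ⟨locallyIntegrableOn_congr h.1 hf, h.2.1, fun φ hφ hc hs => ?_⟩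
  rw [← h.2.2 φ hφ hc hs]
  refine integral_congr_ae ?_
  filter_upwards [hf] with x hx
  rw [hx]

/-- `mulH` is defined by extension from smooth functions; that it is pointwise multiplication is
verified against test functions. -/
lemma coeFn_mulH {ℓ : ℝ} (hℓ : 0 < ℓ) (u : Cm 0) (x : Hsp ℓ 0) :
    compL ℓ 0 0 (mulH ℓ u x) =ᵐ[volume.restrict (Ioo (-ℓ) ℓ)]
      fun y => (u : ℝ → ℝ) y * compL ℓ 0 0 x y := by
  have huc := (contDiff_Cm u).continuous
  have hloc : ∀ w : Hsp ℓ 0, LocallyIntegrableOn (compL ℓ 0 0 w) (Ioo (-ℓ) ℓ) := fun w =>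
    locallyIntegrableOn_coeFn _ _
  have h1 := isOpen_Ioo.ae_eq_zero_of_integral_contDiff_smul_eq_zero
    ((hloc (mulH ℓ u x)).sub ((hloc x).continuousOn_mul huc.continuousOn
      isOpen_Ioo.isLocallyClosed)) fun φ hφ hc hs => ?_
  · refine (ae_restrict_iff' measurableSet_Ioo).2 ?_
    filter_upwards [h1] with y hy hyI
    exact sub_eq_zero.1 (hy hyI)
  · have hφc := hφ.continuous
    obtain ⟨P, hi, hP, hPj⟩ := exists_jet_pairing (ℓ := ℓ) (m := 0) 0 (ψ := φ) hφc hs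
    obtain ⟨P', hi', hP', hPj'⟩ := exists_jet_pairing (ℓ := ℓ) (m := 0) 0
      (ψ := fun y => (u : ℝ → ℝ) y * φ y) (by fun_prop) (tsupport_mul_subset_of_subset hs _)
    have h2 : P.comp (mulH ℓ u) = P' := by
      refine clm_ext_jet hℓ fun f => ?_
      have e3 : (((0 : Fin (0 + 1)) : ℕ)) = 0 := rfl
      rw [ContinuousLinearMap.comp_apply, mulH_jet hℓ, hPj, hPj', e3, iteratedDeriv_zero,
        iteratedDeriv_zero]
      congr 1
      ext y
      simp only [mulC, LinearMap.coe_mk, AddHom.coe_mk]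
      ring
    have h3 : P (mulH ℓ u x) = P' x := by rw [← h2]; rfl
    rw [hP, hP', ← sub_eq_zero, ← integral_sub (hi _) (hi' _)] at h3
    rw [← setIntegral_eq_integral_of_forall_compl_eq_zero (s := Ioo (-ℓ) ℓ) fun y hy => by
      rw [image_eq_zero_of_notMem_tsupport fun h => hy (hs h), zero_smul]]
    rw [← h3]
    congr 1
    ext y
    simp only [Pi.sub_apply, smul_eq_mul]
    ring

/-- `𝓛` on `ℋ⁴` in terms of the elliptic operator. -/
lemma isLinOp_iff {ℓ : ℝ} (hℓ : 0 < ℓ) {M : ℕ} (q : Coefs ℓ M) (hm : 0 + 4 ≤ M) (u : Cm M)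
    {U : ℝ → ℝ} (hu : ∃ K c, 0 < c ∧ Coef ℓ K c M u)
    (hU : ∀ x ∈ Ioo (-ℓ) ℓ, U x = (ℓ ^ 2 - x ^ 2) ^ 2 * (u : ℝ → ℝ) x)
    (hPhi : ∀ x ∈ Ioo (-ℓ) ℓ, Phi U x = (ℓ ^ 2 - x ^ 2) ^ 3 * q.β x)
    (hα : ∀ x, q.α x = (u : ℝ → ℝ) x ^ 2) (hγ : ∀ x, q.γ x = (u : ℝ → ℝ) x / 5)
    (w : Hsp ℓ (0 + 4)) (f : L2w ℓ) :
    IsLinOp ℓ U (toL2w w) f ↔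
      mulH ℓ (inclC (Nat.zero_le M) u) ((baseE hℓ).symm f) = ellH q hm w := by
  have hβ : ContDiff ℝ 1 q.β := by exact_mod_cast (q.hβ.natLE (m := 1) (by lia)).smooth
  have hu0 : ∃ K c, 0 < c ∧ Coef ℓ K c 0 (inclC (Nat.zero_le M) u : Cm 0) := by
    obtain ⟨K, c, hc, hu⟩ := hu
    exact ⟨K, c, hc, hu.natLE (Nat.zero_le M)⟩
  have hupos : ∀ x ∈ Ioo (-ℓ) ℓ, 0 < (u : ℝ → ℝ) x := fun x hx => by
    obtain ⟨K, c, hc, hu⟩ := hu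
    exact hc.trans_le (hu.lower x (Ioo_subset_Icc_self hx))
  have hex : ∀ f : L2w ℓ, mulH ℓ (inclC (Nat.zero_le M) u) ((baseE hℓ).symm f) = ellH q hm w →
      IsLinOp ℓ U (toL2w w) f := by
    intro f hf
    have h1 := coeFn_mulH hℓ (inclC (Nat.zero_le M) u) ((baseE hℓ).symm f)
    rw [hf] at h1
    have h2 : compL ℓ 0 0 ((baseE hℓ).symm f) = f := (baseE hℓ).apply_symm_apply f
    rw [h2] at h1
    refine ⟨_, _, _, _, hasWeakDeriv_comp_one hℓ w, hasWeakDeriv_comp_two hℓ w,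
      (hasWeakDeriv_fourth_order hℓ q hm w).congr ?_,
      (hasWeakDeriv_second_order hℓ hβ w).congr ?_, ?_⟩
    · filter_upwards [ae_restrict_mem measurableSet_Ioo] with x hx
      rw [hU x hx, hα]
      ring
    · filter_upwards [ae_restrict_mem measurableSet_Ioo] with x hx
      rw [hPhi x hx]
    · filter_upwards [h1, ae_restrict_mem measurableSet_Ioo] with x h3 hx
      have h4 := hupos x hx
      have h5 : 0 < ℓ ^ 2 - x ^ 2 := by nlinarith [hx.1, hx.2]
      have h6 : compL ℓ (0 + 4) 0 w x = toL2w w x := rfl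
      have h7 : ((inclC (Nat.zero_le M) u : Cm 0) : ℝ → ℝ) x = (u : ℝ → ℝ) x := rfl
      rw [h3, hU x hx, h6, h7, hγ]
      field_simp
      ring
  refine ⟨fun h => ?_, hex f⟩
  -- Conversely, `u` being invertible, some function `x` solves the algebraic relation and is thus a
  -- value of `𝓛 w`; weak derivatives are unique, so `x = f`.
  obtain ⟨x, hx⟩ := (mulE hℓ _ hu0).surjective (ellH q hm w)
  have hx' : mulH ℓ (inclC (Nat.zero_le M) u) ((baseE hℓ).symm (baseE hℓ x)) = ellH q hm w := by
    rw [ContinuousLinearEquiv.symm_apply_apply]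
    exact hx
  have h1 := (hex _ hx').unique h
  have h2 : baseE hℓ x = f := Lp.ext (ae_wMeasure_iff.2 h1)
  rw [← h2]
  exact hx'

/-! ### Functions with values in `ℓ²` -/

/-- The sequence `x`, or `0` if it is not square summable. -/
def seqOf {ι : Type} (x : ι → ℝ) : Seq2 ι :=
  open Classical in if h : Summable fun n => x n ^ 2 then seqMk x h else 0

/-- The sum of the squares, with values in `[0, ∞]`. -/
def sqSum {ι : Type} (x : ι → ℝ) : ℝ≥0∞ := ∑' n, ENNReal.ofReal (x n ^ 2)

lemma seqOf_apply {ι : Type} {x : ι → ℝ} (h : Summable fun n => x n ^ 2) (n : ι) :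
    seqOf x n = x n := by
  rw [seqOf, dif_pos h, seqMk_apply]

lemma summable_of_sqSum_ne_top {ι : Type} {x : ι → ℝ} (h : sqSum x ≠ ⊤) :
    Summable fun n => x n ^ 2 := by
  have := ENNReal.summable_toReal h
  simpa [ENNReal.toReal_ofReal, sq_nonneg] using this

lemma enorm_sq_eq_sqSum {ι : Type} (x : Seq2 ι) : ‖x‖ₑ ^ 2 = sqSum (fun n => x n) := by
  have h := hasSum_sq x
  rw [sqSum, ← ENNReal.ofReal_tsum_of_nonneg (fun n => sq_nonneg _) h.summable, h.tsum_eq,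
    ENNReal.ofReal_pow (norm_nonneg _), ofReal_norm]

lemma enorm_sq_seqOf {ι : Type} {x : ι → ℝ} (h : Summable fun n => x n ^ 2) :
    ‖seqOf x‖ₑ ^ 2 = sqSum x := by
  rw [enorm_sq_eq_sqSum]
  congr 1
  ext n
  exact seqOf_apply h n

lemma enorm_sq_seqOf_le {ι : Type} (x : ι → ℝ) : ‖seqOf x‖ₑ ^ 2 ≤ sqSum x := by
  by_cases h : Summable fun n => x n ^ 2
  · exact (enorm_sq_seqOf h).le
  · rw [seqOf, dif_neg h]
    simp

lemma sqSum_const_mul {ι : Type} (c : ℝ) (x : ι → ℝ) :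
    sqSum (fun n => c * x n) = ENNReal.ofReal (c ^ 2) * sqSum x := by
  rw [sqSum, sqSum, ← ENNReal.tsum_mul_left]
  congr 1
  ext n
  rw [mul_pow, ENNReal.ofReal_mul (sq_nonneg c)]

lemma aestronglyMeasurable_seqOf {ι : Type} [Countable ι] {m : Measure ℝ} {x : ι → ℝ → ℝ}
    (hx : ∀ n, AEStronglyMeasurable (x n) m)
    (h : ∀ᵐ s ∂m, Summable fun n => x n s ^ 2) :
    AEStronglyMeasurable (fun s => seqOf fun n => x n s) m := by
  classical
  refine aestronglyMeasurable_of_tendsto_ae (ι := Finset ι) Filter.atTop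
    (f := fun t s => ∑ n ∈ t, lp.single (E := fun _ : ι => ℝ) 2 n (x n s)) (fun t => ?_) ?_
  · refine Finset.aestronglyMeasurable_fun_sum t fun n _ => ?_
    exact (lp.isometry_single (E := fun _ : ι => ℝ) (p := 2) n).continuous.comp_aestronglyMeasurable
      (hx n)
  · filter_upwards [h] with s hs
    have h1 := lp.hasSum_single (E := fun _ : ι => ℝ) (p := 2) (by simp) (seqOf fun n => x n s)
    simp only [seqOf_apply hs] at h1
    exact h1

lemma aemeasurable_sqSum {ι : Type} [Countable ι] {m : Measure ℝ} {x : ι → ℝ → ℝ}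
    (hx : ∀ n, AEStronglyMeasurable (x n) m) : AEMeasurable (fun s => sqSum fun n => x n s) m :=
  AEMeasurable.tsum fun n => ((hx n).aemeasurable.pow_const 2).ennreal_ofReal

lemma ae_summable {ι : Type} [Countable ι] {m : Measure ℝ} {x : ι → ℝ → ℝ}
    (hx : ∀ n, AEStronglyMeasurable (x n) m) (h : ∫⁻ s, sqSum (fun n => x n s) ∂m ≠ ⊤) :
    ∀ᵐ s ∂m, Summable fun n => x n s ^ 2 := by
  filter_upwards [ae_lt_top' (aemeasurable_sqSum hx) h] with s hs
  exact summable_of_sqSum_ne_top hs.ne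

lemma memLp_seqOf {ι : Type} [Countable ι] {m : Measure ℝ} {x : ι → ℝ → ℝ}
    (hx : ∀ n, AEStronglyMeasurable (x n) m) (h : ∫⁻ s, sqSum (fun n => x n s) ∂m ≠ ⊤) :
    MemLp (fun s => seqOf fun n => x n s) 2 m := by
  refine ⟨aestronglyMeasurable_seqOf hx (ae_summable hx h), ?_⟩
  rw [eLpNorm_lt_top_iff_lintegral_rpow_enorm_lt_top (by simp) (by simp)]
  refine lt_of_le_of_lt (lintegral_mono fun s => ?_) h.lt_top
  simpa using enorm_sq_seqOf_le fun n => x n s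

/-- Dominated convergence for series: coordinatewise continuity and a summable majorant independent
of `s`. -/
lemma continuousOn_seqOf {ι : Type} {T : Set ℝ} {x : ι → ℝ → ℝ} (hx : ∀ n, ContinuousOn (x n) T)
    {b : ι → ℝ} (hb : Summable b) (hxb : ∀ n, ∀ s ∈ T, x n s ^ 2 ≤ b n) :
    ContinuousOn (fun s => seqOf fun n => x n s) T := by
  have hs : ∀ s ∈ T, Summable fun n => x n s ^ 2 := fun s hs =>
    hb.of_nonneg_of_le (fun n => sq_nonneg _) fun n => hxb n s hs
  intro s₀ hs₀
  refine tendsto_iff_norm_sub_tendsto_zero.2 ?_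
  have key : Filter.Tendsto (fun s => ∑' n, (x n s - x n s₀) ^ 2) (nhdsWithin s₀ T) (nhds 0) := by
    rw [← tsum_zero (α := ℝ) (β := ι)]
    refine tendsto_tsum_of_dominated_convergence (bound := fun n => 4 * b n) (hb.mul_left 4)
      (fun n => ?_) ?_
    · have h1 : Filter.Tendsto (x n) (nhdsWithin s₀ T) (nhds (x n s₀)) := hx n s₀ hs₀
      have h2 : Filter.Tendsto (fun s => (x n s - x n s₀) ^ 2) (nhdsWithin s₀ T)
          (nhds ((x n s₀ - x n s₀) ^ 2)) := Filter.Tendsto.pow (h1.sub_const (x n s₀)) 2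
      rwa [sub_self, zero_pow two_ne_zero] at h2
    · filter_upwards [self_mem_nhdsWithin] with s hs n
      rw [Real.norm_eq_abs, abs_of_nonneg (sq_nonneg _)]
      nlinarith [hxb n s hs, hxb n s₀ hs₀, sq_nonneg (x n s + x n s₀)]
  have h2 := (Real.continuous_sqrt.tendsto _).comp key
  rw [Real.sqrt_zero] at h2
  refine h2.congr' ?_
  filter_upwards [self_mem_nhdsWithin] with s hs'
  rw [Function.comp_apply, ← Real.sqrt_sq (norm_nonneg (seqOf (fun n => x n s) - _)),
    ← (hasSum_sq _).tsum_eq]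
  congr 2
  ext n
  rw [lp.coeFn_sub, Pi.sub_apply, seqOf_apply (hs s hs'), seqOf_apply (hs s₀ hs₀)]

/-! ### The equation `a' = -μ a + f` -/

/-- The solution of `a' = -μ a + f` with `a(0) = a₀`. -/
def mode (μ a₀ : ℝ) (f : ℝ → ℝ) (s : ℝ) : ℝ :=
  Real.exp (-μ * s) * (a₀ + ∫ r in (0 : ℝ)..s, Real.exp (μ * r) * f r)

lemma mode_zero (μ a₀ : ℝ) (f : ℝ → ℝ) : mode μ a₀ f 0 = a₀ := by
  simp [mode]

lemma intervalIntegrable_of_memLp {f : ℝ → ℝ} (hf : MemLp f 2 (volume.restrict (Ioi 0)))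
    {T : ℝ} (hT : 0 ≤ T) : IntervalIntegrable f volume 0 T ∧
      IntervalIntegrable (fun x => f x ^ 2) volume 0 T := by
  have hsub : Ioc 0 T ⊆ Ioi 0 := fun x hx => hx.1
  have h1 : MemLp f 2 (volume.restrict (Ioc 0 T)) :=
    hf.mono_measure (Measure.restrict_mono hsub le_rfl)
  rw [intervalIntegrable_iff_integrableOn_Ioc_of_le hT,
    intervalIntegrable_iff_integrableOn_Ioc_of_le hT]
  exact ⟨h1.integrable one_le_two, h1.integrable_sq⟩

/-- As `f` is only square integrable, the equation holds almost everywhere, and absolute continuity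
replaces differentiability in the integrations by parts. -/
lemma mode_ac {f : ℝ → ℝ} (hf : MemLp f 2 (volume.restrict (Ioi 0))) (μ a₀ : ℝ) {T : ℝ}
    (hT : 0 ≤ T) : AbsolutelyContinuousOnInterval (mode μ a₀ f) 0 T ∧
      ∀ᵐ x, x ∈ uIcc 0 T → HasDerivAt (mode μ a₀ f) (f x - μ * mode μ a₀ f x) x := by
  have hi : IntervalIntegrable (fun r => Real.exp (μ * r) * f r) volume 0 T :=
    (intervalIntegrable_of_memLp hf hT).1.continuousOn_mul (by fun_prop)
  have h1 : AbsolutelyContinuousOnInterval (fun s => Real.exp (-μ * s)) 0 T :=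
    ContDiffOn.absolutelyContinuousOnInterval (by fun_prop)
  have h2 : AbsolutelyContinuousOnInterval (fun _ => a₀) 0 T :=
    ContDiffOn.absolutelyContinuousOnInterval (by fun_prop)
  have h3 := hi.absolutelyContinuousOnInterval_intervalIntegral (c := 0) left_mem_uIcc
  refine ⟨h1.mul (h2.add h3), ?_⟩
  filter_upwards [hi.ae_hasDerivAt_integral] with x hx hxT
  have h4 := (hx hxT 0 left_mem_uIcc).const_add a₀
  have h5 : HasDerivAt (fun s => Real.exp (-μ * s)) (Real.exp (-μ * x) * -μ) x := by
    simpa using ((hasDerivAt_id x).const_mul (-μ)).exp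
  refine (h5.mul h4).congr_deriv ?_
  have h6 : Real.exp (-μ * x) * Real.exp (μ * x) = 1 := by
    rw [← Real.exp_add]; simp
  rw [mode]
  linear_combination f x * h6

lemma mode_continuousOn {f : ℝ → ℝ} (hf : MemLp f 2 (volume.restrict (Ioi 0))) (μ a₀ : ℝ) :
    ContinuousOn (mode μ a₀ f) (Ici 0) := by
  intro s hs
  have hs : (0 : ℝ) ≤ s := hs
  have h1 := (mode_ac hf μ a₀ (T := s + 1) (by linarith)).1.continuousOn
  rw [uIcc_of_le (by linarith)] at h1
  refine (h1 s ⟨hs, by linarith⟩).mono_of_mem_nhdsWithin ?_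
  rw [← Ici_inter_Iic]
  exact Filter.inter_mem self_mem_nhdsWithin
    (mem_nhdsWithin_of_mem_nhds (Iic_mem_nhds (by linarith)))

/-- Integrate the derivative of `s^i a²` and use `2 a f ≤ μ a² + μ⁻¹ f²`. Differentiating the weight
leaves a term with `s^(i-1)`; for `i = 0` its factor `i` vanishes, so the truncated exponent is
harmless. -/
lemma mode_energy {f : ℝ → ℝ} (hf : MemLp f 2 (volume.restrict (Ioi 0))) {μ : ℝ} (hμ : 0 < μ)
    (a₀ : ℝ) (i : ℕ) {T : ℝ} (hT : 0 ≤ T) :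
    T ^ i * mode μ a₀ f T ^ 2 + μ * ∫ r in (0 : ℝ)..T, r ^ i * mode μ a₀ f r ^ 2 ≤
      (if i = 0 then a₀ ^ 2 else 0) + i * (∫ r in (0 : ℝ)..T, r ^ (i - 1) * mode μ a₀ f r ^ 2) +
        μ⁻¹ * ∫ r in (0 : ℝ)..T, r ^ i * f r ^ 2 := by
  obtain ⟨hac, hd⟩ := mode_ac hf μ a₀ hT
  have hc := hac.continuousOn
  set a := mode μ a₀ f with ha
  have ha2 : AbsolutelyContinuousOnInterval (fun s => s ^ i * (a s * a s)) 0 T :=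
    (ContDiffOn.absolutelyContinuousOnInterval (f := fun s : ℝ => s ^ i) (by fun_prop)).fun_mul
      (hac.fun_mul hac)
  have hint := ha2.integral_deriv_eq_sub
  have hi1 : ∀ j : ℕ, IntervalIntegrable (fun r => r ^ j * a r ^ 2) volume 0 T := fun j =>
    ContinuousOn.intervalIntegrable (by fun_prop)
  have hi2 : IntervalIntegrable (fun r => r ^ i * f r ^ 2) volume 0 T :=
    (intervalIntegrable_of_memLp hf hT).2.continuousOn_mul (by fun_prop)
  have hmono : ∫ r in (0 : ℝ)..T, deriv (fun s => s ^ i * (a s * a s)) r ≤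
      ∫ r in (0 : ℝ)..T, (i * (r ^ (i - 1) * a r ^ 2) - μ * (r ^ i * a r ^ 2) +
        μ⁻¹ * (r ^ i * f r ^ 2)) := by
    refine intervalIntegral.integral_mono_ae_restrict hT ha2.intervalIntegrable_deriv
      ((((hi1 _).const_mul _).sub ((hi1 _).const_mul _)).add (hi2.const_mul _)) ?_
    refine (ae_restrict_iff' measurableSet_Icc).2 ?_
    filter_upwards [hd] with x hx hxT
    rw [uIcc_of_le hT] at hx
    have h1 := hx hxT
    rw [((hasDerivAt_pow i x).fun_mul (h1.fun_mul h1)).deriv]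
    have h2 : 0 ≤ x ^ i := pow_nonneg hxT.1 i
    have h3 : 2 * (a x * f x) ≤ μ * a x ^ 2 + μ⁻¹ * f x ^ 2 := by
      have h4 := mul_nonneg (inv_nonneg.2 hμ.le) (sq_nonneg (μ * a x - f x))
      have h5 : μ⁻¹ * (μ * a x - f x) ^ 2 = μ * a x ^ 2 + μ⁻¹ * f x ^ 2 - 2 * (a x * f x) := by
        field_simp
        ring
      linarith
    nlinarith [mul_le_mul_of_nonneg_left h3 h2]
  rw [hint, intervalIntegral.integral_add (((hi1 _).const_mul _).sub ((hi1 _).const_mul _))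
    (hi2.const_mul _), intervalIntegral.integral_sub ((hi1 _).const_mul _) ((hi1 _).const_mul _),
    intervalIntegral.integral_const_mul, intervalIntegral.integral_const_mul,
    intervalIntegral.integral_const_mul] at hmono
  have h0 : (0 : ℝ) ^ i * (a 0 * a 0) = if i = 0 then a₀ ^ 2 else 0 := by
    rw [ha, mode_zero]
    split_ifs with h
    · rw [h]; ring
    · rw [zero_pow h, zero_mul]
  rw [h0] at hmono
  linarith

/-- The inequality of weight `i` has `i Y (i - 1)` on the right, already bounded at the preceding
weight, so the bounds accumulate by induction. -/
lemma exists_sum_bound (K : ℕ) : ∃ C : ℝ, 1 ≤ C ∧ ∀ (X Y Z : ℕ → ℝ) (p : ℝ), 0 ≤ p →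
    (∀ i, 0 ≤ X i) → (∀ i, 0 ≤ Y i) → (∀ i, 0 ≤ Z i) →
    (∀ i, X i + Y i ≤ (if i = 0 then p else 0) + i * Y (i - 1) + Z i) →
    ∑ i ∈ Finset.range K, (X i + Y i) ≤ C * (p + ∑ i ∈ Finset.range K, Z i) := by
  induction K with
  | zero => exact ⟨1, le_rfl, fun X Y Z p hp _ _ _ _ => by simpa using hp⟩
  | succ K ih =>
    obtain ⟨C, hC, h⟩ := ih
    refine ⟨C + K * C + 1, by nlinarith [(Nat.cast_nonneg K : (0 : ℝ) ≤ K)], fun X Y Z p hp hX hY hZ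
      hXY => ?_⟩
    have h1 := h X Y Z p hp hX hY hZ hXY
    rw [Finset.sum_range_succ, Finset.sum_range_succ]
    set S := ∑ i ∈ Finset.range K, Z i with hS
    have hS0 : 0 ≤ S := Finset.sum_nonneg fun i _ => hZ i
    have hK : (0 : ℝ) ≤ K := Nat.cast_nonneg K
    have h2 := hXY K
    have h3 : (K : ℝ) * Y (K - 1) ≤ K * (C * (p + S)) := by
      rcases Nat.eq_zero_or_pos K with h0 | h0
      · subst h0; simp
      · refine mul_le_mul_of_nonneg_left (le_trans ?_ h1) hK
        refine le_trans (le_add_of_nonneg_left (hX (K - 1))) (Finset.single_le_sum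
          (f := fun i => X i + Y i) (fun i _ => add_nonneg (hX i) (hY i))
          (Finset.mem_range.2 (Nat.sub_lt h0 one_pos)))
    have h4 : (if K = 0 then p else 0) ≤ p := by split_ifs <;> linarith
    have h5 := mul_nonneg hK (mul_nonneg (zero_le_one.trans hC) (hZ K))
    have h6 := mul_nonneg (zero_le_one.trans hC) (hZ K)
    nlinarith [hZ K]

/-- Multiplied by `μ^(i+3)`, the term of weight `i - 1` in `mode_energy` becomes exactly `i` times
the dissipation at weight `i - 1`. Hence the constant does not depend on `μ`, and the estimate can
be summed over modes. -/
lemma mode_bound (K : ℕ) : ∃ C : ℝ, 1 ≤ C ∧ ∀ (f : ℝ → ℝ),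
    MemLp f 2 (volume.restrict (Ioi 0)) → ∀ (μ a₀ T : ℝ), 0 < μ → 0 ≤ T →
    ∑ i ∈ Finset.range K, (T ^ i * (μ ^ (i + 3) * mode μ a₀ f T ^ 2) +
        ∫ r in (0 : ℝ)..T, r ^ i * (μ ^ (i + 4) * mode μ a₀ f r ^ 2)) ≤
      C * (μ ^ 3 * a₀ ^ 2 + ∑ i ∈ Finset.range K,
        ∫ r in (0 : ℝ)..T, r ^ i * (μ ^ (i + 2) * f r ^ 2)) := by
  obtain ⟨C, hC, h⟩ := exists_sum_bound K
  refine ⟨C, hC, fun f hf μ a₀ T hμ hT => h _ _ _ _ (by positivity) (fun i => by positivity)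
    (fun i => ?_) (fun i => ?_) fun i => ?_⟩
  · refine intervalIntegral.integral_nonneg hT fun r hr => ?_
    have := hr.1
    positivity
  · refine intervalIntegral.integral_nonneg hT fun r hr => ?_
    have := hr.1
    positivity
  · have h1 := mul_le_mul_of_nonneg_left (mode_energy hf hμ a₀ i hT) (pow_pos hμ (i + 3)).le
    have e : ∀ (j l : ℕ) (g : ℝ → ℝ), ∫ r in (0 : ℝ)..T, r ^ j * (μ ^ l * g r ^ 2) =
        μ ^ l * ∫ r in (0 : ℝ)..T, r ^ j * g r ^ 2 := fun j l g => by
      rw [← intervalIntegral.integral_const_mul]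
      congr 1
      ext r
      ring
    rw [e, e, e]
    have h2 : μ ^ (i + 3) * μ⁻¹ = μ ^ (i + 2) := by
      rw [pow_succ μ (i + 2), mul_assoc, mul_inv_cancel₀ hμ.ne', mul_one]
    rcases Nat.eq_zero_or_pos i with h0 | h0
    · subst h0
      simp only [if_true, Nat.cast_zero, zero_mul, add_zero] at h1 ⊢
      calc _ = μ ^ (0 + 3) * (T ^ 0 * mode μ a₀ f T ^ 2 +
            μ * ∫ r in (0 : ℝ)..T, r ^ 0 * mode μ a₀ f r ^ 2) := by ring
        _ ≤ _ := h1
        _ = _ := by rw [mul_add, ← mul_assoc, h2]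
    · rw [if_neg h0.ne'] at h1 ⊢
      have h3 : i - 1 + 4 = i + 3 := by omega
      rw [h3]
      calc _ = μ ^ (i + 3) * (T ^ i * mode μ a₀ f T ^ 2 +
            μ * ∫ r in (0 : ℝ)..T, r ^ i * mode μ a₀ f r ^ 2) := by ring
        _ ≤ _ := h1
        _ = _ := by rw [mul_add, ← mul_assoc (μ ^ (i + 3)) μ⁻¹, h2]; ring

lemma mode_weak_deriv {f : ℝ → ℝ} (hf : MemLp f 2 (volume.restrict (Ioi 0))) (μ a₀ : ℝ)
    {φ : ℝ → ℝ} (hφ : ContDiff ℝ ∞ φ) (hc : HasCompactSupport φ) (hs : tsupport φ ⊆ Ioi 0) :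
    ∫ s in Ioi (0 : ℝ), deriv φ s * mode μ a₀ f s =
      -∫ s in Ioi (0 : ℝ), φ s * (f s - μ * mode μ a₀ f s) := by
  obtain ⟨T, hT⟩ := hc.isCompact.bddAbove
  set T' := max T 0 + 1 with hT'
  have hT0 : 0 ≤ T' := by positivity
  have hφ1 : ContDiff ℝ 1 φ := hφ.of_le (by exact_mod_cast le_top)
  have hz : ∀ s, s ∉ Ioc 0 T' → s ∉ tsupport φ := fun s hsn hmem => hsn
    ⟨hs hmem, (hT hmem).trans (by rw [hT']; linarith [le_max_left T 0])⟩
  have h0 : ∀ s, s ∉ Ioc 0 T' → φ s = 0 := fun s h => image_eq_zero_of_notMem_tsupport (hz s h)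
  have h0' : ∀ s, s ∉ Ioc 0 T' → deriv φ s = 0 := fun s h =>
    image_eq_zero_of_notMem_tsupport fun h' => hz s h (tsupport_deriv_subset h')
  have hset : ∀ g : ℝ → ℝ, (∀ s, s ∉ Ioc 0 T' → g s = 0) →
      ∫ s in Ioi (0 : ℝ), g s = ∫ s in (0 : ℝ)..T', g s := fun g hg => by
    rw [intervalIntegral.integral_of_le hT0]
    exact (setIntegral_eq_of_subset_of_forall_sdiff_eq_zero measurableSet_Ioi
      (fun x hx => hx.1) fun x hx => hg x hx.2)
  obtain ⟨hac, hd⟩ := mode_ac hf μ a₀ hT0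
  have hφac : AbsolutelyContinuousOnInterval φ 0 T' := hφ1.contDiffOn.absolutelyContinuousOnInterval
  have h1 := hac.integral_mul_deriv_eq_deriv_mul hφac
  rw [h0 0 (fun h => lt_irrefl _ h.1), mul_zero] at h1
  have hT'φ : φ T' = 0 := image_eq_zero_of_notMem_tsupport fun h => by
    have := hT h
    have := le_max_left T 0
    rw [hT'] at *
    linarith
  rw [hT'φ, mul_zero, sub_zero, zero_sub] at h1
  rw [hset _ fun s h => by rw [h0' s h, zero_mul], hset _ fun s h => by rw [h0 s h, zero_mul]]
  refine Eq.trans ?_ (h1.trans ?_)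
  · congr 1
    ext s
    ring
  · congr 1
    refine intervalIntegral.integral_congr_ae ?_
    filter_upwards [hd] with x hx hxT
    rw [(hx (uIoc_subset_uIcc hxT)).deriv]
    ring

/-! ### Uniqueness for the weak equation `a' = -μ a + f` -/

lemma integrable_smul_of_tsupport {E : Type} [NormedAddCommGroup E] [NormedSpace ℝ E]
    {g : ℝ → E} (hg : LocallyIntegrableOn g (Ioi 0)) {φ : ℝ → ℝ} (hφ : Continuous φ)
    (hc : HasCompactSupport φ) (hs : tsupport φ ⊆ Ioi 0) :
    Integrable (fun s => φ s • g s) (volume.restrict (Ioi 0)) := by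
  have h1 : IntegrableOn (fun x => φ x • g x) (tsupport φ) :=
    (hg.integrableOn_compact_subset hs hc).continuousOn_smul hφ.continuousOn hc
  have h2 : Integrable (fun x => φ x • g x) := by
    rwa [integrableOn_iff_integrable_of_support_subset] at h1
    exact fun x hx => subset_tsupport φ (fun h0 => hx (by simp [h0]))
  exact h2.restrict

lemma exists_test_primitive {φ : ℝ → ℝ} (hφ : ContDiff ℝ ∞ φ) (hc : HasCompactSupport φ)
    (hs : tsupport φ ⊆ Ioi 0) (hi : ∫ x, φ x = 0) :
    ∃ ψ : ℝ → ℝ, ContDiff ℝ ∞ ψ ∧ HasCompactSupport ψ ∧ tsupport ψ ⊆ Ioi 0 ∧ deriv ψ = φ := by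
  obtain ⟨a, b, ha, hab⟩ : ∃ a b : ℝ, 0 < a ∧ tsupport φ ⊆ Icc a b := by
    rcases (tsupport φ).eq_empty_or_nonempty with h | h
    · exact ⟨1, 1, one_pos, by rw [h]; exact empty_subset _⟩
    · obtain ⟨a, ha, hmin⟩ := hc.isCompact.exists_isLeast h
      obtain ⟨b, hb⟩ := hc.isCompact.bddAbove
      exact ⟨a, b, hs ha, fun x hx => ⟨hmin hx, hb hx⟩⟩
  have h0 : ∀ x, x ∉ Icc a b → φ x = 0 := fun x hx =>
    image_eq_zero_of_notMem_tsupport fun h => hx (hab h)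
  have hd := hasDerivAt_primitive hφ.continuous 0
  have hsupp : Function.support (fun x => ∫ y in (0 : ℝ)..x, φ y) ⊆ Icc a b := by
    intro x hx
    by_contra hxn
    refine hx ?_
    rcases lt_or_ge x a with hxa | hxa
    · refine intervalIntegral.integral_zero_ae (Filter.Eventually.of_forall fun y hy => h0 y ?_)
      intro hy'
      rw [uIoc, mem_Ioc] at hy
      exact absurd (hy'.1.trans hy.2) (not_le.2 (max_lt ha hxa))
    · have hxb : b < x := by
        by_contra h
        exact hxn ⟨hxa, not_lt.1 h⟩
      have hx0 : 0 ≤ x := ha.le.trans hxa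
      change ∫ y in (0 : ℝ)..x, φ y = 0
      rw [intervalIntegral.integral_of_le hx0]
      refine (setIntegral_eq_integral_of_forall_compl_eq_zero fun y hy =>
        h0 y fun hy' => hy ?_).trans hi
      exact ⟨ha.trans_le hy'.1, hy'.2.trans hxb.le⟩
  have hts : tsupport (fun x => ∫ y in (0 : ℝ)..x, φ y) ⊆ Icc a b :=
    closure_minimal hsupp isClosed_Icc
  have hderiv : deriv (fun x => ∫ y in (0 : ℝ)..x, φ y) = φ := funext fun x => (hd x).deriv
  refine ⟨_, contDiff_infty_iff_deriv.2 ⟨fun x => (hd x).differentiableAt, by rwa [hderiv]⟩,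
    isCompact_Icc.of_isClosed_subset (isClosed_tsupport _) hts,
    hts.trans fun x hx => ha.trans_le hx.1, hderiv⟩

/-- Du Bois-Reymond: with `χ` a test function of integral one, `φ - (∫ φ) χ` is the derivative of a
test function, so `y` pairs with every `φ` as the constant `∫ χ y` does. Continuity up to `0` fixes
that constant as `y 0`. -/
lemma eq_of_weak_deriv_zero {y : ℝ → ℝ} (hy : ContinuousOn y (Ici 0))
    (h : ∀ φ : ℝ → ℝ, ContDiff ℝ ∞ φ → HasCompactSupport φ → tsupport φ ⊆ Ioi 0 →
      ∫ s in Ioi (0 : ℝ), deriv φ s * y s = 0) : ∀ s, 0 ≤ s → y s = y 0 := by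
  have hyl : LocallyIntegrableOn y (Ioi 0) :=
    (hy.mono Ioi_subset_Ici_self).locallyIntegrableOn measurableSet_Ioi
  -- Supported in `[1, 3]`, hence away from `s = 0`.
  let bump : ContDiffBump (2 : ℝ) := ⟨1 / 2, 1, by norm_num, by norm_num⟩
  set χ : ℝ → ℝ := bump.normed volume with hχ
  have hχs : ContDiff ℝ ∞ χ := bump.contDiff_normed
  have hχc : HasCompactSupport χ := bump.hasCompactSupport_normed
  have hχt : tsupport χ ⊆ Ioi 0 := by
    rw [hχ, bump.tsupport_normed_eq, Real.closedBall_eq_Icc]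
    intro x hx
    have : (1 : ℝ) ≤ x := by
      have := hx.1
      norm_num [bump] at this
      exact this
    exact one_pos.trans_le this
  have hχi : ∫ x, χ x = 1 := bump.integral_normed
  set c := ∫ s in Ioi (0 : ℝ), χ s * y s with hcdef
  have key : ∀ φ : ℝ → ℝ, ContDiff ℝ ∞ φ → HasCompactSupport φ → tsupport φ ⊆ Ioi 0 →
      ∫ s in Ioi (0 : ℝ), φ s * y s = (∫ x, φ x) * c := by
    intro φ hφ hc hs
    set I := ∫ x, φ x with hI
    have hsub : tsupport (fun x => φ x - I * χ x) ⊆ tsupport φ ∪ tsupport χ := by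
      refine (tsupport_sub _ _).trans (union_subset_union_right _ ?_)
      exact tsupport_mul_subset_right
    have hcs : HasCompactSupport fun x => φ x - I * χ x :=
      (hc.isCompact.union hχc.isCompact).of_isClosed_subset (isClosed_tsupport _) hsub
    have hi1 : Integrable φ := hφ.continuous.integrable_of_hasCompactSupport hc
    have hi2 : Integrable χ := hχs.continuous.integrable_of_hasCompactSupport hχc
    obtain ⟨ψ, hψ, hψc, hψs, hψd⟩ := exists_test_primitive
      (φ := fun x => φ x - I * χ x) (hφ.sub (contDiff_const.mul hχs)) hcs
      (hsub.trans (union_subset hs hχt)) (by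
        rw [integral_sub hi1 (hi2.const_mul I), integral_const_mul, hχi, mul_one, sub_self])
    have h1 := h ψ hψ hψc hψs
    rw [hψd] at h1
    have h2 := integrable_smul_of_tsupport hyl hφ.continuous hc hs
    have h3 := (integrable_smul_of_tsupport hyl hχs.continuous hχc hχt).const_mul I
    simp only [smul_eq_mul] at h2 h3
    have h4 : ∫ s in Ioi (0 : ℝ), (φ s - I * χ s) * y s =
        (∫ s in Ioi (0 : ℝ), φ s * y s) - I * c := by
      rw [hcdef, ← integral_const_mul, ← integral_sub h2 h3]
      congr 1
      ext s
      ring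
    rw [h4] at h1
    linarith
  have hconst : ∀ᵐ x, x ∈ Ioi (0 : ℝ) → y x - c = 0 := by
    refine isOpen_Ioi.ae_eq_zero_of_integral_contDiff_smul_eq_zero (f := fun x => y x - c)
      (hyl.sub (continuousOn_const.locallyIntegrableOn measurableSet_Ioi)) fun φ hφ hc hs => ?_
    have h1 := key φ hφ hc hs
    have h2 := integrable_smul_of_tsupport hyl hφ.continuous hc hs
    have hz : ∀ x, x ∉ Ioi (0 : ℝ) → φ x = 0 := fun x hx =>
      image_eq_zero_of_notMem_tsupport fun h => hx (hs h)
    have hi1 : Integrable φ := hφ.continuous.integrable_of_hasCompactSupport hc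
    rw [← setIntegral_eq_integral_of_forall_compl_eq_zero (s := Ioi 0) fun x hx => by
      rw [hz x hx, zero_smul]]
    rw [← setIntegral_eq_integral_of_forall_compl_eq_zero hz] at h1
    simp only [smul_eq_mul, mul_sub] at h2 ⊢
    rw [integral_sub h2 (hi1.restrict.mul_const c), h1, integral_mul_const, sub_self]
  have heq : EqOn y (fun _ => c) (Ioi 0) := by
    refine Measure.eqOn_open_of_ae_eq (μ := volume) ?_ isOpen_Ioi (hy.mono Ioi_subset_Ici_self)
      continuousOn_const
    refine (ae_restrict_iff' measurableSet_Ioi).2 ?_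
    filter_upwards [hconst] with x hx hx0
    exact sub_eq_zero.1 (hx hx0)
  have heq' : EqOn y (fun _ => c) (Ici 0) :=
    heq.of_subset_closure hy continuousOn_const Ioi_subset_Ici_self (by rw [closure_Ioi])
  intro s hs
  exact (heq' hs).trans (heq' (mem_Ici.2 le_rfl)).symm

/-- Integrating factor in weak form: testing with `exp (μ s) φ` shows that `exp (μ s) z` has zero
weak derivative. -/
lemma eq_zero_of_weak_ode {z : ℝ → ℝ} {μ : ℝ} (hz : ContinuousOn z (Ici 0)) (h0 : z 0 = 0)
    (h : ∀ φ : ℝ → ℝ, ContDiff ℝ ∞ φ → HasCompactSupport φ → tsupport φ ⊆ Ioi 0 →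
      ∫ s in Ioi (0 : ℝ), deriv φ s * z s = μ * ∫ s in Ioi (0 : ℝ), φ s * z s) :
    ∀ s, 0 ≤ s → z s = 0 := by
  have hzl : LocallyIntegrableOn z (Ioi 0) :=
    (hz.mono Ioi_subset_Ici_self).locallyIntegrableOn measurableSet_Ioi
  have h1 := eq_of_weak_deriv_zero (y := fun s => Real.exp (μ * s) * z s)
    (ContinuousOn.mul (by fun_prop) hz) fun φ hφ hc hs => by
      have hE : ContDiff ℝ ∞ fun s => Real.exp (μ * s) := by fun_prop
      have hsub : tsupport (fun s => Real.exp (μ * s) * φ s) ⊆ tsupport φ :=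
        tsupport_mul_subset_right
      have hψ := hE.mul hφ
      have hψc : HasCompactSupport fun s => Real.exp (μ * s) * φ s :=
        hc.isCompact.of_isClosed_subset (isClosed_tsupport _) hsub
      have h2 := h _ hψ hψc (hsub.trans hs)
      have hd : ∀ s, deriv (fun s => Real.exp (μ * s) * φ s) s =
          μ * (Real.exp (μ * s) * φ s) + Real.exp (μ * s) * deriv φ s := fun s => by
        have h5 : HasDerivAt (fun s => Real.exp (μ * s)) (Real.exp (μ * s) * μ) s := by
          simpa using ((hasDerivAt_id s).const_mul μ).exp
        rw [(h5.fun_mul (hφ.differentiable (by simp) s).hasDerivAt).deriv]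
        ring
      have hi1 := (integrable_smul_of_tsupport hzl hψ.continuous hψc (hsub.trans hs)).const_mul μ
      have hφ1 : ContDiff ℝ 1 φ := hφ.of_le (by exact_mod_cast le_top)
      have hsub' : tsupport (fun s => Real.exp (μ * s) * deriv φ s) ⊆ tsupport φ :=
        tsupport_mul_subset_right.trans tsupport_deriv_subset
      have hi2 := integrable_smul_of_tsupport hzl
        (φ := fun s => Real.exp (μ * s) * deriv φ s)
        (hE.continuous.mul (hφ1.continuous_deriv le_rfl))
        (hc.isCompact.of_isClosed_subset (isClosed_tsupport _) hsub') (hsub'.trans hs)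
      simp only [smul_eq_mul] at hi1 hi2
      have h3 : ∫ s in Ioi (0 : ℝ), deriv (fun s => Real.exp (μ * s) * φ s) s * z s =
          μ * (∫ s in Ioi (0 : ℝ), Real.exp (μ * s) * φ s * z s) +
            ∫ s in Ioi (0 : ℝ), Real.exp (μ * s) * deriv φ s * z s := by
        rw [← integral_const_mul, ← integral_add hi1 hi2]
        congr 1
        ext s
        rw [hd]
        ring
      rw [h3] at h2
      have h4 : ∫ s in Ioi (0 : ℝ), Real.exp (μ * s) * deriv φ s * z s = 0 := by linarith
      refine Eq.trans ?_ h4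
      congr 1
      ext s
      ring
  intro s hs
  have h2 := h1 s hs
  rw [h0, mul_zero] at h2
  exact (mul_eq_zero.1 h2).resolve_left (Real.exp_ne_zero _)

lemma mode_unique {f : ℝ → ℝ} (hf : MemLp f 2 (volume.restrict (Ioi 0))) {μ a₀ : ℝ} {b : ℝ → ℝ}
    (hb : ContinuousOn b (Ici 0)) (h0 : b 0 = a₀)
    (h : ∀ φ : ℝ → ℝ, ContDiff ℝ ∞ φ → HasCompactSupport φ → tsupport φ ⊆ Ioi 0 →
      ∫ s in Ioi (0 : ℝ), deriv φ s * b s = -∫ s in Ioi (0 : ℝ), φ s * (f s - μ * b s)) :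
    ∀ s, 0 ≤ s → b s = mode μ a₀ f s := by
  have ha := mode_continuousOn hf μ a₀
  have hloc : ∀ {g : ℝ → ℝ}, ContinuousOn g (Ici 0) → LocallyIntegrableOn g (Ioi 0) := fun hg =>
    (hg.mono Ioi_subset_Ici_self).locallyIntegrableOn measurableSet_Ioi
  have hfl : LocallyIntegrableOn f (Ioi 0) := by
    rw [locallyIntegrableOn_iff isOpen_Ioi.isLocallyClosed]
    intro k hk hkc
    have h1 : MemLp f 2 (volume.restrict k) := hf.mono_measure (Measure.restrict_mono hk le_rfl)
    have : IsFiniteMeasure (volume.restrict k) := ⟨by simpa using hkc.measure_lt_top⟩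
    exact h1.integrable one_le_two
  have key := eq_zero_of_weak_ode (z := fun s => b s - mode μ a₀ f s) (μ := μ) (hb.sub ha)
    (by rw [h0, mode_zero, sub_self]) fun φ hφ hc hs => by
      have hφ1 : ContDiff ℝ 1 φ := hφ.of_le (by exact_mod_cast le_top)
      have hφ' := hφ1.continuous_deriv le_rfl
      have hsd : tsupport (deriv φ) ⊆ Ioi 0 := tsupport_deriv_subset.trans hs
      have i1 := integrable_smul_of_tsupport (hloc hb) hφ' hc.deriv hsd
      have i2 := integrable_smul_of_tsupport (hloc ha) hφ' hc.deriv hsd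
      have i3 := integrable_smul_of_tsupport
        (hfl.sub (hloc (g := fun s => μ * b s) (continuousOn_const.mul hb))) hφ.continuous hc hs
      have i4 := integrable_smul_of_tsupport
        (hfl.sub (hloc (g := fun s => μ * mode μ a₀ f s) (continuousOn_const.mul ha)))
        hφ.continuous hc hs
      simp only [smul_eq_mul, Pi.sub_apply] at i1 i2 i3 i4
      simp only [mul_sub (deriv φ _)]
      rw [integral_sub i1 i2, h φ hφ hc hs, mode_weak_deriv hf μ a₀ hφ hc hs, neg_sub_neg,
        ← integral_sub i4 i3, ← integral_const_mul]
      congr 1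
      ext s
      ring
  intro s hs
  exact sub_eq_zero.1 (key s hs)

/-! ### The energy estimate for sequences of modes -/

lemma setLIntegral_Ioi_le {g : ℝ → ℝ≥0∞} {M : ℝ≥0∞}
    (h : ∀ T : ℝ, 0 ≤ T → ∫⁻ s in Ioo 0 T, g s ≤ M) : ∫⁻ s in Ioi (0 : ℝ), g s ≤ M := by
  have h1 : Ioi (0 : ℝ) = ⋃ n : ℕ, Ioo 0 (n : ℝ) := by
    ext x
    simp only [mem_Ioi, mem_iUnion, mem_Ioo]
    exact ⟨fun hx => (exists_nat_gt x).imp fun n hn => ⟨hx, hn⟩, fun ⟨n, hn⟩ => hn.1⟩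
  rw [h1, setLIntegral_iUnion_of_directed]
  · exact iSup_le fun n => h n n.cast_nonneg
  · exact Monotone.directed_le fun m n hmn =>
      Ioo_subset_Ioo_right (by exact_mod_cast hmn)

lemma sqSum_sub_le {ι : Type} (x y : ι → ℝ) :
    sqSum (fun n => x n - y n) ≤ 2 * sqSum x + 2 * sqSum y := by
  rw [sqSum, sqSum, sqSum, ← ENNReal.tsum_mul_left, ← ENNReal.tsum_mul_left, ← ENNReal.tsum_add]
  refine ENNReal.tsum_le_tsum fun n => ?_
  rw [← ENNReal.ofReal_ofNat 2, ← ENNReal.ofReal_mul (by norm_num),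
    ← ENNReal.ofReal_mul (by norm_num), ← ENNReal.ofReal_add (by positivity) (by positivity)]
  exact ENNReal.ofReal_le_ofReal (by nlinarith [sq_nonneg (x n + y n)])

lemma ofReal_integral_pow_mul {T : ℝ} (hT : 0 ≤ T) (i : ℕ) (c : ℝ) {g : ℝ → ℝ}
    (hg : IntervalIntegrable (fun r => g r ^ 2) volume 0 T) :
    ENNReal.ofReal (∫ r in (0 : ℝ)..T, r ^ i * (c ^ 2 * g r ^ 2)) =
      ∫⁻ r in Ioo 0 T, ENNReal.ofReal (r ^ i) * ENNReal.ofReal ((c * g r) ^ 2) := by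
  have h1 : IntervalIntegrable (fun r => r ^ i * (c ^ 2 * g r ^ 2)) volume 0 T :=
    (hg.const_mul (c ^ 2)).continuousOn_mul (by fun_prop)
  rw [intervalIntegral.integral_of_le hT, ofReal_integral_eq_lintegral_ofReal
    ((intervalIntegrable_iff_integrableOn_Ioc_of_le hT).1 h1), ← restrict_Ioo_eq_restrict_Ioc]
  · refine setLIntegral_congr_fun measurableSet_Ioo fun r hr => ?_
    have := hr.1.le
    simp only [mul_pow]
    rw [ENNReal.ofReal_mul (by positivity)]
  · filter_upwards [ae_restrict_mem measurableSet_Ioc] with r hr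
    have := hr.1.le
    positivity

section Modes

variable {ι : Type} {ν a₀ : ι → ℝ} {f : ι → ℝ → ℝ}

lemma mode_sq_intervalIntegrable {f : ℝ → ℝ} (hf : MemLp f 2 (volume.restrict (Ioi 0)))
    (μ a₀ : ℝ) {T : ℝ} (hT : 0 ≤ T) :
    IntervalIntegrable (fun r => mode μ a₀ f r ^ 2) volume 0 T := by
  refine ContinuousOn.intervalIntegrable ?_
  refine ((mode_continuousOn hf μ a₀).mono ?_).pow 2
  rw [uIcc_of_le hT]
  exact Icc_subset_Ici_self

lemma aestronglyMeasurable_mode {f : ℝ → ℝ} (hf : MemLp f 2 (volume.restrict (Ioi 0)))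
    (μ a₀ : ℝ) : AEStronglyMeasurable (mode μ a₀ f) (volume.restrict (Ioi 0)) :=
  ((mode_continuousOn hf μ a₀).mono Ioi_subset_Ici_self).aestronglyMeasurable measurableSet_Ioi

/-- The right-hand side of the energy estimate for a single mode. -/
def modeData (K : ℕ) (ν a₀ : ℝ) (f : ℝ → ℝ) (S : Set ℝ) : ℝ≥0∞ :=
  ENNReal.ofReal ((ν ^ 3 * a₀) ^ 2) + ∑ i ∈ Finset.range K,
    ∫⁻ r in S, ENNReal.ofReal (r ^ i) * ENNReal.ofReal ((ν ^ (i + 2) * f r) ^ 2)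

lemma modeData_mono (K : ℕ) (ν a₀ : ℝ) (f : ℝ → ℝ) {S T : Set ℝ} (h : S ⊆ T) :
    modeData K ν a₀ f S ≤ modeData K ν a₀ f T :=
  add_le_add le_rfl (Finset.sum_le_sum fun _ _ => lintegral_mono_set h)

/-- `mode_bound` with `μ = ν²` and values in `[0, ∞]`, where sums over modes and time integrals may
be interchanged without prior summability. -/
lemma mode_bound_lintegral (K : ℕ) : ∃ C : ℝ≥0, ∀ (f : ℝ → ℝ),
    MemLp f 2 (volume.restrict (Ioi 0)) → ∀ (ν a₀ T : ℝ), 0 < ν → 0 ≤ T →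
    ∑ i ∈ Finset.range K,
      (ENNReal.ofReal (T ^ i) * ENNReal.ofReal ((ν ^ (i + 3) * mode (ν ^ 2) a₀ f T) ^ 2) +
        ∫⁻ r in Ioo 0 T, ENNReal.ofReal (r ^ i) *
          ENNReal.ofReal ((ν ^ (i + 4) * mode (ν ^ 2) a₀ f r) ^ 2)) ≤
      C * modeData K ν a₀ f (Ioo 0 T) := by
  obtain ⟨C, hC, h⟩ := mode_bound K
  refine ⟨C.toNNReal, fun f hf ν a₀ T hν hT => ?_⟩
  have h1 := h f hf (ν ^ 2) a₀ T (by positivity) hT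
  have h2 := ENNReal.ofReal_le_ofReal h1
  have hn : ∀ (l i : ℕ) (g : ℝ → ℝ), 0 ≤ ∫ r in (0 : ℝ)..T, r ^ i * ((ν ^ 2) ^ l * g r ^ 2) :=
    fun l i g => by
      refine intervalIntegral.integral_nonneg hT fun r hr => ?_
      have := hr.1
      positivity
  have hp : ∀ l : ℕ, (ν ^ 2) ^ l = (ν ^ l) ^ 2 := fun l => by ring
  rw [ENNReal.ofReal_sum_of_nonneg (fun i _ => add_nonneg (by positivity) (hn _ _ _)),
    ENNReal.ofReal_mul (by linarith), ENNReal.ofReal_add (by positivity)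
      (Finset.sum_nonneg fun i _ => hn _ _ _),
    ENNReal.ofReal_sum_of_nonneg (fun i _ => hn _ _ _)] at h2
  rw [modeData]
  convert h2 using 1
  · refine Finset.sum_congr rfl fun i _ => ?_
    rw [ENNReal.ofReal_add (by positivity) (hn _ _ _), hp, hp,
      ofReal_integral_pow_mul hT i _ (mode_sq_intervalIntegrable hf _ _ hT),
      ENNReal.ofReal_mul (by positivity), mul_pow]
  · congr 1
    congr 1
    · rw [hp, mul_pow]
    · refine Finset.sum_congr rfl fun i _ => ?_
      rw [hp, ofReal_integral_pow_mul hT i _ (intervalIntegrable_of_memLp hf hT).2]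

lemma tsum_modeData [Countable ι] (K : ℕ)
    (hf : ∀ n, AEStronglyMeasurable (f n) (volume.restrict (Ioi 0))) {S : Set ℝ}
    (hS : S ⊆ Ioi 0) :
    ∑' n, modeData K (ν n) (a₀ n) (f n) S = sqSum (fun n => ν n ^ 3 * a₀ n) +
      ∑ i ∈ Finset.range K,
        ∫⁻ r in S, ENNReal.ofReal (r ^ i) * sqSum (fun n => ν n ^ (i + 2) * f n r) := by
  simp only [modeData]
  rw [ENNReal.tsum_add, Summable.tsum_finsetSum fun _ _ => ENNReal.summable]
  congr 1
  refine Finset.sum_congr rfl fun i _ => ?_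
  rw [← lintegral_tsum]
  · simp only [sqSum, ENNReal.tsum_mul_left]
  · intro n
    have := ((hf n).mono_measure (Measure.restrict_mono hS le_rfl)).aemeasurable
    fun_prop

lemma modes_bound [Countable ι] {K : ℕ} {C : ℝ≥0} {T : ℝ}
    (hf : ∀ n, MemLp (f n) 2 (volume.restrict (Ioi 0)))
    (hC : ∀ n, ∑ i ∈ Finset.range K,
      (ENNReal.ofReal (T ^ i) *
          ENNReal.ofReal ((ν n ^ (i + 3) * mode (ν n ^ 2) (a₀ n) (f n) T) ^ 2) +
        ∫⁻ r in Ioo 0 T, ENNReal.ofReal (r ^ i) *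
          ENNReal.ofReal ((ν n ^ (i + 4) * mode (ν n ^ 2) (a₀ n) (f n) r) ^ 2)) ≤
      C * modeData K (ν n) (a₀ n) (f n) (Ioo 0 T)) :
    ∑ i ∈ Finset.range K,
      (ENNReal.ofReal (T ^ i) *
          sqSum (fun n => ν n ^ (i + 3) * mode (ν n ^ 2) (a₀ n) (f n) T) +
        ∫⁻ r in Ioo 0 T, ENNReal.ofReal (r ^ i) *
          sqSum (fun n => ν n ^ (i + 4) * mode (ν n ^ 2) (a₀ n) (f n) r)) ≤
      C * (sqSum (fun n => ν n ^ 3 * a₀ n) + ∑ i ∈ Finset.range K,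
        ∫⁻ r in Ioo 0 T, ENNReal.ofReal (r ^ i) * sqSum (fun n => ν n ^ (i + 2) * f n r)) := by
  have hS : Ioo 0 T ⊆ Ioi 0 := fun x hx => hx.1
  have h1 := ENNReal.tsum_le_tsum hC
  rw [ENNReal.tsum_mul_left, tsum_modeData K (fun n => (hf n).1) hS,
    Summable.tsum_finsetSum fun _ _ => ENNReal.summable] at h1
  refine le_of_eq_of_le (Finset.sum_congr rfl fun i _ => ?_) h1
  rw [ENNReal.tsum_add, ENNReal.tsum_mul_left, ← lintegral_tsum]
  · simp only [sqSum, ENNReal.tsum_mul_left]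
  · intro n
    have := ((aestronglyMeasurable_mode (hf n) (ν n ^ 2) (a₀ n)).mono_measure
      (Measure.restrict_mono hS le_rfl)).aemeasurable
    fun_prop

end Modes

/-! ### Spectral description of the spaces of functions of time -/

lemma exists_enorm_sq_equiv {X : Type} [NormedAddCommGroup X] [NormedSpace ℝ X] {ι : Type}
    (E : X ≃L[ℝ] Seq2 ι) : ∃ K : ℝ≥0, 1 ≤ K ∧ ∀ w, ‖E w‖ₑ ^ 2 ≤ K * ‖w‖ₑ ^ 2 ∧
      ‖w‖ₑ ^ 2 ≤ K * ‖E w‖ₑ ^ 2 := by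
  set a : ℝ≥0 := ‖(E : X →L[ℝ] Seq2 ι)‖₊
  set b : ℝ≥0 := ‖(E.symm : Seq2 ι →L[ℝ] X)‖₊
  have h1 : ∀ w, ‖E w‖ₑ ≤ a * ‖w‖ₑ := fun w => by
    have := (E : X →L[ℝ] Seq2 ι).le_opNNNorm w
    rw [enorm_eq_nnnorm, enorm_eq_nnnorm]
    exact_mod_cast this
  have h2 : ∀ w, ‖w‖ₑ ≤ b * ‖E w‖ₑ := fun w => by
    have := (E.symm : Seq2 ι →L[ℝ] X).le_opNNNorm (E w)
    rw [ContinuousLinearEquiv.coe_coe, E.symm_apply_apply] at this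
    rw [enorm_eq_nnnorm, enorm_eq_nnnorm]
    exact_mod_cast this
  refine ⟨1 + a ^ 2 + b ^ 2, by rw [add_assoc]; exact le_self_add, fun w => ⟨?_, ?_⟩⟩
  · calc ‖E w‖ₑ ^ 2 ≤ (a * ‖w‖ₑ) ^ 2 := by gcongr; exact h1 w
      _ = ((a ^ 2 : ℝ≥0) : ℝ≥0∞) * ‖w‖ₑ ^ 2 := by rw [mul_pow, ENNReal.coe_pow]
      _ ≤ _ := by
        gcongr
        rw [add_comm 1, add_assoc]
        exact le_self_add
  · calc ‖w‖ₑ ^ 2 ≤ (b * ‖E w‖ₑ) ^ 2 := by gcongr; exact h2 w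
      _ = ((b ^ 2 : ℝ≥0) : ℝ≥0∞) * ‖E w‖ₑ ^ 2 := by rw [mul_pow, ENNReal.coe_pow]
      _ ≤ _ := by
        gcongr
        exact le_add_self

lemma lintegral_enorm_sq_ne_top {X : Type} [NormedAddCommGroup X] {m : Measure ℝ} {g : ℝ → X}
    (hg : MemLp g 2 m) : ∫⁻ s, ‖g s‖ₑ ^ 2 ∂m ≠ ⊤ := by
  have h := hg.2
  rw [eLpNorm_lt_top_iff_lintegral_rpow_enorm_lt_top (by simp) (by simp)] at h
  simpa using h.ne

lemma weight_sq {s : ℝ} (hs : 0 ≤ s) (j : ℕ) :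
    (s ^ ((((j + 2 : ℕ) : ℝ) - 2) / 2)) ^ 2 = s ^ j := by
  have h1 : (((j + 2 : ℕ) : ℝ) - 2) / 2 * ((2 : ℕ) : ℝ) = j := by push_cast; ring
  rw [← Real.rpow_natCast (s ^ _) 2, ← Real.rpow_mul hs, h1, Real.rpow_natCast]

lemma memLp_unweight {X : Type} [NormedAddCommGroup X] [NormedSpace ℝ X] {g : ℝ → X}
    (hg : MemLp g 2 (volume.restrict (Ioi 0))) {p : ℝ} (hp : 0 ≤ p) {a : ℝ} (b : ℝ) (ha : 0 < a) :
    MemLp (fun s => s ^ (-p) • g s) 2 (volume.restrict (Icc a b)) := by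
  have h1 : MemLp g 2 (volume.restrict (Icc a b)) :=
    hg.mono_measure (Measure.restrict_mono (fun x hx => ha.trans_le hx.1) le_rfl)
  refine h1.of_le_mul (c := a ^ (-p)) ?_ ?_
  · refine AEStronglyMeasurable.smul ?_ h1.1
    exact (measurable_id.pow_const (-p)).aestronglyMeasurable
  · filter_upwards [ae_restrict_mem measurableSet_Icc] with s hs
    have hs0 : 0 < s := ha.trans_le hs.1
    rw [norm_smul, Real.norm_eq_abs, abs_of_nonneg (Real.rpow_nonneg hs0.le _)]
    exact mul_le_mul_of_nonneg_right
      (Real.rpow_le_rpow_of_nonpos ha hs.1 (neg_nonpos.2 hp)) (norm_nonneg _)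

section Time

variable {ℓ : ℝ}

lemma unweight_weighted {s : ℝ} (hs : 0 < s) (k' : ℕ) (f : ℝ → L2w ℓ) :
    s ^ (-(((k' : ℝ) - 2) / 2)) • weighted k' f s = f s := by
  rw [weighted, smul_smul, ← Real.rpow_add hs, neg_add_cancel, Real.rpow_zero, one_smul]

lemma weighted_two (f : ℝ → L2w ℓ) : weighted 2 f = f := by
  funext s
  rw [weighted, Nat.cast_ofNat, sub_self, zero_div, Real.rpow_zero, one_smul]

lemma weight_exponent_nonneg {k' : ℕ} (h : 2 ≤ k') : 0 ≤ ((k' : ℝ) - 2) / 2 := by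
  have : (2 : ℝ) ≤ k' := by exact_mod_cast h
  linarith

lemma memL2loc_of_weighted {m k' : ℕ} {f : ℝ → L2w ℓ} (hk : 2 ≤ k')
    (h : MemL2 m (weighted k' f)) : MemL2loc m f := by
  obtain ⟨g, hg, hgf⟩ := h
  refine ⟨fun s => s ^ (-(((k' : ℝ) - 2) / 2)) • g s, fun a b ha =>
    memLp_unweight hg (weight_exponent_nonneg hk) b ha, ?_⟩
  filter_upwards [hgf, ae_restrict_mem measurableSet_Ioi] with s hs hs0
  rw [← unweight_weighted hs0 k' f, ← hs]
  exact map_smul (toL2wL ℓ m) _ _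

lemma memC0_of_weighted {m k' : ℕ} {f : ℝ → L2w ℓ}
    (h : MemC0 m (Ici 0) (weighted k' f)) : MemC0 m (Ioi 0) f := by
  obtain ⟨g, hg, hgf⟩ := h
  refine ⟨fun s => s ^ (-(((k' : ℝ) - 2) / 2)) • g s, ?_, fun s hs => ?_⟩
  · have h1 : ContinuousOn (fun s : ℝ => s ^ (-(((k' : ℝ) - 2) / 2))) (Ioi 0) := fun s hs =>
      (Real.continuousAt_rpow_const s _ (Or.inl (ne_of_gt hs))).continuousWithinAt
    exact h1.smul (hg.mono Ioi_subset_Ici_self)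
  · rw [← unweight_weighted hs k' f, ← hgf s (Ioi_subset_Ici_self hs)]
    exact map_smul (toL2wL ℓ m) _ _

lemma MemL2loc.mono (hℓ : 0 < ℓ) {m n : ℕ} (hnm : n ≤ m) {f : ℝ → L2w ℓ} (h : MemL2loc m f) :
    MemL2loc n f := by
  obtain ⟨g, hg, hgf⟩ := h
  refine ⟨fun s => resH ℓ hnm (g s), fun a b ha => (resH ℓ hnm).comp_memLp' (hg a b ha), ?_⟩
  filter_upwards [hgf] with s hs
  rw [toL2w_resH hℓ, hs]

lemma locallyIntegrableOn_of_memLp {X : Type} [NormedAddCommGroup X] {g : ℝ → X}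
    (hg : ∀ a b : ℝ, 0 < a → MemLp g 2 (volume.restrict (Icc a b))) :
    LocallyIntegrableOn g (Ioi 0) := by
  intro x hx
  have hx : 0 < x := hx
  refine ⟨Icc (x / 2) (x + 1), mem_nhdsWithin_of_mem_nhds (Icc_mem_nhds (by linarith)
    (by linarith)), ?_⟩
  exact (hg (x / 2) (x + 1) (by positivity)).integrable one_le_two

lemma MemL2loc.locallyIntegrableOn {m : ℕ} {f : ℝ → L2w ℓ} (h : MemL2loc m f) :
    LocallyIntegrableOn f (Ioi 0) := by
  obtain ⟨g, hg, hgf⟩ := h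
  have h1 : LocallyIntegrableOn (toL2wL ℓ m ∘ g) (Ioi 0) :=
    locallyIntegrableOn_of_memLp fun a b ha => (toL2wL ℓ m).comp_memLp' (hg a b ha)
  rw [locallyIntegrableOn_iff isOpen_Ioi.isLocallyClosed] at h1 ⊢
  intro K hK hKc
  exact (h1 K hK hKc).congr (ae_mono (Measure.restrict_mono hK le_rfl) hgf)

lemma MemL2.comp_memLp {m : ℕ} {f : ℝ → L2w ℓ} (h : MemL2 m f) :
    MemLp f 2 (volume.restrict (Ioi 0)) := by
  obtain ⟨g, hg, hgf⟩ := h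
  exact ((toL2wL ℓ m).comp_memLp' hg).ae_eq hgf

end Time

namespace Diagonalization

variable {ℓ : ℝ} {N : ℕ} {P : Hsp ℓ 4 → L2w ℓ → Prop} (𝒟 : Diagonalization ℓ N P)

lemma ν_pos (n : 𝒟.ι) : 0 < 𝒟.ν n := 𝒟.ν₀_pos.trans_le (𝒟.le_ν n)

/-- The coordinate `n` of a function. -/
def coord (n : 𝒟.ι) : L2w ℓ →L[ℝ] ℝ :=
  (lp.evalCLM ℝ (fun _ : 𝒟.ι => ℝ) 2 n).comp (𝒟.B : L2w ℓ →L[ℝ] Seq2 𝒟.ι)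

lemma coord_apply (n : 𝒟.ι) (v : L2w ℓ) : 𝒟.coord n v = 𝒟.B v n := rfl

lemma coord_ext {v w : L2w ℓ} (h : ∀ n, 𝒟.coord n v = 𝒟.coord n w) : v = w :=
  𝒟.B.injective (lp.ext (funext h))

/-- The squared spectral norm of order `i`. -/
def energy (i : ℕ) (v : L2w ℓ) : ℝ≥0∞ := sqSum fun n => 𝒟.ν n ^ i * 𝒟.coord n v

lemma energy_smul (i : ℕ) (c : ℝ) (v : L2w ℓ) :
    𝒟.energy i (c • v) = ENNReal.ofReal (c ^ 2) * 𝒟.energy i v := by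
  rw [energy, energy, ← sqSum_const_mul]
  congr 1
  ext n
  rw [map_smul, smul_eq_mul]
  ring

lemma energy_weighted (i j : ℕ) (f : ℝ → L2w ℓ) {s : ℝ} (hs : 0 ≤ s) :
    𝒟.energy i (weighted (j + 2) f s) = ENNReal.ofReal (s ^ j) * 𝒟.energy i (f s) := by
  rw [weighted, energy_smul, weight_sq hs]

variable {𝒟} in
lemma energy_toL2w {i m : ℕ} (hi : m = 2 * i) (hm : m ≤ N) (w : Hsp ℓ m) :
    𝒟.energy i (toL2w w) = ‖𝒟.E i m hi hm w‖ₑ ^ 2 := by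
  rw [enorm_sq_eq_sqSum, energy]
  congr 1
  ext n
  exact (𝒟.E_apply i m hi hm w n).symm

variable {𝒟} in
lemma toL2w_E_symm {i m : ℕ} (hi : m = 2 * i) (hm : m ≤ N) {v : L2w ℓ}
    (h : Summable fun n => (𝒟.ν n ^ i * 𝒟.coord n v) ^ 2) :
    toL2w ((𝒟.E i m hi hm).symm (seqOf fun n => 𝒟.ν n ^ i * 𝒟.coord n v)) = v := by
  refine 𝒟.coord_ext fun n => ?_
  refine mul_left_cancel₀ (pow_pos (𝒟.ν_pos n) i).ne' ?_
  rw [coord_apply, ← 𝒟.E_apply i m hi hm, ContinuousLinearEquiv.apply_symm_apply, seqOf_apply h]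

/-- Equivalence of the spectral and Sobolev norms, including the value `∞`: a finite energy yields a
representative in `ℋ^m` through the inverse of `E`, and a representative is unique because `E`
depends only on the underlying function. -/
lemma exists_energy_bound_single {i m : ℕ} (hi : m = 2 * i) (hm : m ≤ N) :
    ∃ K : ℝ≥0, ∀ v : L2w ℓ, hnorm m v ^ 2 ≤ K * 𝒟.energy i v ∧
      𝒟.energy i v ≤ K * hnorm m v ^ 2 ∧
      ∀ w : Hsp ℓ m, 𝒟.energy i (toL2w w) ≤ K * ‖w‖ₑ ^ 2 := by
  obtain ⟨K, hK1, hK⟩ := exists_enorm_sq_equiv (𝒟.E i m hi hm)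
  have hK0 : (K : ℝ≥0∞) ≠ 0 := by
    have := zero_lt_one.trans_le hK1
    exact_mod_cast this.ne'
  have hw : ∀ w : Hsp ℓ m, 𝒟.energy i (toL2w w) ≤ K * ‖w‖ₑ ^ 2 := fun w => by
    rw [energy_toL2w hi hm]
    exact (hK w).1
  refine ⟨K, fun v => ⟨?_, ?_, hw⟩⟩
  · by_cases h : 𝒟.energy i v = ⊤
    · rw [h, ENNReal.mul_top hK0]
      exact le_top
    have hs := summable_of_sqSum_ne_top h
    have h1 : hnorm m v ≤ ‖(𝒟.E i m hi hm).symm (seqOf fun n => 𝒟.ν n ^ i * 𝒟.coord n v)‖ₑ :=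
      iInf₂_le (f := fun (w : Hsp ℓ m) (_ : toL2w w = v) => ‖w‖ₑ) _ (toL2w_E_symm hi hm hs)
    refine (pow_le_pow_left₀ zero_le h1 2).trans ((hK _).2.trans ?_)
    rw [ContinuousLinearEquiv.apply_symm_apply, enorm_sq_seqOf hs, energy]
  · by_cases h : ∃ w : Hsp ℓ m, toL2w w = v
    · obtain ⟨w, rfl⟩ := h
      have h1 : ‖w‖ₑ ≤ hnorm m (toL2w w) := by
        refine le_iInf₂ fun w' hw' => le_of_eq ?_
        congr 1
        refine (𝒟.E i m hi hm).injective (lp.ext (funext fun n => ?_))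
        rw [𝒟.E_apply, 𝒟.E_apply, hw']
      exact (hw w).trans (by gcongr)
    · have h1 : hnorm m v = ⊤ := by
        rw [hnorm, iInf_eq_top]
        intro w
        rw [iInf_eq_top]
        exact fun hw => absurd ⟨w, hw⟩ h
      rw [h1, ENNReal.top_pow two_ne_zero, ENNReal.mul_top hK0]
      exact le_top

lemma exists_energy_bound : ∃ K : ℝ≥0, ∀ i, 2 * i ≤ N → ∀ v : L2w ℓ,
    hnorm (2 * i) v ^ 2 ≤ K * 𝒟.energy i v ∧ 𝒟.energy i v ≤ K * hnorm (2 * i) v ^ 2 ∧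
      ∀ w : Hsp ℓ (2 * i), 𝒟.energy i (toL2w w) ≤ K * ‖w‖ₑ ^ 2 := by
  have h : ∀ i, ∃ K : ℝ≥0, 2 * i ≤ N → ∀ v : L2w ℓ,
      hnorm (2 * i) v ^ 2 ≤ K * 𝒟.energy i v ∧ 𝒟.energy i v ≤ K * hnorm (2 * i) v ^ 2 ∧
      ∀ w : Hsp ℓ (2 * i), 𝒟.energy i (toL2w w) ≤ K * ‖w‖ₑ ^ 2 := fun i => by
    by_cases hi : 2 * i ≤ N
    · exact (𝒟.exists_energy_bound_single rfl hi).imp fun K hK _ => hK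
    · exact ⟨0, fun h => absurd h hi⟩
  choose K hK using h
  -- The sum dominates each of the finitely many constants, giving one for all relevant `i`.
  refine ⟨∑ i ∈ Finset.range (N + 1), K i, fun i hi v => ?_⟩
  have h1 : (K i : ℝ≥0∞) ≤ (∑ i ∈ Finset.range (N + 1), K i : ℝ≥0) := by
    exact_mod_cast Finset.single_le_sum (f := K) (fun _ _ => zero_le)
      (Finset.mem_range.2 (show i < N + 1 by omega))
  obtain ⟨a, b, c⟩ := hK i hi v
  exact ⟨a.trans (by gcongr), b.trans (by gcongr), fun w => (c w).trans (by gcongr)⟩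

lemma memL2_of_energy {i m : ℕ} (hi : m = 2 * i) (hm : m ≤ N) {f : ℝ → L2w ℓ}
    (hf : ∀ n, AEStronglyMeasurable (fun s => 𝒟.coord n (f s)) (volume.restrict (Ioi 0)))
    (h : ∫⁻ s in Ioi (0 : ℝ), 𝒟.energy i (f s) ≠ ⊤) : MemL2 m f := by
  have := 𝒟.countable
  have hx : ∀ n, AEStronglyMeasurable (fun s => 𝒟.ν n ^ i * 𝒟.coord n (f s))
      (volume.restrict (Ioi 0)) := fun n => (hf n).const_mul _
  refine ⟨fun s => (𝒟.E i m hi hm).symm (seqOf fun n => 𝒟.ν n ^ i * 𝒟.coord n (f s)), ?_, ?_⟩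
  · exact ((𝒟.E i m hi hm).symm : Seq2 𝒟.ι →L[ℝ] Hsp ℓ m).comp_memLp' (memLp_seqOf hx h)
  · filter_upwards [ae_summable hx h] with s hs
    exact toL2w_E_symm hi hm hs

lemma memC0_of_bound {i m : ℕ} (hi : m = 2 * i) (hm : m ≤ N) {f : ℝ → L2w ℓ} {T : Set ℝ}
    (hf : ∀ n, ContinuousOn (fun s => 𝒟.coord n (f s)) T) {b : 𝒟.ι → ℝ} (hb : Summable b)
    (h : ∀ n, ∀ s ∈ T, (𝒟.ν n ^ i * 𝒟.coord n (f s)) ^ 2 ≤ b n) : MemC0 m T f := by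
  refine ⟨fun s => (𝒟.E i m hi hm).symm (seqOf fun n => 𝒟.ν n ^ i * 𝒟.coord n (f s)), ?_,
    fun s hs => ?_⟩
  · exact (𝒟.E i m hi hm).symm.continuous.comp_continuousOn
      (continuousOn_seqOf (fun n => (hf n).const_smul (𝒟.ν n ^ i)) hb h)
  · exact toL2w_E_symm hi hm (hb.of_nonneg_of_le (fun n => sq_nonneg _) fun n => h n s hs)

lemma lintegral_energy_ne_top {i m : ℕ} (hi : m = 2 * i) (hm : m ≤ N) {f : ℝ → L2w ℓ}
    (h : MemL2 m f) : ∫⁻ s in Ioi (0 : ℝ), 𝒟.energy i (f s) ≠ ⊤ := by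
  obtain ⟨K, hK⟩ := 𝒟.exists_energy_bound_single hi hm
  obtain ⟨g, hg, hgf⟩ := h
  refine ne_top_of_le_ne_top (b := K * ∫⁻ s in Ioi (0 : ℝ), ‖g s‖ₑ ^ 2)
    (ENNReal.mul_ne_top ENNReal.coe_ne_top (lintegral_enorm_sq_ne_top hg)) ?_
  rw [← lintegral_const_mul' _ _ ENNReal.coe_ne_top]
  refine lintegral_mono_ae ?_
  filter_upwards [hgf] with s hs
  rw [← hs]
  exact (hK (f s)).2.2 (g s)

end Diagonalization

namespace Diagonalization

/-! ### The solution of the linear equation -/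

variable {ℓ : ℝ} {N : ℕ} {P : Hsp ℓ 4 → L2w ℓ → Prop} (𝒟 : Diagonalization ℓ N P)

/-- The coordinate `n` of the solution. -/
def solCoord (v₀ : L2w ℓ) (F : ℝ → L2w ℓ) (n : 𝒟.ι) (s : ℝ) : ℝ :=
  mode (𝒟.ν n ^ 2) (𝒟.coord n v₀) (fun r => 𝒟.coord n (F r)) s

/-- The solution with initial value `v₀` and right-hand side `F`. -/
def sol (v₀ : L2w ℓ) (F : ℝ → L2w ℓ) (s : ℝ) : L2w ℓ :=
  𝒟.B.symm (seqOf fun n => 𝒟.solCoord v₀ F n s)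

/-- The time derivative of the solution. -/
def solDeriv (v₀ : L2w ℓ) (F : ℝ → L2w ℓ) (s : ℝ) : L2w ℓ :=
  𝒟.B.symm (seqOf fun n => 𝒟.coord n (F s) - 𝒟.ν n ^ 2 * 𝒟.solCoord v₀ F n s)

/-- The hypotheses on the initial value and the right-hand side, in terms of the coordinates. -/
structure Admissible (K : ℕ) (v₀ : L2w ℓ) (F : ℝ → L2w ℓ) : Prop where
  memLp : MemLp F 2 (volume.restrict (Ioi 0))
  initial : 𝒟.energy 3 v₀ ≠ ⊤
  rhs : ∀ i < K, ∫⁻ s in Ioi (0 : ℝ), ENNReal.ofReal (s ^ i) * 𝒟.energy (i + 2) (F s) ≠ ⊤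

/-- The right-hand side of the energy estimate. -/
def dataEnergy (K : ℕ) (v₀ : L2w ℓ) (F : ℝ → L2w ℓ) (S : Set ℝ) : ℝ≥0∞ :=
  𝒟.energy 3 v₀ + ∑ i ∈ Finset.range K,
    ∫⁻ s in S, ENNReal.ofReal (s ^ i) * 𝒟.energy (i + 2) (F s)

lemma coord_symm_seqOf {x : 𝒟.ι → ℝ} (h : Summable fun n => x n ^ 2) (n : 𝒟.ι) :
    𝒟.coord n (𝒟.B.symm (seqOf x)) = x n := by
  rw [coord_apply, ContinuousLinearEquiv.apply_symm_apply, seqOf_apply h]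

lemma summable_of_weighted (i : ℕ) {x : 𝒟.ι → ℝ}
    (h : Summable fun n => (𝒟.ν n ^ i * x n) ^ 2) : Summable fun n => x n ^ 2 := by
  refine (h.mul_left (((𝒟.ν₀ ^ i) ^ 2)⁻¹)).of_nonneg_of_le (fun n => sq_nonneg _) fun n => ?_
  have h0 : 0 < (𝒟.ν₀ ^ i) ^ 2 := pow_pos (pow_pos 𝒟.ν₀_pos i) 2
  rw [inv_mul_eq_div, le_div_iff₀ h0, mul_pow, mul_comm]
  have h1 : 𝒟.ν₀ ^ i ≤ 𝒟.ν n ^ i := pow_le_pow_left₀ 𝒟.ν₀_pos.le (𝒟.le_ν n) i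
  have h2 := pow_le_pow_left₀ (pow_pos 𝒟.ν₀_pos i).le h1 2
  exact mul_le_mul_of_nonneg_right h2 (sq_nonneg _)

variable {𝒟} {K : ℕ} {v₀ : L2w ℓ} {F : ℝ → L2w ℓ}

namespace Admissible

lemma memLp_coord (hA : 𝒟.Admissible K v₀ F) (n : 𝒟.ι) :
    MemLp (fun r => 𝒟.coord n (F r)) 2 (volume.restrict (Ioi 0)) :=
  (𝒟.coord n).comp_memLp' hA.memLp

lemma dataEnergy_ne_top (hA : 𝒟.Admissible K v₀ F) {S : Set ℝ} (hS : S ⊆ Ioi 0) :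
    𝒟.dataEnergy K v₀ F S ≠ ⊤ :=
  ENNReal.add_ne_top.2 ⟨hA.initial, ENNReal.sum_ne_top.2 fun i hi =>
    ne_top_of_le_ne_top (hA.rhs i (Finset.mem_range.1 hi)) (lintegral_mono_set hS)⟩

lemma tsum_modeData (hA : 𝒟.Admissible K v₀ F) {S : Set ℝ} (hS : S ⊆ Ioi 0) :
    ∑' n, modeData K (𝒟.ν n) (𝒟.coord n v₀) (fun r => 𝒟.coord n (F r)) S =
      𝒟.dataEnergy K v₀ F S := by
  have := 𝒟.countable
  exact ThinFilm.tsum_modeData K (fun n => (hA.memLp_coord n).1) hS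

lemma solCoord_continuousOn (hA : 𝒟.Admissible K v₀ F) (n : 𝒟.ι) :
    ContinuousOn (𝒟.solCoord v₀ F n) (Ici 0) :=
  mode_continuousOn (hA.memLp_coord n) _ _

/-- A summable majorant uniform in `s ≥ 0`, namely the modewise data over all of `(0, ∞)`. It is
what makes the weighted solution continuous, including at `s = 0`. -/
lemma exists_dominating (hA : 𝒟.Admissible K v₀ F) : ∃ b : 𝒟.ι → ℝ, Summable b ∧
    ∀ i < K, ∀ n, ∀ s : ℝ, 0 ≤ s → s ^ i * (𝒟.ν n ^ (i + 3) * 𝒟.solCoord v₀ F n s) ^ 2 ≤ b n := by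
  obtain ⟨C, hC⟩ := mode_bound_lintegral K
  set e : 𝒟.ι → ℝ≥0∞ := fun n =>
    C * modeData K (𝒟.ν n) (𝒟.coord n v₀) (fun r => 𝒟.coord n (F r)) (Ioi 0) with he
  have hsum : ∑' n, e n ≠ ⊤ := by
    rw [he, ENNReal.tsum_mul_left, hA.tsum_modeData Subset.rfl]
    exact ENNReal.mul_ne_top ENNReal.coe_ne_top (hA.dataEnergy_ne_top Subset.rfl)
  refine ⟨fun n => (e n).toReal, ENNReal.summable_toReal hsum, fun i hi n s hs => ?_⟩
  refine (ENNReal.ofReal_le_iff_le_toReal (ENNReal.ne_top_of_tsum_ne_top hsum n)).1 ?_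
  rw [ENNReal.ofReal_mul (by positivity)]
  calc _ ≤ _ := le_self_add
    _ ≤ _ := Finset.single_le_sum (f := fun i => ENNReal.ofReal (s ^ i) *
        ENNReal.ofReal ((𝒟.ν n ^ (i + 3) * 𝒟.solCoord v₀ F n s) ^ 2) +
        ∫⁻ r in Ioo 0 s, ENNReal.ofReal (r ^ i) *
          ENNReal.ofReal ((𝒟.ν n ^ (i + 4) * 𝒟.solCoord v₀ F n r) ^ 2))
        (fun _ _ => zero_le) (Finset.mem_range.2 hi)
    _ ≤ _ := hC _ (hA.memLp_coord n) (𝒟.ν n) (𝒟.coord n v₀) s (𝒟.ν_pos n) hs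
    _ ≤ _ := mul_le_mul' le_rfl (modeData_mono _ _ _ _ fun x hx => hx.1)

lemma coord_sol (hA : 𝒟.Admissible K v₀ F) (hK : 0 < K) (n : 𝒟.ι) {s : ℝ} (hs : 0 ≤ s) :
    𝒟.coord n (𝒟.sol v₀ F s) = 𝒟.solCoord v₀ F n s := by
  obtain ⟨b, hb, h⟩ := hA.exists_dominating
  refine 𝒟.coord_symm_seqOf (𝒟.summable_of_weighted 3
    (hb.of_nonneg_of_le (fun n => sq_nonneg _) fun n => ?_)) n
  simpa using h 0 hK n s hs

lemma energy_sol (hA : 𝒟.Admissible K v₀ F) (hK : 0 < K) (i : ℕ) {s : ℝ} (hs : 0 ≤ s) :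
    𝒟.energy i (𝒟.sol v₀ F s) = sqSum fun n => 𝒟.ν n ^ i * 𝒟.solCoord v₀ F n s := by
  rw [energy]
  simp only [hA.coord_sol hK _ hs]

lemma sol_continuousOn (hA : 𝒟.Admissible K v₀ F) (hK : 0 < K) (n : 𝒟.ι) :
    ContinuousOn (fun s => 𝒟.coord n (𝒟.sol v₀ F s)) (Ici 0) :=
  (hA.solCoord_continuousOn n).congr fun _ hs => hA.coord_sol hK n hs

lemma sol_zero (hA : 𝒟.Admissible K v₀ F) (hK : 0 < K) : 𝒟.sol v₀ F 0 = v₀ :=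
  𝒟.coord_ext fun n => by rw [hA.coord_sol hK n le_rfl, solCoord, mode_zero]

lemma energy_solDeriv_le (hA : 𝒟.Admissible K v₀ F) (hK : 0 < K) (i : ℕ) {s : ℝ} (hs : 0 ≤ s) :
    𝒟.energy i (𝒟.solDeriv v₀ F s) ≤
      2 * 𝒟.energy i (F s) + 2 * 𝒟.energy (i + 2) (𝒟.sol v₀ F s) := by
  by_cases h : Summable fun n => (𝒟.coord n (F s) - 𝒟.ν n ^ 2 * 𝒟.solCoord v₀ F n s) ^ 2
  · refine le_of_eq_of_le ?_ (sqSum_sub_le _ _)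
    rw [energy]
    congr 1
    ext n
    rw [hA.coord_sol hK n hs, solDeriv, 𝒟.coord_symm_seqOf h]
    ring
  -- At exceptional times where the coordinates are not square summable, `seqOf` is zero by default
  -- and the bound is trivial.
  · rw [solDeriv, seqOf, dif_neg h, map_zero, energy]
    simp [sqSum]

lemma measurable_coord (hA : 𝒟.Admissible K v₀ F) (n : 𝒟.ι) :
    AEStronglyMeasurable (fun s => 𝒟.coord n (F s)) (volume.restrict (Ioi 0)) :=
  (hA.memLp_coord n).1

lemma measurable_coord_sol (hA : 𝒟.Admissible K v₀ F) (hK : 0 < K) (n : 𝒟.ι) :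
    AEStronglyMeasurable (fun s => 𝒟.coord n (𝒟.sol v₀ F s)) (volume.restrict (Ioi 0)) :=
  ((hA.sol_continuousOn hK n).mono Ioi_subset_Ici_self).aestronglyMeasurable measurableSet_Ioi

lemma _root_.ThinFilm.Diagonalization.aemeasurable_energy (𝒟 : Diagonalization ℓ N P)
    {G : ℝ → L2w ℓ}
    (hG : ∀ n, AEStronglyMeasurable (fun s => 𝒟.coord n (G s)) (volume.restrict (Ioi 0))) (i : ℕ) :
    AEMeasurable (fun s => 𝒟.energy i (G s)) (volume.restrict (Ioi 0)) := by
  have := 𝒟.countable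
  exact aemeasurable_sqSum fun n => (hG n).const_mul _

lemma lintegral_solDeriv_le (hA : 𝒟.Admissible K v₀ F) (hK : 0 < K) (i : ℕ) {S : Set ℝ}
    (hS : S ⊆ Ioi 0) (hSm : MeasurableSet S) :
    ∫⁻ s in S, ENNReal.ofReal (s ^ i) * 𝒟.energy (i + 2) (𝒟.solDeriv v₀ F s) ≤
      2 * (∫⁻ s in S, ENNReal.ofReal (s ^ i) * 𝒟.energy (i + 2) (F s)) +
      2 * ∫⁻ s in S, ENNReal.ofReal (s ^ i) * 𝒟.energy (i + 4) (𝒟.sol v₀ F s) := by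
  have h1 := (𝒟.aemeasurable_energy hA.measurable_coord (i + 2)).mono_measure
    (Measure.restrict_mono hS le_rfl)
  rw [← lintegral_const_mul' _ _ ENNReal.ofNat_ne_top,
    ← lintegral_const_mul' _ _ ENNReal.ofNat_ne_top, ← lintegral_add_left' (by fun_prop)]
  refine setLIntegral_mono' hSm fun s hs => ?_
  calc _ ≤ ENNReal.ofReal (s ^ i) * (2 * 𝒟.energy (i + 2) (F s) +
        2 * 𝒟.energy (i + 2 + 2) (𝒟.sol v₀ F s)) := by
        gcongr
        exact hA.energy_solDeriv_le hK _ (le_of_lt (hS hs))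
    _ = _ := by ring

end Admissible

variable (𝒟) in
/-- The energy estimate in terms of the coordinates. -/
lemma exists_energy_estimate (hK : 0 < K) : ∃ C : ℝ≥0, ∀ (v₀ : L2w ℓ) (F : ℝ → L2w ℓ),
    𝒟.Admissible K v₀ F → ∀ T : ℝ, 0 ≤ T →
    ∑ i ∈ Finset.range K, (ENNReal.ofReal (T ^ i) * 𝒟.energy (i + 3) (𝒟.sol v₀ F T) +
        ∫⁻ r in Ioo 0 T, ENNReal.ofReal (r ^ i) * 𝒟.energy (i + 4) (𝒟.sol v₀ F r)) ≤
      C * 𝒟.dataEnergy K v₀ F (Ioo 0 T) := by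
  obtain ⟨C, hC⟩ := mode_bound_lintegral K
  refine ⟨C, fun v₀ F hA T hT => ?_⟩
  have := 𝒟.countable
  refine le_of_eq_of_le (Finset.sum_congr rfl fun i _ => ?_)
    (modes_bound hA.memLp_coord fun n => hC _ (hA.memLp_coord n) (𝒟.ν n) (𝒟.coord n v₀) T
      (𝒟.ν_pos n) hT)
  rw [hA.energy_sol hK _ hT]
  congr 1
  refine setLIntegral_congr_fun measurableSet_Ioo fun r hr => ?_
  simp only [hA.energy_sol hK _ hr.1.le]
  rfl

namespace Admissible

lemma lintegral_sol_ne_top (hA : 𝒟.Admissible K v₀ F) {i : ℕ} (hi : i < K) :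
    ∫⁻ s in Ioi (0 : ℝ), ENNReal.ofReal (s ^ i) * 𝒟.energy (i + 4) (𝒟.sol v₀ F s) ≠ ⊤ := by
  obtain ⟨C, hC⟩ := 𝒟.exists_energy_estimate (Nat.zero_lt_of_lt hi)
  refine ne_top_of_le_ne_top (b := C * 𝒟.dataEnergy K v₀ F (Ioi 0))
    (ENNReal.mul_ne_top ENNReal.coe_ne_top (hA.dataEnergy_ne_top Subset.rfl))
    (setLIntegral_Ioi_le fun T hT => ?_)
  calc _ ≤ _ := le_add_self
    _ ≤ _ := Finset.single_le_sum (f := fun i => ENNReal.ofReal (T ^ i) *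
        𝒟.energy (i + 3) (𝒟.sol v₀ F T) + ∫⁻ r in Ioo 0 T, ENNReal.ofReal (r ^ i) *
          𝒟.energy (i + 4) (𝒟.sol v₀ F r)) (fun _ _ => zero_le) (Finset.mem_range.2 hi)
    _ ≤ _ := hC v₀ F hA T hT
    _ ≤ _ := by
      gcongr
      exact add_le_add le_rfl (Finset.sum_le_sum fun _ _ => lintegral_mono_set fun x hx => hx.1)

lemma lintegral_solDeriv_ne_top (hA : 𝒟.Admissible K v₀ F) {i : ℕ} (hi : i < K) :
    ∫⁻ s in Ioi (0 : ℝ), ENNReal.ofReal (s ^ i) * 𝒟.energy (i + 2) (𝒟.solDeriv v₀ F s) ≠ ⊤ :=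
  ne_top_of_le_ne_top (ENNReal.add_ne_top.2
    ⟨ENNReal.mul_ne_top ENNReal.ofNat_ne_top (hA.rhs i hi),
      ENNReal.mul_ne_top ENNReal.ofNat_ne_top (hA.lintegral_sol_ne_top hi)⟩)
    (hA.lintegral_solDeriv_le (Nat.zero_lt_of_lt hi) i Subset.rfl measurableSet_Ioi)

/-- At almost every time `F` has finite energy of order 2 and the solution of order 4, so the
sequence `F - ν² V` is square summable and defines `∂_s V`. -/
lemma ae_coord_solDeriv (hA : 𝒟.Admissible K v₀ F) (hK : 0 < K) :
    ∀ᵐ s ∂volume.restrict (Ioi (0 : ℝ)), ∀ n, 𝒟.coord n (𝒟.solDeriv v₀ F s) =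
      𝒟.coord n (F s) - 𝒟.ν n ^ 2 * 𝒟.solCoord v₀ F n s := by
  have h1 := hA.rhs 0 hK
  have h2 := hA.lintegral_sol_ne_top hK
  simp only [pow_zero, ENNReal.ofReal_one, one_mul, zero_add] at h1 h2
  filter_upwards [ae_lt_top' (𝒟.aemeasurable_energy hA.measurable_coord 2) h1,
    ae_lt_top' (𝒟.aemeasurable_energy (hA.measurable_coord_sol hK) 4) h2,
    ae_restrict_mem measurableSet_Ioi] with s h3 h4 hs
  refine 𝒟.coord_symm_seqOf (𝒟.summable_of_weighted 2 (summable_of_sqSum_ne_top ?_))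
  have h5 := sqSum_sub_le (fun n => 𝒟.ν n ^ 2 * 𝒟.coord n (F s))
    fun n => 𝒟.ν n ^ 4 * 𝒟.coord n (𝒟.sol v₀ F s)
  refine ne_top_of_le_ne_top (ENNReal.add_ne_top.2
    ⟨ENNReal.mul_ne_top ENNReal.ofNat_ne_top h3.ne,
      ENNReal.mul_ne_top ENNReal.ofNat_ne_top h4.ne⟩) (le_of_eq_of_le ?_ h5)
  congr 1
  ext n
  rw [hA.coord_sol hK n (le_of_lt hs)]
  ring

lemma measurable_coord_solDeriv (hA : 𝒟.Admissible K v₀ F) (hK : 0 < K) (n : 𝒟.ι) :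
    AEStronglyMeasurable (fun s => 𝒟.coord n (𝒟.solDeriv v₀ F s)) (volume.restrict (Ioi 0)) := by
  have h1 : AEStronglyMeasurable (𝒟.solCoord v₀ F n) (volume.restrict (Ioi 0)) :=
    aestronglyMeasurable_mode (hA.memLp_coord n) _ _
  refine ((hA.measurable_coord n).sub (h1.const_mul (𝒟.ν n ^ 2))).congr ?_
  filter_upwards [hA.ae_coord_solDeriv hK] with s hs
  exact (hs n).symm

end Admissible

lemma memL2_weighted {i j m : ℕ} (hi : m = 2 * i) (hm : m ≤ N) {f : ℝ → L2w ℓ}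
    (hf : ∀ n, AEStronglyMeasurable (fun s => 𝒟.coord n (f s)) (volume.restrict (Ioi 0)))
    (h : ∫⁻ s in Ioi (0 : ℝ), ENNReal.ofReal (s ^ j) * 𝒟.energy i (f s) ≠ ⊤) :
    MemL2 m (weighted (j + 2) f) := by
  refine 𝒟.memL2_of_energy hi hm (fun n => ?_) ?_
  · simp only [weighted, map_smul, smul_eq_mul]
    exact (measurable_id.pow_const _).aestronglyMeasurable.mul (hf n)
  · rwa [setLIntegral_congr_fun measurableSet_Ioi
      fun s hs => 𝒟.energy_weighted i j f (le_of_lt hs)]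

lemma lintegral_weighted_ne_top {i j m : ℕ} (hi : m = 2 * i) (hm : m ≤ N) {f : ℝ → L2w ℓ}
    (h : MemL2 m (weighted (j + 2) f)) :
    ∫⁻ s in Ioi (0 : ℝ), ENNReal.ofReal (s ^ j) * 𝒟.energy i (f s) ≠ ⊤ := by
  have h1 := 𝒟.lintegral_energy_ne_top hi hm h
  rwa [setLIntegral_congr_fun measurableSet_Ioi
      fun s hs => 𝒟.energy_weighted i j f (le_of_lt hs)] at h1

lemma Admissible.memC0_weighted (hA : 𝒟.Admissible K v₀ F) {j m : ℕ} (hj : j < K)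
    (hi : m = 2 * (j + 3)) (hm : m ≤ N) :
    MemC0 m (Ici 0) (weighted (j + 2) (𝒟.sol v₀ F)) := by
  have hK := Nat.zero_lt_of_lt hj
  obtain ⟨b, hb, h⟩ := hA.exists_dominating
  refine 𝒟.memC0_of_bound hi hm (fun n => ?_) hb fun n s hs => ?_
  · simp only [weighted, map_smul, smul_eq_mul]
    exact (Real.continuous_rpow_const (weight_exponent_nonneg (by omega))).continuousOn.mul
      (hA.sol_continuousOn hK n)
  · refine le_of_eq_of_le ?_ (h j hj n s hs)
    rw [weighted, map_smul, smul_eq_mul, hA.coord_sol hK n hs, ← weight_sq hs]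
    ring

end Diagonalization

/-! ### Well-posedness and estimates for the operator of a profile. -/

lemma IsProfile.exists_diagonalization {ℓ : ℝ} (hℓ : 0 < ℓ) {U : ℝ → ℝ} (h : IsProfile ℓ U) {N : ℕ}
    (hN : 4 ≤ N) :
    Nonempty (Diagonalization ℓ N fun w f => IsLinOp ℓ U (toL2w w) f) := by
  obtain ⟨q, u, hu, hU, hPhi, hα, hγ⟩ := h.exists_coefs hℓ N
  have hN' : 0 + 4 ≤ N := by omega
  have h1 : (fun (w : Hsp ℓ 4) (f : L2w ℓ) => (IsLinOp ℓ U (toL2w w) f : Prop)) = fun w f =>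
      mulH ℓ (inclC (Nat.zero_le N) u) ((baseE hℓ).symm f) = ellH q hN' w :=
    funext fun w => funext fun f => propext (isLinOp_iff hℓ q hN' u hu hU hPhi hα hγ w f)
  rw [h1]
  exact ThinFilm.exists_diagonalization hℓ q u hu hN'

lemma sum_Icc_two {M : Type} [AddCommMonoid M] {k : ℕ} (hk : 2 ≤ k) (a : ℕ → M) :
    ∑ k' ∈ Finset.Icc 2 k, a k' = ∑ i ∈ Finset.range (k - 1), a (i + 2) := by
  rw [← Finset.Ico_add_one_right_eq_Icc, Finset.sum_Ico_eq_sum_range]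
  have : k + 1 - 2 = k - 1 := by omega
  rw [this]
  exact Finset.sum_congr rfl fun i _ => by rw [add_comm]

namespace Diagonalization

variable {ℓ : ℝ} {U : ℝ → ℝ} {k : ℕ}
  {𝒟 : Diagonalization ℓ (2 * k + 4) fun w f => IsLinOp ℓ U (toL2w w) f}

lemma admissible (hk : 2 ≤ k) (V₀ : Hsp ℓ 6) {F : ℝ → L2w ℓ}
    (hF : ∀ k', 2 ≤ k' → k' ≤ k → MemL2 (2 * k') (weighted k' F)) :
    𝒟.Admissible (k - 1) (toL2w V₀) F where
  memLp := by
    have h := (hF 2 le_rfl hk).comp_memLp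
    rwa [weighted_two] at h
  initial := by
    obtain ⟨K, hK⟩ := 𝒟.exists_energy_bound_single (i := 3) (m := 6) rfl (by omega)
    exact ne_top_of_le_ne_top (ENNReal.mul_ne_top ENNReal.coe_ne_top (by simp))
      ((hK (toL2w V₀)).2.2 V₀)
  rhs i hi := lintegral_weighted_ne_top rfl (by omega) (hF (i + 2) (by omega) (by omega))

lemma Admissible.isTimeDeriv {v₀ : L2w ℓ} {F : ℝ → L2w ℓ} {K : ℕ} (hA : 𝒟.Admissible K v₀ F)
    (hK : 0 < K) (hV : LocallyIntegrableOn (𝒟.sol v₀ F) (Ioi 0))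
    (hD : LocallyIntegrableOn (𝒟.solDeriv v₀ F) (Ioi 0)) :
    IsTimeDeriv (𝒟.sol v₀ F) (𝒟.solDeriv v₀ F) := by
  refine ⟨hV, hD, fun φ hφ hc hs => 𝒟.coord_ext fun n => ?_⟩
  have hφ1 : ContDiff ℝ 1 φ := hφ.of_le (by exact_mod_cast le_top)
  rw [map_neg, ← ContinuousLinearMap.integral_comp_comm _ (integrable_smul_of_tsupport hV
      (hφ1.continuous_deriv le_rfl) hc.deriv (tsupport_deriv_subset.trans hs)),
    ← ContinuousLinearMap.integral_comp_comm _ (integrable_smul_of_tsupport hD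
      hφ.continuous hc hs)]
  have h1 := mode_weak_deriv (hA.memLp_coord n) (𝒟.ν n ^ 2) (𝒟.coord n v₀) hφ hc hs
  refine Eq.trans (setIntegral_congr_fun measurableSet_Ioi fun s hs => ?_)
    (h1.trans (congrArg Neg.neg (integral_congr_ae ?_)))
  · simp only [map_smul, smul_eq_mul]
    rw [hA.coord_sol hK n (le_of_lt hs)]
    rfl
  · filter_upwards [hA.ae_coord_solDeriv hK] with s hs
    rw [map_smul, smul_eq_mul, hs n]
    rfl

lemma isSolution (hℓ : 0 < ℓ) (hk : 2 ≤ k) (V₀ : Hsp ℓ 6) {F : ℝ → L2w ℓ}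
    (hF : ∀ k', 2 ≤ k' → k' ≤ k → MemL2 (2 * k') (weighted k' F)) :
    IsSolution ℓ U k V₀ F (𝒟.sol (toL2w V₀) F) (𝒟.solDeriv (toL2w V₀) F) := by
  have hA : 𝒟.Admissible (k - 1) (toL2w V₀) F := admissible hk V₀ hF
  have hK : 0 < k - 1 := by omega
  have hV : ∀ k', 2 ≤ k' → k' ≤ k →
      MemL2 (2 * k' + 4) (weighted k' (𝒟.sol (toL2w V₀) F)) := fun k' h2 hk' => by
    obtain ⟨i, rfl⟩ := Nat.exists_eq_add_of_le' h2
    exact memL2_weighted (i := i + 4) (by omega) (by omega) (hA.measurable_coord_sol hK)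
      (hA.lintegral_sol_ne_top (by omega))
  have hD : ∀ k', 2 ≤ k' → k' ≤ k →
      MemL2 (2 * k') (weighted k' (𝒟.solDeriv (toL2w V₀) F)) := fun k' h2 hk' => by
    obtain ⟨i, rfl⟩ := Nat.exists_eq_add_of_le' h2
    exact memL2_weighted (i := i + 2) (by omega) (by omega) (hA.measurable_coord_solDeriv hK)
      (hA.lintegral_solDeriv_ne_top (by omega))
  have hC : ∀ k', 2 ≤ k' → k' ≤ k →
      MemC0 (2 * k' + 2) (Ici 0) (weighted k' (𝒟.sol (toL2w V₀) F)) := fun k' h2 hk' => by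
    obtain ⟨i, rfl⟩ := Nat.exists_eq_add_of_le' h2
    exact hA.memC0_weighted (by omega) (by omega) (by omega)
  have hVloc := memL2loc_of_weighted hk (hV k hk le_rfl)
  have hDloc := memL2loc_of_weighted hk (hD k hk le_rfl)
  refine ⟨hA.isTimeDeriv hK hVloc.locallyIntegrableOn hDloc.locallyIntegrableOn,
    ⟨hVloc.mono hℓ (by omega), hDloc⟩, hVloc, memC0_of_weighted (hC k hk le_rfl), hV, hD, hC,
    hA.sol_zero hK, ?_⟩
  -- For `k' = 2` the weight is trivial, so `V(s)` lies in `ℋ⁸`, hence in the domain `ℋ⁴` of the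
  -- diagonalised operator, for almost every `s`; there the equation is an identity between
  -- coordinates.
  obtain ⟨g, -, hg⟩ := hV 2 le_rfl hk
  filter_upwards [hg, hA.ae_coord_solDeriv hK, ae_restrict_mem measurableSet_Ioi] with s h1 h2 hs
  rw [weighted_two] at h1
  have h3 := toL2w_resH hℓ (show 4 ≤ 2 * 2 + 4 by omega) (g s)
  rw [h1] at h3
  rw [← h3]
  refine (𝒟.eq_iff _ _).2 fun n => ?_
  rw [← coord_apply, ← coord_apply, h3, map_sub, h2, hA.coord_sol hK n (le_of_lt hs)]
  ring

/-- Each coordinate of a solution is continuous on `[0, ∞)` by the case `k' = 2`, and solves the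
scalar equation weakly, so it is the Duhamel solution by `mode_unique`. -/
lemma eq_sol (hℓ : 0 < ℓ) (hk : 2 ≤ k) {V₀ : Hsp ℓ 6} {F : ℝ → L2w ℓ}
    (hF : ∀ k', 2 ≤ k' → k' ≤ k → MemL2 (2 * k') (weighted k' F)) {V D : ℝ → L2w ℓ}
    (h : IsSolution ℓ U k V₀ F V D) {s : ℝ} (hs : 0 ≤ s) : V s = 𝒟.sol (toL2w V₀) F s := by
  have hA : 𝒟.Admissible (k - 1) (toL2w V₀) F := admissible hk V₀ hF
  have hK : 0 < k - 1 := by omega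
  refine 𝒟.coord_ext fun n => ?_
  rw [hA.coord_sol hK n hs]
  obtain ⟨g, hg, hgV⟩ := h.weighted_C0 2 le_rfl hk
  rw [weighted_two] at hgV
  have hcont : ContinuousOn (fun s => 𝒟.coord n (V s)) (Ici 0) := by
    refine ((𝒟.coord n).continuous.comp (toL2wL ℓ _).continuous).comp_continuousOn hg |>.congr ?_
    intro s hs
    exact congrArg (𝒟.coord n) (hgV s hs).symm
  refine mode_unique (b := fun s => 𝒟.coord n (V s)) (hA.memLp_coord n) hcont
    (congrArg (𝒟.coord n) h.initial) (fun φ hφ hc hs => ?_) s hs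
  have hφ1 : ContDiff ℝ 1 φ := hφ.of_le (by exact_mod_cast le_top)
  have h1 := congrArg (𝒟.coord n) (h.timeDeriv.2.2 φ hφ hc hs)
  rw [map_neg, ← ContinuousLinearMap.integral_comp_comm _ (integrable_smul_of_tsupport
      h.timeDeriv.1 (hφ1.continuous_deriv le_rfl) hc.deriv (tsupport_deriv_subset.trans hs)),
    ← ContinuousLinearMap.integral_comp_comm _ (integrable_smul_of_tsupport h.timeDeriv.2.1
      hφ.continuous hc hs)] at h1
  simp only [map_smul, smul_eq_mul] at h1
  refine h1.trans (congrArg Neg.neg (integral_congr_ae ?_))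
  -- Membership in `ℋ⁸` for almost every time permits reading the equation in coordinates.
  obtain ⟨w, -, hw⟩ := h.weighted_L2 2 le_rfl hk
  filter_upwards [hw, h.equation] with s h2 h3
  rw [weighted_two] at h2
  have h4 := toL2w_resH hℓ (show 4 ≤ 2 * 2 + 4 by omega) (w s)
  rw [h2] at h4
  rw [← h4] at h3 ⊢
  have h5 := (𝒟.eq_iff _ _).1 h3 n
  rw [← coord_apply, ← coord_apply, map_sub] at h5
  rw [← h5]
  ring

variable (𝒟) in
lemma exists_estimate (hk : 2 ≤ k) : ∃ C : ℝ≥0, ∀ (V₀ : Hsp ℓ 6) (F : ℝ → L2w ℓ),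
    (∀ k', 2 ≤ k' → k' ≤ k → MemL2 (2 * k') (weighted k' F)) → ∀ s : ℝ, 0 ≤ s →
    ∑ k' ∈ Finset.Icc 2 k,
      (ENNReal.ofReal (s ^ (k' - 2)) * hnorm (2 * k' + 2) (𝒟.sol (toL2w V₀) F s) ^ 2 +
        ∫⁻ s' in Ioo 0 s, ENNReal.ofReal (s' ^ (k' - 2)) *
          (hnorm (2 * k') (𝒟.solDeriv (toL2w V₀) F s') ^ 2 +
            hnorm (2 * k' + 4) (𝒟.sol (toL2w V₀) F s') ^ 2)) ≤
    C * (‖V₀‖ₑ ^ 2 + ∑ k' ∈ Finset.Icc 2 k,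
      ∫⁻ s' in Ioo 0 s, ENNReal.ofReal (s' ^ (k' - 2)) * hnorm (2 * k') (F s') ^ 2) := by
  obtain ⟨K, hK⟩ := 𝒟.exists_energy_bound
  obtain ⟨C, hC⟩ := 𝒟.exists_energy_estimate (K := k - 1) (by omega)
  have hk1 : 0 < k - 1 := by omega
  -- The outer factors `K` convert between spectral and Sobolev norms. Bounding `∂_s V = F - 𝓛 V` by
  -- twice each part contributes two further copies of the dissipation, three in all, and two of the
  -- forcing.
  refine ⟨K * (3 * C + 2) * K, fun V₀ F hF s hs => ?_⟩
  have hA : 𝒟.Admissible (k - 1) (toL2w V₀) F := admissible hk V₀ hF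
  set V := 𝒟.sol (toL2w V₀) F with hV
  set D := 𝒟.solDeriv (toL2w V₀) F with hD
  have hS : Ioo 0 s ⊆ Ioi 0 := fun x hx => hx.1
  have hdata : 𝒟.dataEnergy (k - 1) (toL2w V₀) F (Ioo 0 s) ≤ K * (‖V₀‖ₑ ^ 2 +
      ∑ k' ∈ Finset.Icc 2 k,
        ∫⁻ s' in Ioo 0 s, ENNReal.ofReal (s' ^ (k' - 2)) * hnorm (2 * k') (F s') ^ 2) := by
    rw [sum_Icc_two hk, mul_add, Finset.mul_sum, dataEnergy]
    refine add_le_add ((hK 3 (by omega) (toL2w V₀)).2.2 V₀) (Finset.sum_le_sum fun i hi => ?_)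
    have hi := Finset.mem_range.1 hi
    rw [← lintegral_const_mul' _ _ ENNReal.coe_ne_top]
    refine lintegral_mono fun r => ?_
    rw [mul_left_comm]
    exact mul_le_mul' le_rfl (hK (i + 2) (by omega) (F r)).2.1
  set I : ℕ → ℝ≥0∞ := fun i => ∫⁻ r in Ioo 0 s, ENNReal.ofReal (r ^ i) * 𝒟.energy (i + 4) (V r)
  set J : ℕ → ℝ≥0∞ := fun i => ∫⁻ r in Ioo 0 s, ENNReal.ofReal (r ^ i) * 𝒟.energy (i + 2) (F r)
  have hest := hC _ F hA s hs
  have hJ : ∑ i ∈ Finset.range (k - 1), J i ≤ 𝒟.dataEnergy (k - 1) (toL2w V₀) F (Ioo 0 s) :=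
    le_add_self
  have hterm : ∀ i ∈ Finset.range (k - 1),
      ENNReal.ofReal (s ^ (i + 2 - 2)) * hnorm (2 * (i + 2) + 2) (V s) ^ 2 +
        ∫⁻ s' in Ioo 0 s, ENNReal.ofReal (s' ^ (i + 2 - 2)) *
          (hnorm (2 * (i + 2)) (D s') ^ 2 + hnorm (2 * (i + 2) + 4) (V s') ^ 2) ≤
      K * (3 * (ENNReal.ofReal (s ^ i) * 𝒟.energy (i + 3) (V s) + I i) + 2 * J i) := by
    intro i hi
    have hi := Finset.mem_range.1 hi
    have h1 : ∀ r, hnorm (2 * (i + 2) + 2) (V r) ^ 2 ≤ K * 𝒟.energy (i + 3) (V r) := fun r =>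
      (hK (i + 3) (by omega) (V r)).1
    have h2 : ∀ r, hnorm (2 * (i + 2) + 4) (V r) ^ 2 ≤ K * 𝒟.energy (i + 4) (V r) := fun r =>
      (hK (i + 4) (by omega) (V r)).1
    have h3 : ∀ r, hnorm (2 * (i + 2)) (D r) ^ 2 ≤ K * 𝒟.energy (i + 2) (D r) := fun r =>
      (hK (i + 2) (by omega) (D r)).1
    have hm : AEMeasurable (fun r => ENNReal.ofReal (r ^ i) * 𝒟.energy (i + 4) (V r))
        (volume.restrict (Ioo 0 s)) := by
      have := (𝒟.aemeasurable_energy (hA.measurable_coord_sol hk1) (i + 4)).mono_measure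
        (Measure.restrict_mono hS le_rfl)
      fun_prop
    have h4 : ∫⁻ s' in Ioo 0 s, ENNReal.ofReal (s' ^ i) *
        (hnorm (2 * (i + 2)) (D s') ^ 2 + hnorm (2 * (i + 2) + 4) (V s') ^ 2) ≤
        K * (3 * I i + 2 * J i) := by
      calc _ ≤ ∫⁻ r in Ioo 0 s, K * (ENNReal.ofReal (r ^ i) * 𝒟.energy (i + 2) (D r) +
            ENNReal.ofReal (r ^ i) * 𝒟.energy (i + 4) (V r)) := by
            refine lintegral_mono fun r => ?_
            calc _ ≤ ENNReal.ofReal (r ^ i) * (K * 𝒟.energy (i + 2) (D r) +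
                  K * 𝒟.energy (i + 4) (V r)) :=
                  mul_le_mul' le_rfl (add_le_add (h3 r) (h2 r))
              _ = _ := by ring
        _ = K * ((∫⁻ r in Ioo 0 s, ENNReal.ofReal (r ^ i) * 𝒟.energy (i + 2) (D r)) + I i) := by
            rw [lintegral_const_mul' _ _ ENNReal.coe_ne_top, lintegral_add_right' _ hm]
        _ ≤ K * ((2 * J i + 2 * I i) + I i) :=
            mul_le_mul' le_rfl (add_le_add
              (hA.lintegral_solDeriv_le hk1 i hS measurableSet_Ioo) le_rfl)
        _ = _ := by ring
    rw [Nat.add_sub_cancel]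
    calc _ ≤ ENNReal.ofReal (s ^ i) * (K * 𝒟.energy (i + 3) (V s)) + K * (3 * I i + 2 * J i) :=
          add_le_add (mul_le_mul' le_rfl (h1 s)) h4
      _ = K * (ENNReal.ofReal (s ^ i) * 𝒟.energy (i + 3) (V s)) + K * (3 * I i + 2 * J i) := by
          ring
      _ ≤ K * (3 * (ENNReal.ofReal (s ^ i) * 𝒟.energy (i + 3) (V s))) +
            K * (3 * I i + 2 * J i) := by
          refine add_le_add (mul_le_mul' le_rfl ?_) le_rfl
          exact le_mul_of_one_le_left zero_le (by norm_num)
      _ = _ := by ring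
  rw [sum_Icc_two hk]
  refine (Finset.sum_le_sum hterm).trans ?_
  rw [← Finset.mul_sum, Finset.sum_add_distrib, ← Finset.mul_sum, ← Finset.mul_sum]
  calc _ ≤ (K : ℝ≥0∞) * (3 * (C * 𝒟.dataEnergy (k - 1) (toL2w V₀) F (Ioo 0 s)) +
        2 * 𝒟.dataEnergy (k - 1) (toL2w V₀) F (Ioo 0 s)) :=
        mul_le_mul' le_rfl (add_le_add (mul_le_mul' le_rfl hest) (mul_le_mul' le_rfl hJ))
    _ = K * (3 * C + 2) * 𝒟.dataEnergy (k - 1) (toL2w V₀) F (Ioo 0 s) := by ring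
    _ ≤ K * (3 * C + 2) * _ := mul_le_mul' le_rfl hdata
    _ = _ := by
      push_cast
      ring

end Diagonalization

end ThinFilm

end

theorem mainTheorem3 (k : ℕ) (hk : 2 ≤ k) (ℓ : ℝ) (hℓ : 0 < ℓ) :
    ∃ C : ℝ≥0, ∀ U : ℝ → ℝ, ThinFilm.IsProfile ℓ U →
      ∀ (V₀ : ThinFilm.Hsp ℓ 6) (F : ℝ → ThinFilm.L2w ℓ),
        ThinFilm.MemL2loc (2 * k) F →
        (∀ k' : ℕ, 2 ≤ k' → k' ≤ k → ThinFilm.MemL2 (2 * k') (ThinFilm.weighted k' F)) →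
        ∃ V D : ℝ → ThinFilm.L2w ℓ,
          ThinFilm.IsSolution ℓ U k V₀ F V D ∧
          (∀ V' D' : ℝ → ThinFilm.L2w ℓ, ThinFilm.IsSolution ℓ U k V₀ F V' D' →
            ∀ s : ℝ, 0 ≤ s → V' s = V s) ∧
          ∀ s : ℝ, 0 ≤ s →
            ∑ k' ∈ Finset.Icc 2 k,
              (ENNReal.ofReal (s ^ (k' - 2)) * ThinFilm.hnorm (2 * k' + 2) (V s) ^ 2 +
                ∫⁻ s' in Ioo 0 s, ENNReal.ofReal (s' ^ (k' - 2)) *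
                  (ThinFilm.hnorm (2 * k') (D s') ^ 2 +
                    ThinFilm.hnorm (2 * k' + 4) (V s') ^ 2)) ≤
            C * (‖V₀‖ₑ ^ 2 +
              ∑ k' ∈ Finset.Icc 2 k,
                ∫⁻ s' in Ioo 0 s, ENNReal.ofReal (s' ^ (k' - 2)) *
                  ThinFilm.hnorm (2 * k') (F s') ^ 2) := by
  -- The constant must be fixed before the profile. It is taken from the only possible profile, if
  -- there is one; otherwise any constant will do.
  by_cases hU : ∃ U, ThinFilm.IsProfile ℓ U
  · obtain ⟨U, hU⟩ := hU
    obtain ⟨𝒟⟩ := hU.exists_diagonalization hℓ (show 4 ≤ 2 * k + 4 by omega)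
    obtain ⟨C, hC⟩ := 𝒟.exists_estimate hk
    refine ⟨C, fun U' hU' V₀ F _ hF => ?_⟩
    obtain rfl := hU.unique hℓ hU'
    -- At `s = 0` the terms with `k' > 2` carry the factor `0`, and `0 · ∞ = 0` in `[0, ∞]` agrees
    -- with the convention of the statement.
    exact ⟨𝒟.sol (ThinFilm.toL2w V₀) F, 𝒟.solDeriv (ThinFilm.toL2w V₀) F,
      ThinFilm.Diagonalization.isSolution hℓ hk V₀ hF,
      fun V' D' h s hs => ThinFilm.Diagonalization.eq_sol hℓ hk hF h hs, hC V₀ F hF⟩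
  · exact ⟨0, fun U h => absurd ⟨U, h⟩ hU⟩
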